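/- Let $R$ be a commutative ring and $d\ge 0$ an integer. **Diagrams.** A generalized $T_*^*$-diagram consists of $n\ge 0$ active points $t_1<\dots<t_n$ on the line, a set of oriented chords joining distinct active points, at most one chord for each pair, such that the graph of chords is a forest, and, on the vertical half-line over each $t_i$, an optional bottom asterisk (at $t_i$) and $k_i\ge 0$ top asterisks. It is a $T_*^*$-diagram if every active point is adjacent to a chord or carries an asterisk. Diagrams are oriented by a monomial in the letters $t_i,a_i^j$ of degree $-1$ and $\alpha_{ij}$ (chords), $\alpha_i^*$ (bottom asterisks), $\alpha^{*j}_i$ (top asterisks, $1\le j\le k_i$, counted from top to bottom) of degree $d-1$, each letter of the diagram occurring once, modulo graded commutativity. Let $T_*^*$ be the $R$-module spanned by the oriented $T_*^*$-diagrams modulo $\alpha_{ij}=(-1)^d\alpha_{ji}$ and $\alpha_{ij}\alpha_{jk}+\alpha_{jk}\alpha_{ki}+\alpha_{ki}\alpha_{ij}=0$. It is bigraded by the complexity $i$ (number of chords and asterisks) and the number $j$ of active points and top asterisks; the degree is $i(d-1)-j$. **Differentials.** $\partial_v D$ is the sum, over the active points with a top asterisk, of the diagrams in which the lowest top asterisk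 becomes a bottom asterisk (zero if there is one already); the letter $a_i^j$ is moved to the first place and removed. $\partial_hD$ is the sum over $i$ of the gluings of $t_i$ with $t_{i+1}$: the letter $t_i$ is moved to the first place and removed, the top asterisks over the two points are shuffled in all ways, and a letter $\alpha_{i,i+1}$ (resp. $\alpha_{i+1,i}$) becomes $\alpha_i^*$ (resp. $(-1)^d\alpha_i^*$); a gluing that produces a double bottom asterisk or a cycle is zero. Put $\partial=\partial_h+\partial_v$. **Operations.** The product $*$ is the shuffle of active points, with concatenation of orienting monomials; the unit is the empty diagram; the coproduct is coconcatenation (the sum over all cuts of the line that cross no chord); the counit is the coefficient of the empty diagram. The divided product $\langle A_1,\dots,A_\ell\rangle$ of diagrams is the sum of those terms of $A_1*\dots*A_\ell$ in which the left-most points of the (non-empty) $A_i$ come in the order $i=1,\dots,\ell$; it is extended multilinearly, and $x^{\langle\ell\rangle}=\langle x,\dots,x\rangle$. If $D$ is a generalized diagram with active points $t_1<\dots<t_\ell$ and without top asterisks, then $\langle A_1,\dots,A_\ell|D\rangle$ is obtained from $\langle A_1,\dots,A_\ell\rangle$ by gluing in every term the points $t_1,\dots,t_\ell$ to the left-most points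 of $A_1,\dots,A_\ell$ (zero if this produces a double bottom asterisk); the orienting monomial $t_1\cdots t_\ell\cdot D'$ of $D$ contributes $D'$, on the right. For homogeneous $A$ put $$A\vDash B=(-1)^{|A|-1}\bigl(\partial\langle A,B\rangle-\langle\partial A,B\rangle-(-1)^{|A|}\langle A,\partial B\rangle\bigr),$$ extended bilinearly; this is the gluing of the left-most points of $A$ and $B$, all other points being shuffled. **The map $I$.** Let $Z_k$ be the diagram with one active point and $k$ top asterisks, oriented by $t_1(\alpha^{*1}_1a_1^1)\cdots(\alpha^{*k}_1a_1^k)$, and let $\hat Z_k$ be the diagram with active points $t_0<\dots<t_k$ and chords $\alpha_{01},\dots,\alpha_{0k}$, oriented by $t_0(\alpha_{01}t_1)\cdots(\alpha_{0k}t_k)$; thus $Z_0=\hat Z_0$ is a single point. Put $$I(Z_k)=\sum_{i=0}^kZ_{k-i}\vDash\hat Z_i .$$ A diagram $D$ with $\ell$ active points is uniquely $\langle Z_{k_1},\dots,Z_{k_\ell}|D_{bottom}\rangle$, where $D_{bottom}$ is $D$ without its top asterisks and $k_i$ is the number of top asterisks over its $i$-th point; put $$I(D)=\langle IZ_{k_1},\dots,IZ_{k_\ell}|D_{bottom}\rangle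 .$$ **Proposition.** The module $T_*^*$ is stable under $\partial_h$, $\partial$, the product, the coproduct and the divided products, and contains the unit. The map $I$ is an isomorphism of differential Hopf algebras with divided powers $(T_*^*,\partial_h)\to(T_*^*,\partial)$. That is: $I$ restricts to an $R$-linear automorphism of $T_*^*$ that maps each bigraded component onto itself; $I\partial_h=\partial I$; $I$ preserves the unit and the counit; $I(x*y)=I(x)*I(y)$ and $\Delta I=(I\otimes I)\Delta$; and $I$ preserves all divided products, $I\langle x_1,\dots,x_\ell\rangle=\langle Ix_1,\dots,Ix_\ell\rangle$, in particular all divided powers, $I(x^{\langle\ell\rangle})=I(x)^{\langle\ell\rangle}$. Moreover $I(x\vDash y)=I(x)\vDash I(y)$ for all $x,y\in T_*^*$. -/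

import Mathlib

open scoped TensorProduct

noncomputable section

namespace KnotDiagrams

/-! ### The algebra of chords and bottom asterisks

The ambient dimension is `d`; only its parity enters the signs.  We write `(-1)^(d+1)` for
`(-1)^(d-1)`. -/

/-- Elements of the orienting set of degree `d-1` that live on the line: `chord i j` is the element
`α_{ij}` of a chord oriented from the `i`-th to the `j`-th active point, `star i` is the element
`α_i^*` of a bottom asterisk at the `i`-th active point.  Active points are numbered from `0`,
from left to right. -/
inductive Gen : Type
  | chord (i j : ℕ) : Gen
  | star (i : ℕ) : Gen

/-- The relations between the letters `α_{ij}`, `α_i^*`: graded commutativity (all letters have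
degree `d-1`); no multiple chord or multiple bottom asterisk; a chord joins two distinct points;
reversal of a chord; the Arnold relations. -/
inductive Rel (R : Type*) [CommRing R] (d : ℕ) : FreeAlgebra R Gen → FreeAlgebra R Gen → Prop
  | comm (x y : Gen) : Rel R d (FreeAlgebra.ι R x * FreeAlgebra.ι R y)
      ((-1 : R) ^ (d + 1) • (FreeAlgebra.ι R y * FreeAlgebra.ι R x))
  | sq (x : Gen) : Rel R d (FreeAlgebra.ι R x * FreeAlgebra.ι R x) 0
  | loop (i : ℕ) : Rel R d (FreeAlgebra.ι R (Gen.chord i i)) 0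
  | flip (i j : ℕ) : Rel R d (FreeAlgebra.ι R (Gen.chord i j))
      ((-1 : R) ^ d • FreeAlgebra.ι R (Gen.chord j i))
  | arnold (i j k : ℕ) : Rel R d
      (FreeAlgebra.ι R (Gen.chord i j) * FreeAlgebra.ι R (Gen.chord j k)
        + FreeAlgebra.ι R (Gen.chord j k) * FreeAlgebra.ι R (Gen.chord k i)
        + FreeAlgebra.ι R (Gen.chord k i) * FreeAlgebra.ι R (Gen.chord i j)) 0

/-- The algebra of chords and bottom asterisks modulo the above relations. A product of letters
whose chords contain a cycle vanishes, as a consequence of the Arnold relations. -/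
def Alg (R : Type*) [CommRing R] (d : ℕ) : Type _ := RingQuot (Rel R d)

instance (R : Type*) [CommRing R] (d : ℕ) : Ring (Alg R d) :=
  inferInstanceAs (Ring (RingQuot (Rel R d)))

instance (R : Type*) [CommRing R] (d : ℕ) : Algebra R (Alg R d) :=
  inferInstanceAs (Algebra R (RingQuot (Rel R d)))

/-- The projection from the free algebra. -/
def proj (R : Type*) [CommRing R] (d : ℕ) : FreeAlgebra R Gen →ₐ[R] Alg R d :=
  RingQuot.mkAlgHom R (Rel R d)

theorem proj_rel (R : Type*) [CommRing R] (d : ℕ) {x y : FreeAlgebra R Gen} (h : Rel R d x y) :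
    proj R d x = proj R d y :=
  RingQuot.mkAlgHom_rel R h

theorem algHom_ext (R : Type*) [CommRing R] (d : ℕ) {B : Type*} [Ring B] [Algebra R B]
    {f g : Alg R d →ₐ[R] B} (h : f.comp (proj R d) = g.comp (proj R d)) : f = g :=
  RingQuot.ringQuot_ext' R f g h

/-- A letter, as an element of the algebra. -/
def gen (R : Type*) [CommRing R] (d : ℕ) (x : Gen) : Alg R d :=
  proj R d (FreeAlgebra.ι R x)

theorem gen_comm (R : Type*) [CommRing R] (d : ℕ) (x y : Gen) :
    gen R d x * gen R d y = (-1 : R) ^ (d + 1) • (gen R d y * gen R d x) := by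
  have h := proj_rel R d (Rel.comm (R := R) (d := d) x y)
  simpa only [gen, map_mul, map_smul] using h

theorem gen_sq (R : Type*) [CommRing R] (d : ℕ) (x : Gen) : gen R d x * gen R d x = 0 := by
  have h := proj_rel R d (Rel.sq (R := R) (d := d) x)
  simpa only [gen, map_mul, map_zero] using h

theorem gen_loop (R : Type*) [CommRing R] (d : ℕ) (i : ℕ) : gen R d (Gen.chord i i) = 0 := by
  have h := proj_rel R d (Rel.loop (R := R) (d := d) i)
  simpa only [gen, map_zero] using h

theorem gen_flip (R : Type*) [CommRing R] (d : ℕ) (i j : ℕ) :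
    gen R d (Gen.chord i j) = (-1 : R) ^ d • gen R d (Gen.chord j i) := by
  have h := proj_rel R d (Rel.flip (R := R) (d := d) i j)
  simpa only [gen, map_smul] using h

theorem gen_arnold (R : Type*) [CommRing R] (d : ℕ) (i j k : ℕ) :
    gen R d (Gen.chord i j) * gen R d (Gen.chord j k)
      + gen R d (Gen.chord j k) * gen R d (Gen.chord k i)
      + gen R d (Gen.chord k i) * gen R d (Gen.chord i j) = 0 := by
  have h := proj_rel R d (Rel.arnold (R := R) (d := d) i j k)
  simpa only [gen, map_add, map_mul, map_zero] using h

/-- The relations for the images of the letters in another algebra. -/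
structure Compat (R : Type*) [CommRing R] (d : ℕ) {B : Type*} [Ring B] [Algebra R B]
    (f : Gen → B) : Prop where
  comm : ∀ x y, f x * f y = (-1 : R) ^ (d + 1) • (f y * f x)
  sq : ∀ x, f x * f x = 0
  loop : ∀ i, f (Gen.chord i i) = 0
  flip : ∀ i j, f (Gen.chord i j) = (-1 : R) ^ d • f (Gen.chord j i)
  arnold : ∀ i j k, f (Gen.chord i j) * f (Gen.chord j k) + f (Gen.chord j k) * f (Gen.chord k i)
    + f (Gen.chord k i) * f (Gen.chord i j) = 0

/-- The algebra homomorphism with prescribed values on the letters. -/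
def lift (R : Type*) [CommRing R] (d : ℕ) {B : Type*} [Ring B] [Algebra R B]
    (f : Gen → B) (hf : Compat R d f) : Alg R d →ₐ[R] B :=
  RingQuot.liftAlgHom R (s := Rel R d) ⟨FreeAlgebra.lift R f, by
    intro x y h
    cases h with
    | comm x y => simpa using hf.comm x y
    | sq x => simpa using hf.sq x
    | loop i => simpa using hf.loop i
    | flip i j => simpa using hf.flip i j
    | arnold i j k => simpa using hf.arnold i j k⟩

theorem lift_gen (R : Type*) [CommRing R] (d : ℕ) {B : Type*} [Ring B] [Algebra R B]
    (f : Gen → B) (hf : Compat R d f) (x : Gen) : lift R d f hf (gen R d x) = f x :=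
  (RingQuot.liftAlgHom_mkAlgHom_apply R _ _ _).trans (FreeAlgebra.lift_ι_apply _ _)

/-- Renumbering of the active points. -/
def relabelGen (f : ℕ → ℕ) : Gen → Gen
  | Gen.chord i j => Gen.chord (f i) (f j)
  | Gen.star i => Gen.star (f i)

theorem compat_relabel (R : Type*) [CommRing R] (d : ℕ) (f : ℕ → ℕ) :
    Compat R d (fun x => gen R d (relabelGen f x)) where
  comm _ _ := gen_comm R d _ _
  sq _ := gen_sq R d _
  loop _ := gen_loop R d _
  flip _ _ := gen_flip R d _ _
  arnold _ _ _ := gen_arnold R d _ _ _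

/-- Renumbering of the active points, on the algebra. -/
def relabel (R : Type*) [CommRing R] (d : ℕ) (f : ℕ → ℕ) : Alg R d →ₐ[R] Alg R d :=
  lift R d _ (compat_relabel R d f)

theorem compat_parity (R : Type*) [CommRing R] (d : ℕ) :
    Compat R d (fun x => (-1 : R) ^ (d + 1) • gen R d x) where
  comm x y := by
    simp only [smul_mul_smul_comm]
    rw [gen_comm R d x y, smul_comm]
  sq x := by simp only [smul_mul_smul_comm, gen_sq, smul_zero]
  loop i := by simp only [gen_loop, smul_zero]
  flip i j := by rw [gen_flip R d i j, smul_comm]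
  arnold i j k := by
    simp only [smul_mul_smul_comm, ← smul_add, gen_arnold, smul_zero]

/-- The parity automorphism `a ↦ (-1)^{|a|} a`. -/
def parity (R : Type*) [CommRing R] (d : ℕ) : Alg R d →ₐ[R] Alg R d :=
  lift R d _ (compat_parity R d)

/-- The augmentation, which kills all letters. -/
def aug (R : Type*) [CommRing R] (d : ℕ) : Alg R d →ₐ[R] R :=
  lift R d (fun _ => 0) ⟨by simp, by simp, by simp, by simp, by simp⟩

/-- The renumbering of active points when the points `i` and `i+1` are glued together. -/
def gluePos (i j : ℕ) : ℕ := if j ≤ i then j else j - 1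

/-- Effect of gluing the points `i` and `i+1` on a letter: `α_{i,i+1}` becomes `α_i^*`,
`α_{i+1,i}` becomes `(-1)^d α_i^*`, all other letters are renumbered. -/
def glueGen (R : Type*) [CommRing R] (d : ℕ) (i : ℕ) : Gen → Alg R d
  | Gen.chord a b =>
    if a = i ∧ b = i + 1 then gen R d (Gen.star i)
    else if a = i + 1 ∧ b = i then (-1 : R) ^ d • gen R d (Gen.star i)
    else gen R d (Gen.chord (gluePos i a) (gluePos i b))
  | Gen.star a => gen R d (Gen.star (gluePos i a))

theorem glueGen_eq (R : Type*) [CommRing R] (d : ℕ) (i : ℕ) (x : Gen) :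
    ∃ (u : R) (y : Gen), glueGen R d i x = u • gen R d y := by
  cases x with
  | chord a b =>
    simp only [glueGen]
    split_ifs
    · exact ⟨1, _, (one_smul _ _).symm⟩
    · exact ⟨_, _, rfl⟩
    · exact ⟨1, _, (one_smul _ _).symm⟩
  | star a => exact ⟨1, _, (one_smul _ _).symm⟩

theorem glue_flip (R : Type*) [CommRing R] (d : ℕ) (i a b : ℕ) :
    glueGen R d i (Gen.chord a b) = (-1 : R) ^ d • glueGen R d i (Gen.chord b a) := by
  have e : (-1 : R) ^ d * (-1 : R) ^ d = 1 := by rw [← mul_pow]; simp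
  simp only [glueGen]
  split_ifs with h1 h2 h3 h4 h5 h6 <;> first | omega | skip
  · rw [smul_smul, e, one_smul]
  · rfl
  · exact gen_flip R d _ _

theorem glue_arnold_aux (R : Type*) [CommRing R] (d : ℕ) (i m : ℕ) :
    gen R d (Gen.star i) * gen R d (Gen.chord i m)
      + gen R d (Gen.chord i m) * gen R d (Gen.chord m i)
      + gen R d (Gen.chord m i) * gen R d (Gen.star i) = 0 := by
  have e : (-1 : R) ^ d * (-1 : R) ^ (d + 1) = -1 := by rw [pow_succ, ← mul_assoc, ← mul_pow]; simp
  rw [gen_flip R d m i, gen_comm R d (Gen.star i)]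
  simp only [mul_smul_comm, smul_mul_assoc, gen_sq, smul_zero, add_zero]
  rw [← add_smul, pow_succ]
  simp

theorem compat_glue (R : Type*) [CommRing R] (d : ℕ) (i : ℕ) : Compat R d (glueGen R d i) where
  comm x y := by
    obtain ⟨u, x', hx⟩ := glueGen_eq R d i x
    obtain ⟨v, y', hy⟩ := glueGen_eq R d i y
    rw [hx, hy, smul_mul_smul_comm, smul_mul_smul_comm, gen_comm R d x' y', smul_comm, mul_comm]
  sq x := by
    obtain ⟨u, x', hx⟩ := glueGen_eq R d i x
    rw [hx, smul_mul_smul_comm, gen_sq, smul_zero]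
  loop a := by
    have h1 : ¬ (a = i ∧ a = i + 1) := by omega
    have h2 : ¬ (a = i + 1 ∧ a = i) := by omega
    simp only [glueGen, if_neg h1, if_neg h2, gen_loop]
  flip a b := glue_flip R d i a b
  arnold := by
    have key : ∀ c, glueGen R d i (Gen.chord i (i + 1)) * glueGen R d i (Gen.chord (i + 1) c)
        + glueGen R d i (Gen.chord (i + 1) c) * glueGen R d i (Gen.chord c i)
        + glueGen R d i (Gen.chord c i) * glueGen R d i (Gen.chord i (i + 1)) = 0 := by
      intro c
      by_cases h1 : c = i
      · subst h1
        simp [glueGen, gluePos, gen_sq, gen_loop]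
      by_cases h2 : c = i + 1
      · subst h2
        simp [glueGen, gluePos, gen_sq, gen_loop]
      · simpa [glueGen, gluePos, h1, h2] using glue_arnold_aux R d i (gluePos i c)
    have rot : ∀ x y z : Alg R d, x + y + z = 0 → y + z + x = 0 := by
      intro x y z h; rw [← h]; abel
    have e : (-1 : R) ^ d * (-1 : R) ^ d = 1 := by rw [← mul_pow]; simp
    -- a cyclic triple read backwards satisfies the same relation
    have rev : ∀ a b c, glueGen R d i (Gen.chord a b) * glueGen R d i (Gen.chord b c)
        + glueGen R d i (Gen.chord b c) * glueGen R d i (Gen.chord c a)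
        + glueGen R d i (Gen.chord c a) * glueGen R d i (Gen.chord a b) = 0 →
        glueGen R d i (Gen.chord b a) * glueGen R d i (Gen.chord a c)
        + glueGen R d i (Gen.chord a c) * glueGen R d i (Gen.chord c b)
        + glueGen R d i (Gen.chord c b) * glueGen R d i (Gen.chord b a) = 0 := by
      intro a b c h
      have cm : ∀ x y, glueGen R d i x * glueGen R d i y
          = (-1 : R) ^ (d + 1) • (glueGen R d i y * glueGen R d i x) := by
        intro x y
        obtain ⟨u, x', hx⟩ := glueGen_eq R d i x
        obtain ⟨v, y', hy⟩ := glueGen_eq R d i y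
        rw [hx, hy, smul_mul_smul_comm, smul_mul_smul_comm, gen_comm R d x' y', smul_comm, mul_comm]
      rw [glue_flip R d i b a, glue_flip R d i a c, glue_flip R d i c b]
      simp only [smul_mul_smul_comm, e, one_smul]
      rw [cm (Gen.chord a b) (Gen.chord c a), cm (Gen.chord c a) (Gen.chord b c),
        cm (Gen.chord b c) (Gen.chord a b), ← smul_add, ← smul_add]
      rw [add_right_comm, rot _ _ _ (rot _ _ _ h), smul_zero]
    intro a b c
    by_cases h1 : a = i ∧ b = i + 1
    · obtain ⟨rfl, rfl⟩ := h1; exact key c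
    by_cases h2 : b = i ∧ c = i + 1
    · obtain ⟨rfl, rfl⟩ := h2; exact rot _ _ _ (rot _ _ _ (key a))
    by_cases h3 : c = i ∧ a = i + 1
    · obtain ⟨rfl, rfl⟩ := h3; exact rot _ _ _ (key b)
    by_cases h4 : b = i ∧ a = i + 1
    · obtain ⟨rfl, rfl⟩ := h4; exact rev _ _ _ (key c)
    by_cases h5 : c = i ∧ b = i + 1
    · obtain ⟨rfl, rfl⟩ := h5; exact rot _ _ _ (rot _ _ _ (rev _ _ _ (key a)))
    by_cases h6 : a = i ∧ c = i + 1
    · obtain ⟨rfl, rfl⟩ := h6; exact rot _ _ _ (rev _ _ _ (key b))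
    · have g : ∀ a b, ¬ (a = i ∧ b = i + 1) → ¬ (b = i ∧ a = i + 1) →
          glueGen R d i (Gen.chord a b) = gen R d (Gen.chord (gluePos i a) (gluePos i b)) := by
        intro a b h h'
        simp only [glueGen, if_neg h, if_neg (fun h'' : a = i + 1 ∧ b = i => h' ⟨h''.2, h''.1⟩)]
      rw [g a b h1 h4, g b c h2 h5, g c a h3 h6]
      exact gen_arnold R d _ _ _

/-- Gluing of the points `i` and `i+1`, on the algebra. -/
def glue (R : Type*) [CommRing R] (d : ℕ) (i : ℕ) : Alg R d →ₐ[R] Alg R d :=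
  lift R d _ (compat_glue R d i)

/-- The action of a letter on `Alg ⊗ Alg` by multiplication (with the Koszul sign
`x · (a ⊗ b) = (-1)^{|x||a|} a ⊗ x b` for the letters of the second factor), after cutting the line
between the points `p-1` and `p`: the letters on the left of the cut belong to the first factor,
those on the right of the cut to the second one (renumbered from `0`), and a chord that crosses the
cut gives zero. -/
def cutGen (R : Type*) [CommRing R] (d : ℕ) (p : ℕ) : Gen → Module.End R (Alg R d ⊗[R] Alg R d)
  | Gen.chord a b =>
    if a < p ∧ b < p then
      TensorProduct.map (LinearMap.mulLeft R (gen R d (Gen.chord a b))) LinearMap.id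
    else if p ≤ a ∧ p ≤ b then
      TensorProduct.map (parity R d).toLinearMap
        (LinearMap.mulLeft R (gen R d (Gen.chord (a - p) (b - p))))
    else 0
  | Gen.star a =>
    if a < p then TensorProduct.map (LinearMap.mulLeft R (gen R d (Gen.star a))) LinearMap.id
    else TensorProduct.map (parity R d).toLinearMap
        (LinearMap.mulLeft R (gen R d (Gen.star (a - p))))

theorem compat_cut (R : Type*) [CommRing R] (d : ℕ) (p : ℕ) : Compat R d (cutGen R d p) := by
  have e : (-1 : R) ^ (d + 1) * (-1 : R) ^ (d + 1) = 1 := by rw [← mul_pow]; simp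
  have pg : ∀ x, parity R d (gen R d x) = (-1 : R) ^ (d + 1) • gen R d x := fun x => lift_gen R d _ _ x
  -- the two kinds of operators
  let L : Gen → Module.End R (Alg R d ⊗[R] Alg R d) := fun x =>
    TensorProduct.map (LinearMap.mulLeft R (gen R d x)) LinearMap.id
  let Q : Gen → Module.End R (Alg R d ⊗[R] Alg R d) := fun x =>
    TensorProduct.map (parity R d).toLinearMap (LinearMap.mulLeft R (gen R d x))
  have LL : ∀ x y, L x * L y
      = TensorProduct.map (LinearMap.mulLeft R (gen R d x * gen R d y)) LinearMap.id := by
    intro x y; ext a b; simp [L]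
  have pp : ∀ a, parity R d (parity R d a) = a := by
    have : (parity R d).comp (parity R d) = AlgHom.id R _ := by
      apply algHom_ext
      apply FreeAlgebra.hom_ext
      funext x
      change parity R d (parity R d (gen R d x)) = gen R d x
      rw [pg, map_smul, pg, smul_smul, e, one_smul]
    intro a; exact DFunLike.congr_fun this a
  have QQ : ∀ x y, Q x * Q y
      = TensorProduct.map LinearMap.id (LinearMap.mulLeft R (gen R d x * gen R d y)) := by
    intro x y; ext a b; simp [Q, pp]
  have LQ : ∀ x y, L x * Q y = (-1 : R) ^ (d + 1) • (Q y * L x) := by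
    intro x y; ext a b
    simp [L, Q, pg, TensorProduct.smul_tmul', smul_smul, e]
  have QL : ∀ x y, Q x * L y = (-1 : R) ^ (d + 1) • (L y * Q x) := by
    intro x y; rw [LQ, smul_smul, e, one_smul]
  have ml : ∀ (r : R) (a : Alg R d), LinearMap.mulLeft R (r • a) = r • LinearMap.mulLeft R a := by
    intro r a; ext b; simp
  have L2 : ∀ x, L x * L x = 0 := by
    intro x; rw [LL, gen_sq, LinearMap.mulLeft_zero_eq_zero, TensorProduct.map_zero_left]
  have Q2 : ∀ x, Q x * Q x = 0 := by
    intro x; rw [QQ, gen_sq, LinearMap.mulLeft_zero_eq_zero, TensorProduct.map_zero_right]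
  have cases3 : ∀ x, (∃ y, cutGen R d p x = L y) ∨ (∃ y, cutGen R d p x = Q y)
      ∨ cutGen R d p x = 0 := by
    intro x
    cases x with
    | chord a b =>
      simp only [cutGen]
      split_ifs
      · exact Or.inl ⟨_, rfl⟩
      · exact Or.inr (Or.inl ⟨_, rfl⟩)
      · exact Or.inr (Or.inr rfl)
    | star a =>
      simp only [cutGen]
      split_ifs
      · exact Or.inl ⟨_, rfl⟩
      · exact Or.inr (Or.inl ⟨_, rfl⟩)
  refine ⟨?_, ?_, ?_, ?_, ?_⟩
  · intro x y
    rcases cases3 x with ⟨x', hx⟩ | ⟨x', hx⟩ | hx <;>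
    rcases cases3 y with ⟨y', hy⟩ | ⟨y', hy⟩ | hy <;> rw [hx, hy]
    · rw [LL, LL, gen_comm, ml, TensorProduct.map_smul_left]
    · exact LQ _ _
    · simp
    · exact QL _ _
    · rw [QQ, QQ, gen_comm, ml, TensorProduct.map_smul_right]
    all_goals simp
  · intro x
    rcases cases3 x with ⟨x', hx⟩ | ⟨x', hx⟩ | hx <;> rw [hx]
    · exact L2 _
    · exact Q2 _
    · simp
  · intro i
    simp only [cutGen, gen_loop, LinearMap.mulLeft_zero_eq_zero, TensorProduct.map_zero_left,
      TensorProduct.map_zero_right, ite_self]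
  · intro i j
    simp only [cutGen, and_comm (a := j < p), and_comm (a := p ≤ j)]
    split_ifs
    · rw [gen_flip, ml, TensorProduct.map_smul_left]
    · rw [gen_flip, ml, TensorProduct.map_smul_right]
    · simp
  · intro i j k
    have hL : ∀ a b, a < p → b < p → cutGen R d p (Gen.chord a b) = L (Gen.chord a b) := by
      intro a b ha hb; simp only [cutGen, if_pos (And.intro ha hb), L]
    have hQ : ∀ a b, p ≤ a → p ≤ b →
        cutGen R d p (Gen.chord a b) = Q (Gen.chord (a - p) (b - p)) := by
      intro a b ha hb
      simp only [cutGen, if_neg (fun h : a < p ∧ b < p => absurd h.1 (not_lt.mpr ha)),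
        if_pos (And.intro ha hb), Q]
    have h0 : ∀ a b, a < p → p ≤ b → cutGen R d p (Gen.chord a b) = 0 := by
      intro a b ha hb
      simp only [cutGen, if_neg (fun h : a < p ∧ b < p => absurd h.2 (not_lt.mpr hb)),
        if_neg (fun h : p ≤ a ∧ p ≤ b => absurd h.1 (not_le.mpr ha))]
    have h0' : ∀ a b, p ≤ a → b < p → cutGen R d p (Gen.chord a b) = 0 := by
      intro a b ha hb
      simp only [cutGen, if_neg (fun h : a < p ∧ b < p => absurd h.1 (not_lt.mpr ha)),
        if_neg (fun h : p ≤ a ∧ p ≤ b => absurd h.2 (not_le.mpr hb))]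
    rcases lt_or_ge i p with hi | hi <;> rcases lt_or_ge j p with hj | hj <;>
      rcases lt_or_ge k p with hk | hk
    · rw [hL i j hi hj, hL j k hj hk, hL k i hk hi, LL, LL, LL, ← TensorProduct.map_add_left,
        ← TensorProduct.map_add_left]
      have : LinearMap.mulLeft R (gen R d (Gen.chord i j) * gen R d (Gen.chord j k))
          + LinearMap.mulLeft R (gen R d (Gen.chord j k) * gen R d (Gen.chord k i))
          + LinearMap.mulLeft R (gen R d (Gen.chord k i) * gen R d (Gen.chord i j)) = 0 := by
        ext b
        simp only [LinearMap.add_apply, LinearMap.mulLeft_apply, ← add_mul, gen_arnold, zero_mul,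
          LinearMap.zero_apply]
      rw [this, TensorProduct.map_zero_left]
    · simp [h0 j k hj hk, h0' k i hk hi]
    · simp [h0 i j hi hj, h0' j k hj hk]
    · simp [h0 i j hi hj, h0' k i hk hi]
    · simp [h0 k i hk hi, h0' i j hi hj]
    · simp [h0 j k hj hk, h0' i j hi hj]
    · simp [h0 k i hk hi, h0' j k hj hk]
    · rw [hQ i j hi hj, hQ j k hj hk, hQ k i hk hi, QQ, QQ, QQ, ← TensorProduct.map_add_right,
        ← TensorProduct.map_add_right]
      have : LinearMap.mulLeft R (gen R d (Gen.chord (i - p) (j - p)) * gen R d (Gen.chord (j - p) (k - p)))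
          + LinearMap.mulLeft R (gen R d (Gen.chord (j - p) (k - p)) * gen R d (Gen.chord (k - p) (i - p)))
          + LinearMap.mulLeft R (gen R d (Gen.chord (k - p) (i - p)) * gen R d (Gen.chord (i - p) (j - p))) = 0 := by
        ext b
        simp only [LinearMap.add_apply, LinearMap.mulLeft_apply, ← add_mul, gen_arnold, zero_mul,
          LinearMap.zero_apply]
      rw [this, TensorProduct.map_zero_right]

/-- Cutting a product of letters between the points `p-1` and `p`. -/
def cut (R : Type*) [CommRing R] (d : ℕ) (p : ℕ) : Alg R d →ₗ[R] Alg R d ⊗[R] Alg R d :=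
  LinearMap.applyₗ (1 ⊗ₜ[R] 1) ∘ₗ (lift R d _ (compat_cut R d p)).toLinearMap

/-! ### Diagrams -/

/-- An ambient space for the spaces of diagrams.  The element `single [k₁, …, kₙ] a`, where `a` is a
product of letters, stands for the diagram with `n` active points, with `kᵢ` top asterisks over the
`i`-th one, with the chords and bottom asterisks of `a`, and with the orienting monomial
`t₁(α*₁¹a₁¹)⋯(α*₁^{k₁}a₁^{k₁}) t₂(α*₂¹a₂¹)⋯ ⋯ tₙ(α*ₙ¹aₙ¹)⋯(α*ₙ^{kₙ}aₙ^{kₙ}) · a`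
(top asterisks are counted from top to bottom; `tᵢ` and `aᵢʲ` have degree `-1`, `α*ᵢʲ` has degree
`d-1`).  Every other orientation of the diagram is, by definition, the multiple of this one by the
sign of graded commutativity. -/
abbrev Space (R : Type*) [CommRing R] (d : ℕ) : Type _ := List ℕ →₀ Alg R d

/-- Generalized `T_*^*`-diagrams (active points without chord and asterisk are allowed).  `top`
lists the numbers of top asterisks over the active points from left to right, its length is the
number of active points.  The chords and the bottom asterisks are listed in the order in which they
occur in the orienting monomial. -/
structure Diagram where
  top : List ℕ
  chords : List (ℕ × ℕ)
  bottom : List ℕ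
  chords_lt : ∀ c ∈ chords, c.1 < top.length ∧ c.2 < top.length
  chords_ne : ∀ c ∈ chords, c.1 ≠ c.2
  chords_nodup : (chords.map fun c => s(c.1, c.2)).Nodup
  forest : (SimpleGraph.fromEdgeSet {e | e ∈ chords.map fun c => s(c.1, c.2)}).IsAcyclic
  bottom_lt : ∀ i ∈ bottom, i < top.length
  bottom_nodup : bottom.Nodup

namespace Diagram

/-- `T_*^*`-diagrams: each active point is adjacent to a chord, or its half-line contains an
asterisk. -/
def IsProper (D : Diagram) : Prop :=
  ∀ i < D.top.length, (∃ c ∈ D.chords, c.1 = i ∨ c.2 = i) ∨ i ∈ D.bottom ∨ 0 < D.top.getD i 0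

/-- The product of the letters of the chords and bottom asterisks of a diagram. -/
def word (R : Type*) [CommRing R] (d : ℕ) (D : Diagram) : Alg R d :=
  (D.chords.map fun c => gen R d (Gen.chord c.1 c.2)).prod
    * (D.bottom.map fun i => gen R d (Gen.star i)).prod

/-- The element of the space of diagrams given by an oriented diagram. -/
def toSpace (R : Type*) [CommRing R] (d : ℕ) (D : Diagram) : Space R d :=
  Finsupp.single D.top (D.word R d)

/-- Number of chords and asterisks. -/
def complexity (D : Diagram) : ℕ := D.chords.length + D.bottom.length + D.top.sum

/-- Number of active points and top asterisks. -/
def points (D : Diagram) : ℕ := D.top.length + D.top.sum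

end Diagram

/-- The space of `T_*^*`-diagrams. -/
def TSpace (R : Type*) [CommRing R] (d : ℕ) : Submodule R (Space R d) :=
  Submodule.span R {x | ∃ D : Diagram, D.IsProper ∧ D.toSpace R d = x}

/-- The part of the space of `T_*^*`-diagrams of complexity `i` with `j` geometrically distinct
points. Its elements have degree `i (d-1) - j`. -/
def TBigraded (R : Type*) [CommRing R] (d : ℕ) (i j : ℕ) : Submodule R (Space R d) :=
  Submodule.span R {x | ∃ D : Diagram,
    D.IsProper ∧ D.complexity = i ∧ D.points = j ∧ D.toSpace R d = x}

/-! ### The differentials -/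

/-- The degree modulo 2 of the product of the blocks `tᵢ(α*ᵢ¹aᵢ¹)⋯(α*ᵢ^{kᵢ}aᵢ^{kᵢ})`, each of them
being of degree `-1 + kᵢ(d-2)`. -/
def blockDeg (d : ℕ) (k : List ℕ) : ℕ := (k.map fun t => 1 + t * d).sum

/-- The quantum binomial coefficient at `q = (-1)^d`. -/
def qbinom (d k n : ℕ) : ℕ :=
  if Even d then (k + n).choose k
  else if Odd k ∧ Odd n then 0 else ((k + n) / 2).choose (k / 2)

/-- Horizontal part of the differential: the sum over all gluings of neighbour active points. The
sign is that of moving the left one of the two points `tᵢ` to the first place of the orienting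
monomial, and then `t_{i+1}` in front of the top asterisks which were over `tᵢ`; the quantum
binomial coefficient is the signed number of shuffles of the two sets of top asterisks. -/
def boundaryH (R : Type*) [CommRing R] (d : ℕ) : Space R d →ₗ[R] Space R d :=
  Finsupp.lsum R fun k => ∑ i ∈ Finset.range (k.length - 1),
    ((-1 : R) ^ (blockDeg d (k.take i) + k.getD i 0 * d)
        * (qbinom d (k.getD i 0) (k.getD (i + 1) 0) : R)) •
      (Finsupp.lsingle (k.take i ++ (k.getD i 0 + k.getD (i + 1) 0) :: k.drop (i + 2)) ∘ₗ
        (glue R d i).toLinearMap)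

/-- Vertical part of the differential: the sum over all active points with top asterisks of the
diagrams where the lowest top asterisk becomes a bottom asterisk. The sign is that of moving the
element `aᵢ^{kᵢ}` to the first place of the orienting monomial, and then of moving the element
`α*ᵢ^{kᵢ}`, which becomes `αᵢ^*`, behind the last block. -/
def boundaryV (R : Type*) [CommRing R] (d : ℕ) : Space R d →ₗ[R] Space R d :=
  Finsupp.lsum R fun k => ∑ i ∈ Finset.range k.length,
    if k.getD i 0 = 0 then 0 else
      ((-1 : R) ^ (blockDeg d (k.take i) + k.getD i 0 * d
          + (d + 1) * blockDeg d (k.drop (i + 1)))) •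
        (Finsupp.lsingle (k.set i (k.getD i 0 - 1)) ∘ₗ
          LinearMap.mulLeft R (gen R d (Gen.star i)))

/-- The differential `∂ = ∂_h + ∂_v`. -/
def boundary (R : Type*) [CommRing R] (d : ℕ) : Space R d →ₗ[R] Space R d :=
  boundaryH R d + boundaryV R d

/-! ### Shuffles, products -/

/-- A shuffle of `ℓ` sequences of points is given by the map that assigns to each of the `N` points
of the shuffled sequence the number of the sequence where it comes from. This is the position in the
shuffled sequence of the `j`-th point (counted from `0`) of the `i`-th sequence. -/
def pos {ℓ N : ℕ} (c : Fin N → Fin ℓ) (i : Fin ℓ) (j : ℕ) : ℕ :=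
  Nat.nth (fun p => ∃ h : p < N, c ⟨p, h⟩ = i) j

/-- The `i`-th sequence has as many points as prescribed. -/
def IsShuffle {ℓ N : ℕ} (κ : Fin ℓ → List ℕ) (c : Fin N → Fin ℓ) : Prop :=
  ∀ i, (Finset.univ.filter fun p => c p = i).card = (κ i).length

/-- The left-most points of the sequences come in the order of the sequences (there is no condition
on empty sequences). -/
def IsDivided {ℓ N : ℕ} (c : Fin N → Fin ℓ) : Prop :=
  ∀ i i', i < i' → (∃ p, c p = i) → ∀ q, c q = i' → ∃ p, p < q ∧ c p = i

/-- The number of top asterisks over the point `p` of the shuffled sequence. -/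
def shuffledTop {ℓ N : ℕ} (κ : Fin ℓ → List ℕ) (c : Fin N → Fin ℓ) (p : Fin N) : ℕ :=
  (κ (c p)).getD (Finset.univ.filter fun q => q < p ∧ c q = c p).card 0

/-- The Koszul sign of the permutation of the blocks of the active points in a shuffle. -/
def shuffleSign (R : Type*) [CommRing R] (d : ℕ) {ℓ N : ℕ} (κ : Fin ℓ → List ℕ)
    (c : Fin N → Fin ℓ) : R :=
  ∏ p : Fin N, ∏ q : Fin N, if p < q ∧ c q < c p then
    (-1 : R) ^ ((1 + shuffledTop κ c p * d) * (1 + shuffledTop κ c q * d)) else 1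

/-- Let `A₁,…,A_ℓ` be the diagrams `single (κ i) (a i)`, let `c` be a shuffle of their active points
and `D` be a product of letters on points `t₁ < … < t_ℓ`. This is the diagram obtained from the
`Aᵢ` by shuffling their active points according to `c` and then gluing the points `tᵢ` to the
left-most points of the `Aᵢ`. The orienting monomial is the concatenation of those of
`A₁,…,A_ℓ` and of `D` without its first part `t₁⋯t_ℓ`; in order to bring it to the standard form,
`a i` is moved behind the blocks of all `A_j`, `j > i`, and the blocks are permuted. -/
def shuffleTerm (R : Type*) [CommRing R] (d : ℕ) {ℓ N : ℕ} (κ : Fin ℓ → List ℕ)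
    (a : Fin ℓ → Alg R d) (c : Fin N → Fin ℓ) : Alg R d →ₗ[R] Space R d :=
  shuffleSign R d κ c •
    (Finsupp.lsingle (List.ofFn (shuffledTop κ c)) ∘ₗ
      LinearMap.mulLeft R (List.ofFn fun i : Fin ℓ => relabel R d (pos c i)
        ((parity R d ^ (∑ j ∈ Finset.Ioi i, blockDeg d (κ j))) (a i))).prod ∘ₗ
      (relabel R d fun j => if h : j < ℓ then pos c ⟨j, h⟩ 0 else 0).toLinearMap)

open Classical in
/-- The operation `⟨A₁,…,A_ℓ | D⟩`, extended multilinearly. Here `D`, a generalized diagram with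
`ℓ` active points and without top asterisks, is oriented by `t₁⋯t_ℓ · D`. -/
def insertion (R : Type*) [CommRing R] (d : ℕ) {ℓ : ℕ} (A : Fin ℓ → Space R d) :
    Alg R d →ₗ[R] Space R d :=
  ∑ κ ∈ Fintype.piFinset fun i => (A i).support,
    ∑ c : Fin (∑ i, (κ i).length) → Fin ℓ with IsShuffle κ c ∧ IsDivided c,
      shuffleTerm R d κ (fun i => A i (κ i)) c

/-- The divided product `⟨A₁,…,A_ℓ⟩`. -/
def dividedProduct (R : Type*) [CommRing R] (d : ℕ) {ℓ : ℕ} (A : Fin ℓ → Space R d) : Space R d :=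
  insertion R d A 1

/-- The divided powers `x^{⟨ℓ⟩} = ⟨x,…,x⟩`. -/
def dividedPower (R : Type*) [CommRing R] (d : ℕ) (ℓ : ℕ) (x : Space R d) : Space R d :=
  dividedProduct R d fun _ : Fin ℓ => x

open Classical in
/-- The shuffle product `A * B`. -/
def mul (R : Type*) [CommRing R] (d : ℕ) (A B : Space R d) : Space R d :=
  ∑ κ ∈ Fintype.piFinset fun i => ((![A, B] : Fin 2 → Space R d) i).support,
    ∑ c : Fin (∑ i, (κ i).length) → Fin 2 with IsShuffle κ c,
      shuffleTerm R d κ (fun i => (![A, B] : Fin 2 → Space R d) i (κ i)) c 1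

/-- The trivial diagram. -/
def unit (R : Type*) [CommRing R] (d : ℕ) : Space R d := Finsupp.single [] 1

/-- The counit: the coefficient of the trivial diagram. -/
def counit (R : Type*) [CommRing R] (d : ℕ) : Space R d →ₗ[R] R :=
  (aug R d).toLinearMap ∘ₗ Finsupp.lapply []

/-- The coproduct: the sum over all cuts of the line that cross no chord. The parity operator
accounts for moving the letters of the left part in front of the blocks of the right part. -/
def comul (R : Type*) [CommRing R] (d : ℕ) : Space R d →ₗ[R] Space R d ⊗[R] Space R d :=
  Finsupp.lsum R fun k => ∑ p ∈ Finset.range (k.length + 1),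
    TensorProduct.map
      (Finsupp.lsingle (k.take p) ∘ₗ (parity R d ^ blockDeg d (k.drop p)).toLinearMap)
      (Finsupp.lsingle (k.drop p)) ∘ₗ cut R d p

/-- The parity operator `A ↦ (-1)^{|A|} A`. -/
def spaceParity (R : Type*) [CommRing R] (d : ℕ) : Space R d →ₗ[R] Space R d :=
  Finsupp.lsum R fun k =>
      (((-1 : R) ^ blockDeg d k) •
    (Finsupp.lsingle k ∘ₗ (parity R d).toLinearMap))

/-- The operation
`A ⊨ B = (-1)^{|A|-1} (∂⟨A,B⟩ - ⟨∂A,B⟩ - (-1)^{|A|} ⟨A,∂B⟩)`, extended bilinearly. -/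
def vdash (R : Type*) [CommRing R] (d : ℕ) (A B : Space R d) : Space R d :=
  - (boundary R d (dividedProduct R d ![spaceParity R d A, B])
      - dividedProduct R d ![boundary R d (spaceParity R d A), B]
      - dividedProduct R d ![A, boundary R d B])

/-! ### The map `I` -/

/-- The diagram `Z_k` with one active point and `k` top asterisks, oriented by
`t₁(α*₁¹a₁¹)⋯(α*₁ᵏa₁ᵏ)`. -/
def Z (R : Type*) [CommRing R] (d : ℕ) (k : ℕ) : Space R d := Finsupp.single [k] 1

/-- The diagram `Ẑ_k` on the points `t₀,…,t_k` with the chords `α₀₁,…,α₀ₖ`, oriented by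
`t₀(α₀₁t₁)⋯(α₀ₖtₖ) = (-1)^{(d-1)k(k+1)/2} t₀t₁⋯tₖ α₀₁⋯α₀ₖ`. -/
def Zhat (R : Type*) [CommRing R] (d : ℕ) (k : ℕ) : Space R d :=
  Finsupp.single (List.replicate (k + 1) 0)
    ((-1 : R) ^ ((d + 1) * (k * (k + 1) / 2)) •
      ((List.range k).map fun j => gen R d (Gen.chord 0 (j + 1))).prod)

/-- `I(Z_k) = ∑_{i=0}^k Z_{k-i} ⊨ Ẑ_i`. -/
def IZ (R : Type*) [CommRing R] (d : ℕ) (k : ℕ) : Space R d :=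
  ∑ i ∈ Finset.range (k + 1), vdash R d (Z R d (k - i)) (Zhat R d i)

/-- The map `I`. The diagram `single [k₁,…,k_ℓ] a` is `⟨Z_{k₁},…,Z_{k_ℓ} | D⟩`, where `D` is the
diagram without top asterisks oriented by `t₁⋯t_ℓ · a`; it is sent to
`⟨I Z_{k₁},…,I Z_{k_ℓ} | D⟩`. -/
def I (R : Type*) [CommRing R] (d : ℕ) : Space R d →ₗ[R] Space R d :=
  Finsupp.lsum R fun k => insertion R d fun i : Fin k.length => IZ R d (k.get i)

end KnotDiagrams

end

/-!
The points of a diagram are given labels, and a diagram is written as a word of letters together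
with an element of the algebra of chords and bottom asterisks on these labels: `core x k` is the
point with label `x` and `k` top asterisks, and `leaf x` is a further point which is joined by a
chord to the point with label `x`. `Phi` turns linear combinations of such words into diagrams. Words
form a graded shuffle algebra `sh` with half-shuffles `hs` (shuffles in which the first letter of the
left-hand word stays in front). Products of diagrams are shuffles of words and divided products are
iterated half-shuffles (`shuffleTerm_eq`, `sum_koszul`, `shufML_Phi`), with one Koszul sign for the
points together with their chords and asterisks (`koszul_wordProd`).

The gluing of a single point to a diagram only shuffles top asterisks (`vdash_point`). Hence
`I(Z_k)` is the sum of the words `core x (k - i)` followed by `i` letters `leaf x` (`IZ_eq`), and on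
words `I` becomes the half-shuffle homomorphism `IWord` that extends this map `expand` on letters
(`I_single`). A half-shuffle homomorphism preserves `hs` and `sh` (`ZinCompat.zin_hs`,
`ZinCompat.zin_sh`), which gives the compatibility of `I` with products and divided products
(`I_shufML`). The coproduct is the sum over the cuts of a word that do not separate a leaf from its
point (`comul_phi`). Leaves can be shuffled freely into the part of a word behind their point, and a
cut which separates none of them is a cut of the original word (`cutWordL_IWord`); this gives
`comul_I`.

For the differentials, `∂` is written as an operator `bdWord` on words, the sum of the gluings of
neighbour letters and the drops of asterisks (`boundary_phi`). In `∂ I` three things happen. A bottom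
asterisk arises either from a top asterisk or from the gluing of a point with a leaf of its own, and
these terms cancel (`sum_star_cancel`). The gluings of a leaf with other letters cancel in pairs,
because the two orders of the letters occur with opposite signs (`glueDer_replicate_sh`). What is
left are gluings of neighbour points of the original word (`bdWord_IWord`), and these agree with the
terms of `I ∂_h` (`I_boundaryH`): shuffles of top asterisks and of leaves are counted by quantum
binomial coefficients at `q = (-1) ^ d`, and the quantum Vandermonde identity `sum_qbinom` says that
distributing the asterisks first and shuffling afterwards gives the same result
(`contract_expandPair`). Since `∂_v` is a derivation of the divided product
(`boundaryV_dividedProduct`), the operation `⊨` can be defined with `∂_h` in the place of `∂`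
(`vdash_eq`), and `I (x ⊨ y) = I x ⊨ I y` follows from `I ∂_h = ∂ I`.

By the Arnold relation, a product of chords that contains a cycle vanishes (`chordWord_walk`,
`chordWord_eq_zero_or`). So the module of diagrams is spanned by all products of letters that leave
no point isolated (`span_diagrams_eq_TS`), and its stability under the operations is seen on letters.
Finally, `I` is the identity up to diagrams of the same bidegree with fewer top asterisks
(`I_sub_mem_TS`), so it maps each bigraded component bijectively onto itself (`map_I_TS`,
`exists_equiv_I`).
-/

noncomputable section

namespace KnotDiagrams

section

variable {R : Type*} [CommRing R] {d : ℕ}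

/-! ### Signs and the graded algebra of letters -/

theorem sign_congr {m n : ℕ} (h : Even m ↔ Even n) : (-1 : R) ^ m = (-1 : R) ^ n := by
  rcases Nat.even_or_odd m with hm | hm
  · rw [hm.neg_one_pow, (h.1 hm).neg_one_pow]
  · have hn : Odd n := by
      rw [← Nat.not_even_iff_odd] at hm ⊢
      exact fun h' => hm (h.2 h')
    rw [hm.neg_one_pow, hn.neg_one_pow]

theorem sign_mul_self (n : ℕ) : (-1 : R) ^ n * (-1 : R) ^ n = 1 := by
  rw [← mul_pow]; simp

theorem neg_sign (n : ℕ) : -(-1 : R) ^ n = (-1 : R) ^ (n + 1) := by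
  rw [pow_succ]; simp

theorem proj_surjective : Function.Surjective (proj R d) :=
  RingQuot.mkAlgHom_surjective R (Rel R d)

theorem alg_induction {p : Alg R d → Prop} (hr : ∀ r : R, p (algebraMap R _ r))
    (hg : ∀ x, p (gen R d x)) (hm : ∀ a b, p a → p b → p (a * b))
    (ha : ∀ a b, p a → p b → p (a + b)) (a : Alg R d) : p a := by
  obtain ⟨y, rfl⟩ := proj_surjective a
  induction y using FreeAlgebra.induction with
  | grade0 r => rw [AlgHom.commutes]; exact hr r
  | grade1 x => exact hg x
  | mul a b h1 h2 => rw [map_mul]; exact hm _ _ h1 h2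
  | add a b h1 h2 => rw [map_add]; exact ha _ _ h1 h2

theorem alg_hom_ext {B : Type*} [Semiring B] [Algebra R B] {f g : Alg R d →ₐ[R] B}
    (h : ∀ x, f (gen R d x) = g (gen R d x)) : f = g := by
  ext a
  induction a using alg_induction with
  | hr r => rw [AlgHom.commutes, AlgHom.commutes]
  | hg x => exact h x
  | hm a b h1 h2 => rw [map_mul, map_mul, h1, h2]
  | ha a b h1 h2 => rw [map_add, map_add, h1, h2]

@[simp] theorem parity_gen (x : Gen) :
    parity R d (gen R d x) = (-1 : R) ^ (d + 1) • gen R d x := lift_gen R d _ _ x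

@[simp] theorem relabel_gen (f : ℕ → ℕ) (x : Gen) :
    relabel R d f (gen R d x) = gen R d (relabelGen f x) := lift_gen R d _ _ x

@[simp] theorem glue_gen (i : ℕ) (x : Gen) : glue R d i (gen R d x) = glueGen R d i x :=
  lift_gen R d _ _ x

/-- The `n`-th power of the parity operator, `a ↦ (-1)^{n|a|} a`. -/
def par (R : Type*) [CommRing R] (d n : ℕ) : Alg R d →ₐ[R] Alg R d := parity R d ^ n

theorem parity_pow (n : ℕ) : parity R d ^ n = par R d n := rfl

theorem parity_eq_par : parity R d = par R d 1 := (pow_one _).symm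

theorem par_add (m n : ℕ) (a : Alg R d) : par R d (m + n) a = par R d m (par R d n a) := by
  rw [par, pow_add]; rfl

@[simp] theorem par_zero (a : Alg R d) : par R d 0 a = a := rfl

theorem par_gen (n : ℕ) (x : Gen) :
    par R d n (gen R d x) = (-1 : R) ^ (n * (d + 1)) • gen R d x := by
  induction n with
  | zero => simp
  | succ n ih =>
    rw [par_add, ← parity_eq_par, parity_gen, map_smul, ih, smul_smul, ← pow_add]
    congr 2; ring

theorem par_congr {m n : ℕ} (h : Even m ↔ Even n) : par R d m = par R d n := by
  apply alg_hom_ext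
  intro x
  rw [par_gen, par_gen, sign_congr]
  simp only [Nat.even_mul, h]

theorem relabel_par (f : ℕ → ℕ) (n : ℕ) (a : Alg R d) :
    relabel R d f (par R d n a) = par R d n (relabel R d f a) := by
  have : (relabel R d f).comp (par R d n) = (par R d n).comp (relabel R d f) := by
    apply alg_hom_ext
    intro x
    simp [par_gen]
  exact DFunLike.congr_fun this a

theorem glue_par (i : ℕ) (n : ℕ) (a : Alg R d) :
    glue R d i (par R d n a) = par R d n (glue R d i a) := by
  have : (glue R d i).comp (par R d n) = (par R d n).comp (glue R d i) := by
    apply alg_hom_ext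
    intro x
    obtain ⟨u, y, h⟩ := glueGen_eq R d i x
    simp only [AlgHom.comp_apply, par_gen, glue_gen, map_smul, h]
    rw [smul_comm]
  exact DFunLike.congr_fun this a

theorem relabel_relabel (f g : ℕ → ℕ) (a : Alg R d) :
    relabel R d f (relabel R d g a) = relabel R d (f ∘ g) a := by
  have : (relabel R d f).comp (relabel R d g) = relabel R d (f ∘ g) := by
    apply alg_hom_ext
    intro x
    cases x <;> simp [relabelGen]
  exact DFunLike.congr_fun this a

/-- An element `b` of the algebra of letters is homogeneous of degree `n` modulo 2 if it has the
parity of `n` and commutes with all other elements up to the corresponding sign. -/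
structure Homog (n : ℕ) (b : Alg R d) : Prop where
  par_eq : ∀ m, par R d m b = (-1 : R) ^ (m * n) • b
  comm : ∀ a, b * a = par R d n a * b

theorem homog_gen (x : Gen) : Homog (d + 1) (gen R d x) where
  par_eq m := par_gen m x
  comm a := by
    induction a using alg_induction with
    | hr r => rw [AlgHom.commutes, Algebra.commutes]
    | hg y =>
      rw [par_gen, gen_comm, smul_mul_assoc]
      congr 1
      exact sign_congr (by simp [Nat.even_mul])
    | hm a b h1 h2 => rw [map_mul, ← mul_assoc, h1, mul_assoc, h2, mul_assoc]
    | ha a b h1 h2 => rw [map_add, mul_add, h1, h2, add_mul]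

theorem homog_one : Homog 0 (1 : Alg R d) where
  par_eq m := by simp
  comm a := by simp

theorem Homog.smul {n : ℕ} {b : Alg R d} (h : Homog n b) (r : R) : Homog n (r • b) where
  par_eq m := by rw [map_smul, h.par_eq, smul_comm]
  comm a := by rw [smul_mul_assoc, h.comm, mul_smul_comm]

theorem Homog.mul {m n : ℕ} {a b : Alg R d} (ha : Homog m a) (hb : Homog n b) :
    Homog (m + n) (a * b) where
  par_eq k := by rw [map_mul, ha.par_eq, hb.par_eq, smul_mul_smul_comm, ← pow_add, mul_add]
  comm x := by rw [mul_assoc, hb.comm, ← mul_assoc, ha.comm, par_add, mul_assoc]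

theorem Homog.mul_comm {m n : ℕ} {a b : Alg R d} (ha : Homog m a) (hb : Homog n b) :
    a * b = (-1 : R) ^ (m * n) • (b * a) := by
  rw [ha.comm, hb.par_eq, smul_mul_assoc]

/-! ### Supports -/

/-- The letter involves only active points from `S`. -/
def Gen.InSet (S : Set ℕ) : Gen → Prop
  | Gen.chord i j => i ∈ S ∧ j ∈ S
  | Gen.star i => i ∈ S

/-- The subalgebra generated by the letters on the points of `S`. -/
def supp (R : Type*) [CommRing R] (d : ℕ) (S : Set ℕ) : Subalgebra R (Alg R d) :=
  Algebra.adjoin R (gen R d '' {g | g.InSet S})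

theorem gen_mem_supp {S : Set ℕ} {g : Gen} (h : g.InSet S) : gen R d g ∈ supp R d S :=
  Algebra.subset_adjoin ⟨g, h, rfl⟩

theorem Gen.InSet.mono {S T : Set ℕ} (h : S ⊆ T) {g : Gen} (hg : g.InSet S) : g.InSet T := by
  cases g with
  | chord i j => exact ⟨h hg.1, h hg.2⟩
  | star i => exact h hg

theorem Gen.InSet.relabel {S T : Set ℕ} {f : ℕ → ℕ} (h : Set.MapsTo f S T) {g : Gen}
    (hg : g.InSet S) : (relabelGen f g).InSet T := by
  cases g with
  | chord i j => exact ⟨h hg.1, h hg.2⟩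
  | star i => exact h hg

theorem relabelGen_congr {S : Set ℕ} {f g : ℕ → ℕ} (h : Set.EqOn f g S) {x : Gen}
    (hx : x.InSet S) : relabelGen f x = relabelGen g x := by
  cases x with
  | chord i j => simp only [relabelGen, h hx.1, h hx.2]
  | star i => simp only [relabelGen, h (show i ∈ S from hx)]

theorem supp_mono {S T : Set ℕ} (h : S ⊆ T) : supp R d S ≤ supp R d T :=
  Algebra.adjoin_mono (Set.image_mono fun _ hg => Gen.InSet.mono h hg)

/-- Two algebra homomorphisms agree on `supp S` as soon as they agree on the letters on `S`. -/
theorem eq_of_mem_supp {B : Type*} [Semiring B] [Algebra R B] {S : Set ℕ} {f g : Alg R d →ₐ[R] B}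
    (h : ∀ x : Gen, x.InSet S → f (gen R d x) = g (gen R d x)) {a : Alg R d}
    (ha : a ∈ supp R d S) : f a = g a := by
  have : supp R d S ≤ AlgHom.equalizer f g := by
    refine Algebra.adjoin_le ?_
    rintro _ ⟨x, hx, rfl⟩
    exact h x hx
  exact this ha

theorem relabel_congr {S : Set ℕ} {f g : ℕ → ℕ} (h : Set.EqOn f g S) {a : Alg R d}
    (ha : a ∈ supp R d S) : relabel R d f a = relabel R d g a :=
  eq_of_mem_supp (fun x hx => by rw [relabel_gen, relabel_gen, relabelGen_congr h hx]) ha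

theorem relabel_id_of_mem {S : Set ℕ} {f : ℕ → ℕ} (h : ∀ x ∈ S, f x = x) {a : Alg R d}
    (ha : a ∈ supp R d S) : relabel R d f a = a := by
  have : relabel R d f a = AlgHom.id R _ a := by
    refine eq_of_mem_supp (fun x hx => ?_) ha
    rw [relabel_gen]
    cases x with
    | chord i j => simp [relabelGen, h i hx.1, h j hx.2]
    | star i => simp [relabelGen, h i hx]
  exact this

theorem relabel_id (b : Alg R d) : relabel R d id b = b :=
  relabel_id_of_mem (S := Set.univ) (fun _ _ => rfl) (by
    induction b using alg_induction with
    | hr r => exact Subalgebra.algebraMap_mem _ r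
    | hg y => exact gen_mem_supp (by cases y <;> simp [Gen.InSet])
    | hm a b ha hb => exact Subalgebra.mul_mem _ ha hb
    | ha a b ha hb => exact Subalgebra.add_mem _ ha hb)

/-- An algebra endomorphism that sends the letters on `S` into `supp T` sends `supp S` into
`supp T`. -/
theorem map_mem_supp {S T : Set ℕ} (f : Alg R d →ₐ[R] Alg R d)
    (h : ∀ x : Gen, x.InSet S → f (gen R d x) ∈ supp R d T) {a : Alg R d}
    (ha : a ∈ supp R d S) : f a ∈ supp R d T := by
  have : supp R d S ≤ (supp R d T).comap f := by
    refine Algebra.adjoin_le ?_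
    rintro _ ⟨x, hx, rfl⟩
    exact h x hx
  exact this ha

theorem relabel_mem_supp {S T : Set ℕ} {f : ℕ → ℕ} (h : Set.MapsTo f S T) {a : Alg R d}
    (ha : a ∈ supp R d S) : relabel R d f a ∈ supp R d T :=
  map_mem_supp _ (fun x hx => by rw [relabel_gen]; exact gen_mem_supp (hx.relabel h)) ha

theorem par_mem_supp {S : Set ℕ} (n : ℕ) {a : Alg R d} (ha : a ∈ supp R d S) :
    par R d n a ∈ supp R d S :=
  map_mem_supp _ (fun x hx => by
    rw [par_gen]; exact Subalgebra.smul_mem _ (gen_mem_supp hx) _) ha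

end

section

/-! ### The graded shuffle algebra -/

section Shuffle

variable {R : Type*} [CommRing R] {V : Type*}

/-- The free module on the words in the letters `V`. -/
def Words (R : Type*) [CommRing R] (V : Type*) : Type _ := List V →₀ R

instance (R : Type*) [CommRing R] (V : Type*) : AddCommGroup (Words R V) :=
  inferInstanceAs (AddCommGroup (List V →₀ R))

instance (R : Type*) [CommRing R] (V : Type*) : Module R (Words R V) :=
  inferInstanceAs (Module R (List V →₀ R))

/-- A word, as an element of the free module. -/
def wd (R : Type*) [CommRing R] {V : Type*} (w : List V) : Words R V :=
  Finsupp.single w (1 : R)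

/-- The degree of a word. -/
def wdeg (deg : V → ℕ) (w : List V) : ℕ := (w.map deg).sum

@[simp] theorem wdeg_nil (deg : V → ℕ) : wdeg deg [] = 0 := rfl
@[simp] theorem wdeg_cons (deg : V → ℕ) (x : V) (w : List V) :
    wdeg deg (x :: w) = deg x + wdeg deg w := rfl
@[simp] theorem wdeg_append (deg : V → ℕ) (u w : List V) :
    wdeg deg (u ++ w) = wdeg deg u + wdeg deg w := by simp [wdeg]

/-- The linear map with prescribed values on words. -/
def onWords {N : Type*} [AddCommMonoid N] [Module R N] (f : List V → N) : Words R V →ₗ[R] N :=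
  Finsupp.linearCombination R f

theorem onWords_wd {N : Type*} [AddCommMonoid N] [Module R N] (f : List V → N) (w : List V) :
    onWords f (wd R w) = f w :=
  (Finsupp.linearCombination_single R 1 w).trans (one_smul _ _)

theorem words_ext {N : Type*} [AddCommMonoid N] [Module R N] {f g : Words R V →ₗ[R] N}
    (h : ∀ w, f (wd R w) = g (wd R w)) : f = g :=
  Finsupp.lhom_ext' fun w => LinearMap.ext_ring (h w)

theorem words_ext₂ {V' N : Type*} [AddCommMonoid N] [Module R N]
    {f g : Words R V →ₗ[R] Words R V' →ₗ[R] N}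
    (h : ∀ u v, f (wd R u) (wd R v) = g (wd R u) (wd R v)) (a : Words R V) (b : Words R V') :
    f a b = g a b := by
  have : f = g := words_ext fun u => words_ext fun v => h u v
  rw [this]

/-- Putting a letter in front of a word. -/
def cons {R : Type*} [CommRing R] {V : Type*} (x : V) : Words R V →ₗ[R] Words R V := onWords fun w => wd R (x :: w)

@[simp] theorem cons_wd (x : V) (w : List V) : cons (R := R) x (wd R w) = wd R (x :: w) := onWords_wd _ _

variable (deg : V → ℕ)

/-- The `n`-th power of the parity operator on words. -/
def pm (n : ℕ) : Words R V →ₗ[R] Words R V :=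
  onWords fun w => (-1 : R) ^ (n * wdeg deg w) • wd R w

@[simp] theorem pm_wd (n : ℕ) (w : List V) :
    pm (R := R) deg n (wd R w) = (-1 : R) ^ (n * wdeg deg w) • wd R w := onWords_wd _ _

theorem pm_cons (n : ℕ) (x : V) (m : Words R V) :
    pm deg n (cons x m) = (-1 : R) ^ (n * deg x) • cons x (pm deg n m) := by
  have : pm (R := R) deg n ∘ₗ cons x = (-1 : R) ^ (n * deg x) • (cons x ∘ₗ pm deg n) := by
    apply words_ext; intro w
    simp only [LinearMap.comp_apply, LinearMap.smul_apply, cons_wd, pm_wd, map_smul, smul_smul,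
      ← pow_add, wdeg_cons, mul_add]
  exact DFunLike.congr_fun this m

theorem pm_add (k n : ℕ) (m : Words R V) : pm deg (k + n) m = pm deg k (pm deg n m) := by
  have : pm deg (k + n) = (pm deg k ∘ₗ pm deg n : Words R V →ₗ[R] Words R V) := by
    apply words_ext; intro w
    simp only [pm_wd, LinearMap.comp_apply, map_smul, smul_smul]
    rw [← pow_add]; congr 2; ring
  exact DFunLike.congr_fun this m

theorem pm_zero (m : Words R V) : pm deg 0 m = m := by
  have : pm deg 0 = (LinearMap.id : Words R V →ₗ[R] Words R V) := by
    refine words_ext fun w => ?_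
    rw [pm_wd]; simp
  rw [this]; rfl

theorem pm_congr {k n : ℕ} (h : Even k ↔ Even n) : pm (R := R) deg k = pm deg n := by
  refine words_ext fun w => ?_
  rw [pm_wd, pm_wd]
  congr 1
  exact sign_congr (by simp only [Nat.even_mul, h])

/-- The graded shuffle of two words. -/
def shWord (R : Type*) [CommRing R] {V : Type*} (deg : V → ℕ) : List V → List V → Words R V
  | [], v => wd R v
  | x :: u, [] => wd R (x :: u)
  | x :: u, y :: v => cons x (shWord R deg u (y :: v))
      + (-1 : R) ^ (deg y * wdeg deg (x :: u)) • cons y (shWord R deg (x :: u) v)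
termination_by u v => u.length + v.length

/-- The graded shuffle product. -/
def sh : Words R V →ₗ[R] Words R V →ₗ[R] Words R V := onWords fun u => onWords fun v => shWord R deg u v

theorem sh_wd (u v : List V) : sh deg (wd R u) (wd R v) = shWord R deg u v := by
  rw [sh, onWords_wd, onWords_wd]

@[simp] theorem one_sh (m : Words R V) : sh deg (wd R []) m = m := by
  have : sh deg (wd R []) = (LinearMap.id : Words R V →ₗ[R] Words R V) := by
    apply words_ext; intro w
    rw [sh_wd, shWord]; rfl
  rw [this]; rfl

@[simp] theorem sh_one (m : Words R V) : sh deg m (wd R []) = m := by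
  have : (sh deg).flip (wd R []) = (LinearMap.id : Words R V →ₗ[R] Words R V) := by
    apply words_ext; intro w
    rw [LinearMap.flip_apply, sh_wd]
    cases w <;> simp [shWord]
  exact DFunLike.congr_fun this m

theorem cons_sh_cons (x y : V) (m n : Words R V) :
    sh deg (cons x m) (cons y n) = cons x (sh deg m (cons y n))
      + cons y (sh deg (pm deg (deg y) (cons x m)) n) := by
  refine words_ext₂ (f := (sh deg).compl₁₂ (cons x) (cons y))
    (g := ((sh deg).compl₂ (cons y)).compr₂ (cons x)
      + ((sh deg).comp (pm deg (deg y) ∘ₗ cons x)).compr₂ (cons y)) (fun u v => ?_) m n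
  simp only [LinearMap.compl₁₂_apply, cons_wd, LinearMap.add_apply, LinearMap.compr₂_apply,
    LinearMap.compl₂_apply, LinearMap.comp_apply, pm_wd, map_smul, LinearMap.smul_apply]
  rw [sh_wd, sh_wd, sh_wd, shWord]

theorem pm_shWord (n : ℕ) (u v : List V) :
    pm deg n (shWord R deg u v) = (-1 : R) ^ (n * (wdeg deg u + wdeg deg v)) • shWord R deg u v := by
  fun_induction shWord R deg u v with
  | case1 v => simp
  | case2 x u => simp
  | case3 x u y v h1 h2 =>
    rw [map_add, map_smul, pm_cons, pm_cons, h1, h2]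
    simp only [map_smul, smul_smul, smul_add, ← pow_add, wdeg_cons]
    congr 2
    · congr 1; ring
    · congr 1; ring

theorem pm_sh (n : ℕ) (a b : Words R V) :
    pm deg n (sh deg a b) = sh deg (pm deg n a) (pm deg n b) := by
  refine words_ext₂ (f := (sh deg).compr₂ (pm deg n))
    (g := (sh deg).compl₁₂ (pm deg n) (pm deg n)) (fun u v => ?_) a b
  simp only [LinearMap.compl₁₂_apply, LinearMap.compr₂_apply, pm_wd, map_smul,
    LinearMap.smul_apply, smul_smul, sh_wd, pm_shWord]
  rw [← pow_add]; congr 2; ring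

/-- Graded commutativity of the shuffle product. -/
theorem shWord_comm (u v : List V) :
    shWord R deg u v = (-1 : R) ^ (wdeg deg u * wdeg deg v) • shWord R deg v u := by
  fun_induction shWord R deg u v with
  | case1 v => cases v <;> simp [shWord]
  | case2 x u => simp [shWord]
  | case3 x u y v h1 h2 =>
    rw [h1, h2]
    rw [shWord, smul_add, add_comm]
    simp only [map_smul, smul_smul, ← pow_add, wdeg_cons]
    congr 2
    · apply sign_congr; simp only [Nat.even_add, Nat.even_mul]; tauto
    · apply sign_congr; simp only [Nat.even_add, Nat.even_mul]; tauto

/-- The product of three non-empty words, sorted by the first letter of the result. -/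
theorem sh_sh_cons (x y z : V) (a b c : Words R V) :
    sh deg (sh deg (cons x a) (cons y b)) (cons z c)
      = cons x (sh deg (sh deg a (cons y b)) (cons z c))
        + cons y (sh deg (sh deg (pm deg (deg y) (cons x a)) b) (cons z c))
        + cons z (sh deg (sh deg (pm deg (deg z) (cons x a)) (pm deg (deg z) (cons y b))) c) := by
  rw [← pm_sh]
  simp only [cons_sh_cons deg x y, map_add, LinearMap.add_apply, cons_sh_cons deg _ z]
  abel

theorem sh_cons_sh (x y z : V) (a b c : Words R V) :
    sh deg (cons x a) (sh deg (cons y b) (cons z c))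
      = cons x (sh deg a (sh deg (cons y b) (cons z c)))
        + cons y (sh deg (pm deg (deg y) (cons x a)) (sh deg b (cons z c)))
        + cons z (sh deg (pm deg (deg z) (cons x a)) (sh deg (pm deg (deg z) (cons y b)) c)) := by
  simp only [cons_sh_cons deg y z, map_add, cons_sh_cons deg x]
  abel

theorem sh_wd_assoc (u v w : List V) :
    sh deg (sh deg (wd R u) (wd R v)) (wd R w) = sh deg (wd R u) (sh deg (wd R v) (wd R w)) := by
  induction hn : u.length + v.length + w.length using Nat.strong_induction_on
    generalizing u v w with
  | _ n ih =>
  match u, v, w with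
  | [], v, w => simp
  | x :: u, [], w => simp
  | x :: u, y :: v, [] => simp
  | x :: u, y :: v, z :: w =>
    have h1 := ih _ (by simp at hn ⊢; omega) u (y :: v) (z :: w) rfl
    have h2 := ih _ (by simp at hn ⊢; omega) (x :: u) v (z :: w) rfl
    have h3 := ih _ (by simp at hn ⊢; omega) (x :: u) (y :: v) w rfl
    simp only [← cons_wd] at h1 h2 h3 ⊢
    rw [sh_sh_cons, sh_cons_sh, h1]
    simp only [cons_wd, pm_wd, map_smul, LinearMap.smul_apply] at h2 h3 ⊢
    rw [h2, h3]

theorem sh_assoc (a b c : Words R V) : sh deg (sh deg a b) c = sh deg a (sh deg b c) := by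
  have h : ∀ u, sh deg (sh deg (wd R u) b) c = sh deg (wd R u) (sh deg b c) := by
    intro u
    refine words_ext₂ (f := (sh deg).comp (sh deg (wd R u)))
      (g := (sh deg).compr₂ (sh deg (wd R u))) (fun v w => ?_) b c
    exact sh_wd_assoc deg u v w
  exact DFunLike.congr_fun (words_ext (f := ((sh deg).flip c).comp ((sh deg).flip b))
    (g := (sh deg).flip (sh deg b c)) h) a

theorem sh_comm_of_homog {n : ℕ} {a : Words R V}
    (ha : ∀ k, pm deg k a = (-1 : R) ^ (k * n) • a) (b : Words R V) :
    sh deg a b = sh deg (pm deg n b) a := by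
  have h : ∀ v, sh deg a (wd R v) = (-1 : R) ^ (n * wdeg deg v) • sh deg (wd R v) a := by
    intro v
    have h' : sh deg a (wd R v) = sh deg (wd R v) (pm deg (wdeg deg v) a) := by
      refine DFunLike.congr_fun (words_ext (f := (sh deg).flip (wd R v))
        (g := (sh deg (wd R v)).comp (pm deg (wdeg deg v))) fun u => ?_) a
      rw [LinearMap.flip_apply, LinearMap.comp_apply, pm_wd, map_smul, sh_wd, sh_wd, shWord_comm,
        mul_comm]
    rw [h', ha, map_smul, mul_comm]
  refine DFunLike.congr_fun (words_ext (f := sh deg a)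
    (g := ((sh deg).flip a).comp (pm deg n)) fun v => ?_) b
  rw [h, LinearMap.comp_apply, pm_wd, map_smul, LinearMap.flip_apply]

/-! ### Half-shuffles -/

/-- The half-shuffle: the sum of the terms of the shuffle product that begin with the first letter
of the left factor. By convention the half-shuffle with the empty word on the left is the
identity. -/
def hs : Words R V →ₗ[R] Words R V →ₗ[R] Words R V := onWords fun u =>
  match u with
  | [] => LinearMap.id
  | x :: u => cons x ∘ₗ sh deg (wd R u)

@[simp] theorem hs_nil (m : Words R V) : hs deg (wd R []) m = m := by
  rw [hs, onWords_wd]; rfl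

theorem hs_wd_cons (x : V) (u : List V) (m : Words R V) :
    hs deg (wd R (x :: u)) m = cons x (sh deg (wd R u) m) := by
  rw [hs, onWords_wd]; rfl

theorem hs_cons (x : V) (a m : Words R V) : hs deg (cons x a) m = cons x (sh deg a m) := by
  refine words_ext₂ (f := (hs deg).comp (cons x)) (g := (sh deg).compr₂ (cons x))
    (fun u v => ?_) a m
  rw [LinearMap.comp_apply, cons_wd, hs_wd_cons]; rfl

/-- The submodule of combinations of words that satisfy `P`. -/
def wordsIn (R : Type*) [CommRing R] {V : Type*} (P : List V → Prop) :
    Submodule R (Words R V) := Finsupp.supported R R {w | P w}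

theorem wordsIn_eq_span (P : List V → Prop) :
    wordsIn R P = Submodule.span R (wd R '' {w | P w}) :=
  Finsupp.supported_eq_span_single R _

theorem wd_mem {P : List V → Prop} {w : List V} (h : P w) : wd R w ∈ wordsIn R P :=
  Finsupp.single_mem_supported R 1 h

theorem wordsIn_mono {P Q : List V → Prop} (h : ∀ w, P w → Q w) : wordsIn R P ≤ wordsIn R Q :=
  Finsupp.supported_mono h

theorem wordsIn_induction {P : List V → Prop} {p : Words R V → Prop} {m : Words R V}
    (hm : m ∈ wordsIn R P) (zero : p 0) (add : ∀ a b, p a → p b → p (a + b))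
    (smul : ∀ (r : R) a, p a → p (r • a)) (word : ∀ w, P w → p (wd R w)) : p m := by
  rw [wordsIn_eq_span] at hm
  induction hm using Submodule.span_induction with
  | mem x hx => obtain ⟨w, hw, rfl⟩ := hx; exact word w hw
  | zero => exact zero
  | add a b _ _ h1 h2 => exact add a b h1 h2
  | smul r a _ h1 => exact smul r a h1

/-- Linear maps that agree on the words with property `P`. -/
theorem eqOn_wordsIn {N : Type*} [AddCommMonoid N] [Module R N] {P : List V → Prop}
    {f g : Words R V →ₗ[R] N} (h : ∀ w, P w → f (wd R w) = g (wd R w)) {m : Words R V}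
    (hm : m ∈ wordsIn R P) : f m = g m := by
  refine wordsIn_induction (p := fun m => f m = g m) hm (by simp)
    (fun a b ha hb => by simp [ha, hb]) (fun r a ha => by simp [ha]) h

theorem map_mem_wordsIn {N : Type*} [AddCommMonoid N] [Module R N] {P : List V → Prop}
    {S : Submodule R N} {f : Words R V →ₗ[R] N} (h : ∀ w, P w → f (wd R w) ∈ S) {m : Words R V}
    (hm : m ∈ wordsIn R P) : f m ∈ S := by
  refine wordsIn_induction (p := fun m => f m ∈ S) hm (by simp)
    (fun a b ha hb => by simpa using S.add_mem ha hb)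
    (fun r a ha => by simpa using S.smul_mem r ha) h

/-- Each term of the shuffle product of two words is a permutation of their concatenation. -/
theorem shWord_perm (u v : List V) : shWord R deg u v ∈ wordsIn R fun w => w.Perm (u ++ v) := by
  fun_induction shWord R deg u v with
  | case1 v => exact wd_mem (List.Perm.refl _)
  | case2 x u => exact wd_mem (by simp)
  | case3 x u y v h1 h2 =>
    refine Submodule.add_mem _ ?_ (Submodule.smul_mem _ _ ?_)
    · exact map_mem_wordsIn (fun w hw => by rw [cons_wd]; exact wd_mem (List.Perm.cons x hw)) h1
    · refine map_mem_wordsIn (fun w hw => ?_) h2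
      rw [cons_wd]
      exact wd_mem ((List.Perm.cons y hw).trans List.perm_middle.symm)

theorem sh_mem {P Q T : List V → Prop} (h : ∀ u v, P u → Q v → ∀ w, w.Perm (u ++ v) → T w)
    {a b : Words R V} (ha : a ∈ wordsIn R P) (hb : b ∈ wordsIn R Q) :
    sh deg a b ∈ wordsIn R T := by
  refine map_mem_wordsIn (f := (sh deg).flip b) (fun u hu => ?_) ha
  refine map_mem_wordsIn (f := sh deg (wd R u)) (fun v hv => ?_) hb
  rw [sh_wd]
  exact wordsIn_mono (fun w hw => h u v hu hv w hw) (shWord_perm deg u v)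

theorem cons_mem {P T : List V → Prop} (x : V) (h : ∀ u, P u → T (x :: u)) {a : Words R V}
    (ha : a ∈ wordsIn R P) : cons x a ∈ wordsIn R T :=
  map_mem_wordsIn (fun w hw => by rw [cons_wd]; exact wd_mem (h w hw)) ha

theorem hs_mem {P Q T : List V → Prop} (h : ∀ u v, P u → Q v → ∀ w, w.Perm (u ++ v) → T w)
    {a b : Words R V} (ha : a ∈ wordsIn R P) (hb : b ∈ wordsIn R Q) :
    hs deg a b ∈ wordsIn R T := by
  refine map_mem_wordsIn (f := (hs deg).flip b) (fun u hu => ?_) ha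
  rw [LinearMap.flip_apply]
  cases u with
  | nil =>
    rw [hs_nil]
    exact wordsIn_mono (fun w hw => h [] w hu hw w (List.Perm.refl _)) hb
  | cons x u =>
    rw [hs_wd_cons]
    refine cons_mem x (P := fun w => ∃ v, Q v ∧ w.Perm (u ++ v)) ?_ ?_
    · rintro w ⟨v, hv, hw⟩
      exact h _ v hu hv _ (List.Perm.cons x hw)
    · exact sh_mem deg (P := fun w => w = u) (fun u' v hu' hv w hw => ⟨v, hv, hu' ▸ hw⟩)
        (wd_mem rfl) hb

/-- An element of the module of words without constant term. -/
abbrev NoConst (m : Words R V) : Prop := m ∈ wordsIn R fun w => w ≠ []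

/-- The half-shuffles form a Zinbiel algebra: this identity and the associativity of the shuffle
product carry all computations with divided products. -/
theorem hs_hs {a : Words R V} (ha : NoConst a) (b c : Words R V) :
    hs deg (hs deg a b) c = hs deg a (sh deg b c) := by
  refine eqOn_wordsIn (f := ((hs deg).flip c).comp ((hs deg).flip b))
    (g := (hs deg).flip (sh deg b c)) (fun w hw => ?_) ha
  obtain ⟨x, u, rfl⟩ := List.exists_cons_of_ne_nil hw
  simp only [LinearMap.comp_apply, LinearMap.flip_apply]
  rw [hs_wd_cons, hs_cons, hs_wd_cons, sh_assoc]

theorem wdeg_perm {u v : List V} (h : u.Perm v) : wdeg deg u = wdeg deg v :=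
  (h.map deg).sum_eq

/-- Combinations of words whose degree has the parity of `k`. -/
abbrev HomogIn (k : ℕ) (m : Words R V) : Prop :=
  m ∈ wordsIn R fun w => Even (wdeg deg w) ↔ Even k

variable {deg} in
theorem HomogIn.pm_eq {k : ℕ} {m : Words R V} (h : HomogIn deg k m) (n : ℕ) :
    pm deg n m = (-1 : R) ^ (n * k) • m := by
  refine eqOn_wordsIn (f := pm deg n) (g := (-1 : R) ^ (n * k) • LinearMap.id) (fun w hw => ?_) h
  rw [pm_wd, LinearMap.smul_apply, LinearMap.id_apply]
  congr 1
  exact sign_congr (by simp only [Nat.even_mul, hw])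

/-- The shuffle product of two half-shuffles. -/
theorem hs_sh_hs {k : ℕ} {a b : Words R V} (ha : NoConst a)
    (hb : b ∈ wordsIn R fun w => w ≠ [] ∧ (Even (wdeg deg w) ↔ Even k)) (m n : Words R V) :
    sh deg (hs deg a m) (hs deg b n) = hs deg a (sh deg m (hs deg b n))
      + hs deg b (sh deg (pm deg k (hs deg a m)) n) := by
  refine eqOn_wordsIn (f := ((sh deg).flip (hs deg b n)).comp ((hs deg).flip m))
    (g := (hs deg).flip (sh deg m (hs deg b n)) + (hs deg b).comp (((sh deg).flip n).comp
      ((pm deg k).comp ((hs deg).flip m)))) (fun w hw => ?_) ha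
  obtain ⟨x, u, rfl⟩ := List.exists_cons_of_ne_nil hw
  simp only [LinearMap.comp_apply, LinearMap.flip_apply, LinearMap.add_apply]
  refine eqOn_wordsIn (f := (sh deg (hs deg (wd R (x :: u)) m)).comp ((hs deg).flip n))
    (g := (hs deg (wd R (x :: u))).comp ((sh deg m).comp ((hs deg).flip n))
      + (hs deg).flip (sh deg (pm deg k (hs deg (wd R (x :: u)) m)) n)) (fun w' hw' => ?_) hb
  obtain ⟨y, v, rfl⟩ := List.exists_cons_of_ne_nil hw'.1
  simp only [LinearMap.comp_apply, LinearMap.flip_apply, LinearMap.add_apply]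
  have hk : ∀ A : Words R V, pm deg k A = pm deg (wdeg deg (y :: v)) A := by
    intro A
    rw [pm_congr deg hw'.2]
  rw [hk, wdeg_cons, add_comm (deg y), pm_add, hs_wd_cons, hs_wd_cons, hs_wd_cons, hs_wd_cons,
    cons_sh_cons, sh_assoc]
  congr 2
  generalize cons x (sh deg (wd R u) m) = A
  have hc : sh deg (pm deg (deg y) A) (wd R v) = sh deg (wd R v) (pm deg (wdeg deg v) (pm deg (deg y) A)) := by
    rw [sh_comm_of_homog deg (n := wdeg deg v) (a := wd R v) (fun k => pm_wd _ _ _),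
      ← pm_add deg (wdeg deg v) (wdeg deg v), pm_congr deg (k := wdeg deg v + wdeg deg v) (n := 0)
      (by simp), pm_zero]
  rw [← sh_assoc, hc, sh_assoc]

end Shuffle

end

section

section Shuffle

variable {R : Type*} [CommRing R] {U V : Type*}

/-! ### Homomorphisms of shuffle algebras given by half-shuffles -/

/-- The extension of a map `X` from letters to elements of a shuffle algebra which sends the word
`x₁x₂⋯` to the iterated half-shuffle of `X x₁`, `X x₂`, …. -/
def zin (deg : V → ℕ) (X : U → Words R V) : List U → Words R V
  | [] => wd R []
  | x :: w => hs deg (X x) (zin deg X w)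

/-- The linear extension of `zin`. -/
def zinL (deg : V → ℕ) (X : U → Words R V) : Words R U →ₗ[R] Words R V := onWords (zin deg X)

/-- `X` preserves degrees modulo 2 and its values have no constant term. -/
def ZinCompat (degU : U → ℕ) (deg : V → ℕ) (X : U → Words R V) : Prop :=
  ∀ x, X x ∈ wordsIn R fun w => w ≠ [] ∧ (Even (wdeg deg w) ↔ Even (degU x))

variable {degU : U → ℕ} {deg : V → ℕ} {X : U → Words R V}

@[simp] theorem zinL_wd (w : List U) : zinL deg X (wd R w) = zin deg X w := onWords_wd _ _

theorem zinL_cons (x : U) (m : Words R U) :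
    zinL deg X (cons x m) = hs deg (X x) (zinL deg X m) :=
  DFunLike.congr_fun (words_ext (f := (zinL deg X).comp (cons x))
    (g := (hs deg (X x)).comp (zinL deg X)) fun w => by
      simp only [LinearMap.comp_apply, cons_wd, zinL_wd, zin]) m

theorem ZinCompat.noConst (h : ZinCompat degU deg X) (x : U) : NoConst (X x) :=
  wordsIn_mono (fun _ hw => hw.1) (h x)

theorem ZinCompat.homog (h : ZinCompat degU deg X) (w : List U) :
    HomogIn deg (wdeg degU w) (zin deg X w) := by
  induction w with
  | nil => exact wd_mem (by simp)
  | cons x w ih =>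
    refine hs_mem deg (fun u v hu hv w' hw' => ?_) (h x) ih
    rw [wdeg_perm deg hw', wdeg_append, wdeg_cons, Nat.even_add, Nat.even_add, hu.2, hv]

/-- A half-shuffle homomorphism is a homomorphism for the shuffle product; this is where the parity
condition in `ZinCompat` is used. -/
theorem ZinCompat.zin_sh_wd (h : ZinCompat degU deg X) (u v : List U) :
    zinL deg X (sh degU (wd R u) (wd R v)) = sh deg (zin deg X u) (zin deg X v) := by
  induction hn : u.length + v.length using Nat.strong_induction_on generalizing u v with
  | _ n ih =>
  match u, v with
  | [], v => simp [zin]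
  | x :: u, [] => rw [sh_one, zinL_wd]; simp [zin]
  | x :: u, y :: v =>
    have h1 := ih _ (by simp at hn ⊢; omega) u (y :: v) rfl
    have h2 := ih _ (by simp at hn ⊢; omega) (x :: u) v rfl
    rw [← cons_wd x u, ← cons_wd y v, cons_sh_cons, map_add, zinL_cons, zinL_cons, cons_wd,
      cons_wd, pm_wd, map_smul, LinearMap.smul_apply, map_smul, h1, h2]
    change _ = sh deg (hs deg (X x) (zin deg X u)) (hs deg (X y) (zin deg X v))
    rw [hs_sh_hs deg (h.noConst x) (h y)]
    congr 1
    change _ = hs deg (X y) (sh deg (pm deg (degU y) (zin deg X (x :: u))) (zin deg X v))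
    simp only [(h.homog (x :: u)).pm_eq, map_smul, LinearMap.smul_apply]

theorem ZinCompat.zin_sh (h : ZinCompat degU deg X) (a b : Words R U) :
    zinL deg X (sh degU a b) = sh deg (zinL deg X a) (zinL deg X b) :=
  words_ext₂ (f := (sh degU).compr₂ (zinL deg X)) (g := (sh deg).compl₁₂ (zinL deg X) (zinL deg X))
    (fun u v => by
      simp only [LinearMap.compr₂_apply, LinearMap.compl₁₂_apply, zinL_wd, h.zin_sh_wd]) a b

theorem ZinCompat.zin_hs (h : ZinCompat degU deg X) (a b : Words R U) :
    zinL deg X (hs degU a b) = hs deg (zinL deg X a) (zinL deg X b) := by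
  refine words_ext₂ (f := (hs degU).compr₂ (zinL deg X))
    (g := (hs deg).compl₁₂ (zinL deg X) (zinL deg X)) (fun u v => ?_) a b
  simp only [LinearMap.compr₂_apply, LinearMap.compl₁₂_apply]
  cases u with
  | nil => rw [hs_nil, zinL_wd [], zin, hs_nil]
  | cons x u =>
    rw [hs_wd_cons, zinL_cons, h.zin_sh, ← cons_wd x u, zinL_cons, hs_hs deg (h.noConst x)]

/-! ### Derivations of the shuffle algebra -/

/-- The operator of odd degree on words which replaces one letter `x` by `c x • g x`. -/
def letterDer (deg : V → ℕ) (c : V → R) (g : V → V) : List V → Words R V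
  | [] => 0
  | x :: w => c x • wd R (g x :: w) + (-1 : R) ^ deg x • cons x (letterDer deg c g w)

/-- The linear extension of `letterDer`. -/
def letterDerL (deg : V → ℕ) (c : V → R) (g : V → V) : Words R V →ₗ[R] Words R V :=
  onWords (letterDer deg c g)

variable {c : V → R} {g : V → V}

@[simp] theorem letterDerL_wd (w : List V) : letterDerL deg c g (wd R w) = letterDer deg c g w :=
  onWords_wd _ _

theorem letterDerL_cons (x : V) (m : Words R V) : letterDerL deg c g (cons x m)
    = c x • cons (g x) m + (-1 : R) ^ deg x • cons x (letterDerL deg c g m) :=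
  DFunLike.congr_fun (words_ext (f := (letterDerL deg c g).comp (cons x))
    (g := c x • cons (g x) + (-1 : R) ^ deg x • (cons x).comp (letterDerL deg c g)) fun w => by
      simp [letterDer]) m

/-- The letter `g x` is of opposite parity to `x` unless its coefficient vanishes. -/
def OddLetters (deg : V → ℕ) (c : V → R) (g : V → V) : Prop :=
  ∀ x, c x = 0 ∨ (Even (deg (g x)) ↔ Even (deg x + 1))

theorem OddLetters.smul_pm (h : OddLetters deg c g) (x : V) (m : Words R V) :
    c x • pm deg (deg (g x)) m = c x • pm deg (deg x + 1) m := by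
  rcases h x with h | h
  · simp [h]
  · rw [pm_congr deg h]

theorem OddLetters.smul_sign (h : OddLetters deg c g) (n : ℕ) (x : V) :
    c x * (-1 : R) ^ (n * deg (g x)) = c x * (-1 : R) ^ (n * (deg x + 1)) := by
  rcases h x with h | h
  · simp [h]
  · congr 1; exact sign_congr (by simp only [Nat.even_mul, h])

theorem OddLetters.pm_der (h : OddLetters deg c g) (n : ℕ) (m : Words R V) :
    pm deg n (letterDerL deg c g m) = (-1 : R) ^ n • letterDerL deg c g (pm deg n m) := by
  refine DFunLike.congr_fun (words_ext (f := (pm deg n).comp (letterDerL deg c g))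
    (g := (-1 : R) ^ n • (letterDerL deg c g).comp (pm deg n)) fun w => ?_) m
  simp only [LinearMap.comp_apply, LinearMap.smul_apply, pm_wd, map_smul, letterDerL_wd]
  induction w with
  | nil => simp [letterDer]
  | cons x w ih =>
    simp only [letterDer, map_add, map_smul, pm_wd, pm_cons, ih, smul_smul, smul_add]
    congr 2
    · rw [wdeg_cons, mul_add, pow_add, ← mul_assoc, h.smul_sign, wdeg_cons]
      ring
    · rw [wdeg_cons]; ring

/-- The operator `letterDerL` is an odd derivation of the shuffle product. -/
theorem OddLetters.der_sh (h : OddLetters deg c g) (a b : Words R V) :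
    letterDerL deg c g (sh deg a b)
      = sh deg (letterDerL deg c g a) b + sh deg (pm deg 1 a) (letterDerL deg c g b) := by
  refine words_ext₂ (f := (sh deg).compr₂ (letterDerL deg c g))
    (g := (sh deg).comp (letterDerL deg c g)
      + (sh deg).compl₁₂ (pm deg 1) (letterDerL deg c g)) (fun u v => ?_) a b
  simp only [LinearMap.compr₂_apply, LinearMap.add_apply, LinearMap.compl₁₂_apply,
    LinearMap.comp_apply]
  induction hn : u.length + v.length using Nat.strong_induction_on generalizing u v with
  | _ n ih =>
  match u, v with
  | [], v => simp [letterDer]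
  | x :: u, [] => rw [sh_one]; simp [letterDer]
  | x :: u, y :: v =>
    have h1 := ih _ (by simp at hn ⊢; omega) u (y :: v) rfl
    have h2 := ih _ (by simp at hn ⊢; omega) (x :: u) v rfl
    -- The induction hypothesis for `x :: u` and `v`, with the sign from the passage of `y`.
    have h3 : (-1 : R) ^ deg y • letterDerL deg c g (sh deg (pm deg (deg y) (wd R (x :: u))) (wd R v))
        = sh deg (pm deg (deg y) (letterDerL deg c g (wd R (x :: u)))) (wd R v)
          + (-1 : R) ^ deg y •
            sh deg (pm deg (deg y) (pm deg 1 (wd R (x :: u)))) (letterDerL deg c g (wd R v)) := by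
      rw [h.pm_der]
      simp only [pm_wd, map_smul, LinearMap.smul_apply, h2, smul_add]
      rw [smul_comm ((-1 : R) ^ (1 * _))]
    -- The letter `g y` has the opposite parity to `y`, so its passage over `x :: u` absorbs `pm
    -- deg 1`.
    have e3 : c y • cons (g y) (sh deg (pm deg (deg (g y)) (pm deg 1 (wd R (x :: u)))) (wd R v))
        = c y • cons (g y) (sh deg (pm deg (deg y) (wd R (x :: u))) (wd R v)) := by
      rw [← map_smul, ← LinearMap.smul_apply, ← map_smul, h.smul_pm, map_smul, LinearMap.smul_apply,
        map_smul, ← pm_add, pm_congr deg (k := deg y + 1 + 1) (n := deg y)]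
      simp only [Nat.even_add, Nat.not_even_one]; tauto
    have e : pm deg 1 (wd R (x :: u)) = (-1 : R) ^ deg x • cons x (pm deg 1 (wd R u)) := by
      rw [← cons_wd, pm_cons, one_mul]
    -- The left-hand side, sorted by the first letter of the result.
    have L : letterDerL deg c g (sh deg (wd R (x :: u)) (wd R (y :: v)))
        = c x • cons (g x) (sh deg (wd R u) (wd R (y :: v)))
          + (-1 : R) ^ deg x • cons x (letterDerL deg c g (sh deg (wd R u) (wd R (y :: v))))
          + c y • cons (g y) (sh deg (pm deg (deg y) (wd R (x :: u))) (wd R v))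
          + cons y ((-1 : R) ^ deg y •
            letterDerL deg c g (sh deg (pm deg (deg y) (wd R (x :: u))) (wd R v))) := by
      rw [← cons_wd x u, ← cons_wd y v, cons_sh_cons, map_add, letterDerL_cons, letterDerL_cons,
        map_smul]
      abel
    have R1 : sh deg (letterDerL deg c g (wd R (x :: u))) (wd R (y :: v))
        = c x • cons (g x) (sh deg (wd R u) (wd R (y :: v)))
          + (-1 : R) ^ deg x • cons x (sh deg (letterDerL deg c g (wd R u)) (wd R (y :: v)))
          + cons y (sh deg (pm deg (deg y) (letterDerL deg c g (wd R (x :: u)))) (wd R v)) := by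
      rw [← cons_wd x u, ← cons_wd y v, letterDerL_cons]
      simp only [map_add, LinearMap.add_apply, map_smul, LinearMap.smul_apply, cons_sh_cons,
        smul_add]
      abel
    have R2 : sh deg (pm deg 1 (wd R (x :: u))) (letterDerL deg c g (wd R (y :: v)))
        = (-1 : R) ^ deg x • cons x (sh deg (pm deg 1 (wd R u)) (letterDerL deg c g (wd R (y :: v))))
          + c y • cons (g y) (sh deg (pm deg (deg (g y)) (pm deg 1 (wd R (x :: u)))) (wd R v))
          + (-1 : R) ^ deg y • cons y
            (sh deg (pm deg (deg y) (pm deg 1 (wd R (x :: u)))) (letterDerL deg c g (wd R v))) := by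
      rw [e, ← cons_wd y v, letterDerL_cons]
      simp only [map_add, map_smul, LinearMap.smul_apply, cons_sh_cons, smul_add,
        smul_smul, mul_comm (c y), mul_comm ((-1 : R) ^ deg y)]
      abel
    rw [L, R1, R2, h1, h3, e3]
    simp only [map_add, map_smul, smul_add]
    abel

theorem OddLetters.der_hs (h : OddLetters deg c g) (a b : Words R V) :
    letterDerL deg c g (hs deg a b)
      = hs deg (letterDerL deg c g a) b + hs deg (pm deg 1 a) (letterDerL deg c g b) := by
  refine words_ext₂ (f := (hs deg).compr₂ (letterDerL deg c g))
    (g := (hs deg).comp (letterDerL deg c g)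
      + (hs deg).compl₁₂ (pm deg 1) (letterDerL deg c g)) (fun u v => ?_) a b
  simp only [LinearMap.compr₂_apply, LinearMap.add_apply, LinearMap.compl₁₂_apply,
    LinearMap.comp_apply]
  cases u with
  | nil => simp [letterDer]
  | cons x u =>
    rw [← cons_wd x u, hs_cons, letterDerL_cons, letterDerL_cons, h.der_sh, pm_cons, one_mul]
    simp only [map_add, LinearMap.add_apply, map_smul, LinearMap.smul_apply, hs_cons, smul_add]
    abel

/-! ### Gluing of neighbour letters -/

/-- Gluing of the letter `p` to the first letter `q` of a word, with result `c p q • g p q`. -/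
def glueFirst (c : V → V → R) (g : V → V → V) (p : V) : List V → Words R V
  | [] => 0
  | q :: w => c p q • wd R (g p q :: w)

/-- The linear extension of `glueFirst`. -/
def glueFirstL (c : V → V → R) (g : V → V → V) (p : V) : Words R V →ₗ[R] Words R V :=
  onWords (glueFirst c g p)

/-- The operator of odd degree on words which glues two neighbour letters. -/
def glueDer (deg : V → ℕ) (c : V → V → R) (g : V → V → V) : List V → Words R V
  | [] => 0
  | p :: w => glueFirst c g p w + (-1 : R) ^ deg p • cons p (glueDer deg c g w)

/-- The linear extension of `glueDer`. -/
def glueDerL (deg : V → ℕ) (c : V → V → R) (g : V → V → V) : Words R V →ₗ[R] Words R V :=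
  onWords (glueDer deg c g)

variable {c₂ : V → V → R} {g₂ : V → V → V}

@[simp] theorem glueDerL_wd (w : List V) : glueDerL deg c₂ g₂ (wd R w) = glueDer deg c₂ g₂ w :=
  onWords_wd _ _

@[simp] theorem glueFirstL_wd (p : V) (w : List V) :
    glueFirstL c₂ g₂ p (wd R w) = glueFirst c₂ g₂ p w := onWords_wd _ _

theorem glueFirstL_cons (p q : V) (m : Words R V) :
    glueFirstL c₂ g₂ p (cons q m) = c₂ p q • cons (g₂ p q) m :=
  DFunLike.congr_fun (words_ext (f := (glueFirstL c₂ g₂ p).comp (cons q))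
    (g := c₂ p q • cons (g₂ p q)) fun w => by simp [glueFirst]) m

theorem glueDerL_cons (p : V) (m : Words R V) : glueDerL deg c₂ g₂ (cons p m)
    = glueFirstL c₂ g₂ p m + (-1 : R) ^ deg p • cons p (glueDerL deg c₂ g₂ m) :=
  DFunLike.congr_fun (words_ext (f := (glueDerL deg c₂ g₂).comp (cons p))
    (g := glueFirstL c₂ g₂ p + (-1 : R) ^ deg p • (cons p).comp (glueDerL deg c₂ g₂)) fun w => by
      simp [glueDer]) m

/-- The gluing with the letter `p` is graded antisymmetric and the glued letter has the expected
parity. -/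
structure GlueAnti (deg : V → ℕ) (c₂ : V → V → R) (g₂ : V → V → V) (p q : V) : Prop where
  anti : ∀ m : Words R V, c₂ p q • cons (g₂ p q) m
    = (-1 : R) ^ (deg p * deg q + 1) • c₂ q p • cons (g₂ q p) m

/-- The parity of glued letters. -/
def OddGlue (deg : V → ℕ) (c₂ : V → V → R) (g₂ : V → V → V) : Prop :=
  ∀ p q, c₂ p q = 0 ∨ (Even (deg (g₂ p q)) ↔ Even (deg p + deg q + 1))

theorem OddGlue.smul_sign (h : OddGlue deg c₂ g₂) (n : ℕ) (p q : V) :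
    c₂ p q * (-1 : R) ^ (deg (g₂ p q) * n) = c₂ p q * (-1 : R) ^ ((deg p + deg q + 1) * n) := by
  rcases h p q with h | h
  · simp [h]
  · congr 1; exact sign_congr (by simp only [Nat.even_mul, h])

theorem replicate_sh_cons (deg : V → ℕ) (l y : V) (i : ℕ) (m : Words R V) :
    sh deg (wd R (List.replicate (i + 1) l)) (cons y m)
      = cons l (sh deg (wd R (List.replicate i l)) (cons y m))
        + (-1 : R) ^ (deg y * ((i + 1) * deg l)) •
          cons y (sh deg (wd R (List.replicate (i + 1) l)) m) := by
  rw [List.replicate_succ, ← cons_wd, cons_sh_cons, cons_wd, pm_wd, ← List.replicate_succ, wdeg,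
    List.map_replicate, List.sum_replicate, smul_eq_mul, map_smul, LinearMap.smul_apply, map_smul]

/-- Gluing a letter `l` with the first letter of a shuffle of copies of `l` with a word: only the
term in which the word comes first contributes, as `l` cannot be glued with itself. -/
theorem glueFirst_replicate_sh_cons {l : V} (hl : c₂ l l = 0) (y : V) (i : ℕ) (m : Words R V) :
    glueFirstL c₂ g₂ l (sh deg (wd R (List.replicate i l)) (cons y m))
      = (-1 : R) ^ (deg y * (i * deg l)) • c₂ l y •
        cons (g₂ l y) (sh deg (wd R (List.replicate i l)) m) := by
  cases i with
  | zero => simp [glueFirstL_cons]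
  | succ i => rw [replicate_sh_cons, map_add, map_smul, glueFirstL_cons, hl, zero_smul, zero_add,
      glueFirstL_cons]

theorem glueDer_replicate {l : V} (hl : c₂ l l = 0) (i : ℕ) :
    glueDer deg c₂ g₂ (List.replicate i l) = 0 := by
  induction i with
  | zero => rfl
  | succ i ih =>
    rw [List.replicate_succ, glueDer, ih]
    cases i with
    | zero => simp [glueFirst]
    | succ i => simp [List.replicate_succ, glueFirst, hl]

/-- The shuffle product with a power of a letter `l` commutes, up to sign, with the gluing of
neighbour letters, provided that the gluing with `l` is antisymmetric. -/
theorem glueDer_replicate_sh (ho : OddGlue deg c₂ g₂) {l : V} (hl : c₂ l l = 0) (i : ℕ) (w : List V)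
    (hw : ∀ y ∈ w, GlueAnti deg c₂ g₂ l y) :
    glueDerL deg c₂ g₂ (sh deg (wd R (List.replicate i l)) (wd R w))
      = (-1 : R) ^ (i * deg l) • sh deg (wd R (List.replicate i l)) (glueDerL deg c₂ g₂ (wd R w)) := by
  induction hn : i + w.length using Nat.strong_induction_on generalizing i w with
  | _ n ih =>
  match i, w with
  | 0, w => simp
  | i + 1, [] => simp [glueDer_replicate hl, glueDer]
  | i + 1, y :: w =>
    have h1 := ih _ (by simp at hn ⊢; omega) i (y :: w) hw rfl
    have h2 := ih _ (by simp at hn ⊢; omega) (i + 1) w (fun z hz => hw z (List.mem_cons_of_mem _ hz)) rfl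
    have hy := (hw y List.mem_cons_self).anti
    -- Gluings of `y` with the letter behind it: this is `l`, or else the second letter of the
    -- word, and then no `l` stands between them.
    have hQ : glueFirstL c₂ g₂ y (sh deg (wd R (List.replicate (i + 1) l)) (wd R w))
        = c₂ y l • cons (g₂ y l) (sh deg (wd R (List.replicate i l)) (wd R w))
          + (-1 : R) ^ ((deg y + 1) * ((i + 1) * deg l)) •
            (sh deg (wd R (List.replicate (i + 1) l)) (glueFirst c₂ g₂ y w)
              - cons l (sh deg (wd R (List.replicate i l)) (glueFirst c₂ g₂ y w))) := by
      cases w with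
      | nil => simp [List.replicate_succ, glueFirst]
      | cons z w =>
        rw [← cons_wd z w, replicate_sh_cons, map_add, glueFirstL_cons, map_smul, glueFirstL_cons,
          glueFirst]
        congr 1
        rw [map_smul, map_smul, map_smul, ← cons_wd, replicate_sh_cons, ← smul_sub, add_sub_cancel_left,
          smul_smul, smul_smul, smul_smul]
        congr 1
        have e : (-1 : R) ^ (deg z * ((i + 1) * deg l)) = (-1 : R) ^ ((deg y + 1) * ((i + 1) * deg l))
            * (-1 : R) ^ ((deg y + deg z + 1) * ((i + 1) * deg l)) := by
          rw [← pow_add]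
          apply sign_congr
          simp only [Nat.even_add, Nat.even_mul]; tauto
        rw [mul_assoc, ho.smul_sign, e]
        ring
    rw [← cons_wd y w, replicate_sh_cons, map_add, map_smul, glueDerL_cons, glueDerL_cons,
      glueFirst_replicate_sh_cons hl, hy, cons_wd, h1, h2, hQ, ← cons_wd y w, glueDerL_cons]
    simp only [map_add, map_smul, replicate_sh_cons, smul_add, smul_sub, glueFirstL_wd]
    have e1 : (-1 : R) ^ (deg y * (i * deg l)) * (-1 : R) ^ (deg l * deg y + 1)
        = - (-1 : R) ^ (deg y * ((i + 1) * deg l)) := by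
      rw [neg_sign, ← pow_add]
      apply sign_congr
      simp only [Nat.even_add, Nat.even_mul]; tauto
    have e2 : (-1 : R) ^ deg l * (-1 : R) ^ (i * deg l) = (-1 : R) ^ ((i + 1) * deg l) := by
      rw [← pow_add]; congr 1; ring
    have e3 : (-1 : R) ^ (deg y * ((i + 1) * deg l)) * (-1 : R) ^ ((deg y + 1) * ((i + 1) * deg l))
        = (-1 : R) ^ ((i + 1) * deg l) := by
      rw [← pow_add]
      apply sign_congr
      simp only [Nat.even_add, Nat.even_mul]; tauto
    generalize cons (g₂ y l) (sh deg (wd R (List.replicate i l)) (wd R w)) = G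
    generalize sh deg (wd R (List.replicate (i + 1) l)) (glueFirst c₂ g₂ y w) = G'
    generalize cons l (sh deg (wd R (List.replicate i l)) (glueFirst c₂ g₂ y w)) = A
    generalize cons l (sh deg (wd R (List.replicate i l)) (cons y (glueDerL deg c₂ g₂ (wd R w)))) = B
    -- The gluings of `l` with a following `y` cancel those of `y` with a following `l`, by
    -- antisymmetry.
    linear_combination (norm := module) (e1 * c₂ y l) • G + e2 • A + ((-1 : R) ^ deg y * e2) • B
      + e3 • (G' - A)

/-- An odd derivation that annihilates the letter `l` commutes up to sign with the shuffle
multiplication by a power of `l`. -/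
theorem letterDer_replicate_sh (h : OddLetters deg c g) {l : V} (hl : c l = 0) (i : ℕ)
    (m : Words R V) : letterDerL deg c g (sh deg (wd R (List.replicate i l)) m)
      = (-1 : R) ^ (i * deg l) • sh deg (wd R (List.replicate i l)) (letterDerL deg c g m) := by
  have h0 : letterDer deg c g (List.replicate i l) = 0 := by
    induction i with
    | zero => rfl
    | succ i ih => rw [List.replicate_succ, letterDer, ih, hl]; simp
  rw [h.der_sh, letterDerL_wd, h0, pm_wd, map_zero, LinearMap.zero_apply, zero_add, map_smul,
    LinearMap.smul_apply, wdeg, List.map_replicate, List.sum_replicate, smul_eq_mul, one_mul]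

end Shuffle

end

section

/-! ### Shuffles of several words -/

section Merge

variable {R : Type*} [CommRing R] {V : Type*} {ℓ N : ℕ}

/-- The letter at the place `p` of the shuffle of the words `u i` according to `c`. -/
def letterAt [Inhabited V] (u : Fin ℓ → List V) (c : Fin N → Fin ℓ) (p : Fin N) : V :=
  (u (c p)).getD (Finset.univ.filter fun q => q < p ∧ c q = c p).card default

/-- The map `c` prescribes as many letters of each word as there are. -/
def Fits (u : Fin ℓ → List V) (c : Fin N → Fin ℓ) : Prop :=
  ∀ i, (Finset.univ.filter fun p => c p = i).card = (u i).length

/-- The first letters of the words with numbers `≥ s` come after the first letters of all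
words with smaller numbers `≥ s`. -/
def DivFrom (s : ℕ) (c : Fin N → Fin ℓ) : Prop :=
  ∀ i i', s ≤ i.1 → i < i' → (∃ p, c p = i) → ∀ q, c q = i' → ∃ p, p < q ∧ c p = i

/-- The Koszul sign of a shuffle. -/
def koszul (R : Type*) [CommRing R] [Inhabited V] (deg : V → ℕ) (u : Fin ℓ → List V)
    (c : Fin N → Fin ℓ) : R :=
  ∏ p : Fin N, ∏ q : Fin N, if p < q ∧ c q < c p then
    (-1 : R) ^ (deg (letterAt u c p) * deg (letterAt u c q)) else 1

/-- Removing the first letter of the `j`-th word. -/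
def peel (u : Fin ℓ → List V) (j : Fin ℓ) : Fin ℓ → List V := Function.update u j (u j).tail

theorem peel_self (u : Fin ℓ → List V) (j : Fin ℓ) : peel u j j = (u j).tail := by simp [peel]

theorem peel_of_ne (u : Fin ℓ → List V) {i j : Fin ℓ} (h : i ≠ j) : peel u j i = u i := by
  simp [peel, h]

theorem letterAt_cons_zero [Inhabited V] (u : Fin ℓ → List V) (j : Fin ℓ) (c : Fin N → Fin ℓ) :
    letterAt u (Fin.cons j c : Fin (N + 1) → Fin ℓ) 0 = (u j).getD 0 default := by
  simp [letterAt]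

theorem card_filter_cons (j : Fin ℓ) (c : Fin N → Fin ℓ) (p : Fin N) :
    (Finset.univ.filter fun q : Fin (N + 1) => q < p.succ ∧
      (Fin.cons j c : Fin (N + 1) → Fin ℓ) q = c p).card
      = (if j = c p then 1 else 0) + (Finset.univ.filter fun q => q < p ∧ c q = c p).card := by
  rw [Fin.card_filter_univ_succ]
  simp only [Fin.succ_pos, Fin.cons_zero, true_and, Fin.cons_succ,
    Fin.succ_lt_succ_iff]
  split_ifs <;> omega

theorem letterAt_cons_succ [Inhabited V] (u : Fin ℓ → List V) (j : Fin ℓ) (c : Fin N → Fin ℓ)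
    (p : Fin N) : letterAt u (Fin.cons j c : Fin (N + 1) → Fin ℓ) p.succ
      = letterAt (peel u j) c p := by
  simp only [letterAt, Fin.cons_succ, card_filter_cons]
  by_cases h : j = c p
  · subst h
    rw [if_pos rfl, peel_self]
    cases u (c p) <;> simp [add_comm 1]
  · rw [if_neg h, peel_of_ne u (Ne.symm h), zero_add]

theorem ofFn_letterAt_cons [Inhabited V] (u : Fin ℓ → List V) (j : Fin ℓ) (c : Fin N → Fin ℓ) :
    List.ofFn (letterAt u (Fin.cons j c : Fin (N + 1) → Fin ℓ))
      = (u j).getD 0 default :: List.ofFn (letterAt (peel u j) c) := by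
  rw [List.ofFn_succ, letterAt_cons_zero]
  simp only [letterAt_cons_succ]

/-- A shuffle pattern of words is the choice of the word that provides the first letter, followed
by a pattern for the rest. -/
theorem fits_cons {u : Fin ℓ → List V} {j : Fin ℓ} {c : Fin N → Fin ℓ} :
    Fits u (Fin.cons j c : Fin (N + 1) → Fin ℓ) ↔ u j ≠ [] ∧ Fits (peel u j) c := by
  have h : ∀ i, (Finset.univ.filter fun p => (Fin.cons j c : Fin (N + 1) → Fin ℓ) p = i).card
      = (if j = i then 1 else 0) + (Finset.univ.filter fun p => c p = i).card := by
    intro i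
    rw [Fin.card_filter_univ_succ]
    simp only [Fin.cons_zero, Fin.cons_succ]
    split_ifs <;> omega
  simp only [Fits, h]
  constructor
  · intro H
    have hj : u j ≠ [] := by
      intro h0
      have := H j
      rw [if_pos rfl, h0] at this
      simp at this
    refine ⟨hj, fun i => ?_⟩
    by_cases hi : j = i
    · subst hi
      have := H j
      rw [if_pos rfl] at this
      rw [peel_self, List.length_tail]; omega
    · have := H i
      rw [if_neg hi] at this
      rw [peel_of_ne u (Ne.symm hi)]; omega
  · rintro ⟨hj, H⟩ i
    have := H i
    by_cases hi : j = i
    · subst hi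
      rw [peel_self, List.length_tail] at this
      have := List.length_pos_iff.2 hj
      rw [if_pos rfl]; omega
    · rw [peel_of_ne u (Ne.symm hi)] at this
      rw [if_neg hi]; omega

theorem Fits.exists_iff {u : Fin ℓ → List V} {c : Fin N → Fin ℓ} (h : Fits u c) (i : Fin ℓ) :
    (∃ p, c p = i) ↔ u i ≠ [] := by
  rw [← List.length_pos_iff, ← h i, Finset.card_pos]
  simp [Finset.Nonempty]

/-- A first letter from the word `j` forces the constrained words before `j` to be empty; for the rest
of the pattern, the words up to `j` are no longer constrained. -/
theorem divFrom_cons {s : ℕ} {j : Fin ℓ} {c : Fin N → Fin ℓ} :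
    DivFrom s (Fin.cons j c : Fin (N + 1) → Fin ℓ) ↔
      (∀ i : Fin ℓ, s ≤ i.1 → i < j → ¬ ∃ p, c p = i) ∧ DivFrom (max s (j.1 + 1)) c := by
  constructor
  · intro H
    refine ⟨?_, ?_⟩
    · rintro i hs hij ⟨p, hp⟩
      obtain ⟨q, hq, -⟩ := H i j hs hij ⟨p.succ, by simpa using hp⟩ 0 rfl
      exact absurd hq (Fin.not_lt_zero q)
    · rintro i i' hs hii ⟨p, hp⟩ q hq
      obtain ⟨p', hp', hc⟩ := H i i' (by omega) hii ⟨p.succ, by simpa using hp⟩ q.succ (by simpa using hq)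
      cases p' using Fin.cases with
      | zero =>
        rw [Fin.cons_zero] at hc
        subst hc; omega
      | succ p' => exact ⟨p', Fin.succ_lt_succ_iff.1 hp', by simpa using hc⟩
  · rintro ⟨h1, h2⟩ i i' hs hii ⟨p, hp⟩ q hq
    by_cases hj : i = j
    · subst hj
      refine ⟨0, ?_, rfl⟩
      cases q using Fin.cases with
      | zero => rw [Fin.cons_zero] at hq; exact absurd hq hii.ne
      | succ q => exact Fin.succ_pos q
    have hp' : ∃ p, c p = i := by
      cases p using Fin.cases with
      | zero => exact absurd hp.symm hj
      | succ p => exact ⟨p, by simpa using hp⟩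
    have hji : ¬ i < j := fun h => h1 i hs h hp'
    cases q using Fin.cases with
    | zero =>
      rw [Fin.cons_zero] at hq
      subst hq; exact absurd hii hji
    | succ q =>
      obtain ⟨p', hlt, hc⟩ := h2 i i' (by omega) hii hp' q (by simpa using hq)
      exact ⟨p'.succ, Fin.succ_lt_succ_iff.2 hlt, by simpa using hc⟩

/-- A shuffle uses each letter of each word exactly once. -/
theorem sum_deg_letterAt [Inhabited V] (deg : V → ℕ) (P : Fin ℓ → Prop) [DecidablePred P] :
    ∀ {N : ℕ} {u : Fin ℓ → List V} {c : Fin N → Fin ℓ}, Fits u c →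
      (∑ q, if P (c q) then deg (letterAt u c q) else 0) = ∑ i, if P i then wdeg deg (u i) else 0 := by
  intro N
  induction N with
  | zero =>
    intro u c h
    have h0 : ∀ i, u i = [] := fun i => by
      rw [← List.length_eq_zero_iff, ← h i]; simp
    simp [h0]
  | succ N ih =>
    intro u c h
    obtain ⟨j, c, rfl⟩ : ∃ (j : Fin ℓ) (c' : Fin N → Fin ℓ), c = (Fin.cons j c' : Fin (N + 1) → Fin ℓ) :=
      ⟨c 0, Fin.tail c, (Fin.cons_self_tail c).symm⟩
    obtain ⟨hj, h'⟩ := fits_cons.1 h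
    rw [Fin.sum_univ_succ]
    simp only [Fin.cons_zero, Fin.cons_succ, letterAt_cons_zero, letterAt_cons_succ]
    rw [ih h', ← Finset.add_sum_erase _ _ (Finset.mem_univ j),
      ← Finset.add_sum_erase (a := j) _ (fun i => if P i then wdeg deg (u i) else 0) (Finset.mem_univ j),
      ← add_assoc]
    congr 1
    · rw [peel_self]
      obtain ⟨x, w, hx⟩ := List.exists_cons_of_ne_nil hj
      rw [hx]
      split_ifs <;> simp
    · refine Finset.sum_congr rfl fun i hi => ?_
      rw [peel_of_ne u (Finset.ne_of_mem_erase hi)]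

/-- The sum of the degrees of the words with numbers less than `j`. -/
def degBelow (deg : V → ℕ) (u : Fin ℓ → List V) (j : Fin ℓ) : ℕ :=
  ∑ i, if i < j then wdeg deg (u i) else 0

/-- The recursion for the Koszul sign: the first letter passes over all words before its own one.
-/
theorem koszul_cons [Inhabited V] (deg : V → ℕ) {u : Fin ℓ → List V} {j : Fin ℓ} {c : Fin N → Fin ℓ}
    (h : Fits u (Fin.cons j c : Fin (N + 1) → Fin ℓ)) :
    koszul R deg u (Fin.cons j c : Fin (N + 1) → Fin ℓ)
      = (-1 : R) ^ (deg ((u j).getD 0 default) * degBelow deg u j) * koszul R deg (peel u j) c := by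
  have h' := (fits_cons.1 h).2
  rw [koszul, Fin.prod_univ_succ]
  congr 1
  · rw [Fin.prod_univ_succ]
    simp only [Fin.cons_zero, Fin.cons_succ, letterAt_cons_zero, letterAt_cons_succ, lt_irrefl,
      false_and, if_false, one_mul, Fin.succ_pos, true_and]
    have : degBelow deg u j = ∑ i, if i < j then wdeg deg (peel u j i) else 0 := by
      refine Finset.sum_congr rfl fun i _ => ?_
      split_ifs with hi
      · rw [peel_of_ne u hi.ne]
      · rfl
    rw [this, ← sum_deg_letterAt deg (fun i => i < j) h', Finset.mul_sum, ← Finset.prod_pow_eq_pow_sum]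
    refine Finset.prod_congr rfl fun q _ => ?_
    split_ifs <;> simp
  · rw [koszul]
    refine Finset.prod_congr rfl fun p _ => ?_
    rw [Fin.prod_univ_succ]
    simp only [Fin.cons_succ, letterAt_cons_succ, Fin.not_lt_zero, false_and, if_false, one_mul,
      Fin.succ_lt_succ_iff]

/-- The composition of a bilinear map with a multilinear map in the second argument. -/
def bilinComp {M : Type*} [AddCommGroup M] [Module R M] (B : M →ₗ[R] M →ₗ[R] M)
    (F : MultilinearMap R (fun _ : Fin ℓ => M) M) :
    M →ₗ[R] MultilinearMap R (fun _ : Fin ℓ => M) M where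
  toFun a := (B a).compMultilinearMap F
  map_add' a b := by ext m; simp
  map_smul' r a := by ext m; simp

/-- The iterated product `a₀ ⧢ (⋯ a_{s-1} ⧢ (a_s ≺ (a_{s+1} ≺ ⋯)))` of shuffle products `⧢` and
half-shuffles `≺`. -/
def nest (R : Type*) [CommRing R] (deg : V → ℕ) : (ℓ : ℕ) → ℕ →
    MultilinearMap R (fun _ : Fin ℓ => Words R V) (Words R V)
  | 0, _ => MultilinearMap.constOfIsEmpty R _ (wd R [])
  | ℓ + 1, 0 => (bilinComp (hs deg) (nest R deg ℓ 0)).uncurryLeft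
  | ℓ + 1, s + 1 => (bilinComp (sh deg) (nest R deg ℓ s)).uncurryLeft

theorem nest_zero (deg : V → ℕ) (s : ℕ) (m : Fin 0 → Words R V) : nest R deg 0 s m = wd R [] := rfl

theorem nest_succ_zero (deg : V → ℕ) (m : Fin (ℓ + 1) → Words R V) :
    nest R deg (ℓ + 1) 0 m = hs deg (m 0) (nest R deg ℓ 0 fun i => m i.succ) := rfl

theorem nest_succ_succ (deg : V → ℕ) (s : ℕ) (m : Fin (ℓ + 1) → Words R V) :
    nest R deg (ℓ + 1) (s + 1) m = sh deg (m 0) (nest R deg ℓ s fun i => m i.succ) := rfl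

theorem nest_nil (deg : V → ℕ) (s : ℕ) {u : Fin ℓ → List V} (h : ∀ i, u i = []) :
    nest R deg ℓ s (fun i => wd R (u i)) = wd R [] := by
  induction ℓ generalizing s with
  | zero => rfl
  | succ ℓ ih =>
    cases s with
    | zero => rw [nest_succ_zero, h, hs_nil, ih 0 fun i => h i.succ]
    | succ s => rw [nest_succ_succ, h, one_sh, ih s fun i => h i.succ]

theorem peel_succ (u : Fin (ℓ + 1) → List V) (j : Fin ℓ) :
    (fun i : Fin ℓ => peel u j.succ i.succ) = peel (fun i => u i.succ) j := by
  funext i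
  by_cases h : i = j
  · subst h; simp [peel_self]
  · rw [peel_of_ne _ h, peel_of_ne _ (by simpa using h)]

theorem degBelow_succ (deg : V → ℕ) (u : Fin (ℓ + 1) → List V) (j : Fin ℓ) :
    degBelow deg u j.succ = wdeg deg (u 0) + degBelow deg (fun i => u i.succ) j := by
  rw [degBelow, Fin.sum_univ_succ]
  simp [degBelow, Fin.succ_lt_succ_iff]

open Classical in
/-- Expansion of an iterated product of words with respect to the first letter of the result. -/
theorem nest_expand [Inhabited V] (deg : V → ℕ) : ∀ {ℓ : ℕ} (s : ℕ) (u : Fin ℓ → List V),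
    (∃ i, u i ≠ []) → nest R deg ℓ s (fun i => wd R (u i))
      = ∑ j, if u j ≠ [] ∧ ∀ i : Fin ℓ, s ≤ i.1 → i < j → u i = [] then
        (-1 : R) ^ (deg ((u j).getD 0 default) * degBelow deg u j) •
          cons ((u j).getD 0 default)
            (nest R deg ℓ (max s (j.1 + 1)) fun i => wd R (peel u j i)) else 0 := by
  intro ℓ
  induction ℓ with
  | zero => rintro s u ⟨i, -⟩; exact i.elim0
  | succ ℓ ih =>
    intro s u hu
    have hd0 : degBelow deg u 0 = 0 := by simp [degBelow]
    have hp0 : ∀ i : Fin ℓ, peel u 0 i.succ = u i.succ := fun i => peel_of_ne u (Fin.succ_ne_zero i)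
    have hps : ∀ j : Fin ℓ, peel u j.succ 0 = u 0 := fun j => peel_of_ne u (Fin.succ_ne_zero j).symm
    rw [Fin.sum_univ_succ]
    simp only [hd0, degBelow_succ, Fin.not_lt_zero, false_implies, implies_true, and_true, mul_zero,
      pow_zero, one_smul]
    by_cases h0 : u 0 = []
    · -- the first word is empty
      have hu' : ∃ i : Fin ℓ, u i.succ ≠ [] := by
        obtain ⟨i, hi⟩ := hu
        cases i using Fin.cases with
        | zero => exact absurd h0 hi
        | succ i => exact ⟨i, hi⟩
      rw [if_neg (not_not.2 h0), zero_add]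
      have L : nest R deg (ℓ + 1) s (fun i => wd R (u i))
          = nest R deg ℓ (s - 1) (fun i => wd R (u i.succ)) := by
        cases s with
        | zero => rw [nest_succ_zero, h0, hs_nil]
        | succ s => rw [nest_succ_succ, h0, one_sh, Nat.add_sub_cancel]
      rw [L, ih _ _ hu']
      refine Finset.sum_congr rfl fun j _ => ?_
      have hc : (∀ i : Fin ℓ, s - 1 ≤ i.1 → i < j → u i.succ = []) ↔
          ∀ i : Fin (ℓ + 1), s ≤ i.1 → i < j.succ → u i = [] := by
        constructor
        · intro H i hs hi
          cases i using Fin.cases with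
          | zero => exact h0
          | succ i =>
            exact H i (by rw [Fin.val_succ] at hs; omega) (Fin.succ_lt_succ_iff.1 hi)
        · intro H i hs hi
          exact H i.succ (by rw [Fin.val_succ]; omega) (Fin.succ_lt_succ_iff.2 hi)
      refine if_congr (and_congr Iff.rfl hc) ?_ rfl
      rw [h0, wdeg_nil, zero_add]
      congr 2
      have e : max s (j.succ.1 + 1) = max (s - 1) (j.1 + 1) + 1 := by
        rw [Fin.val_succ]; omega
      rw [e, nest_succ_succ, hps, h0, one_sh]
      simp only [← peel_succ]
    · obtain ⟨x, w, hx⟩ := List.exists_cons_of_ne_nil h0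
      rw [if_pos h0]
      cases s with
      | zero =>
        rw [Finset.sum_eq_zero, add_zero]
        · rw [nest_succ_zero, show max 0 ((0 : Fin (ℓ + 1)).1 + 1) = 0 + 1 by simp, nest_succ_succ,
            peel_self, hx, hs_wd_cons]
          simp only [hp0]
          rfl
        · intro j _
          rw [if_neg]
          exact fun H => h0 (H.2 0 (Nat.zero_le _) (Fin.succ_pos j))
      | succ s =>
        rw [nest_succ_succ, show max (s + 1) ((0 : Fin (ℓ + 1)).1 + 1) = s + 1 by simp,
          nest_succ_succ, peel_self, hx]
        simp only [hp0]
        by_cases hu' : ∃ i : Fin ℓ, u i.succ ≠ []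
        · have e : cons (R := R) x (sh deg (wd R w) (nest R deg ℓ s fun i => wd R (u i.succ)))
              = ∑ j : Fin ℓ, if u j.succ ≠ [] ∧ ∀ i : Fin ℓ, s ≤ i.1 → i < j → u i.succ = [] then
                (-1 : R) ^ (deg ((u j.succ).getD 0 default) * degBelow deg (fun i => u i.succ) j) •
                  cons x (sh deg (wd R w) (cons ((u j.succ).getD 0 default)
                    (nest R deg ℓ (max s (j.1 + 1)) fun i => wd R (peel (fun i => u i.succ) j i))))
                else 0 := by
            rw [ih s _ hu', map_sum, map_sum]
            refine Finset.sum_congr rfl fun j _ => ?_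
            split_ifs <;> simp
          change _ = cons (R := R) x (sh deg (wd R w) (nest R deg ℓ s fun i => wd R (u i.succ))) + _
          rw [e, ih s _ hu', map_sum, ← Finset.sum_add_distrib]
          refine Finset.sum_congr rfl fun j _ => ?_
          have hc : (∀ i : Fin ℓ, s ≤ i.1 → i < j → u i.succ = []) ↔
              ∀ i : Fin (ℓ + 1), s + 1 ≤ i.1 → i < j.succ → u i = [] := by
            constructor
            · intro H i hs hi
              cases i using Fin.cases with
              | zero => simp at hs
              | succ i =>
                exact H i (by rw [Fin.val_succ] at hs; omega) (Fin.succ_lt_succ_iff.1 hi)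
            · intro H i hs hi
              exact H i.succ (by rw [Fin.val_succ]; omega) (Fin.succ_lt_succ_iff.2 hi)
          by_cases H : u j.succ ≠ [] ∧ ∀ i : Fin ℓ, s ≤ i.1 → i < j → u i.succ = []
          · rw [if_pos H, if_pos H, if_pos ⟨H.1, hc.1 H.2⟩, map_smul, ← cons_wd x w, cons_sh_cons, smul_add, cons_wd, pm_wd, map_smul,
              LinearMap.smul_apply, map_smul, smul_smul, ← pow_add, ← mul_add, add_comm (degBelow _ _ _)]
            congr 3
            have e : max (s + 1) (j.succ.1 + 1) = max s (j.1 + 1) + 1 := by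
              rw [Fin.val_succ]; omega
            rw [e, nest_succ_succ, hps, hx]
            simp only [← peel_succ]
          · rw [if_neg H, if_neg H, if_neg fun H' => H ⟨H'.1, hc.2 H'.2⟩, map_zero, add_zero]
        · push Not at hu'
          rw [nest_nil deg s hu', sh_one, sh_one, Finset.sum_eq_zero, add_zero, List.tail_cons,
            cons_wd]
          · rfl
          · intro j _
            rw [if_neg]
            exact fun H => H.1 (hu' j)

open Classical in
/-- The sum of all shuffles of the words `u i` that satisfy the divided-product condition from
the word number `s` on. -/
theorem sum_koszul [Inhabited V] (deg : V → ℕ) {ℓ : ℕ} : ∀ {N : ℕ} (s : ℕ) (u : Fin ℓ → List V),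
    N = ∑ i, (u i).length →
    (∑ c : Fin N → Fin ℓ with Fits u c ∧ DivFrom s c,
      koszul R deg u c • wd R (List.ofFn (letterAt u c))) = nest R deg ℓ s fun i => wd R (u i) := by
  intro N
  induction N with
  | zero =>
    intro s u hN
    have h0 : ∀ i, u i = [] := fun i =>
      List.length_eq_zero_iff.1 (Finset.sum_eq_zero_iff.1 hN.symm i (Finset.mem_univ i))
    rw [nest_nil deg s h0, Finset.sum_filter, Fintype.sum_unique, if_pos]
    · simp [koszul]
    · exact ⟨fun i => by simp [h0], fun i i' _ _ h => by obtain ⟨p, -⟩ := h; exact p.elim0⟩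
  | succ N ih =>
    intro s u hN
    have hu : ∃ i, u i ≠ [] := by
      by_contra! h
      simp [h] at hN
    rw [nest_expand deg s u hu, Finset.sum_filter,
      ← Equiv.sum_comp (Fin.consEquiv fun _ : Fin (N + 1) => Fin ℓ), Fintype.sum_prod_type]
    refine Finset.sum_congr rfl fun j _ => ?_
    change (∑ c : Fin N → Fin ℓ, if Fits u (Fin.cons j c : Fin (N + 1) → Fin ℓ)
      ∧ DivFrom s (Fin.cons j c : Fin (N + 1) → Fin ℓ) then
        koszul R deg u (Fin.cons j c : Fin (N + 1) → Fin ℓ) •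
        wd R (List.ofFn (letterAt u (Fin.cons j c : Fin (N + 1) → Fin ℓ))) else 0) = _
    split_ifs with hj
    · have hN' : N = ∑ i, (peel u j i).length := by
        have h1 : ∑ i, (u i).length = ∑ i, (peel u j i).length + 1 := by
          rw [← Finset.add_sum_erase _ _ (Finset.mem_univ j),
            ← Finset.add_sum_erase (a := j) _ (fun i => (peel u j i).length) (Finset.mem_univ j),
            peel_self, List.length_tail]
          have h2 := List.length_pos_iff.2 hj.1
          have h3 : ∑ x ∈ Finset.univ.erase j, (peel u j x).length
              = ∑ x ∈ Finset.univ.erase j, (u x).length :=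
            Finset.sum_congr rfl fun i hi => by rw [peel_of_ne u (Finset.ne_of_mem_erase hi)]
          omega
        omega
      rw [← ih (max s (j.1 + 1)) (peel u j) hN', Finset.sum_filter, map_sum, Finset.smul_sum]
      refine Finset.sum_congr rfl fun c _ => ?_
      by_cases hf : Fits (peel u j) c
      · have hd : DivFrom s (Fin.cons j c : Fin (N + 1) → Fin ℓ) ↔ DivFrom (max s (j.1 + 1)) c := by
          rw [divFrom_cons, and_iff_right_iff_imp]
          intro _ i hs hi
          rw [hf.exists_iff, peel_of_ne u hi.ne, not_not]
          exact hj.2 i hs hi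
        have hf' : Fits u (Fin.cons j c : Fin (N + 1) → Fin ℓ) := fits_cons.2 ⟨hj.1, hf⟩
        simp only [hf, hf', hd, true_and]
        split_ifs
        · rw [koszul_cons deg hf', ofFn_letterAt_cons, map_smul, cons_wd, smul_smul]
        · simp
      · simp [hf, fits_cons]
    · refine Finset.sum_eq_zero fun c _ => if_neg ?_
      rintro ⟨h1, h2⟩
      refine hj ⟨(fits_cons.1 h1).1, fun i hs hi => ?_⟩
      have := (divFrom_cons.1 h2).1 i hs hi
      rw [(fits_cons.1 h1).2.exists_iff, peel_of_ne u hi.ne, not_not] at this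
      exact this

end Merge

end

section

/-! ### Reordering of odd elements in a shuffle -/

section Reorder

variable {R : Type*} [CommRing R] {d : ℕ} {Q : Type*} {ℓ N : ℕ}

/-- The sum of the degrees of the words with numbers greater than `i`. -/
def degAbove (deg : Q → ℕ) (u : Fin ℓ → List Q) (i : Fin ℓ) : ℕ :=
  ∑ j ∈ Finset.Ioi i, wdeg deg (u j)

/-- The product of the elements `b q` of a word of letters `q`, each of which consists of a block
of degree `t q` followed by `b q`, after moving all blocks to the left. -/
def wordProd (t : Q → ℕ) (b : Q → Alg R d) : List Q → Alg R d
  | [] => 1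
  | q :: w => par R d (wdeg t w) (b q) * wordProd t b w

theorem Homog.wordProd {t β : Q → ℕ} {b : Q → Alg R d} (hb : ∀ q, Homog (β q) (b q)) (w : List Q) :
    Homog (wdeg β w) (wordProd t b w) := by
  induction w with
  | nil => exact homog_one
  | cons q w ih =>
    rw [KnotDiagrams.wordProd, (hb q).par_eq, wdeg_cons]
    exact ((hb q).smul _).mul ih

theorem Homog.mul_eq {n : ℕ} {b : Alg R d} (hb : Homog n b) (a : Alg R d) :
    a * b = b * par R d n a := by
  rw [hb.comm, ← par_add, par_congr (n := 0) (by simp), par_zero]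

/-- A homogeneous element is moved to the front of a product. -/
theorem prod_ofFn_pull {n : ℕ} {b : Alg R d} (hb : Homog n b) (j : Fin ℓ) (X Y : Fin ℓ → Alg R d)
    (h1 : ∀ i < j, par R d n (X i) = Y i) (h2 : X j = b * Y j) (h3 : ∀ i, j < i → X i = Y i) :
    (List.ofFn X).prod = b * (List.ofFn Y).prod := by
  induction ℓ with
  | zero => exact j.elim0
  | succ ℓ ih =>
    rw [List.ofFn_succ, List.ofFn_succ, List.prod_cons, List.prod_cons]
    cases j using Fin.cases with
    | zero =>
      rw [h2, mul_assoc]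
      congr 4
      funext i
      exact h3 _ (Fin.succ_pos i)
    | succ j =>
      rw [ih j (fun i => X i.succ) (fun i => Y i.succ)
        (fun i hi => h1 _ (Fin.succ_lt_succ_iff.2 hi)) h2
        (fun i hi => h3 _ (Fin.succ_lt_succ_iff.2 hi)), ← mul_assoc, hb.mul_eq,
        h1 _ (Fin.succ_pos j), mul_assoc]

theorem prod_ofFn_smul (r : Fin ℓ → R) (X : Fin ℓ → Alg R d) :
    (List.ofFn fun i => r i • X i).prod = (∏ i, r i) • (List.ofFn X).prod := by
  induction ℓ with
  | zero => simp
  | succ ℓ ih =>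
    rw [List.ofFn_succ, List.ofFn_succ, List.prod_cons, List.prod_cons, ih, Fin.prod_univ_succ,
      smul_mul_smul_comm]

theorem sum_wdeg_eq (deg : Q → ℕ) (u : Fin ℓ → List Q) (j : Fin ℓ) :
    ∑ i, wdeg deg (u i) = degBelow deg u j + wdeg deg (u j) + degAbove deg u j := by
  have h : ∀ i, wdeg deg (u i) = (if i < j then wdeg deg (u i) else 0)
      + ((if i = j then wdeg deg (u i) else 0) + if j < i then wdeg deg (u i) else 0) := by
    intro i
    rcases lt_trichotomy i j with h | h | h
    · simp [h, h.ne, h.not_gt]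
    · simp [h]
    · simp [h, h.ne', h.not_gt]
  rw [Finset.sum_congr rfl fun i _ => h i, Finset.sum_add_distrib, Finset.sum_add_distrib, degBelow,
    degAbove, Finset.sum_ite_eq' Finset.univ j, if_pos (Finset.mem_univ j), add_assoc]
  congr 2
  refine (Finset.sum_filter _ _).symm.trans (Finset.sum_congr ?_ fun _ _ => rfl)
  ext i; simp

theorem degAbove_peel_of_lt (deg : Q → ℕ) {u : Fin ℓ → List Q} {i j : Fin ℓ} (h : i < j) {q : Q}
    {w : List Q} (hj : u j = q :: w) : degAbove deg u i = deg q + degAbove deg (peel u j) i := by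
  have hm : j ∈ Finset.Ioi i := Finset.mem_Ioi.2 h
  rw [degAbove, degAbove, ← Finset.add_sum_erase _ _ hm,
    ← Finset.add_sum_erase _ (fun k => wdeg deg (peel u j k)) hm, peel_self, hj, wdeg_cons,
    List.tail_cons, add_assoc]
  congr 2
  exact Finset.sum_congr rfl fun k hk => by rw [peel_of_ne u (Finset.ne_of_mem_erase hk)]

theorem degAbove_peel_of_le (deg : Q → ℕ) {u : Fin ℓ → List Q} {i j : Fin ℓ} (h : j ≤ i) :
    degAbove deg (peel u j) i = degAbove deg u i := by
  refine Finset.sum_congr rfl fun k hk => ?_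
  rw [peel_of_ne u (h.trans_lt (Finset.mem_Ioi.1 hk)).ne']

theorem degBelow_peel (deg : Q → ℕ) (u : Fin ℓ → List Q) (j : Fin ℓ) :
    degBelow deg (peel u j) j = degBelow deg u j := by
  refine Finset.sum_congr rfl fun i _ => ?_
  split_ifs with hi
  · rw [peel_of_ne u hi.ne]
  · rfl

/-- The sign identity for the induction step of `koszul_wordProd`, where `t`, `β` are
the degrees of the block and the element of the first letter, `tb`, `βb` those of the words below,
and `T`, `w` those of the blocks in the words above and in the rest of its own word. -/
theorem koszul_sign_aux (t β tb βb T w : ℕ) :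
    (-1 : R) ^ (t * tb) * ((-1 : R) ^ ((t + β) * βb) * (-1 : R) ^ (β * (T + w)))
      = (-1 : R) ^ ((t + β) * (tb + βb)) * (-1 : R) ^ ((tb + w + T) * β) := by
  rw [← pow_add, ← pow_add, ← pow_add]
  apply sign_congr
  simp only [Nat.even_add, Nat.even_mul]
  tauto

/-- In a shuffle of words whose letters are blocks `t` followed by elements `b` of degree `β`, the
elements `b` are collected on the right of all blocks: the Koszul sign of the shuffle of the blocks
is replaced by that of the shuffle of the letters of degree `t + β`. -/
theorem koszul_wordProd [Inhabited Q] {t β : Q → ℕ} {b : Q → Alg R d}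
    (hb : ∀ q, Homog (β q) (b q)) :
    ∀ {N : ℕ} (u : Fin ℓ → List Q) (c : Fin N → Fin ℓ), Fits u c → ∀ a : Fin ℓ → Alg R d,
      koszul R t u c •
        (List.ofFn fun i => par R d (degAbove t u i) (wordProd t b (u i) * a i)).prod
      = koszul R (fun q => t q + β q) u c • (wordProd t b (List.ofFn (letterAt u c)) *
        (List.ofFn fun i => par R d (degAbove (fun q => t q + β q) u i) (a i)).prod) := by
  intro N
  induction N with
  | zero =>
    intro u c h a
    have h0 : ∀ i, u i = [] := fun i => by
      rw [← List.length_eq_zero_iff, ← h i]; simp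
    simp [koszul, degAbove, h0, wordProd]
  | succ N ih =>
    intro u c h a
    obtain ⟨j, c, rfl⟩ : ∃ (j : Fin ℓ) (c' : Fin N → Fin ℓ),
        c = (Fin.cons j c' : Fin (N + 1) → Fin ℓ) := ⟨c 0, Fin.tail c, (Fin.cons_self_tail c).symm⟩
    obtain ⟨hj, h'⟩ := fits_cons.1 h
    obtain ⟨q, w, hq⟩ := List.exists_cons_of_ne_nil hj
    set D := fun q => t q + β q with hD
    -- Induction on the length: the factor `b q` of the first letter `q` of the shuffle, which
    -- comes from the word `j`, is pulled to the front of the product.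
    let a' : Fin ℓ → Alg R d := fun i => if i < j then par R d (D q) (a i) else a i
    let Y : Fin ℓ → Alg R d := fun i =>
      par R d (degAbove t (peel u j) i) (wordProd t b (peel u j i) * a' i)
    -- The signs from this: in the factors `i < j` for the passage over the elements `b` there, and
    -- in the factor `j` for the parity operators applied to `b q`.
    let r : Fin ℓ → R := fun i => (if i < j then (-1 : R) ^ (D q * wdeg β (u i)) else 1) *
      (if i = j then (-1 : R) ^ (β q * (degAbove t u j + wdeg t w)) else 1)
    -- On the factors `i < j`, the missing block `q` in `degAbove` and the passage of `b q`
    -- together change the argument by the parity of degree `D q`, as in the definition of `a'`.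
    have pull : (List.ofFn fun i => par R d (degAbove t u i) (wordProd t b (u i) * a i)).prod
        = b q * (List.ofFn fun i => r i • Y i).prod := by
      refine prod_ofFn_pull (hb q) j _ _ (fun i hi => ?_) ?_ fun i hi => ?_
      · simp only [r, Y, a', if_pos hi, if_neg hi.ne, mul_one]
        rw [degAbove_peel_of_lt t hi hq, ← par_add, ← add_assoc, par_add,
          peel_of_ne u hi.ne, map_mul, map_mul, map_mul]
        have e : ∀ x, par R d (t q + β q) (par R d (degAbove t (peel u j) i) x)
            = par R d (degAbove t (peel u j) i) (par R d (D q) x) := by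
          intro x
          rw [← par_add, ← par_add, add_comm]
        rw [add_comm (β q), e, e, (Homog.wordProd hb (u i)).par_eq (D q), map_smul, smul_mul_assoc]
      · simp only [r, Y, a', lt_irrefl, if_false, if_true, one_mul]
        rw [hq, wordProd, degAbove_peel_of_le t le_rfl, peel_self, hq, List.tail_cons, mul_assoc,
          map_mul, ← par_add, (hb q).par_eq, smul_mul_assoc, mul_smul_comm, mul_comm (β q)]
      · simp only [r, Y, a', if_neg hi.not_gt, if_neg hi.ne', one_mul, one_smul]
        rw [degAbove_peel_of_le t hi.le, peel_of_ne u hi.ne']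
    have hr : ∏ i, r i = (-1 : R) ^ (D q * degBelow β u j) *
        (-1 : R) ^ (β q * (degAbove t u j + wdeg t w)) := by
      simp only [r]
      rw [Finset.prod_mul_distrib]
      congr 1
      · rw [degBelow, Finset.mul_sum, ← Finset.prod_pow_eq_pow_sum]
        refine Finset.prod_congr rfl fun i _ => ?_
        split_ifs <;> simp
      · rw [Finset.prod_ite_eq' Finset.univ j, if_pos (Finset.mem_univ j)]
    have hdef : (u j).getD 0 default = q := by rw [hq]; rfl
    have hwt : wdeg t (List.ofFn (letterAt (peel u j) c))
        = degBelow t u j + wdeg t w + degAbove t u j := by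
      have e1 : wdeg t (List.ofFn (letterAt (peel u j) c)) = ∑ i, wdeg t (peel u j i) := by
        have := sum_deg_letterAt t (fun _ => True) h'
        simp only [if_true] at this
        rw [← this, wdeg, List.map_ofFn, List.sum_ofFn]; rfl
      rw [e1, sum_wdeg_eq t _ j, peel_self, hq, List.tail_cons, degBelow_peel,
        degAbove_peel_of_le t le_rfl]
    -- The modification of `a` is undone by the peeling of the letter `q` of degree `D q`.
    have ha' : (fun i => par R d (degAbove D (peel u j) i) (a' i))
        = fun i => par R d (degAbove D u i) (a i) := by
      funext i
      by_cases hi : i < j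
      · simp only [a', if_pos hi]
        rw [← par_add, degAbove_peel_of_lt D hi hq, add_comm]
      · simp only [a', if_neg hi]
        rw [degAbove_peel_of_le D (not_lt.1 hi)]
    have hb2 : degBelow D u j = degBelow t u j + degBelow β u j := by
      simp only [degBelow, ← Finset.sum_add_distrib]
      refine Finset.sum_congr rfl fun i _ => ?_
      split_ifs
      · simp [hD, wdeg, List.sum_map_add]
      · rfl
    have IH := ih (peel u j) c h' a'
    rw [pull, prod_ofFn_smul, hr, koszul_cons t h, koszul_cons D h, hdef, ofFn_letterAt_cons, hdef,
      wordProd, hwt, (hb q).par_eq, hb2]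
    rw [ha'] at IH
    rw [mul_smul_comm, smul_smul]
    set s1 := koszul R t (peel u j) c
    set s2 := koszul R D (peel u j) c
    have IH' : s1 • (b q * (List.ofFn Y).prod) = s2 • (b q * (wordProd t b
        (List.ofFn (letterAt (peel u j) c)) *
          (List.ofFn fun i => par R d (degAbove D u i) (a i)).prod)) := by
      rw [← mul_smul_comm, IH, mul_smul_comm]
    rw [show ∀ x y z w : R, x * y * (z * w) = (x * z * w) * y by intros; ring, mul_smul, IH',
      smul_smul, smul_mul_assoc, smul_mul_assoc, smul_smul, mul_assoc (b q)]
    congr 1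
    have key := koszul_sign_aux (R := R) (t q) (β q) (degBelow t u j) (degBelow β u j)
      (degAbove t u j) (wdeg t w)
    change _ = (-1 : R) ^ ((t q + β q) * (degBelow t u j + degBelow β u j)) * s2 * _
    change (-1 : R) ^ (t q * degBelow t u j) * (-1 : R) ^ ((t q + β q) * degBelow β u j) * _ * s2
      = _
    linear_combination s2 * key

end Reorder

end

section

/-! ### Diagrams as words of labelled points -/

/-- The letters of the words which describe diagrams: a point of the line together with everything
that is attached to it. Some points carry a label, which is used in order to refer to the point
independently of its place.
* `core x k`: a point with label `x` and `k` top asterisks;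
* `leaf x`: a point `t` without label, joined to the point with label `x` by a chord `α` that starts
  there; it stands for the monomial `α t`;
* `star x k`: a point with label `x`, `k` top asterisks and a bottom asterisk;
* `pair x k y l`, `mixed x k y`, `twin x y`: results of the gluing of `core x k` with `core y l`,
  of `core x k` with `leaf y`, and of `leaf x` with `leaf y`. -/
inductive Letter : Type
  | core (x k : ℕ) : Letter
  | leaf (x : ℕ) : Letter
  | star (x k : ℕ) : Letter
  | pair (x k y l : ℕ) : Letter
  | mixed (x k y : ℕ) : Letter
  | twin (x y : ℕ) : Letter

namespace Letter

instance : Inhabited Letter := ⟨core 0 0⟩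

/-- The number of top asterisks. -/
def top : Letter → ℕ
  | core _ k => k
  | star _ k => k
  | _ => 0

/-- The label of a point. -/
def label : Letter → Option ℕ
  | core x _ => some x
  | star x _ => some x
  | _ => none

/-- The degree modulo 2 of the block of a point. -/
def tdeg (d : ℕ) (l : Letter) : ℕ := 1 + l.top * d

/-- The degree modulo 2 of the part of a letter which is not in the block of the point. For the
glued letters it is chosen so as to make the degree of the letter one more than the sum of the
degrees of its two parts. -/
def bdeg (d : ℕ) : Letter → ℕ
  | core _ _ => 0
  | leaf _ => d + 1
  | star _ _ => d + 1
  | pair _ k _ l => k * d + l * d + 2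
  | mixed _ k _ => k * d + d + 3
  | twin _ _ => 2 * d + 4

/-- The degree modulo 2 of a letter. -/
def deg (d : ℕ) (l : Letter) : ℕ := l.tdeg d + l.bdeg d

/-- The chord or bottom asterisk of a letter at the place `p`, if `f` gives the places of the
labelled points. (The value for glued letters is not used.) -/
def fac (R : Type*) [CommRing R] (d : ℕ) (f : ℕ → ℕ) (p : ℕ) : Letter → Alg R d
  | core _ _ => 1
  | leaf x => (-1 : R) ^ (d + 1) • gen R d (Gen.chord (f x) p)
  | star _ _ => gen R d (Gen.star p)
  | _ => 0

end Letter

open Letter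

section Phi

variable {R : Type*} [CommRing R] {d : ℕ} {ℓ N : ℕ}

theorem homog_zero (n : ℕ) : Homog n (0 : Alg R d) := ⟨by simp, by simp⟩

theorem homog_fac (f : ℕ → ℕ) (p : ℕ) (l : Letter) : Homog (l.bdeg d) (fac R d f p l) := by
  cases l with
  | core => exact homog_one
  | leaf => exact (homog_gen _).smul _
  | star => exact homog_gen _
  | _ => exact homog_zero _

/-- The labels of the points of a word. -/
def labels (w : List Letter) : List ℕ := w.filterMap label

theorem mem_labels {w : List Letter} {x : ℕ} : x ∈ labels w ↔ ∃ l ∈ w, l.label = some x := by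
  simp [labels]

/-- The place of the point with label `x`. -/
def coreIdx (w : List Letter) (x : ℕ) : ℕ := w.findIdx fun l => l.label = some x

theorem coreIdx_lt {w : List Letter} {x : ℕ} : coreIdx w x < w.length ↔ x ∈ labels w := by
  rw [coreIdx, List.findIdx_lt_length, mem_labels]
  simp

theorem label_coreIdx {w : List Letter} {x : ℕ} (h : coreIdx w x < w.length) :
    (w[coreIdx w x]).label = some x := by
  have := List.findIdx_getElem (p := fun l : Letter => l.label = some x) (xs := w) (w := h)
  exact of_decide_eq_true this

theorem label_ne_of_lt_coreIdx {w : List Letter} {x i : ℕ} (h : i < coreIdx w x)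
    (hi : i < w.length) : (w[i]).label ≠ some x := by
  have := List.not_of_lt_findIdx h
  simpa using this

theorem coreIdx_eq {w : List Letter} {x i : ℕ} (hi : i < w.length) (h1 : (w[i]).label = some x)
    (h2 : ∀ j (hj : j < i), (w[j]'(hj.trans hi)).label ≠ some x) : coreIdx w x = i := by
  rw [coreIdx, List.findIdx_eq hi]
  exact ⟨by simpa using h1, fun j hj => by simpa using h2 j hj⟩

/-- The product of the chords and bottom asterisks of a word, the first letter of which is at the
place `n`, after moving all blocks to the left. -/
def algOf (R : Type*) [CommRing R] (d : ℕ) (f : ℕ → ℕ) (n : ℕ) : List Letter → Alg R d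
  | [] => 1
  | l :: w => par R d (wdeg (tdeg d) w) (fac R d f n l) * algOf R d f (n + 1) w

/-- The element of the space of diagrams described by a word of labelled points together with
an element of the algebra of letters on the labels of these points. -/
def phi (R : Type*) [CommRing R] (d : ℕ) (w : List Letter) : Alg R d →ₗ[R] Space R d :=
  Finsupp.lsingle (w.map top) ∘ₗ LinearMap.mulLeft R (algOf R d (coreIdx w) 0 w) ∘ₗ
    (relabel R d (coreIdx w)).toLinearMap

theorem phi_apply (w : List Letter) (a : Alg R d) : phi R d w a
    = Finsupp.single (w.map top) (algOf R d (coreIdx w) 0 w * relabel R d (coreIdx w) a) := rfl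

/-- The linear extension of `phi`. -/
def Phi (R : Type*) [CommRing R] (d : ℕ) : Words R Letter →ₗ[R] Alg R d →ₗ[R] Space R d :=
  onWords (phi R d)

@[simp] theorem Phi_wd (w : List Letter) : Phi R d (wd R w) = phi R d w := onWords_wd _ _

/-! ### Places in a shuffle -/

theorem count_eq_card (c : Fin N → Fin ℓ) (i : Fin ℓ) [DecidablePred fun p => ∃ h : p < N, c ⟨p, h⟩ = i]
    (p : Fin N) : Nat.count (fun p => ∃ h : p < N, c ⟨p, h⟩ = i) p
      = (Finset.univ.filter fun q => q < p ∧ c q = i).card := by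
  rw [Nat.count_eq_card_filter_range]
  symm
  refine Finset.card_bij (fun q _ => q.1) ?_ ?_ ?_
  · intro q hq
    simp only [Finset.mem_filter, Finset.mem_univ, true_and] at hq
    simp only [Finset.mem_filter, Finset.mem_range]
    exact ⟨hq.1, q.2, hq.2⟩
  · intro q _ q' _ h
    exact Fin.ext h
  · intro q hq
    simp only [Finset.mem_filter, Finset.mem_range] at hq
    obtain ⟨h1, h2, h3⟩ := hq
    exact ⟨⟨q, h2⟩, by simpa using ⟨h1, h3⟩, rfl⟩

/-- The `r`-th point of a word, where `r` counts the earlier points from the same word, is at its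
own place. -/
theorem pos_rank (c : Fin N → Fin ℓ) (p : Fin N) :
    pos c (c p) (Finset.univ.filter fun q => q < p ∧ c q = c p).card = p := by
  classical
  rw [← count_eq_card, pos, Nat.nth_count]
  exact ⟨p.2, rfl⟩

theorem rank_lt {V : Type*} {u : Fin ℓ → List V} {c : Fin N → Fin ℓ} (h : Fits u c) (p : Fin N) :
    (Finset.univ.filter fun q => q < p ∧ c q = c p).card < (u (c p)).length := by
  rw [← h (c p)]
  refine Finset.card_lt_card (Finset.ssubset_iff_of_subset ?_ |>.2 ⟨p, ?_, ?_⟩)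
  · intro q hq
    simp only [Finset.mem_filter, Finset.mem_univ, true_and] at hq ⊢
    exact hq.2
  · simp
  · simp

/-- The place in the shuffle of the `j`-th letter of the `i`-th word. -/
theorem exists_pos {V : Type*} {u : Fin ℓ → List V} {c : Fin N → Fin ℓ} (h : Fits u c) {i : Fin ℓ}
    {j : ℕ} (hj : j < (u i).length) : ∃ p : Fin N, c p = i ∧
      (Finset.univ.filter fun q => q < p ∧ c q = c p).card = j ∧ pos c i j = p := by
  classical
  let P : ℕ → Prop := fun p => ∃ h : p < N, c ⟨p, h⟩ = i
  have hcard : ∀ hf : (Set.ofPred P).Finite, j < hf.toFinset.card := by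
    intro hf
    refine hj.trans_eq ?_
    rw [← h i]
    refine Finset.card_bij (fun q _ => q.1) ?_ ?_ ?_
    · intro q hq
      simp only [Finset.mem_filter, Finset.mem_univ, true_and] at hq
      simp only [Set.Finite.mem_toFinset, Set.mem_ofPred_eq, P]
      exact ⟨q.2, hq⟩
    · intro q _ q' _ h
      exact Fin.ext h
    · intro q hq
      simp only [Set.Finite.mem_toFinset, Set.mem_ofPred_eq, P] at hq
      obtain ⟨h1, h2⟩ := hq
      exact ⟨⟨q, h1⟩, by simpa using h2, rfl⟩
  obtain ⟨hN, hc⟩ := Nat.nth_mem j hcard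
  refine ⟨⟨Nat.nth P j, hN⟩, hc, ?_, rfl⟩
  rw [hc, ← count_eq_card]
  exact Nat.count_nth hcard

theorem letterAt_eq {V : Type*} [Inhabited V] {u : Fin ℓ → List V} {c : Fin N → Fin ℓ}
    (h : Fits u c) (p : Fin N) : letterAt u c p = (u (c p))[(Finset.univ.filter fun q => q < p ∧ c q = c p).card]'(rank_lt h p) := by
  rw [letterAt, List.getD_eq_getElem]

/-- The place of a labelled point in the shuffle of words with disjoint sets of labels. -/
theorem coreIdx_shuffle {u : Fin ℓ → List Letter} {c : Fin N → Fin ℓ} (h : Fits u c)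
    (hd : ∀ i i' x, x ∈ labels (u i) → x ∈ labels (u i') → i = i') {i : Fin ℓ} {x : ℕ}
    (hx : x ∈ labels (u i)) :
    coreIdx (List.ofFn (letterAt u c)) x = pos c i (coreIdx (u i) x) := by
  obtain ⟨p, hp, hr, hpos⟩ := exists_pos h (coreIdx_lt.2 hx)
  rw [hpos]
  refine coreIdx_eq (by simp) ?_ ?_
  · rw [List.getElem_ofFn, letterAt_eq h]
    simp only [Fin.eta, hr]
    subst hp
    exact label_coreIdx _
  · intro q hq
    rw [List.getElem_ofFn, letterAt_eq h]
    set q' : Fin N := ⟨q, hq.trans p.2⟩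
    intro hl
    have hi : c q' = i := hd _ _ x (mem_labels.2 ⟨_, List.getElem_mem _, hl⟩) hx
    have hlt : (Finset.univ.filter fun r => r < q' ∧ c r = c q').card < coreIdx (u (c q')) x := by
      rw [hi, ← hr, hp]
      refine Finset.card_lt_card (Finset.ssubset_iff_of_subset ?_ |>.2 ⟨q', ?_, ?_⟩)
      · intro r hr'
        simp only [Finset.mem_filter, Finset.mem_univ, true_and] at hr' ⊢
        exact ⟨hr'.1.trans hq, hr'.2⟩
      · simpa using ⟨hq, hi⟩
      · simp
    exact label_ne_of_lt_coreIdx hlt (rank_lt h q') hl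

/-! ### Shuffles of diagrams -/

theorem map_mapIdx {U V W : Type*} (f : ℕ → U → V) (g : V → W) (w : List U) :
    (w.mapIdx f).map g = w.mapIdx fun i x => g (f i x) :=
  List.ext_getElem (by simp) (by simp)

theorem mapIdx_eq_map {U V : Type*} (f : U → V) (w : List U) :
    (w.mapIdx fun _ x => f x) = w.map f :=
  List.ext_getElem (by simp) (by simp)

theorem relabel_fac {f f' g : ℕ → ℕ} {l : Letter} (h : ∀ x, l = leaf x → g (f x) = f' x) (p : ℕ) :
    relabel R d g (fac R d f p l) = fac R d f' (g p) l := by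
  cases l with
  | core => simp [fac]
  | leaf x => simp [fac, relabelGen, h x rfl]
  | star => simp [fac, relabelGen]
  | _ => simp [fac]

/-- A point of a shuffle together with the data which determine its chord: the places of the
labelled points and the own place. -/
abbrev PlacedLetter : Type := (ℕ → ℕ) × ℕ × Letter

theorem relabel_algOf {f f' g : ℕ → ℕ} {w : List Letter} (h : ∀ x, leaf x ∈ w → g (f x) = f' x)
    (n : ℕ) : relabel R d g (algOf R d f n w)
      = wordProd (fun q : PlacedLetter => q.2.2.tdeg d) (fun q => fac R d q.1 q.2.1 q.2.2)
        (w.mapIdx fun p l => (f', g (n + p), l)) := by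
  induction w generalizing n with
  | nil => simp [algOf, wordProd]
  | cons l w ih =>
    rw [algOf, map_mul, relabel_par, relabel_fac (f' := f') (fun x hx => h x (hx ▸ List.mem_cons_self)),
      ih (fun x hx => h x (List.mem_cons_of_mem _ hx)), List.mapIdx_cons, wordProd]
    congr 2
    · rw [wdeg, wdeg, map_mapIdx, mapIdx_eq_map]
    · congr 1
      funext p l
      rw [add_assoc, add_comm 1]

theorem algOf_eq_wordProd (f : ℕ → ℕ) (w : List Letter) : algOf R d f 0 w
    = wordProd (fun q : PlacedLetter => q.2.2.tdeg d) (fun q => fac R d q.1 q.2.1 q.2.2)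
        (w.mapIdx fun p l => (f, p, l)) := by
  have h := relabel_algOf (R := R) (d := d) (f := f) (f' := f) (g := id) (w := w) (fun _ _ => rfl) 0
  have e : relabel R d id = AlgHom.id R _ := by
    apply alg_hom_ext
    intro x
    cases x <;> simp [relabelGen]
  rw [e] at h
  simpa using h

theorem koszul_congr {V V' : Type*} [Inhabited V] [Inhabited V'] {deg : V → ℕ} {deg' : V' → ℕ}
    {u : Fin ℓ → List V} {u' : Fin ℓ → List V'} {c : Fin N → Fin ℓ}
    (h : ∀ p, deg (letterAt u c p) = deg' (letterAt u' c p)) :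
    koszul R deg u c = koszul R deg' u' c := by
  simp only [koszul, h]

theorem shuffledTop_map_top (u : Fin ℓ → List Letter) (c : Fin N → Fin ℓ) (p : Fin N) :
    shuffledTop (fun i => (u i).map top) c p = (letterAt u c p).top := by
  rw [shuffledTop, letterAt]
  exact List.getD_map (f := top) (d := Letter.core 0 0) _

theorem blockDeg_map_top (w : List Letter) : blockDeg d (w.map top) = wdeg (tdeg d) w := by
  rw [blockDeg, wdeg, List.map_map]; rfl

theorem isShuffle_map_top {u : Fin ℓ → List Letter} {c : Fin N → Fin ℓ} :
    IsShuffle (fun i => (u i).map top) c ↔ Fits u c := by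
  simp [IsShuffle, Fits]

/-- A term of a product, divided product or insertion of diagrams given by words on disjoint sets
of labels is the diagram given by the corresponding shuffle of the words. The sign is the Koszul
sign for the degrees `deg` of points together with their chords and bottom asterisks, and not only
of their blocks. -/
theorem shuffleTerm_eq {u : Fin ℓ → List Letter} {c : Fin N → Fin ℓ} (h : Fits u c)
    (hd : ∀ i i' x, x ∈ labels (u i) → x ∈ labels (u i') → i = i')
    (hl : ∀ i x, leaf x ∈ u i → x ∈ labels (u i)) {a : Fin ℓ → Alg R d}
    (ha : ∀ i, a i ∈ supp R d {x | x ∈ labels (u i)}) {S : Set ℕ} {D : Alg R d} (hD : D ∈ supp R d S)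
    {r : ℕ → ℕ} (hS : ∀ j ∈ S, ∃ hj : j < ℓ, r j ∈ labels (u ⟨j, hj⟩) ∧ coreIdx (u ⟨j, hj⟩) (r j) = 0) :
    shuffleTerm R d (fun i => (u i).map top)
      (fun i => algOf R d (coreIdx (u i)) 0 (u i) * relabel R d (coreIdx (u i)) (a i)) c D
    = koszul R (deg d) u c • phi R d (List.ofFn (letterAt u c))
      ((List.ofFn fun i => par R d (degAbove (deg d) u i) (a i)).prod * relabel R d r D) := by
  set w := List.ofFn (letterAt u c) with hw
  -- Each letter is recorded together with its place in the shuffled word, so that the factors of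
  -- `algOf` keep their meaning after the shuffle.
  let q : Fin ℓ → List PlacedLetter := fun i =>
    (u i).mapIdx fun p l => (coreIdx w, pos c i p, l)
  have hq : Fits q c := fun i => by rw [h i]; simp [q]
  have hqp : ∀ p, letterAt q c p = (coreIdx w, p.1, letterAt u c p) := by
    intro p
    rw [letterAt_eq hq, letterAt_eq h]
    simp [q, pos_rank]
  have hwd : ∀ i, wdeg (fun x : PlacedLetter => x.2.2.tdeg d) (q i) = wdeg (tdeg d) (u i) := by
    intro i
    rw [wdeg, wdeg, map_mapIdx, mapIdx_eq_map]
  have hwd' : ∀ i, wdeg (fun x : PlacedLetter => x.2.2.tdeg d + x.2.2.bdeg d) (q i)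
      = wdeg (deg d) (u i) := by
    intro i
    rw [wdeg, wdeg, map_mapIdx]
    exact congrArg List.sum (mapIdx_eq_map (deg d) (u i))
  have e1 : shuffleSign R d (fun i => (u i).map top) c
      = koszul R (fun x : PlacedLetter => x.2.2.tdeg d) q c := by
    simp only [shuffleSign, koszul, hqp, shuffledTop_map_top, tdeg]
  have e2 : ∀ i, relabel R d (pos c i) (par R d (∑ j ∈ Finset.Ioi i, blockDeg d ((u j).map top))
      (algOf R d (coreIdx (u i)) 0 (u i) * relabel R d (coreIdx (u i)) (a i)))
      = par R d (degAbove (fun x : PlacedLetter => x.2.2.tdeg d) q i)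
        (wordProd (fun x : PlacedLetter => x.2.2.tdeg d) (fun x => fac R d x.1 x.2.1 x.2.2) (q i)
          * relabel R d (coreIdx w) (a i)) := by
    intro i
    rw [relabel_par, map_mul, relabel_algOf (f' := coreIdx w) (fun x hx => (coreIdx_shuffle h hd (hl i x hx)).symm),
      relabel_relabel, relabel_congr (f := pos c i ∘ coreIdx (u i)) (g := coreIdx w) (fun x hx => (coreIdx_shuffle h hd hx).symm) (ha i)]
    simp only [zero_add, degAbove, hwd, blockDeg_map_top]
    rfl
  have e3 : relabel R d (fun j => if h : j < ℓ then pos c ⟨j, h⟩ 0 else 0) D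
      = relabel R d (coreIdx w) (relabel R d r D) := by
    rw [relabel_relabel]
    refine relabel_congr (fun j hj => ?_) hD
    obtain ⟨hj', h1, h2⟩ := hS j hj
    rw [dif_pos hj', Function.comp_apply, coreIdx_shuffle h hd h1, h2]
  have e4 : algOf R d (coreIdx w) 0 w = wordProd (fun x : PlacedLetter => x.2.2.tdeg d)
      (fun x => fac R d x.1 x.2.1 x.2.2) (List.ofFn (letterAt q c)) := by
    rw [algOf_eq_wordProd]
    congr 1
    refine List.ext_getElem (by simp [hw]) fun i h1 h2 => ?_
    simp [hw, hqp]
  -- All factors of `algOf` are moved in front of the elements `a i`.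
  have key := koszul_wordProd (R := R) (d := d) (t := fun x : PlacedLetter => x.2.2.tdeg d)
    (β := fun x => x.2.2.bdeg d) (b := fun x => fac R d x.1 x.2.1 x.2.2) (fun x => homog_fac _ _ _)
    q c hq (fun i => relabel R d (coreIdx w) (a i))
  have e5 : koszul R (fun x : PlacedLetter => x.2.2.tdeg d + x.2.2.bdeg d) q c
      = koszul R (deg d) u c := koszul_congr fun p => by rw [hqp]; rfl
  have e6 : (List.ofFn fun i => par R d (degAbove (fun x : PlacedLetter => x.2.2.tdeg d + x.2.2.bdeg d) q i)
      (relabel R d (coreIdx w) (a i))).prod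
      = relabel R d (coreIdx w) (List.ofFn fun i => par R d (degAbove (deg d) u i) (a i)).prod := by
    rw [map_list_prod, List.map_ofFn]
    congr 2
    funext i
    simp only [degAbove, hwd', Function.comp_apply, relabel_par]
  have e7 : List.ofFn (shuffledTop (fun i => (u i).map top) c) = w.map top := by
    rw [hw, List.map_ofFn]
    congr 1
    funext p
    exact shuffledTop_map_top u c p
  rw [shuffleTerm, LinearMap.smul_apply, LinearMap.comp_apply, LinearMap.comp_apply, e7, phi_apply,
    AlgHom.toLinearMap_apply, e3, LinearMap.mulLeft_apply, e1]
  simp only [parity_pow, e2]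
  rw [Finsupp.lsingle_apply, Finsupp.smul_single, Finsupp.smul_single, ← smul_mul_assoc, key, e5, e6, e4, map_mul, smul_mul_assoc, mul_assoc]

end Phi

end

section

open Letter

variable {R : Type*} [CommRing R] {d ℓ : ℕ}

/-! ### Products of diagrams as shuffles of words -/

section Multilinear

variable {M N : Type*} [AddCommGroup M] [Module R M] [AddCommGroup N] [Module R N]

/-- Multilinear maps which agree on spanning sets agree. -/
theorem multilinear_eq_of_mem_span {f g : MultilinearMap R (fun _ : Fin ℓ => M) N}
    {S : Fin ℓ → Set M} (h : ∀ v : Fin ℓ → M, (∀ i, v i ∈ S i) → f v = g v) {m : Fin ℓ → M}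
    (hm : ∀ i, m i ∈ Submodule.span R (S i)) : f m = g m := by
  have key : ∀ T : Finset (Fin ℓ), ∀ m : Fin ℓ → M, (∀ i, m i ∈ Submodule.span R (S i)) →
      (∀ i ∉ T, m i ∈ S i) → f m = g m := by
    intro T
    induction T using Finset.induction_on with
    | empty => exact fun m _ h' => h m fun i => h' i (by simp)
    | insert j T hj ih =>
      intro m h1 h2
      have e : Set.EqOn (f.toLinearMap m j) (g.toLinearMap m j) (Submodule.span R (S j)) := by
        refine LinearMap.eqOn_span fun x hx => ?_
        refine ih _ (fun i => ?_) (fun i hi => ?_)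
        · by_cases hij : i = j
          · subst hij; simpa using Submodule.subset_span hx
          · simpa [hij] using h1 i
        · by_cases hij : i = j
          · subst hij; simpa using hx
          · simpa [hij] using h2 i (by simp [hij, hi])
      simpa using e (h1 j)
  exact key Finset.univ m hm (by simp)

/-- Values of a multilinear map on spans of sets. -/
theorem multilinear_mem_of_mem_span {f : MultilinearMap R (fun _ : Fin ℓ => M) N}
    {S : Fin ℓ → Set M} {P : Submodule R N} (h : ∀ v : Fin ℓ → M, (∀ i, v i ∈ S i) → f v ∈ P)
    {m : Fin ℓ → M} (hm : ∀ i, m i ∈ Submodule.span R (S i)) : f m ∈ P := by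
  have := multilinear_eq_of_mem_span (f := P.mkQ.compMultilinearMap f) (g := 0) (S := S)
    (fun v hv => by simpa using h v hv) hm
  simpa using this

end Multilinear

/-- `shuffleTerm` as a multilinear map. -/
def termML (R : Type*) [CommRing R] (d : ℕ) {N : ℕ} (κ : Fin ℓ → List ℕ) (c : Fin N → Fin ℓ) :
    MultilinearMap R (fun _ : Fin ℓ => Alg R d) (Alg R d →ₗ[R] Space R d) :=
  (shuffleSign R d κ c • LinearMap.mk₂ R
    (fun b D => Finsupp.single (List.ofFn (shuffledTop κ c))
      (b * relabel R d (fun j => if h : j < ℓ then pos c ⟨j, h⟩ 0 else 0) D))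
    (fun _ _ _ => by simp [add_mul]) (fun _ _ _ => by rw [smul_mul_assoc, Finsupp.smul_single])
    (fun _ _ _ => by simp [mul_add])
    (fun _ _ _ => by rw [map_smul, mul_smul_comm, Finsupp.smul_single])).compMultilinearMap
  ((MultilinearMap.mkPiAlgebraFin R ℓ (Alg R d)).compLinearMap fun i =>
    (relabel R d (pos c i)).toLinearMap ∘ₗ (par R d (∑ j ∈ Finset.Ioi i, blockDeg d (κ j))).toLinearMap)

theorem termML_apply {N : ℕ} (κ : Fin ℓ → List ℕ) (c : Fin N → Fin ℓ) (a : Fin ℓ → Alg R d) :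
    termML R d κ c a = shuffleTerm R d κ a c := by
  ext1 D
  simp [termML, shuffleTerm, parity_pow]

open Classical in
/-- The sum over all shuffles of given diagrams which are divided from the place `s`. -/
def sumML (R : Type*) [CommRing R] (d s : ℕ) (κ : Fin ℓ → List ℕ) :
    MultilinearMap R (fun _ : Fin ℓ => Alg R d) (Alg R d →ₗ[R] Space R d) :=
  ∑ c : Fin (∑ i, (κ i).length) → Fin ℓ with IsShuffle κ c ∧ DivFrom s c, termML R d κ c

/-- `shufML` as a function. -/
def shufFun (R : Type*) [CommRing R] (d s : ℕ) (A : Fin ℓ → Space R d) : Alg R d →ₗ[R] Space R d :=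
  ∑ κ ∈ Fintype.piFinset fun i => (A i).support, sumML R d s κ fun i => A i (κ i)

theorem shufFun_eq_sum (s : ℕ) (A : Fin ℓ → Space R d) (F : Fin ℓ → Finset (List ℕ))
    (hF : ∀ i, (A i).support ⊆ F i) :
    shufFun R d s A = ∑ κ ∈ Fintype.piFinset F, sumML R d s κ fun i => A i (κ i) := by
  refine Finset.sum_subset (Fintype.piFinset_subset _ _ hF) fun κ _ h => ?_
  simp only [Fintype.mem_piFinset, not_forall, Finsupp.mem_support_iff, not_not] at h
  obtain ⟨i, hi⟩ := h
  exact MultilinearMap.map_coord_zero _ i hi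

/-- The sum of the terms of `A₁ * … * A_ℓ` in which the left-most points of those `Aᵢ` with
`s ≤ i` come after the left-most points of the `Aⱼ` with `s ≤ j < i`, glued to the points of a
generalized diagram. This comprises the products and the divided products. -/
def shufML (R : Type*) [CommRing R] (d s ℓ : ℕ) :
    MultilinearMap R (fun _ : Fin ℓ => Space R d) (Alg R d →ₗ[R] Space R d) where
  toFun A := shufFun R d s A
  map_update_add' := by
    intro inst m i x y
    let F : Fin ℓ → Finset (List ℕ) := fun j => (Function.update m i (x + y) j).support ∪
      ((Function.update m i x j).support ∪ (Function.update m i y j).support)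
    rw [shufFun_eq_sum s _ F (fun j => Finset.subset_union_left),
      shufFun_eq_sum s _ F (fun j => Finset.subset_union_left.trans Finset.subset_union_right),
      shufFun_eq_sum s _ F (fun j => Finset.subset_union_right.trans Finset.subset_union_right),
      ← Finset.sum_add_distrib]
    refine Finset.sum_congr rfl fun κ _ => ?_
    exact ((sumML R d s κ).compLinearMap fun i => Finsupp.lapply (κ i)).map_update_add m i x y
  map_update_smul' := by
    intro inst m i r x
    let F : Fin ℓ → Finset (List ℕ) := fun j => (Function.update m i (r • x) j).support ∪
      (Function.update m i x j).support
    rw [shufFun_eq_sum s _ F (fun j => Finset.subset_union_left),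
      shufFun_eq_sum s _ F (fun j => Finset.subset_union_right), Finset.smul_sum]
    refine Finset.sum_congr rfl fun κ _ => ?_
    exact ((sumML R d s κ).compLinearMap fun i => Finsupp.lapply (κ i)).map_update_smul m i r x

theorem shufML_single (s : ℕ) (κ : Fin ℓ → List ℕ) (a : Fin ℓ → Alg R d) :
    shufML R d s ℓ (fun i => Finsupp.single (κ i) (a i)) = sumML R d s κ a := by
  refine (shufFun_eq_sum s _ (fun i => {κ i}) fun i => Finsupp.support_single_subset).trans ?_
  rw [Fintype.piFinset_singleton, Finset.sum_singleton]
  simp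

open Classical in
theorem insertion_eq (A : Fin ℓ → Space R d) : insertion R d A = shufML R d 0 ℓ A := by
  rw [insertion]
  refine Finset.sum_congr rfl fun κ _ => ?_
  rw [sumML, _root_.sum_apply]
  refine Finset.sum_congr ?_ fun c _ => (termML_apply κ c _).symm
  refine Finset.filter_congr fun c _ => and_congr_right fun _ => ?_
  simp [IsDivided, DivFrom]

theorem dividedProduct_eq (A : Fin ℓ → Space R d) :
    dividedProduct R d A = shufML R d 0 ℓ A 1 := by
  rw [dividedProduct, insertion_eq]

open Classical in
/-- The product is the sum over all shuffles, without condition on the order of the first letters.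
-/
theorem mul_eq (A B : Space R d) : mul R d A B = shufML R d 2 2 ![A, B] 1 := by
  rw [mul]
  change _ = (∑ κ ∈ _, sumML R d 2 κ _) 1
  rw [LinearMap.sum_apply]
  refine Finset.sum_congr rfl fun κ _ => ?_
  rw [sumML, _root_.sum_apply, LinearMap.sum_apply]
  refine Finset.sum_congr ?_ fun c _ => by rw [termML_apply]
  refine Finset.filter_congr fun c _ => ?_
  refine (and_iff_left fun i i' h => ?_).symm
  omega

theorem even_sum_congr {ι : Type*} {s : Finset ι} {f g : ι → ℕ}
    (h : ∀ i ∈ s, (Even (f i) ↔ Even (g i))) : Even (∑ i ∈ s, f i) ↔ Even (∑ i ∈ s, g i) := by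
  classical
  induction s using Finset.induction_on with
  | empty => simp
  | insert j s hj ih =>
    rw [Finset.sum_insert hj, Finset.sum_insert hj, Nat.even_add, Nat.even_add,
      h j (Finset.mem_insert_self _ _), ih fun i hi => h i (Finset.mem_insert_of_mem hi)]

/-- The labels of the points of the word `w` are the elements of `L`, and all chords are attached
to such points. -/
def Adm (L : Set ℕ) (w : List Letter) : Prop :=
  (∀ x, x ∈ labels w ↔ x ∈ L) ∧ ∀ x, leaf x ∈ w → x ∈ L

open Classical in
/-- Shuffles of diagrams are given by shuffles of words. -/
theorem shufML_Phi (s : ℕ) {L : Fin ℓ → Set ℕ} (hL : ∀ i i' x, x ∈ L i → x ∈ L i' → i = i')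
    {n : Fin ℓ → ℕ} {S : Set ℕ} {r : ℕ → ℕ} {m : Fin ℓ → Words R Letter}
    (hS : ∀ j ∈ S, ∃ hj : j < ℓ, r j ∈ L ⟨j, hj⟩)
    (hm : ∀ i, m i ∈ wordsIn R fun w => Adm (L i) w ∧ (Even (wdeg (deg d) w) ↔ Even (n i)) ∧
      (i.1 ∈ S → coreIdx w (r i) = 0))
    {a : Fin ℓ → Alg R d} (ha : ∀ i, a i ∈ supp R d (L i)) {D : Alg R d} (hD : D ∈ supp R d S) :
    shufML R d s ℓ (fun i => Phi R d (m i) (a i)) D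
      = Phi R d (nest R (deg d) ℓ s m)
        ((List.ofFn fun i => par R d (∑ j ∈ Finset.Ioi i, n j) (a i)).prod * relabel R d r D) := by
  set b := (List.ofFn fun i => par R d (∑ j ∈ Finset.Ioi i, n j) (a i)).prod * relabel R d r D
  have := multilinear_eq_of_mem_span
    (f := (LinearMap.applyₗ D).compMultilinearMap
      ((shufML R d s ℓ).compLinearMap fun i => (Phi R d).flip (a i)))
    (g := ((Phi R d).flip b).compMultilinearMap (nest R (deg d) ℓ s))
    (S := fun i => wd R '' {w | Adm (L i) w ∧ (Even (wdeg (deg d) w) ↔ Even (n i)) ∧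
      (i.1 ∈ S → coreIdx w (r i) = 0)}) ?_ (m := m) (fun i => by
        have := hm i
        rwa [wordsIn_eq_span] at this)
  · simpa using this
  intro v hv
  choose u hu huv using hv
  obtain rfl : v = fun i => wd R (u i) := funext fun i => (huv i).symm
  simp only [LinearMap.compMultilinearMap_apply, MultilinearMap.compLinearMap_apply,
    LinearMap.flip_apply, Phi_wd, LinearMap.applyₗ_apply_apply, phi_apply]
  rw [shufML_single, sumML, _root_.sum_apply, LinearMap.sum_apply,
    ← sum_koszul (R := R) (deg d) (N := ∑ i, ((u i).map top).length) s u (by simp), map_sum,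
    LinearMap.sum_apply]
  have hc : ∀ c : Fin (∑ i, ((u i).map top).length) → Fin ℓ,
      (IsShuffle (fun i => (u i).map top) c ∧ DivFrom s c) ↔ (Fits u c ∧ DivFrom s c) := fun c => by
    rw [isShuffle_map_top]
  refine Finset.sum_congr (Finset.filter_congr fun c _ => hc c) fun c hcm => ?_
  have hfit : Fits u c := (Finset.mem_filter.1 hcm).2.1
  have hlab : ∀ i, {x | x ∈ labels (u i)} = L i := fun i => Set.ext fun x => (hu i).1.1 x
  rw [termML_apply, shuffleTerm_eq hfit
    (fun i i' x h1 h2 => hL i i' x (((hu i).1.1 x).1 h1) (((hu i').1.1 x).1 h2))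
    (fun i x hx => ((hu i).1.1 x).2 ((hu i).1.2 x hx)) (fun i => by rw [hlab]; exact ha i) hD (r := r)]
  · rw [map_smul, LinearMap.smul_apply, Phi_wd]
    congr 4
    refine congrArg List.ofFn (funext fun i => ?_)
    rw [par_congr]
    exact even_sum_congr fun j _ => (hu j).2.1
  · intro j hj
    obtain ⟨hj', h⟩ := hS j hj
    exact ⟨hj', ((hu _).1.1 _).2 h, (hu ⟨j, hj'⟩).2.2 hj⟩

end

section

open Letter

variable {R : Type*} [CommRing R] {d ℓ : ℕ}

/-! ### Diagrams as words of labelled points without chords to them -/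

/-- The word of the points of a diagram with `k` as its list of numbers of top asterisks; the `p`-th
point is labelled by `x p`. -/
def coreWord (x : ℕ → ℕ) (k : List ℕ) : List Letter := k.mapIdx fun p t => core (x p) t

@[simp] theorem coreWord_nil (x : ℕ → ℕ) : coreWord x [] = [] := rfl

@[simp] theorem coreWord_cons (x : ℕ → ℕ) (t : ℕ) (k : List ℕ) :
    coreWord x (t :: k) = core (x 0) t :: coreWord (x ∘ Nat.succ) k := by
  rw [coreWord, List.mapIdx_cons]; rfl

@[simp] theorem length_coreWord (x : ℕ → ℕ) (k : List ℕ) : (coreWord x k).length = k.length := by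
  simp [coreWord]

@[simp] theorem map_top_coreWord (x : ℕ → ℕ) (k : List ℕ) : (coreWord x k).map top = k := by
  induction k generalizing x with
  | nil => rfl
  | cons t k ih => simp [ih, top]

theorem wdeg_coreWord (x : ℕ → ℕ) (k : List ℕ) : wdeg (deg d) (coreWord x k) = blockDeg d k := by
  induction k generalizing x with
  | nil => rfl
  | cons t k ih => simp [ih, blockDeg, deg, tdeg, bdeg, top]

theorem mem_labels_coreWord {x : ℕ → ℕ} {k : List ℕ} {y : ℕ} :
    y ∈ labels (coreWord x k) ↔ ∃ p < k.length, x p = y := by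
  rw [mem_labels, coreWord]
  constructor
  · rintro ⟨l, hl, h⟩
    obtain ⟨p, hp, rfl⟩ := List.mem_mapIdx.1 hl
    exact ⟨p, hp, by simpa [label] using h⟩
  · rintro ⟨p, hp, rfl⟩
    exact ⟨_, List.mem_mapIdx.2 ⟨p, hp, rfl⟩, rfl⟩

theorem leaf_notMem_coreWord {x : ℕ → ℕ} {k : List ℕ} {y : ℕ} : leaf y ∉ coreWord x k := by
  intro h
  obtain ⟨p, hp, h⟩ := List.mem_mapIdx.1 h
  simp at h

theorem coreIdx_coreWord {x : ℕ → ℕ} {k : List ℕ} (hx : Set.InjOn x {p | p < k.length}) {p : ℕ}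
    (hp : p < k.length) : coreIdx (coreWord x k) (x p) = p := by
  refine coreIdx_eq (by simpa using hp) (by simp [coreWord, label]) fun j hj h => ?_
  simp only [coreWord, List.getElem_mapIdx, label, Option.some.injEq] at h
  exact hj.ne (hx (hj.trans hp) hp h)

theorem algOf_coreWord (f : ℕ → ℕ) (n : ℕ) (x : ℕ → ℕ) (k : List ℕ) :
    algOf R d f n (coreWord x k) = 1 := by
  induction k generalizing x n with
  | nil => rfl
  | cons t k ih => simp [algOf, ih, fac]

/-- Every diagram is given by a word of points, with arbitrary labels. -/
theorem phi_coreWord {x : ℕ → ℕ} {k : List ℕ} (hx : Set.InjOn x {p | p < k.length}) {a : Alg R d}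
    (ha : a ∈ supp R d {p | p < k.length}) :
    phi R d (coreWord x k) (relabel R d x a) = Finsupp.single k a := by
  rw [phi_apply, algOf_coreWord, relabel_relabel, map_top_coreWord, one_mul]
  congr 1
  exact relabel_id_of_mem (fun p hp => coreIdx_coreWord hx hp) ha

theorem relabel_coreWord {x : ℕ → ℕ} {k : List ℕ} {a : Alg R d}
    (ha : a ∈ supp R d {p | p < k.length}) :
    relabel R d x a ∈ supp R d {y | ∃ p < k.length, x p = y} :=
  relabel_mem_supp (T := {y | ∃ p < k.length, x p = y}) (fun p hp => ⟨p, hp, rfl⟩) ha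

theorem adm_coreWord (x : ℕ → ℕ) (k : List ℕ) :
    Adm {y | ∃ p < k.length, x p = y} (coreWord x k) :=
  ⟨fun _ => mem_labels_coreWord, fun _ h => absurd h leaf_notMem_coreWord⟩

/-- The combinations of diagrams. -/
def GSpace (R : Type*) [CommRing R] (d : ℕ) : Submodule R (Space R d) :=
  Submodule.span R {A | ∃ k : List ℕ, ∃ a ∈ supp R d {p | p < k.length}, Finsupp.single k a = A}

theorem single_mem_GSpace {k : List ℕ} {a : Alg R d} (ha : a ∈ supp R d {p | p < k.length}) :
    (Finsupp.single k a : Space R d) ∈ GSpace R d :=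
  Submodule.subset_span ⟨k, a, ha, rfl⟩

theorem pair_injOn (i : ℕ) (S : Set ℕ) : Set.InjOn (Nat.pair i) S :=
  fun _ _ _ _ h => (Nat.pair_eq_pair.1 h).2

/-- Shuffle products of diagrams, after choosing disjoint sets of labels for them. -/
theorem shufML_single_eq (s : ℕ) (κ : Fin ℓ → List ℕ) {a : Fin ℓ → Alg R d}
    (ha : ∀ i, a i ∈ supp R d {p | p < (κ i).length}) :
    shufML R d s ℓ (fun i => Finsupp.single (κ i) (a i)) 1
      = Phi R d (nest R (deg d) ℓ s fun i => wd R (coreWord (Nat.pair i) (κ i)))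
        (List.ofFn fun i => par R d (∑ j ∈ Finset.Ioi i, blockDeg d (κ j))
          (relabel R d (Nat.pair i) (a i))).prod := by
  have := shufML_Phi (R := R) (d := d) s
    (L := fun i : Fin ℓ => {y | ∃ p < (κ i).length, Nat.pair i p = y})
    (n := fun i => blockDeg d (κ i)) (S := ∅) (r := id) (D := 1)
    (m := fun i => wd R (coreWord (Nat.pair i) (κ i))) (a := fun i => relabel R d (Nat.pair i) (a i))
    ?_ (by simp) ?_ (fun i => relabel_coreWord (ha i)) (one_mem _)
  · simp only [Phi_wd, map_one, mul_one] at this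
    rw [← this]
    congr 2
    funext i
    rw [phi_coreWord (pair_injOn _ _) (ha i)]
  · rintro i i' _ ⟨p, _, rfl⟩ ⟨q, _, h⟩
    exact Fin.ext (Nat.pair_eq_pair.1 h).1.symm
  · intro i
    exact wd_mem ⟨adm_coreWord _ _, by rw [wdeg_coreWord], by simp⟩

theorem hs_one {V : Type*} (deg : V → ℕ) (w : List V) : hs (R := R) deg (wd R w) (wd R []) = wd R w := by
  cases w with
  | nil => simp
  | cons x w => rw [hs_wd_cons, sh_one, cons_wd]

/-- In a divided product with a single point on the left, this point stays in front. -/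
theorem dividedProduct_point {k : ℕ} {κ : List ℕ} {a b : Alg R d} (ha : a ∈ supp R d {0})
    (hb : b ∈ supp R d {p | p < κ.length}) :
    dividedProduct R d ![Finsupp.single [k] a, Finsupp.single κ b]
      = Finsupp.single (k :: κ) (par R d (blockDeg d κ) a * relabel R d Nat.succ b) := by
  have e0 : ({p | p < [k].length} : Set ℕ) = {0} := by ext; simp
  have ha' : a ∈ supp R d {p | p < [k].length} := by rwa [e0]
  have e : (![Finsupp.single [k] a, Finsupp.single κ b] : Fin 2 → Space R d)
      = fun i => Finsupp.single ((![[k], κ] : Fin 2 → List ℕ) i) ((![a, b] : Fin 2 → Alg R d) i) := by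
    funext i; fin_cases i <;> rfl
  rw [dividedProduct_eq, e, shufML_single_eq]
  · rw [nest_succ_zero, nest_succ_zero, nest_zero, hs_one]
    let x : ℕ → ℕ := fun p => if p = 0 then Nat.pair 0 0 else Nat.pair 1 (p - 1)
    have hx : Set.InjOn x {p | p < (k :: κ).length} := by
      rintro (_ | p) _ (_ | q) _ h
      · rfl
      · simp [x] at h
      · simp [x] at h
      · simpa [x] using h
    have h1 : wd R (coreWord x (k :: κ)) = (hs (deg d)) (wd R (coreWord (Nat.pair 0) [k]))
        (wd R (coreWord (Nat.pair 1) κ)) := by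
      rw [coreWord_cons, coreWord_cons, coreWord_nil, hs_wd_cons, one_sh, cons_wd]
      rfl
    have h2 : relabel R d x (par R d (blockDeg d κ) a * relabel R d Nat.succ b)
        = par R d (blockDeg d κ) (relabel R d (Nat.pair 0) a) * relabel R d (Nat.pair 1) b := by
      rw [map_mul, relabel_par, relabel_relabel,
        relabel_congr (f := x) (g := Nat.pair 0) (by rintro p rfl; rfl) ha]
      rfl
    have h3 : par R d (blockDeg d κ) a * relabel R d Nat.succ b ∈ supp R d {p | p < (k :: κ).length} := by
      refine mul_mem (par_mem_supp _ (supp_mono ?_ ha)) (relabel_mem_supp (fun p hp => ?_) hb)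
      · rintro _ rfl; simp
      · simpa using hp
    rw [← phi_coreWord hx h3, ← Phi_wd, h2, h1]
    congr 1
    simp [List.ofFn_succ]
  · intro i
    fin_cases i
    · exact ha'
    · exact hb

end

section

open Letter

variable {R : Type*} [CommRing R] {d ℓ : ℕ}

/-! ### The value of `I` on a single point -/

/-- The diagrams with an additional point at the left end. -/
def prepend (R : Type*) [CommRing R] (d k : ℕ) : Space R d →ₗ[R] Space R d :=
  Finsupp.lsum R fun κ => Finsupp.lsingle (k :: κ) ∘ₗ (relabel R d Nat.succ).toLinearMap

@[simp] theorem prepend_single (k : ℕ) (κ : List ℕ) (b : Alg R d) :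
    prepend R d k (Finsupp.single κ b) = Finsupp.single (k :: κ) (relabel R d Nat.succ b) := by
  simp [prepend]

theorem boundaryH_single (κ : List ℕ) (b : Alg R d) : boundaryH R d (Finsupp.single κ b)
    = ∑ i ∈ Finset.range (κ.length - 1),
      ((-1 : R) ^ (blockDeg d (κ.take i) + κ.getD i 0 * d)
        * (qbinom d (κ.getD i 0) (κ.getD (i + 1) 0) : R)) •
      (Finsupp.single (κ.take i ++ (κ.getD i 0 + κ.getD (i + 1) 0) :: κ.drop (i + 2))
        (glue R d i b) : Space R d) := by
  simp [boundaryH]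

theorem boundaryV_single (κ : List ℕ) (b : Alg R d) : boundaryV R d (Finsupp.single κ b)
    = ∑ i ∈ Finset.range κ.length, if κ.getD i 0 = 0 then 0 else
      ((-1 : R) ^ (blockDeg d (κ.take i) + κ.getD i 0 * d
          + (d + 1) * blockDeg d (κ.drop (i + 1)))) •
      (Finsupp.single (κ.set i (κ.getD i 0 - 1)) (gen R d (Gen.star i) * b) : Space R d) := by
  rw [boundaryV, Finsupp.lsum_apply, Finsupp.sum_single_index (by simp), LinearMap.sum_apply]
  refine Finset.sum_congr rfl fun i _ => ?_
  split_ifs <;> simp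

theorem glue_succ_relabel (i : ℕ) (b : Alg R d) : glue R d (i + 1) (relabel R d Nat.succ b)
    = relabel R d Nat.succ (glue R d i b) := by
  have : (glue R d (i + 1)).comp (relabel R d Nat.succ)
      = (relabel R d Nat.succ).comp (glue R d i) := by
    apply alg_hom_ext
    intro x
    have h : ∀ a, gluePos (i + 1) a.succ = (gluePos i a).succ := by
      intro a; simp only [gluePos]; split_ifs <;> omega
    cases x with
    | star a => simp [relabelGen, glueGen, h]
    | chord a b =>
      simp only [AlgHom.comp_apply, relabel_gen, glue_gen, relabelGen, glueGen, Nat.succ_eq_add_one,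
        add_left_inj]
      split_ifs <;> simp [relabelGen, h]
  exact DFunLike.congr_fun this b

theorem glue_zero_relabel (b : Alg R d) : glue R d 0 (relabel R d Nat.succ b) = b := by
  have : (glue R d 0).comp (relabel R d Nat.succ) = AlgHom.id R _ := by
    apply alg_hom_ext
    intro x
    cases x <;> simp [relabelGen, glueGen, gluePos]
  exact DFunLike.congr_fun this b

/-- The new point is glued with the first old point, or does not take part. -/
theorem boundaryH_prepend (k m : ℕ) (κ : List ℕ) (b : Alg R d) :
    boundaryH R d (prepend R d k (Finsupp.single (m :: κ) b))
      = ((-1 : R) ^ (k * d) * (qbinom d k m : R)) • Finsupp.single ((k + m) :: κ) b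
        + (-1 : R) ^ (1 + k * d) • prepend R d k (boundaryH R d (Finsupp.single (m :: κ) b)) := by
  rw [prepend_single, boundaryH_single, boundaryH_single, List.length_cons, List.length_cons,
    Nat.add_sub_cancel, Nat.add_sub_cancel, Finset.sum_range_succ', add_comm]
  congr 1
  · simp [blockDeg, glue_zero_relabel]
  · rw [map_sum, Finset.smul_sum]
    refine Finset.sum_congr rfl fun i _ => ?_
    rw [map_smul, prepend_single, glue_succ_relabel, smul_smul, ← mul_assoc, ← pow_add]
    simp [blockDeg, add_assoc]

/-- The lowest top asterisk over the new point drops, or the new point does not take part. -/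
theorem boundaryV_prepend (k : ℕ) (κ : List ℕ) (b : Alg R d) :
    boundaryV R d (prepend R d k (Finsupp.single κ b))
      = (if k = 0 then 0 else (-1 : R) ^ (k * d + (d + 1) * blockDeg d κ) •
          Finsupp.single ((k - 1) :: κ) (gen R d (Gen.star 0) * relabel R d Nat.succ b))
        + (-1 : R) ^ (1 + k * d) • prepend R d k (boundaryV R d (Finsupp.single κ b)) := by
  rw [prepend_single, boundaryV_single, boundaryV_single, List.length_cons,
    Finset.sum_range_succ', add_comm]
  congr 1
  · simp [blockDeg]
  · rw [map_sum, Finset.smul_sum]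
    refine Finset.sum_congr rfl fun i _ => ?_
    simp only [List.getD_cons_succ]
    split_ifs with h
    · simp
    · rw [map_smul, prepend_single, smul_smul, ← pow_add, map_mul, relabel_gen, relabelGen]
      simp [blockDeg, add_assoc]

theorem update_pair_zero {M : Type*} (A B C : M) : Function.update ![A, B] 0 C = ![C, B] := by
  funext i; fin_cases i <;> rfl

theorem update_pair_one {M : Type*} (A B C : M) : Function.update ![A, B] 1 C = ![A, C] := by
  funext i; fin_cases i <;> rfl

theorem dividedProduct_add_right (A B C : Space R d) :
    dividedProduct R d ![A, B + C] = dividedProduct R d ![A, B] + dividedProduct R d ![A, C] := by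
  simp only [dividedProduct_eq]
  have := (shufML R d 0 2).map_update_add ![A, B] 1 B C
  simp only [update_pair_one] at this
  exact DFunLike.congr_fun this 1

theorem dividedProduct_smul_right (A B : Space R d) (r : R) :
    dividedProduct R d ![A, r • B] = r • dividedProduct R d ![A, B] := by
  simp only [dividedProduct_eq]
  have := (shufML R d 0 2).map_update_smul ![A, B] 1 r B
  simp only [update_pair_one] at this
  exact DFunLike.congr_fun this 1

theorem dividedProduct_add_left (A B C : Space R d) :
    dividedProduct R d ![A + B, C] = dividedProduct R d ![A, C] + dividedProduct R d ![B, C] := by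
  simp only [dividedProduct_eq]
  have := (shufML R d 0 2).map_update_add ![A, C] 0 A B
  simp only [update_pair_zero] at this
  exact DFunLike.congr_fun this 1

theorem dividedProduct_smul_left (A B : Space R d) (r : R) :
    dividedProduct R d ![r • A, B] = r • dividedProduct R d ![A, B] := by
  simp only [dividedProduct_eq]
  have := (shufML R d 0 2).map_update_smul ![A, B] 0 r A
  simp only [update_pair_zero] at this
  exact DFunLike.congr_fun this 1

/-- The divided product of two elements, as a bilinear map. -/
def divided₂ (R : Type*) [CommRing R] (d : ℕ) : Space R d →ₗ[R] Space R d →ₗ[R] Space R d :=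
  LinearMap.mk₂ R (fun A B => dividedProduct R d ![A, B]) dividedProduct_add_left
    (fun r A B => dividedProduct_smul_left A B r) dividedProduct_add_right
    (fun r A B => dividedProduct_smul_right A B r)

theorem dividedProduct_single_point (k : ℕ) {B : Space R d} (hB : B ∈ GSpace R d) :
    dividedProduct R d ![Finsupp.single [k] 1, B] = prepend R d k B := by
  refine LinearMap.eqOn_span (f := divided₂ R d (Finsupp.single [k] 1)) (g := prepend R d k) ?_ hB
  rintro _ ⟨κ, b, hb, rfl⟩
  change dividedProduct R d ![Finsupp.single [k] 1, Finsupp.single κ b] = _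
  rw [dividedProduct_point (one_mem _) hb, map_one, one_mul, prepend_single]

theorem glue_mem_supp {i n : ℕ} (hi : i + 1 < n) {a : Alg R d} (ha : a ∈ supp R d {p | p < n}) :
    glue R d i a ∈ supp R d {p | p < n - 1} := by
  have h : ∀ p < n, gluePos i p < n - 1 := by
    intro p hp; simp only [gluePos]; split_ifs <;> omega
  refine map_mem_supp _ (fun x hx => ?_) ha
  rw [glue_gen]
  cases x with
  | star p => exact gen_mem_supp (h p hx)
  | chord p q =>
    have hs : gen R d (Gen.star i) ∈ supp R d {p | p < n - 1} :=
      gen_mem_supp (show i < n - 1 by omega)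
    simp only [glueGen]
    split_ifs
    · exact hs
    · exact Subalgebra.smul_mem _ hs _
    · exact gen_mem_supp ⟨h p hx.1, h q hx.2⟩

theorem length_glued (κ : List ℕ) (i t : ℕ) (hi : i + 1 < κ.length) :
    (κ.take i ++ t :: κ.drop (i + 2)).length = κ.length - 1 := by
  simp; omega

theorem boundary_mem_GSpace {A : Space R d} (hA : A ∈ GSpace R d) :
    boundaryH R d A ∈ GSpace R d ∧ boundaryV R d A ∈ GSpace R d := by
  refine ⟨(Submodule.span_le (p := (GSpace R d).comap (boundaryH R d))).2 ?_ hA,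
    (Submodule.span_le (p := (GSpace R d).comap (boundaryV R d))).2 ?_ hA⟩
  · rintro _ ⟨κ, b, hb, rfl⟩
    simp only [Submodule.comap_coe, Set.mem_preimage, SetLike.mem_coe, boundaryH_single]
    refine Submodule.sum_mem _ fun i hi => Submodule.smul_mem _ _ (single_mem_GSpace ?_)
    have hi' : i + 1 < κ.length := by have := Finset.mem_range.1 hi; omega
    rw [length_glued _ _ _ hi']
    exact glue_mem_supp hi' hb
  · rintro _ ⟨κ, b, hb, rfl⟩
    simp only [Submodule.comap_coe, Set.mem_preimage, SetLike.mem_coe, boundaryV_single]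
    refine Submodule.sum_mem _ fun i hi => ?_
    split_ifs
    · exact zero_mem _
    · refine Submodule.smul_mem _ _ (single_mem_GSpace ?_)
      rw [List.length_set]
      exact mul_mem (gen_mem_supp (Finset.mem_range.1 hi)) hb

theorem spaceParity_single (κ : List ℕ) (a : Alg R d) : spaceParity R d (Finsupp.single κ a)
    = (-1 : R) ^ blockDeg d κ • Finsupp.single κ (par R d 1 a) := by
  simp [spaceParity, parity_eq_par]

/-- Gluing a single point with `k` top asterisks to a diagram: the top asterisks over its left-most
point are shuffled. -/
theorem vdash_point {k m : ℕ} {κ : List ℕ} {b : Alg R d}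
    (hb : b ∈ supp R d {p | p < (m :: κ).length}) :
    vdash R d (Finsupp.single [k] 1) (Finsupp.single (m :: κ) b)
      = (qbinom d k m : R) • Finsupp.single ((k + m) :: κ) b := by
  have hB := single_mem_GSpace hb
  have e1 : spaceParity R d (Finsupp.single [k] 1)
      = (-1 : R) ^ (1 + k * d) • (Finsupp.single [k] 1 : Space R d) := by
    rw [spaceParity_single, map_one]; simp [blockDeg]
  have e2 : boundary R d (Finsupp.single [k] 1)
      = if k = 0 then 0 else (-1 : R) ^ (k * d) • Finsupp.single [k - 1] (gen R d (Gen.star 0)) := by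
    rw [boundary, LinearMap.add_apply, boundaryH_single, boundaryV_single]
    simp [blockDeg]
  have e3 : dividedProduct R d ![boundary R d (Finsupp.single [k] 1), Finsupp.single (m :: κ) b]
      = if k = 0 then 0 else (-1 : R) ^ (k * d + (d + 1) * blockDeg d (m :: κ)) •
          Finsupp.single ((k - 1) :: m :: κ) (gen R d (Gen.star 0) * relabel R d Nat.succ b) := by
    rw [e2]
    split_ifs
    · exact LinearMap.map_zero₂ (divided₂ R d) (Finsupp.single (m :: κ) b)
    · rw [dividedProduct_smul_left, dividedProduct_point (gen_mem_supp (g := Gen.star 0) (show (0 : ℕ) ∈ ({0} : Set ℕ) from rfl)) hb, par_gen,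
        smul_mul_assoc, ← Finsupp.smul_single, smul_smul, ← pow_add, mul_comm (d + 1)]
  have hbd := boundary_mem_GSpace hB
  rw [vdash, e1, dividedProduct_smul_left, map_smul, map_smul, dividedProduct_smul_left, e3,
    dividedProduct_single_point k hB, boundary, LinearMap.add_apply, LinearMap.add_apply,
    dividedProduct_single_point k (add_mem hbd.1 hbd.2), boundaryH_prepend, boundaryV_prepend, map_add]
  -- In the definition of `vdash`, the terms `E`, `P` and `P'` cancel, and the gluing of the new
  -- point with the first old point remains.
  generalize (if k = 0 then (0 : Space R d) else _) = E
  generalize prepend R d k (boundaryH R d _) = P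
  generalize prepend R d k (boundaryV R d _) = P'
  have s1 : (-1 : R) ^ (1 + k * d) * (-1 : R) ^ (k * d) = -1 := by
    rw [← pow_add]
    have : (-1 : R) ^ (1 + k * d + k * d) = (-1 : R) ^ 1 :=
      sign_congr (by simp only [Nat.even_add]; tauto)
    simpa using this
  have s2 : (-1 : R) ^ (1 + k * d) * (-1 : R) ^ (1 + k * d) = 1 := sign_mul_self _
  linear_combination (norm := module) (-(qbinom d k m : R) * s1) • Finsupp.single ((k + m) :: κ) b
    - s2 • (P + P')

theorem qbinom_zero (d k : ℕ) : qbinom d k 0 = 1 := by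
  simp [qbinom]

/-- The value of `I` on a point: `k - i` top asterisks and `i` chords to new points, for all `i`.
-/
theorem IZ_eq_sum (k : ℕ) : IZ R d k = ∑ i ∈ Finset.range (k + 1),
    Finsupp.single ((k - i) :: List.replicate i 0) ((-1 : R) ^ ((d + 1) * (i * (i + 1) / 2)) •
      ((List.range i).map fun j => gen R d (Gen.chord 0 (j + 1))).prod) := by
  refine Finset.sum_congr rfl fun i _ => ?_
  rw [Z, Zhat, List.replicate_succ, vdash_point, qbinom_zero, Nat.cast_one, one_smul, add_zero]
  refine Subalgebra.smul_mem _ (Subalgebra.list_prod_mem _ fun x hx => ?_) _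
  obtain ⟨j, hj, rfl⟩ := List.mem_map.1 hx
  have := List.mem_range.1 hj
  exact gen_mem_supp ⟨by simp, by simpa using this⟩

/-- A row of leaves of a point at the place `0` gives the chords of a tree, up to the sign from the
reordering of chords and points. -/
theorem algOf_leaves {f : ℕ → ℕ} {x : ℕ} (hf : f x = 0) (n i : ℕ) :
    algOf R d f n (List.replicate i (leaf x)) = (-1 : R) ^ ((d + 1) * (i * (i + 1) / 2)) •
      ((List.range i).map fun j => gen R d (Gen.chord 0 (n + j))).prod := by
  induction i generalizing n with
  | zero => simp [algOf]
  | succ i ih =>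
    have hw : wdeg (tdeg d) (List.replicate i (leaf x)) = i := by simp [wdeg, tdeg, top]
    have hi : (i + 1) * (i + 1 + 1) / 2 = i + 1 + i * (i + 1) / 2 := by
      have : (i + 1) * (i + 1 + 1) = i * (i + 1) + 2 * (i + 1) := by ring
      omega
    rw [List.replicate_succ, algOf, ih, hw, fac, hf, map_smul, par_gen, smul_smul, ← pow_add,
      smul_mul_smul_comm, ← pow_add, List.range_succ_eq_map, List.map_cons, List.prod_cons,
      List.map_map, add_zero, hi]
    congr 2
    · ring
    · congr 3
      funext j
      simp [add_assoc, add_comm 1]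

/-- The effect of the map `I` on a letter: top asterisks are replaced by chords to new points. -/
def expand (R : Type*) [CommRing R] : Letter → Words R Letter
  | core x k => ∑ i ∈ Finset.range (k + 1), wd R (core x (k - i) :: List.replicate i (leaf x))
  | l => wd R [l]

theorem wdeg_replicate_leaf (x i : ℕ) :
    wdeg (deg d) (List.replicate i (leaf x)) = i * (1 + (d + 1)) := by
  simp [wdeg, deg, tdeg, bdeg, top]

theorem expand_compat : ZinCompat (deg d) (deg d) (expand R) := by
  intro l
  cases l with
  | core x k =>
    refine Submodule.sum_mem _ fun i hi => wd_mem ⟨by simp, ?_⟩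
    have hi := Finset.mem_range.1 hi
    obtain ⟨j, rfl⟩ := Nat.exists_eq_add_of_le (show i ≤ k by omega)
    rw [wdeg_cons, wdeg_replicate_leaf, Nat.add_sub_cancel_left]
    simp only [deg, tdeg, top, bdeg, Nat.even_add, Nat.even_mul, Nat.not_even_one, Even.zero]
    tauto
  | _ => exact wd_mem ⟨by simp, by simp⟩

/-- The map `I` on words. -/
abbrev IWord (R : Type*) [CommRing R] (d : ℕ) : List Letter → Words R Letter :=
  zin (deg d) (expand R)

/-- The linear extension of `IWord`. -/
abbrev IWordL (R : Type*) [CommRing R] (d : ℕ) : Words R Letter →ₗ[R] Words R Letter :=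
  zinL (deg d) (expand R)

/-- The value of `I` on a point as a combination of words. -/
theorem IZ_eq (x k : ℕ) : IZ R d k = Phi R d (expand R (core x k)) 1 := by
  rw [IZ_eq_sum, expand, map_sum, LinearMap.sum_apply]
  refine Finset.sum_congr rfl fun i _ => ?_
  have h0 : coreIdx (core x (k - i) :: List.replicate i (leaf x)) x = 0 :=
    coreIdx_eq (by simp) (by simp [label]) (by simp)
  rw [Phi_wd, phi_apply, map_one, mul_one, algOf, fac, map_one, one_mul, algOf_leaves h0]
  simp [top, add_comm 1]

theorem adm_expand (x k i : ℕ) :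
    Adm {x} (core x k :: List.replicate i (leaf x)) := by
  refine ⟨fun y => ?_, fun y hy => ?_⟩
  · have : labels (List.replicate i (leaf x)) = [] := by
      simp [labels, List.filterMap_eq_nil_iff, label]
    rw [labels, List.filterMap_cons]
    simp only [label]
    rw [← labels, this]
    simp
  · simpa using (List.mem_replicate.1 (List.mem_of_ne_of_mem (by simp) hy)).2

/-- The definition of `I` by insertion becomes on words the half-shuffle homomorphism that extends
`expand`. -/
theorem nest_expand_coreWord (x : ℕ → ℕ) (k : List ℕ) :
    nest R (deg d) k.length 0 (fun i : Fin k.length => expand R (core (x i) (k.get i)))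
      = IWord R d (coreWord x k) := by
  induction k generalizing x with
  | nil => rfl
  | cons t k ih =>
    rw [coreWord_cons, IWord, zin, ← IWord, ← ih]
    rfl

/-- The map `I` on diagrams is the map `IWord` on words of labelled points; the chords and bottom
asterisks of the diagram are not affected. -/
theorem I_single {x : ℕ → ℕ} {k : List ℕ} (hx : Set.InjOn x {p | p < k.length}) {b : Alg R d}
    (hb : b ∈ supp R d {p | p < k.length}) :
    I R d (Finsupp.single k b) = Phi R d (IWord R d (coreWord x k)) (relabel R d x b) := by
  rw [I, Finsupp.lsum_apply, Finsupp.sum_single_index (by simp), insertion_eq]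
  have e : (fun i : Fin k.length => IZ R d (k.get i))
      = fun i : Fin k.length => Phi R d (expand R (core (x i) (k.get i))) 1 :=
    funext fun i => IZ_eq _ _
  rw [e, shufML_Phi (L := fun i : Fin k.length => {x i}) (n := fun i => deg d (core (x i) (k.get i)))
    (S := {p | p < k.length}) (r := x) 0 ?_ ?_ ?_ (fun _ => one_mem _) hb, nest_expand_coreWord]
  · congr 1
    simp [List.ofFn_const]
  · rintro i i' _ rfl h
    exact Fin.ext (hx i.2 i'.2 h)
  · intro j hj
    exact ⟨hj, rfl⟩
  · intro i
    refine Submodule.sum_mem _ fun j hj => wd_mem ⟨adm_expand _ _ _, ?_, fun _ => ?_⟩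
    · have hi := Finset.mem_range.1 hj
      obtain ⟨q, hq⟩ := Nat.exists_eq_add_of_le (show j ≤ k.get i by omega)
      rw [wdeg_cons, wdeg_replicate_leaf, hq, Nat.add_sub_cancel_left]
      simp only [deg, tdeg, top, bdeg, Nat.even_add, Nat.even_mul, Nat.not_even_one, Even.zero]
      tauto
    · exact coreIdx_eq (by simp) (by simp [label]) (by simp)

end

section

open Letter

variable {R : Type*} [CommRing R] {d ℓ : ℕ}

/-! ### Compatibility of `I` with products -/

/-- Words of points without chords to them, with different labels. -/
def IsCoreWord (w : List Letter) : Prop := (∀ l ∈ w, ∃ x k, l = core x k) ∧ (labels w).Nodup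

theorem IsCoreWord.of_cons {l : Letter} {w : List Letter} (h : IsCoreWord (l :: w)) :
    ∃ x k, l = core x k ∧ x ∉ labels w ∧ IsCoreWord w := by
  obtain ⟨x, k, rfl⟩ := h.1 l List.mem_cons_self
  have h2 := h.2
  rw [labels, List.filterMap_cons] at h2
  simp only [label, List.nodup_cons] at h2
  exact ⟨x, k, rfl, h2.1, fun l hl => h.1 l (List.mem_cons_of_mem _ hl), h2.2⟩

theorem IsCoreWord.perm {v w : List Letter} (h : IsCoreWord v) (p : v.Perm w) : IsCoreWord w :=
  ⟨fun l hl => h.1 l (p.mem_iff.2 hl), (p.filterMap label).nodup_iff.1 h.2⟩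

theorem labels_core_cons (x k : ℕ) (w : List Letter) : labels (core x k :: w) = x :: labels w := by
  simp [labels, label]

theorem labels_perm {v w : List Letter} (p : v.Perm w) {x : ℕ} : x ∈ labels v ↔ x ∈ labels w :=
  (p.filterMap label).mem_iff

/-- Every word of points with distinct labels is of the form `coreWord x k`. -/
theorem IsCoreWord.exists_eq {w : List Letter} (h : IsCoreWord w) : ∃ x : ℕ → ℕ,
    w = coreWord x (w.map top) ∧ Set.InjOn x {p | p < (w.map top).length} := by
  induction w with
  | nil => exact ⟨id, rfl, fun _ _ _ _ h => h⟩
  | cons l w ih =>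
    obtain ⟨y, k, rfl, hy, hw⟩ := h.of_cons
    obtain ⟨x, hx, hinj⟩ := ih hw
    have hmem : ∀ p < (w.map top).length, x p ∈ labels w := fun p hp => by
      rw [hx]; exact mem_labels_coreWord.2 ⟨p, hp, rfl⟩
    refine ⟨fun p => if p = 0 then y else x (p - 1), ?_, ?_⟩
    · rw [List.map_cons, coreWord_cons]
      exact congrArg _ hx
    · rintro (_ | p) hp (_ | q) hq e
      · rfl
      · exact absurd (hmem q (by simpa using hq)) (by simp at e; rwa [← e])
      · exact absurd (hmem p (by simpa using hp)) (by simp at e; rwa [e])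
      · simp only [Nat.add_eq_zero_iff, one_ne_zero, and_false, if_false, Nat.add_sub_cancel] at e
        rw [hinj (by simpa using hp) (by simpa using hq) e]

/-- The formula of `I_single` for a diagram whose points are labelled in any way. -/
theorem I_phi {w : List Letter} (hw : IsCoreWord w) {a : Alg R d}
    (ha : a ∈ supp R d {x | x ∈ labels w}) : I R d (phi R d w a) = Phi R d (IWord R d w) a := by
  obtain ⟨x, hx, hinj⟩ := hw.exists_eq
  have hr : ∀ y ∈ labels w, x (coreIdx w y) = y := by
    intro y hy
    rw [hx] at hy
    obtain ⟨p, hp, rfl⟩ := mem_labels_coreWord.1 hy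
    conv_lhs => rw [hx]
    rw [coreIdx_coreWord hinj hp]
  have hb : relabel R d (coreIdx w) a ∈ supp R d {p | p < (w.map top).length} :=
    relabel_mem_supp (fun y hy => by simpa using coreIdx_lt.2 hy) ha
  have hab : relabel R d x (relabel R d (coreIdx w) a) = a := by
    rw [relabel_relabel]
    exact relabel_id_of_mem hr ha
  have h := I_single hinj hb
  rw [hab, ← phi_coreWord hinj hb, hab, ← hx] at h
  exact h

theorem I_Phi {S : Set ℕ} {m : Words R Letter}
    (hm : m ∈ wordsIn R fun w => IsCoreWord w ∧ S ⊆ {x | x ∈ labels w}) {a : Alg R d}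
    (ha : a ∈ supp R d S) : I R d (Phi R d m a) = Phi R d (IWordL R d m) a := by
  refine eqOn_wordsIn (f := (I R d).comp ((Phi R d).flip a))
    (g := ((Phi R d).flip a).comp (IWordL R d)) (fun w hw => ?_) hm
  simp only [LinearMap.comp_apply, LinearMap.flip_apply, Phi_wd, zinL_wd]
  exact I_phi hw.1 (supp_mono hw.2 ha)

/-- Each term of a product is an arrangement of the letters of the factors. -/
theorem nest_perm {V : Type*} (deg : V → ℕ) (s : ℕ) (u : Fin ℓ → List V) :
    nest R deg ℓ s (fun i => wd R (u i)) ∈ wordsIn R fun w => w.Perm (List.ofFn u).flatten := by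
  induction ℓ generalizing s with
  | zero => exact wd_mem (by simp)
  | succ ℓ ih =>
    have h : ∀ u' v : List V, u' = u 0 → v.Perm (List.ofFn fun i => u (Fin.succ i)).flatten →
        ∀ w : List V, w.Perm (u' ++ v) → w.Perm (List.ofFn u).flatten := by
      rintro u' v rfl hv w hw
      rw [List.ofFn_succ, List.flatten_cons]
      exact hw.trans (hv.append_left _)
    cases s with
    | zero => exact hs_mem deg h (wd_mem rfl) (ih 0 fun i => u i.succ)
    | succ s => exact sh_mem deg h (wd_mem rfl) (ih s fun i => u i.succ)

/-- A half-shuffle homomorphism is compatible with products, divided products and mixtures of them.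
-/
theorem ZinCompat.zin_nest {U V : Type*} {degU : U → ℕ} {deg : V → ℕ} {X : U → Words R V}
    (h : ZinCompat degU deg X) (s : ℕ) (m : Fin ℓ → Words R U) :
    zinL deg X (nest R degU ℓ s m) = nest R deg ℓ s fun i => zinL deg X (m i) := by
  induction ℓ generalizing s with
  | zero => simp [nest_zero, zin]
  | succ ℓ ih =>
    cases s with
    | zero => rw [nest_succ_zero, nest_succ_zero, h.zin_hs, ih]
    | succ s => rw [nest_succ_succ, nest_succ_succ, h.zin_sh, ih]

/-- The second word arises from the first one, without taking care of the order of its letters, by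
replacing some of the top asterisks by chords to new points. -/
inductive ExpandsTo : List Letter → List Letter → Prop
  | nil : ExpandsTo [] []
  | core {x i k : ℕ} {w v v' : List Letter} : i ≤ k → ExpandsTo w v →
      v'.Perm ((core x (k - i) :: List.replicate i (leaf x)) ++ v) → ExpandsTo (core x k :: w) v'

theorem IWord_expandsTo {w : List Letter} (hw : IsCoreWord w) :
    IWord R d w ∈ wordsIn R fun v => ExpandsTo w v := by
  induction w with
  | nil => exact wd_mem ExpandsTo.nil
  | cons l w ih =>
    obtain ⟨x, k, rfl, -, hw'⟩ := hw.of_cons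
    refine hs_mem (deg d) (P := fun e => ∃ i ≤ k, e = core x (k - i) :: List.replicate i (leaf x))
      ?_ ?_ (ih hw')
    · rintro _ v ⟨i, hi, rfl⟩ hv w' hw'
      exact ExpandsTo.core hi hv hw'
    · refine Submodule.sum_mem _ fun i hi => wd_mem ⟨i, ?_, rfl⟩
      have := Finset.mem_range.1 hi
      omega

theorem labels_replicate_leaf (x i : ℕ) : labels (List.replicate i (leaf x)) = [] := by
  simp [labels, List.filterMap_eq_nil_iff, label]

theorem labels_append (v w : List Letter) : labels (v ++ w) = labels v ++ labels w :=
  List.filterMap_append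

theorem ExpandsTo.labels_perm {w v : List Letter} (h : ExpandsTo w v) :
    (labels v).Perm (labels w) := by
  induction h with
  | nil => rfl
  | @core x i k w v v' _ _ hp ih =>
    refine (hp.filterMap label).trans ?_
    change (labels (_ ++ _)).Perm _
    rw [labels_append, labels_core_cons, labels_replicate_leaf, labels_core_cons, List.cons_append,
      List.nil_append]
    exact ih.cons x

theorem ExpandsTo.mem_labels_iff {w v : List Letter} (h : ExpandsTo w v) {x : ℕ} :
    x ∈ labels v ↔ x ∈ labels w := h.labels_perm.mem_iff

theorem ExpandsTo.leaf {w v : List Letter} (h : ExpandsTo w v) {y : ℕ} (hy : leaf y ∈ v) :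
    y ∈ labels w := by
  induction h with
  | nil => simp at hy
  | @core x i k w v v' _ _ hp ih =>
    rw [labels_core_cons]
    have := hp.mem_iff.1 hy
    simp only [List.cons_append, List.mem_cons, List.mem_append, List.mem_replicate, reduceCtorEq,
      false_or, Letter.leaf.injEq] at this
    rcases this with h | h
    · simp [h.2]
    · exact List.mem_cons_of_mem _ (ih h)

theorem ExpandsTo.adm {w v : List Letter} (h : ExpandsTo w v) : Adm {x | x ∈ labels w} v :=
  ⟨fun _ => h.mem_labels_iff, fun _ hx => h.leaf hx⟩

theorem isCoreWord_coreWord {x : ℕ → ℕ} {k : List ℕ} (hx : Set.InjOn x {p | p < k.length}) :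
    IsCoreWord (coreWord x k) := by
  constructor
  · intro l hl
    obtain ⟨p, hp, rfl⟩ := List.mem_mapIdx.1 hl
    exact ⟨_, _, rfl⟩
  · induction k generalizing x with
    | nil => simp [labels]
    | cons t k ih =>
      rw [coreWord_cons, labels_core_cons, List.nodup_cons]
      refine ⟨fun h => ?_, ih fun p hp q hq h => ?_⟩
      · obtain ⟨p, hp, h⟩ := mem_labels_coreWord.1 h
        exact absurd (hx (show p + 1 < _ by simpa using hp) (show 0 < _ by simp) h) (by simp)
      · exact Nat.succ_injective (hx (show p + 1 < _ by simpa using hp)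
          (show q + 1 < _ by simpa using hq) h)

theorem isCoreWord_flatten {u : Fin ℓ → List Letter} (h : ∀ i, IsCoreWord (u i))
    (hd : ∀ i i' x, x ∈ labels (u i) → x ∈ labels (u i') → i = i') :
    IsCoreWord (List.ofFn u).flatten := by
  induction ℓ with
  | zero => exact ⟨by simp, by simp [labels]⟩
  | succ ℓ ih =>
    have h' := ih (fun i => h i.succ) fun i i' x h1 h2 => Fin.succ_injective _ (hd _ _ x h1 h2)
    rw [List.ofFn_succ, List.flatten_cons]
    refine ⟨fun l hl => ?_, ?_⟩
    · rcases List.mem_append.1 hl with hl | hl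
      · exact (h 0).1 l hl
      · exact h'.1 l hl
    · rw [labels_append]
      refine (h 0).2.append h'.2 fun x hx hx' => ?_
      obtain ⟨l, hl, e⟩ := mem_labels.1 hx'
      obtain ⟨v, hv, hlv⟩ := List.mem_flatten.1 hl
      obtain ⟨i, rfl⟩ := List.mem_ofFn.1 hv
      exact absurd (hd 0 i.succ x hx (mem_labels.2 ⟨l, hlv, e⟩)) (Fin.succ_ne_zero i).symm

theorem prod_ofFn_mem_supp {S : Set ℕ} {a : Fin ℓ → Alg R d} (h : ∀ i, a i ∈ supp R d S) :
    (List.ofFn a).prod ∈ supp R d S :=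
  Subalgebra.list_prod_mem _ fun x hx => by
    obtain ⟨i, rfl⟩ := List.mem_ofFn.1 hx
    exact h i

theorem wordsIn_and {V : Type*} {P Q : List V → Prop} {m : Words R V} (hP : m ∈ wordsIn R P)
    (hQ : m ∈ wordsIn R Q) : m ∈ wordsIn R fun w => P w ∧ Q w := by
  have h := Set.subset_inter ((Finsupp.mem_supported R m).1 hP) ((Finsupp.mem_supported R m).1 hQ)
  exact (Finsupp.mem_supported R m).2 h

theorem I_shufML_single (s : ℕ) (κ : Fin ℓ → List ℕ) {a : Fin ℓ → Alg R d}
    (ha : ∀ i, a i ∈ supp R d {p | p < (κ i).length}) :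
    I R d (shufML R d s ℓ (fun i => Finsupp.single (κ i) (a i)) 1)
      = shufML R d s ℓ (fun i => I R d (Finsupp.single (κ i) (a i))) 1 := by
  -- The factors are labelled by disjoint sets `Nat.pair i`.
  let u : Fin ℓ → List Letter := fun i => coreWord (Nat.pair i) (κ i)
  have hu : ∀ i, IsCoreWord (u i) := fun i => isCoreWord_coreWord (pair_injOn _ _)
  have hL : ∀ i i' x, x ∈ labels (u i) → x ∈ labels (u i') → i = i' := by
    intro i i' x h h'
    obtain ⟨p, -, rfl⟩ := mem_labels_coreWord.1 h
    obtain ⟨q, -, h⟩ := mem_labels_coreWord.1 h'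
    exact Fin.ext (Nat.pair_eq_pair.1 h).1.symm
  have ha' : ∀ i, relabel R d (Nat.pair i) (a i) ∈ supp R d {x | x ∈ labels (u i)} := fun i => by
    have : {x | x ∈ labels (u i)} = {y | ∃ p < (κ i).length, Nat.pair i p = y} :=
      Set.ext fun y => mem_labels_coreWord
    rw [this]
    exact relabel_coreWord (ha i)
  rw [shufML_single_eq s κ ha, I_Phi (S := {x | x ∈ labels (List.ofFn u).flatten}),
    expand_compat.zin_nest]
  · have e : (fun i => I R d (Finsupp.single (κ i) (a i)))
        = fun i : Fin ℓ => Phi R d (IWord R d (u i)) (relabel R d (Nat.pair i) (a i)) :=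
      funext fun i => I_single (pair_injOn _ _) (ha i)
    rw [e, shufML_Phi (L := fun i => {x | x ∈ labels (u i)}) (n := fun i => blockDeg d (κ i))
      (S := ∅) (r := id) s hL (by simp) (fun i => ?_) ha' (one_mem _)]
    · simp only [zinL_wd, map_one, mul_one, u]
    · have h1 := IWord_expandsTo (R := R) (d := d) (hu i)
      have h2 := expand_compat (R := R) (d := d).homog (u i)
      rw [wdeg_coreWord] at h2
      refine wordsIn_mono (fun v hv => ⟨hv.1.adm, hv.2, fun h => h.elim⟩) (wordsIn_and h1 h2)
  · refine wordsIn_mono (fun w hw => ⟨(isCoreWord_flatten hu hL).perm hw.symm, fun x hx => ?_⟩)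
      (nest_perm (deg d) s u)
    exact (labels_perm hw).2 hx
  · refine prod_ofFn_mem_supp fun i => par_mem_supp _ (supp_mono (fun x hx => ?_) (ha' i))
    obtain ⟨l, hl, e⟩ := mem_labels.1 hx
    exact mem_labels.2 ⟨l, List.mem_flatten.2 ⟨_, List.mem_ofFn.2 ⟨i, rfl⟩, hl⟩, e⟩

/-- The map `I` is compatible with products and divided products at the same time: both are
iterated shuffles and half-shuffles of words. -/
theorem I_shufML (s : ℕ) {A : Fin ℓ → Space R d} (hA : ∀ i, A i ∈ GSpace R d) :
    I R d (shufML R d s ℓ A 1) = shufML R d s ℓ (fun i => I R d (A i)) 1 := by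
  refine multilinear_eq_of_mem_span
    (f := ((I R d).comp (LinearMap.applyₗ 1)).compMultilinearMap (shufML R d s ℓ))
    (g := (LinearMap.applyₗ (1 : Alg R d)).compMultilinearMap
      ((shufML R d s ℓ).compLinearMap fun _ => I R d)) (fun v hv => ?_) hA
  choose κ a ha h using hv
  obtain rfl : (fun i => Finsupp.single (κ i) (a i)) = v := funext h
  exact I_shufML_single s κ ha

theorem I_dividedProduct {A : Fin ℓ → Space R d} (hA : ∀ i, A i ∈ GSpace R d) :
    I R d (dividedProduct R d A) = dividedProduct R d fun i => I R d (A i) := by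
  rw [dividedProduct_eq, dividedProduct_eq, I_shufML 0 hA]

theorem I_mul {A B : Space R d} (hA : A ∈ GSpace R d) (hB : B ∈ GSpace R d) :
    I R d (mul R d A B) = mul R d (I R d A) (I R d B) := by
  rw [mul_eq, mul_eq, I_shufML 2 (by intro i; fin_cases i; exacts [hA, hB])]
  congr 2
  funext i
  fin_cases i <;> rfl

end

section

open Letter

variable {R : Type*} [CommRing R] {d ℓ : ℕ}

/-! ### Unit and counit -/

theorem I_unit : I R d (unit R d) = unit R d := by
  rw [unit, I_single (x := id) (fun _ _ _ _ h => h) (one_mem _), coreWord_nil, map_one]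
  simp [zin, phi_apply, algOf]

@[simp] theorem aug_gen (x : Gen) : aug R d (gen R d x) = 0 := lift_gen R d _ _ x

theorem aug_relabel (f : ℕ → ℕ) (a : Alg R d) : aug R d (relabel R d f a) = aug R d a := by
  have : (aug R d).comp (relabel R d f) = aug R d := by
    apply alg_hom_ext
    intro x
    rw [AlgHom.comp_apply, relabel_gen, aug_gen, aug_gen]
  exact DFunLike.congr_fun this a

theorem counit_single (k : List ℕ) (a : Alg R d) :
    counit R d (Finsupp.single k a) = if k = [] then aug R d a else 0 := by
  simp only [counit, LinearMap.comp_apply, Finsupp.lapply_apply, Finsupp.single_apply]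
  split_ifs <;> simp

theorem ExpandsTo.ne_nil {w v : List Letter} (h : ExpandsTo w v) (hw : w ≠ []) : v ≠ [] := by
  cases h with
  | nil => exact hw
  | core _ _ hp =>
    rintro rfl
    simpa using hp.length_eq

/-- Only the empty diagram contributes to the counit, and `I` preserves it, while words with points
have values with points. -/
theorem counit_I {A : Space R d} (hA : A ∈ GSpace R d) : counit R d (I R d A) = counit R d A := by
  refine LinearMap.eqOn_span (f := (counit R d).comp (I R d)) (g := counit R d) ?_ hA
  rintro _ ⟨k, b, hb, rfl⟩
  rw [LinearMap.comp_apply, I_single (x := id) (fun _ _ _ _ h => h) hb, counit_single]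
  split_ifs with hk
  · subst hk
    simp [zin, phi_apply, algOf, counit_single, aug_relabel]
  · have := eqOn_wordsIn (f := (counit R d).comp ((Phi R d).flip (relabel R d id b))) (g := 0)
      (fun v hv => ?_) (IWord_expandsTo (R := R) (d := d) (isCoreWord_coreWord (x := id) (k := k)
        fun _ _ _ _ h => h))
    · exact this
    · have hne := ExpandsTo.ne_nil hv (by rw [ne_eq, ← List.length_eq_zero_iff]; simpa using hk)
      rw [LinearMap.comp_apply, LinearMap.flip_apply, Phi_wd, phi_apply, counit_single,
        if_neg (by simpa using hne)]
      rfl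

/-! ### Cutting of words -/

/-- The sum over all cuts of a word, where those are omitted for which the right part contains a
point which is joined to a point of the left part or to a point whose label is in `B`. -/
def cutWord (R : Type*) [CommRing R] : Set ℕ → List Letter → Words R Letter ⊗[R] Words R Letter
  | _, [] => wd R [] ⊗ₜ wd R []
  | B, l :: w => (open Classical in if ∃ y ∈ B, leaf y ∈ l :: w then 0 else wd R [] ⊗ₜ wd R (l :: w))
      + (cons l).rTensor _ (cutWord R {x | x ∈ B ∨ l.label = some x} w)

/-- The linear extension of `cutWord`. -/
def cutWordL (R : Type*) [CommRing R] (B : Set ℕ) :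
    Words R Letter →ₗ[R] Words R Letter ⊗[R] Words R Letter := onWords (cutWord R B)

theorem cutWordL_cons_of_mem {B : Set ℕ} {y : ℕ} (hy : y ∈ B) (l : Letter) {m : Words R Letter}
    (hm : m ∈ wordsIn R fun w => leaf y ∈ l :: w) : cutWordL R B (cons l m)
      = (cons l).rTensor _ (cutWordL R {x | x ∈ B ∨ l.label = some x} m) := by
  refine eqOn_wordsIn (f := (cutWordL R B).comp (cons l))
    (g := ((cons l).rTensor _).comp (cutWordL R {x | x ∈ B ∨ l.label = some x})) (fun w hw => ?_) hm
  simp only [LinearMap.comp_apply, cons_wd, cutWordL, onWords_wd]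
  rw [cutWord, if_pos ⟨y, hy, hw⟩, zero_add]

theorem cutWordL_cons_of_notMem {B : Set ℕ} (l : Letter) {m : Words R Letter}
    (hm : m ∈ wordsIn R fun w => ∀ y ∈ B, leaf y ∉ l :: w) : cutWordL R B (cons l m)
      = wd R [] ⊗ₜ cons l m
        + (cons l).rTensor _ (cutWordL R {x | x ∈ B ∨ l.label = some x} m) := by
  refine eqOn_wordsIn (f := (cutWordL R B).comp (cons l)) (g := (TensorProduct.mk R _ _ (wd R [])).comp
    (cons l) + ((cons l).rTensor _).comp (cutWordL R {x | x ∈ B ∨ l.label = some x}))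
    (fun w hw => ?_) hm
  simp only [LinearMap.comp_apply, cons_wd, cutWordL, onWords_wd, LinearMap.add_apply,
    TensorProduct.mk_apply]
  rw [cutWord, if_neg (by push Not; exact hw)]

theorem mem_wordsIn_of_forall {V : Type*} {P : List V → Prop} (h : ∀ w, P w) (m : Words R V) :
    m ∈ wordsIn R P :=
  (Finsupp.mem_supported R m).2 fun _ _ => h _

theorem cutWord_replicate {B : Set ℕ} {y : ℕ} (hy : y ∈ B) (i : ℕ) :
    cutWord R B (List.replicate i (leaf y)) = wd R (List.replicate i (leaf y)) ⊗ₜ wd R [] := by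
  induction i with
  | zero => rfl
  | succ i ih =>
    have hB : {x | x ∈ B ∨ (leaf y).label = some x} = B := by simp [label]
    rw [List.replicate_succ, cutWord, if_pos ⟨y, hy, List.mem_cons_self⟩, hB, ih, zero_add]
    simp

/-- Points joined to a point left of the cut have to be left of the cut. -/
theorem cutWord_replicate_sh {B : Set ℕ} {y : ℕ} (hy : y ∈ B) (i : ℕ) (w : List Letter) :
    cutWordL R B (sh (deg d) (wd R (List.replicate i (leaf y))) (wd R w))
      = (sh (deg d) (wd R (List.replicate i (leaf y)))).rTensor _ (cutWord R B w) := by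
  induction hn : i + w.length using Nat.strong_induction_on generalizing i w B with
  | _ n ih =>
  match i, w with
  | 0, w =>
    have : sh (deg d) (wd R (List.replicate 0 (leaf y))) = LinearMap.id := by
      ext1 m; exact one_sh _ m
    rw [this, LinearMap.rTensor_id, LinearMap.id_apply, LinearMap.id_apply, cutWordL, onWords_wd]
  | i + 1, [] =>
    rw [sh_one, cutWordL, onWords_wd, cutWord_replicate hy]
    simp [cutWord]
  | i + 1, z :: w =>
    have h1 := ih _ (by simp at hn ⊢; omega) hy i (z :: w) rfl
    have h2 := ih _ (by simp at hn ⊢; omega) (show y ∈ {x | x ∈ B ∨ z.label = some x} from Or.inl hy)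
      (i + 1) w rfl
    have hB : {x | x ∈ B ∨ (leaf y).label = some x} = B := by simp [label]
    have hmem : sh (deg d) (wd R (List.replicate (i + 1) (leaf y))) (wd R w)
        ∈ wordsIn R fun v => leaf y ∈ z :: v := by
      refine sh_mem (deg d) (P := fun u => u = List.replicate (i + 1) (leaf y)) (Q := fun _ => True)
        ?_ (wd_mem rfl) (wd_mem trivial)
      rintro _ v rfl - v' hv'
      refine List.mem_cons_of_mem _ (hv'.mem_iff.2 ?_)
      simp [List.replicate_succ]
    rw [← cons_wd z w, replicate_sh_cons, map_add, map_smul,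
      cutWordL_cons_of_mem hy (leaf y) (m := sh _ _ _)
        (mem_wordsIn_of_forall (fun _ => List.mem_cons_self) _), hB, cons_wd, h1,
      cutWordL_cons_of_mem hy z hmem, h2, cutWord]
    have e1 : ∀ t : Words R Letter ⊗[R] Words R Letter,
        (sh (deg d) (wd R (List.replicate (i + 1) (leaf y)))).rTensor _ ((cons z).rTensor _ t)
        = (cons (leaf y)).rTensor _ ((sh (deg d) (wd R (List.replicate i (leaf y)))).rTensor _
            ((cons z).rTensor _ t))
          + (-1 : R) ^ (deg d z * ((i + 1) * deg d (leaf y))) • (cons z).rTensor _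
            ((sh (deg d) (wd R (List.replicate (i + 1) (leaf y)))).rTensor _ t) := by
      intro t
      induction t using TensorProduct.induction_on with
      | zero => simp
      | tmul a b =>
        simp only [LinearMap.rTensor_tmul, replicate_sh_cons, TensorProduct.add_tmul,
          TensorProduct.smul_tmul']
      | add a b ha hb => simp only [map_add, ha, hb, smul_add]; abel
    simp only [map_add]
    rw [e1, ← add_assoc]
    congr 2
    split_ifs
    · simp
    · simp [List.replicate_succ]

theorem cutWord_replicate_shL {B : Set ℕ} {y : ℕ} (hy : y ∈ B) (i : ℕ) (m : Words R Letter) :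
    cutWordL R B (sh (deg d) (wd R (List.replicate i (leaf y))) m)
      = (sh (deg d) (wd R (List.replicate i (leaf y)))).rTensor _ (cutWordL R B m) :=
  DFunLike.congr_fun (words_ext (f := (cutWordL R B).comp (sh (deg d) (wd R (List.replicate i (leaf y)))))
    (g := ((sh (deg d) (wd R (List.replicate i (leaf y)))).rTensor _).comp (cutWordL R B)) fun w => by
      rw [LinearMap.comp_apply, LinearMap.comp_apply, cutWord_replicate_sh hy, cutWordL, onWords_wd]) m

/-- The map `I` commutes with cuts, on the level of words. -/
theorem cutWordL_IWord {w : List Letter} (hw : IsCoreWord w) {B : Set ℕ}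
    (hB : ∀ x ∈ labels w, x ∉ B) : cutWordL R B (IWord R d w)
      = TensorProduct.map (IWordL R d) (IWordL R d) (cutWord R B w) := by
  induction w generalizing B with
  | nil => simp [cutWordL, zin, onWords_wd, cutWord]
  | cons l w ih =>
    have hE := IWord_expandsTo (R := R) (d := d) hw
    obtain ⟨x, k, rfl, hx, hw'⟩ := hw.of_cons
    rw [labels_core_cons] at hB
    have hB' : ∀ z ∈ labels w, z ∉ {z | z ∈ B ∨ (core x k).label = some z} := by
      rintro z hz (h | h)
      · exact hB z (List.mem_cons_of_mem _ hz) h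
      · simp only [label, Option.some.injEq] at h
        exact hx (h ▸ hz)
    have hnl : ¬ ∃ y ∈ B, leaf y ∈ core x k :: w := by
      rintro ⟨y, hy, h⟩
      obtain ⟨z, j, hz⟩ := hw.1 _ h
      cases hz
    have hmem : ∀ i, sh (deg d) (wd R (List.replicate i (leaf x))) (IWord R d w)
        ∈ wordsIn R fun v => ∀ y ∈ B, leaf y ∉ core x (k - i) :: v := by
      intro i
      refine sh_mem (deg d) (P := fun u => u = List.replicate i (leaf x)) ?_ (wd_mem rfl)
        (IWord_expandsTo hw')
      rintro _ v rfl hv v' hp y hy h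
      simp only [List.mem_cons, reduceCtorEq, false_or] at h
      rcases List.mem_append.1 (hp.mem_iff.1 h) with h | h
      · have := (List.mem_replicate.1 h).2
        simp only [leaf.injEq] at this
        exact hB x List.mem_cons_self (this ▸ hy)
      · exact hB y (List.mem_cons_of_mem _ (hv.leaf h)) hy
    have hI : zin (deg d) (expand R) (core x k :: w) = ∑ i ∈ Finset.range (k + 1), cons (core x (k - i))
        (sh (deg d) (wd R (List.replicate i (leaf x))) (IWord R d w)) := by
      rw [zin, expand, map_sum, LinearMap.sum_apply]
      exact Finset.sum_congr rfl fun i _ => hs_wd_cons _ _ _ _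
    change cutWordL R B (zin (deg d) (expand R) (core x k :: w)) = _
    rw [cutWord, if_neg hnl, map_add, TensorProduct.map_tmul, zinL_wd, zinL_wd, hI, map_sum,
      TensorProduct.tmul_sum, Finset.sum_congr rfl fun i _ => cutWordL_cons_of_notMem _ (hmem i),
      Finset.sum_add_distrib]
    congr 1
    have hl : ∀ i, {z | z ∈ B ∨ (core x (k - i)).label = some z}
        = {z | z ∈ B ∨ (core x k).label = some z} := fun i => rfl
    simp only [hl, cutWord_replicate_shL (show x ∈ {z | z ∈ B ∨ (core x k).label = some z} from
      Or.inr rfl), ih hw' hB']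
    generalize cutWord R {z | z ∈ B ∨ (core x k).label = some z} w = t
    induction t using TensorProduct.induction_on with
    | zero => simp
    | tmul a b =>
      simp only [LinearMap.rTensor_tmul, TensorProduct.map_tmul, zinL_cons, expand, map_sum,
        LinearMap.sum_apply, ← cons_wd, hs_cons, TensorProduct.sum_tmul]
    | add a b ha hb => simp only [map_add, Finset.sum_add_distrib, ha, hb]

end

section

open Letter

variable {R : Type*} [CommRing R] {d ℓ : ℕ}

/-! ### The coproduct on words -/

/-- The action of the algebra of letters on its tensor square which underlies `cut`. -/
def cutAct (R : Type*) [CommRing R] (d p : ℕ) : Alg R d →ₐ[R] Module.End R (Alg R d ⊗[R] Alg R d) :=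
  lift R d _ (compat_cut R d p)

theorem cutAct_gen (p : ℕ) (x : Gen) : cutAct R d p (gen R d x) = cutGen R d p x :=
  lift_gen R d _ _ x

theorem cut_eq (p : ℕ) (a : Alg R d) : cut R d p a = cutAct R d p a (1 ⊗ₜ 1) := rfl

theorem cut_mul (p : ℕ) (a b : Alg R d) : cut R d p (a * b) = cutAct R d p a (cut R d p b) := by
  rw [cut_eq, map_mul]; rfl

theorem supp_induction {S : Set ℕ} {p : Alg R d → Prop} (hr : ∀ r : R, p (algebraMap R _ r))
    (hg : ∀ x : Gen, x.InSet S → p (gen R d x)) (hm : ∀ a b, p a → p b → p (a * b))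
    (ha : ∀ a b, p a → p b → p (a + b)) {a : Alg R d} (h : a ∈ supp R d S) : p a := by
  induction h using Algebra.adjoin_induction with
  | mem x hx => obtain ⟨g, hg', rfl⟩ := hx; exact hg g hg'
  | algebraMap r => exact hr r
  | add a b _ _ h1 h2 => exact ha a b h1 h2
  | mul a b _ _ h1 h2 => exact hm a b h1 h2

/-- Cuts are compatible with renumberings which respect the two sides of the cut. -/
theorem cutAct_relabel {S : Set ℕ} {p P : ℕ} {h h₁ h₂ : ℕ → ℕ}
    (H₁ : ∀ y ∈ S, y < P → h y < p ∧ h₁ y = h y)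
    (H₂ : ∀ y ∈ S, P ≤ y → p ≤ h y ∧ h₂ (y - P) = h y - p) {a : Alg R d} (ha : a ∈ supp R d S)
    (t : Alg R d ⊗[R] Alg R d) :
    cutAct R d p (relabel R d h a)
        (TensorProduct.map (relabel R d h₁).toLinearMap (relabel R d h₂).toLinearMap t)
      = TensorProduct.map (relabel R d h₁).toLinearMap (relabel R d h₂).toLinearMap
        (cutAct R d P a t) := by
  refine supp_induction (p := fun a => ∀ t, cutAct R d p (relabel R d h a)
        (TensorProduct.map (relabel R d h₁).toLinearMap (relabel R d h₂).toLinearMap t)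
      = TensorProduct.map (relabel R d h₁).toLinearMap (relabel R d h₂).toLinearMap
        (cutAct R d P a t)) ?_ ?_ ?_ ?_ ha t
  · intro r t
    simp [Module.algebraMap_end_apply]
  · intro x hx t
    rw [relabel_gen, cutAct_gen, cutAct_gen]
    have hlt : ∀ y ∈ S, (h y < p ↔ y < P) := fun y hy =>
      ⟨fun hp => by
        by_contra hP
        exact absurd (H₂ y hy (not_lt.1 hP)).1 (not_le.2 hp), fun hP => (H₁ y hy hP).1⟩
    have hge : ∀ y ∈ S, (p ≤ h y ↔ P ≤ y) := fun y hy => by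
      rw [← not_lt, ← not_lt, hlt y hy]
    have L : ∀ g g' : Gen, relabel R d h₁ (gen R d g) = gen R d g' →
        TensorProduct.map (LinearMap.mulLeft R (gen R d g')) LinearMap.id
          (TensorProduct.map (relabel R d h₁).toLinearMap (relabel R d h₂).toLinearMap t)
        = TensorProduct.map (relabel R d h₁).toLinearMap (relabel R d h₂).toLinearMap
          (TensorProduct.map (LinearMap.mulLeft R (gen R d g)) LinearMap.id t) := by
      intro g g' e
      induction t using TensorProduct.induction_on with
      | zero => simp
      | tmul a b => simp only [TensorProduct.map_tmul, LinearMap.mulLeft_apply, LinearMap.id_apply,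
          AlgHom.toLinearMap_apply, map_mul, e]
      | add a b ha hb => simp only [map_add, ha, hb]
    have Q : ∀ g g' : Gen, relabel R d h₂ (gen R d g) = gen R d g' →
        TensorProduct.map (parity R d).toLinearMap (LinearMap.mulLeft R (gen R d g'))
          (TensorProduct.map (relabel R d h₁).toLinearMap (relabel R d h₂).toLinearMap t)
        = TensorProduct.map (relabel R d h₁).toLinearMap (relabel R d h₂).toLinearMap
          (TensorProduct.map (parity R d).toLinearMap (LinearMap.mulLeft R (gen R d g)) t) := by
      intro g g' e
      clear L
      induction t using TensorProduct.induction_on with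
      | zero => simp
      | tmul a b => simp only [TensorProduct.map_tmul, LinearMap.mulLeft_apply,
          AlgHom.toLinearMap_apply, map_mul, e, parity_eq_par, relabel_par]
      | add a b ha hb => simp only [map_add, ha, hb]
    cases x with
    | star y =>
      simp only [relabelGen, cutGen, hlt y hx]
      split_ifs with hy
      · exact L _ _ (by rw [relabel_gen, relabelGen, (H₁ y hx hy).2])
      · exact Q _ _ (by rw [relabel_gen, relabelGen, (H₂ y hx (not_lt.1 hy)).2])
    | chord y z =>
      simp only [relabelGen, cutGen, hlt y hx.1, hlt z hx.2, hge y hx.1, hge z hx.2]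
      split_ifs with h1 h2
      · exact L _ _ (by rw [relabel_gen, relabelGen, (H₁ y hx.1 h1.1).2, (H₁ z hx.2 h1.2).2])
      · exact Q _ _ (by rw [relabel_gen, relabelGen, (H₂ y hx.1 h2.1).2, (H₂ z hx.2 h2.2).2])
      · simp
  · intro a b iha ihb t
    rw [map_mul, map_mul, map_mul, Module.End.mul_apply, Module.End.mul_apply, ihb, iha]
  · intro a b iha ihb t
    rw [map_add, map_add, map_add, LinearMap.add_apply, LinearMap.add_apply, iha, ihb, map_add]

theorem cut_relabel {S : Set ℕ} {p P : ℕ} {h h₁ h₂ : ℕ → ℕ}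
    (H₁ : ∀ y ∈ S, y < P → h y < p ∧ h₁ y = h y)
    (H₂ : ∀ y ∈ S, P ≤ y → p ≤ h y ∧ h₂ (y - P) = h y - p) {a : Alg R d} (ha : a ∈ supp R d S) :
    cut R d p (relabel R d h a)
      = TensorProduct.map (relabel R d h₁).toLinearMap (relabel R d h₂).toLinearMap (cut R d P a) := by
  have := cutAct_relabel H₁ H₂ ha (1 ⊗ₜ 1)
  rw [cut_eq, cut_eq]
  simpa only [TensorProduct.map_tmul, AlgHom.toLinearMap_apply, map_one] using this

/-- Letters on points before the cut act on the left-hand factor. -/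
theorem cutAct_of_mem_supp {p : ℕ} {a : Alg R d} (ha : a ∈ supp R d {q | q < p}) :
    cutAct R d p a = TensorProduct.map (LinearMap.mulLeft R a) LinearMap.id := by
  refine supp_induction (p := fun a => cutAct R d p a = TensorProduct.map (LinearMap.mulLeft R a)
    LinearMap.id) ?_ ?_ ?_ ?_ ha
  · intro r
    ext a b
    simp [Module.algebraMap_end_apply, Algebra.smul_def]
  · intro x hx
    rw [cutAct_gen]
    cases x with
    | star y => rw [cutGen, if_pos (show y < p from hx)]
    | chord y z => rw [cutGen, if_pos (show y < p ∧ z < p from hx)]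
  · intro a b iha ihb
    rw [map_mul, iha, ihb]
    ext x y
    simp
  · intro a b iha ihb
    rw [map_add, iha, ihb]
    ext x y
    simp [add_mul, TensorProduct.add_tmul]

theorem algOf_append (f : ℕ → ℕ) (n : ℕ) (v w : List Letter) : algOf R d f n (v ++ w)
    = par R d (wdeg (tdeg d) w) (algOf R d f n v) * algOf R d f (n + v.length) w := by
  induction v generalizing n with
  | nil => simp [algOf]
  | cons l v ih =>
    rw [List.cons_append, algOf, ih, algOf, map_mul, ← par_add, wdeg_append, mul_assoc,
      List.length_cons, add_comm (wdeg _ v), add_assoc n, add_comm 1]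

theorem algOf_congr {f f' : ℕ → ℕ} {w : List Letter} (h : ∀ x, leaf x ∈ w → f x = f' x) (n : ℕ) :
    algOf R d f n w = algOf R d f' n w := by
  induction w generalizing n with
  | nil => rfl
  | cons l w ih =>
    rw [algOf, algOf, ih fun x hx => h x (List.mem_cons_of_mem _ hx)]
    congr 2
    cases l with
    | leaf x => rw [fac, fac, h x List.mem_cons_self]
    | _ => rfl

theorem algOf_mem_supp {f : ℕ → ℕ} {n N : ℕ} {w : List Letter} (h : ∀ x, leaf x ∈ w → f x < N)
    (hn : n + w.length ≤ N) : algOf R d f n w ∈ supp R d {q | q < N} := by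
  induction w generalizing n with
  | nil => exact one_mem _
  | cons l w ih =>
    rw [List.length_cons] at hn
    refine mul_mem (par_mem_supp _ ?_) (ih (fun x hx => h x (List.mem_cons_of_mem _ hx)) (by omega))
    cases l with
    | core => exact one_mem _
    | star => exact gen_mem_supp (show n < N by omega)
    | leaf x => exact Subalgebra.smul_mem _ (gen_mem_supp (g := Gen.chord (f x) n)
        ⟨h x List.mem_cons_self, show n < N by omega⟩) _
    | _ => exact zero_mem _

theorem par_succ_d : par R d (d + 1) = par R d 1 := by
  apply alg_hom_ext
  intro x
  rw [par_gen, par_gen, sign_congr]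
  simp [Nat.even_mul]

/-- The letters right of a cut. -/
theorem cutAct_algOf {f f' : ℕ → ℕ} {p n : ℕ} {w : List Letter}
    (h : ∀ x, leaf x ∈ w → f x = p + f' x) : cutAct R d p (algOf R d f (p + n) w)
      = TensorProduct.map (par R d (wdeg (bdeg d) w)).toLinearMap
        (LinearMap.mulLeft R (algOf R d f' n w)) := by
  induction w generalizing n with
  | nil =>
    rw [algOf, algOf, map_one]
    ext x y
    simp
  | cons l w ih =>
    have hfac : ∀ k, cutAct R d p (par R d k (fac R d f (p + n) l))
        = TensorProduct.map (par R d (bdeg d l)).toLinearMap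
          (LinearMap.mulLeft R (par R d k (fac R d f' n l))) := by
      intro k
      cases l with
      | core x t =>
        simp only [fac, map_one, bdeg]
        ext x y
        simp
      | star x t =>
        simp only [fac, par_gen, map_smul, cutAct_gen, cutGen]
        rw [if_neg (by omega), Nat.add_sub_cancel_left, parity_eq_par, bdeg, ← par_succ_d]
        ext x y
        simp
      | leaf x =>
        simp only [fac, par_gen, map_smul, cutAct_gen, cutGen, h x List.mem_cons_self]
        rw [if_neg (by omega), if_pos (by omega), Nat.add_sub_cancel_left, Nat.add_sub_cancel_left, parity_eq_par, bdeg, ← par_succ_d]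
        ext x y
        simp
      | _ =>
        simp only [fac, map_zero, LinearMap.mulLeft_zero_eq_zero, TensorProduct.map_zero_right]
    rw [algOf, map_mul, hfac, add_assoc, ih fun x hx => h x (List.mem_cons_of_mem _ hx)]
    ext x y
    simp [algOf, par_add]

/-- A chord that joins a leaf after the cut to a point before it is cut. -/
theorem cutAct_algOf_eq_zero {f : ℕ → ℕ} {p n x : ℕ} {w : List Letter} (hx : leaf x ∈ w)
    (h : f x < p) (hn : p ≤ n) : cutAct R d p (algOf R d f n w) = 0 := by
  induction w generalizing n with
  | nil => simp at hx
  | cons l w ih =>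
    rw [algOf, map_mul]
    rcases List.mem_cons.1 hx with rfl | hx
    · rw [fac, map_smul, par_gen, map_smul, map_smul, cutAct_gen, cutGen, if_neg (by omega),
        if_neg (by omega), smul_zero, smul_zero, zero_mul]
    · rw [ih hx (by omega), mul_zero]

/-- All points without label are joined to points further left or to points with labels in `B`. -/
def Ordered : Set ℕ → List Letter → Prop
  | _, [] => True
  | B, l :: w => (∀ y, l = leaf y → y ∈ B) ∧ Ordered {x | x ∈ B ∨ l.label = some x} w

theorem ordered_replicate {B : Set ℕ} {y : ℕ} (hy : y ∈ B) (i : ℕ) :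
    Ordered B (List.replicate i (leaf y)) := by
  induction i with
  | zero => trivial
  | succ i ih =>
    have hB : {x | x ∈ B ∨ (leaf y).label = some x} = B := by simp [label]
    rw [List.replicate_succ, Ordered, hB]
    refine ⟨fun z hz => ?_, ih⟩
    cases hz
    exact hy

/-- New points may be shuffled into an ordered word if the points they are joined to come before.
-/
theorem ordered_replicate_sh {B : Set ℕ} {y : ℕ} (hy : y ∈ B) (i : ℕ) {w : List Letter}
    (hw : Ordered B w) :
    sh (deg d) (wd R (List.replicate i (leaf y))) (wd R w) ∈ wordsIn R (Ordered B) := by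
  induction hn : i + w.length using Nat.strong_induction_on generalizing i w B with
  | _ n ih =>
  match i, w with
  | 0, w => simpa using wd_mem hw
  | i + 1, [] => simpa using wd_mem (ordered_replicate hy _)
  | i + 1, z :: w =>
    have h1 := ih _ (by simp at hn ⊢; omega) hy i hw rfl
    have h2 := ih _ (by simp at hn ⊢; omega) (show y ∈ {x | x ∈ B ∨ z.label = some x} from Or.inl hy)
      (i + 1) hw.2 rfl
    have hB : {x | x ∈ B ∨ (leaf y).label = some x} = B := by simp [label]
    rw [← cons_wd z w, replicate_sh_cons, cons_wd]
    refine add_mem (cons_mem _ (fun v hv => ?_) h1)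
      (Submodule.smul_mem _ _ (cons_mem _ (fun v hv => ⟨hw.1, hv⟩) h2))
    rw [Ordered, hB]
    refine ⟨fun z hz => ?_, hv⟩
    cases hz
    exact hy

/-- In the values of `I`, the new points stand behind the points which they are joined to. -/
theorem IWord_ordered {w : List Letter} (hw : IsCoreWord w) (B : Set ℕ) :
    IWord R d w ∈ wordsIn R (Ordered B) := by
  induction w generalizing B with
  | nil => exact wd_mem trivial
  | cons l w ih =>
    obtain ⟨x, k, rfl, -, hw'⟩ := hw.of_cons
    rw [IWord, zin, expand, map_sum, LinearMap.sum_apply]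
    refine Submodule.sum_mem _ fun i _ => ?_
    rw [hs_wd_cons]
    refine cons_mem (P := Ordered {y | y ∈ B ∨ y = x}) _ (fun v hv => ⟨by simp, ?_⟩)
      (map_mem_wordsIn (fun v hv => ordered_replicate_sh (Or.inr rfl) i hv) (ih hw' _))
    convert hv using 3
    simp [label, eq_comm]

theorem Ordered.mem_take {B : Set ℕ} {w : List Letter} (h : Ordered B w) (p : ℕ) {y : ℕ}
    (hy : leaf y ∈ w.take p) : y ∈ B ∨ y ∈ labels (w.take p) := by
  induction w generalizing B p with
  | nil => simp at hy
  | cons l w ih =>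
    cases p with
    | zero => simp at hy
    | succ p =>
      rw [List.take_succ_cons] at hy ⊢
      rcases List.mem_cons.1 hy with rfl | hy
      · exact Or.inl (h.1 y rfl)
      · rcases ih h.2 p hy with (h | h) | h
        · exact Or.inl h
        · exact Or.inr (mem_labels.2 ⟨l, List.mem_cons_self, h⟩)
        · obtain ⟨l', h1, h2⟩ := mem_labels.1 h
          exact Or.inr (mem_labels.2 ⟨l', List.mem_cons_of_mem _ h1, h2⟩)

open Classical in
/-- The terms of `cutWord` are the cuts of the word that do not separate a leaf from an earlier
point it is joined to. -/
theorem cutWord_eq_sum (B : Set ℕ) (w : List Letter) : cutWord R B w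
    = ∑ p ∈ Finset.range (w.length + 1),
      if ∃ y, (y ∈ B ∨ y ∈ labels (w.take p)) ∧ leaf y ∈ w.drop p then 0
        else wd R (w.take p) ⊗ₜ wd R (w.drop p) := by
  induction w generalizing B with
  | nil => simp [cutWord]
  | cons l w ih =>
    rw [cutWord, ih, List.length_cons, Finset.sum_range_succ' _ (w.length + 1), add_comm, map_sum]
    congr 1
    · refine Finset.sum_congr rfl fun p _ => ?_
      have e : ∀ y, ((y ∈ {x | x ∈ B ∨ l.label = some x} ∨ y ∈ labels (w.take p)) ∧ leaf y ∈ w.drop p)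
          ↔ ((y ∈ B ∨ y ∈ labels ((l :: w).take (p + 1))) ∧ leaf y ∈ (l :: w).drop (p + 1)) := by
        intro y
        rw [List.take_succ_cons, List.drop_succ_cons, mem_labels, mem_labels]
        simp only [Set.mem_ofPred_eq, List.mem_cons, exists_eq_or_imp, or_assoc]
      simp only [e]
      split_ifs
      · simp
      · simp
    · simp [labels]

/-- The bilinear map on pairs of words which corresponds to the coproduct of diagrams with letters
`a`; the labels are assumed to be less than `P`. -/
def cutPhi (R : Type*) [CommRing R] (d P : ℕ) (a : Alg R d) :
    Words R Letter ⊗[R] Words R Letter →ₗ[R] Space R d ⊗[R] Space R d :=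
  open Classical in
  TensorProduct.lift (onWords fun v => onWords fun z =>
    TensorProduct.map (phi R d v ∘ₗ (par R d (wdeg (deg d) z)).toLinearMap) (phi R d z)
      (cut R d P (relabel R d (fun x => if x ∈ labels v then x else x + P) a)))

open Classical in
theorem cutPhi_tmul (P : ℕ) (a : Alg R d) (v z : List Letter) :
    cutPhi R d P a (wd R v ⊗ₜ wd R z) =
    TensorProduct.map (phi R d v ∘ₗ (par R d (wdeg (deg d) z)).toLinearMap) (phi R d z)
      (cut R d P (relabel R d (fun x => if x ∈ labels v then x else x + P) a)) := by
  rw [cutPhi, TensorProduct.lift.tmul, onWords_wd, onWords_wd]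

theorem comul_single (k : List ℕ) (a : Alg R d) : comul R d (Finsupp.single k a)
    = ∑ p ∈ Finset.range (k.length + 1),
      TensorProduct.map (Finsupp.lsingle (k.take p) ∘ₗ (par R d (blockDeg d (k.drop p))).toLinearMap)
        (Finsupp.lsingle (k.drop p)) (cut R d p a) := by
  simp [comul, parity_pow]

theorem coreIdx_append_left {v z : List Letter} {x : ℕ} (h : x ∈ labels v) :
    coreIdx (v ++ z) x = coreIdx v x := by
  rw [coreIdx, List.findIdx_append]
  exact if_pos (coreIdx_lt.2 h)

theorem coreIdx_append_right {v z : List Letter} {x : ℕ} (h : x ∉ labels v) :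
    coreIdx (v ++ z) x = v.length + coreIdx z x := by
  rw [coreIdx, List.findIdx_append]
  exact (if_neg (mt coreIdx_lt.1 h)).trans (add_comm _ _)

/-- The coproduct of a diagram given by a word, in terms of the cuts of the word. -/
theorem comul_phi {w : List Letter} (hw : Ordered ∅ w) {P : ℕ} (hP : ∀ x ∈ labels w, x < P)
    {a : Alg R d} (ha : a ∈ supp R d {x | x ∈ labels w}) :
    comul R d (phi R d w a) = cutPhi R d P a (cutWord R ∅ w) := by
  classical
  rw [phi_apply, comul_single, cutWord_eq_sum, map_sum, List.length_map]
  refine Finset.sum_congr rfl fun p hp => ?_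
  have hp : p ≤ w.length := by have := Finset.mem_range.1 hp; omega
  set v := w.take p with hv
  set z := w.drop p with hz
  have hvz : w = v ++ z := (List.take_append_drop p w).symm
  have hlen : v.length = p := by simp [hv, hp]
  have hlab : ∀ x, x ∈ labels w ↔ x ∈ labels v ∨ x ∈ labels z := fun x => by
    rw [hvz, labels_append, List.mem_append]
  rw [← List.map_take, ← List.map_drop, ← hv, ← hz, blockDeg_map_top, cut_mul]
  have hA : algOf R d (coreIdx w) 0 w = par R d (wdeg (tdeg d) z) (algOf R d (coreIdx w) 0 v)
      * algOf R d (coreIdx w) (p + 0) z := by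
    conv_lhs => rw [show algOf R d (coreIdx w) 0 w = algOf R d (coreIdx w) 0 (v ++ z) by rw [← hvz]]
    rw [algOf_append, zero_add, hlen, add_zero]
  rw [hA, map_mul, Module.End.mul_apply]
  split_ifs with hbad
  -- A chord to a new point crosses the cut, and the term vanishes on both sides.
  · obtain ⟨y, hy, hyz⟩ := hbad
    have hy : y ∈ labels v := hy.resolve_left id
    have : coreIdx w y < p := by
      rw [hvz, coreIdx_append_left hy, ← hlen]
      exact coreIdx_lt.2 hy
    rw [cutAct_algOf_eq_zero hyz this (Nat.le_add_right p 0)]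
    simp
  · have hgood : ∀ y, leaf y ∈ z → y ∉ labels v := fun y hy h => hbad ⟨y, Or.inr h, hy⟩
    have hleft : ∀ x ∈ labels v, coreIdx w x = coreIdx v x := fun x hx => by
      rw [hvz, coreIdx_append_left hx]
    have hright : ∀ x, x ∉ labels v → coreIdx w x = p + coreIdx z x := fun x hx => by
      rw [hvz, coreIdx_append_right hx, hlen]
    have hleafv : ∀ y, leaf y ∈ v → y ∈ labels v := fun y hy => (hw.mem_take p hy).resolve_left id
    -- The labels of points after the cut are shifted by `P`, so that the letters of `a` can be cut
    -- at `P`.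
    set e : ℕ → ℕ := fun x => if x ∈ labels v then x else x + P with he
    have hrel : relabel R d (coreIdx w) a
        = relabel R d (fun y => if y < P then coreIdx v y else p + coreIdx z (y - P))
          (relabel R d e a) := by
      rw [relabel_relabel]
      refine relabel_congr (fun x hx => ?_) ha
      simp only [Function.comp_apply, he]
      by_cases hxv : x ∈ labels v
      · rw [if_pos hxv, if_pos (hP x hx), hleft x hxv]
      · rw [if_neg hxv, if_neg (by omega), hright x hxv, Nat.add_sub_cancel]
    rw [cutPhi_tmul, hrel, cut_relabel (S := e '' {x | x ∈ labels w}) (P := P) (h₁ := coreIdx v)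
      (h₂ := coreIdx z) ?_ ?_ (relabel_mem_supp (T := e '' {x | x ∈ labels w})
        (fun x hx => ⟨x, hx, rfl⟩) ha),
      algOf_congr (f' := coreIdx v) (fun y hy => hleft y (hleafv y hy)),
      cutAct_of_mem_supp (par_mem_supp _ (algOf_mem_supp (N := p)
        (fun y hy => by rw [← hlen]; exact coreIdx_lt.2 (hleafv y hy)) (by omega))),
      cutAct_algOf (n := 0) fun y hy => hright y (hgood y hy)]
    · have hd : wdeg (deg d) z = wdeg (tdeg d) z + wdeg (bdeg d) z := by
        simp only [wdeg, ← List.sum_map_add]; rfl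
      generalize cut R d P (relabel R d e a) = t
      induction t using TensorProduct.induction_on with
      | zero => simp
      | tmul b c =>
        simp only [TensorProduct.map_tmul, LinearMap.comp_apply, AlgHom.toLinearMap_apply,
          LinearMap.mulLeft_apply, LinearMap.id_apply, phi_apply, map_mul, relabel_par, hd, par_add,
          Finsupp.lsingle_apply]
        rw [← par_add, par_congr (n := 0) (by simp), par_zero]
      | add b c hb hc => simp only [map_add, hb, hc]
    · rintro _ ⟨x, hx, rfl⟩ hlt
      have hxv : x ∈ labels v := by
        by_contra h
        simp only [he, if_neg h] at hlt
        omega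
      simp only [he, if_pos hxv, if_pos (hP x hx), and_true]
      rw [← hlen]
      exact coreIdx_lt.2 hxv
    · rintro _ ⟨x, hx, rfl⟩ hge
      have hxv : x ∉ labels v := by
        intro h
        simp only [he, if_pos h] at hge
        exact absurd (hP x hx) (not_lt.2 hge)
      simp only [he, if_neg hxv]
      rw [if_neg (by omega)]
      omega

theorem IsCoreWord.ordered {w : List Letter} (hw : IsCoreWord w) (B : Set ℕ) : Ordered B w := by
  induction w generalizing B with
  | nil => trivial
  | cons l w ih =>
    obtain ⟨x, k, rfl, -, hw'⟩ := hw.of_cons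
    exact ⟨by simp, ih hw' _⟩

open Classical in
/-- The expansion of points by `I` does not change the labels that occur, hence not the way in
which the chords of the diagram are cut. -/
theorem cutPhi_IWord {v : List Letter} (hv : IsCoreWord v) (z : List Letter) (P : ℕ)
    (a : Alg R d) : cutPhi R d P a (IWord R d v ⊗ₜ IWord R d z)
      = TensorProduct.map (Phi R d (IWord R d v) ∘ₗ (par R d (wdeg (deg d) z)).toLinearMap)
        (Phi R d (IWord R d z))
        (cut R d P (relabel R d (fun x => if x ∈ labels v then x else x + P) a)) := by
  refine wordsIn_induction (p := fun m => cutPhi R d P a (m ⊗ₜ IWord R d z)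
      = TensorProduct.map (Phi R d m ∘ₗ (par R d (wdeg (deg d) z)).toLinearMap)
        (Phi R d (IWord R d z))
        (cut R d P (relabel R d (fun x => if x ∈ labels v then x else x + P) a)))
    (IWord_expandsTo (R := R) (d := d) hv) ?_ ?_ ?_ fun v' hv' => ?_
  · simp
  · intro m n hm hn
    rw [TensorProduct.add_tmul, map_add, hm, hn, map_add, LinearMap.add_comp,
      TensorProduct.map_add_left, LinearMap.add_apply]
  · intro r m hm
    rw [← TensorProduct.smul_tmul', map_smul, hm, map_smul, LinearMap.smul_comp,
      TensorProduct.map_smul_left, LinearMap.smul_apply]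
  refine wordsIn_induction (p := fun m => cutPhi R d P a (wd R v' ⊗ₜ m)
      = TensorProduct.map (Phi R d (wd R v') ∘ₗ (par R d (wdeg (deg d) z)).toLinearMap)
        (Phi R d m) (cut R d P (relabel R d (fun x => if x ∈ labels v then x else x + P) a)))
    ((expand_compat (R := R) (d := d)).homog z) ?_ ?_ ?_ fun z' hz' => ?_
  · simp
  · intro m n hm hn
    rw [TensorProduct.tmul_add, map_add, hm, hn, map_add,
      TensorProduct.map_add_right, LinearMap.add_apply]
  · intro r m hm
    rw [TensorProduct.tmul_smul, map_smul, hm, map_smul,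
      TensorProduct.map_smul_right, LinearMap.smul_apply]
  · simp only [cutPhi_tmul, Phi_wd, par_congr hz', hv'.mem_labels_iff]

/-- Cutting a product of letters on points of `S` gives letters on points of `S` on the two sides of
the cut. -/
theorem cut_mem {S : Set ℕ} (P : ℕ) {a : Alg R d} (ha : a ∈ supp R d S) :
    cut R d P a ∈ Submodule.span R {t | ∃ x ∈ supp R d {y | y ∈ S ∧ y < P},
      ∃ z ∈ supp R d {y | y + P ∈ S}, x ⊗ₜ z = t} := by
  set M := Submodule.span R {t | ∃ x ∈ supp R d {y | y ∈ S ∧ y < P},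
      ∃ z ∈ supp R d {y | y + P ∈ S}, x ⊗ₜ[R] z = t} with hM
  have key : ∀ t ∈ M, cutAct R d P a t ∈ M := by
    refine supp_induction (p := fun a => ∀ t ∈ M, cutAct R d P a t ∈ M) ?_ ?_ ?_ ?_ ha
    · intro r t ht
      rw [AlgHom.commutes, Module.algebraMap_end_apply]
      exact Submodule.smul_mem _ _ ht
    · intro g hg t ht
      have L : ∀ g : Gen, g.InSet {y | y ∈ S ∧ y < P} →
          TensorProduct.map (LinearMap.mulLeft R (gen R d g)) LinearMap.id t ∈ M := by
        intro g hg
        refine (Submodule.span_le (p := M.comap _)).2 ?_ ht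
        rintro _ ⟨x, hx, z, hz, rfl⟩
        exact Submodule.subset_span ⟨_, mul_mem (gen_mem_supp hg) hx, z, hz, rfl⟩
      have Q : ∀ g : Gen, g.InSet {y | y + P ∈ S} → TensorProduct.map (parity R d).toLinearMap
          (LinearMap.mulLeft R (gen R d g)) t ∈ M := by
        intro g hg
        refine (Submodule.span_le (p := M.comap _)).2 ?_ ht
        rintro _ ⟨x, hx, z, hz, rfl⟩
        refine Submodule.subset_span ⟨_, ?_, _, mul_mem (gen_mem_supp hg) hz, rfl⟩
        rw [parity_eq_par]
        exact par_mem_supp 1 hx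
      rw [cutAct_gen]
      cases g with
      | star y =>
        rw [cutGen]
        split_ifs with h
        · exact L _ ⟨hg, h⟩
        · refine Q _ (show y - P + P ∈ S from ?_)
          rw [Nat.sub_add_cancel (not_lt.1 h)]
          exact hg
      | chord y z =>
        rw [cutGen]
        split_ifs with h h'
        · exact L _ ⟨⟨hg.1, h.1⟩, hg.2, h.2⟩
        · refine Q _ ⟨show y - P + P ∈ S from ?_, show z - P + P ∈ S from ?_⟩
          · rw [Nat.sub_add_cancel h'.1]; exact hg.1
          · rw [Nat.sub_add_cancel h'.2]; exact hg.2
        · exact zero_mem _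
    · intro a b iha ihb t ht
      rw [map_mul]
      exact iha _ (ihb t ht)
    · intro a b iha ihb t ht
      rw [map_add]
      exact add_mem (iha t ht) (ihb t ht)
  exact key _ (Submodule.subset_span ⟨1, one_mem _, 1, one_mem _, rfl⟩)

/-- `I` is compatible with the coproduct. -/
theorem comul_I {A : Space R d} (hA : A ∈ GSpace R d) :
    comul R d (I R d A) = TensorProduct.map (I R d) (I R d) (comul R d A) := by
  refine LinearMap.eqOn_span (f := (comul R d).comp (I R d))
    (g := (TensorProduct.map (I R d) (I R d)).comp (comul R d)) ?_ hA
  rintro _ ⟨k, b, hb, rfl⟩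
  have hinj : Set.InjOn id {p | p < k.length} := fun _ _ _ _ h => h
  set w := coreWord id k with hwdef
  have hw : IsCoreWord w := isCoreWord_coreWord hinj
  have hlab : {x | x ∈ labels w} = {p | p < k.length} := by
    ext x; simp [hwdef, mem_labels_coreWord]
  have hI := I_single hinj hb
  have hphi := phi_coreWord hinj hb
  rw [relabel_id, ← hwdef] at hI hphi
  have hbw : b ∈ supp R d {x | x ∈ labels w} := by rwa [hlab]
  have hP : ∀ x ∈ labels w, x < k.length := fun x hx => by
    have : x ∈ {x | x ∈ labels w} := hx
    rwa [hlab] at this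
  have hwo : Ordered ∅ w := hw.ordered ∅
  -- It suffices to compare the cuts of words, where `cutWordL_IWord` applies.
  have h1 : comul R d (I R d (Finsupp.single k b))
      = cutPhi R d k.length b (cutWordL R ∅ (IWord R d w)) := by
    rw [hI]
    refine eqOn_wordsIn (f := (comul R d).comp ((Phi R d).flip b))
      (g := (cutPhi R d k.length b).comp (cutWordL R ∅)) (fun v hv => ?_)
      (wordsIn_and (IWord_expandsTo (R := R) (d := d) hw) (IWord_ordered hw ∅))
    have hl : ∀ x, x ∈ labels v ↔ x ∈ labels w := fun x => hv.1.mem_labels_iff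
    simp only [LinearMap.comp_apply, LinearMap.flip_apply, Phi_wd, cutWordL, onWords_wd]
    exact comul_phi hv.2 (fun x hx => hP x ((hl x).1 hx)) (by simpa only [hl] using hbw)
  rw [LinearMap.comp_apply, h1, cutWordL_IWord hw (by simp), LinearMap.comp_apply, ← hphi,
    comul_phi hwo hP hbw, cutWord_eq_sum, map_sum, map_sum, map_sum, map_sum]
  refine Finset.sum_congr rfl fun p hp => ?_
  split_ifs
  · simp
  set v := w.take p with hv
  set z := w.drop p with hz
  have hvz : w = v ++ z := (List.take_append_drop p w).symm
  have hlabz : ∀ x, x ∈ labels w → x ∉ labels v → x ∈ labels z := fun x h hn => by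
    rw [hvz, labels_append, List.mem_append] at h
    exact h.resolve_left hn
  have hlabv : ∀ x, x ∈ labels v → x ∈ labels w := fun x h => by
    rw [hvz, labels_append, List.mem_append]; exact Or.inl h
  have hvc : IsCoreWord v := ⟨fun l hl => hw.1 l (List.mem_of_mem_take hl),
    (hw.2.sublist ((List.take_sublist p w).filterMap label))⟩
  have hzc : IsCoreWord z := ⟨fun l hl => hw.1 l (List.mem_of_mem_drop hl),
    (hw.2.sublist ((List.drop_sublist p w).filterMap label))⟩
  rw [TensorProduct.map_tmul, zinL_wd, zinL_wd, cutPhi_IWord hvc z, cutPhi_tmul]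
  -- The tensor factors of the cut involve only the labels of their own half, so that `I_phi` can
  -- be applied to both halves.
  have hmem := cut_mem k.length (relabel_mem_supp (f := fun x => if x ∈ labels v then x
      else x + k.length) (T := {y | y ∈ labels v ∨ ∃ x ∈ labels z, y = x + k.length})
    (fun x hx => by
      by_cases h : x ∈ labels v
      · simp [h]
      · exact Or.inr ⟨x, hlabz x hx h, by simp [h]⟩) hbw)
  refine (LinearMap.eqOn_span (f := (TensorProduct.map (Phi R d (IWord R d v)
      ∘ₗ (par R d (wdeg (deg d) z)).toLinearMap) (Phi R d (IWord R d z))))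
    (g := (TensorProduct.map (I R d) (I R d)) ∘ₗ (TensorProduct.map (phi R d v
      ∘ₗ (par R d (wdeg (deg d) z)).toLinearMap) (phi R d z))) ?_ hmem)
  rintro _ ⟨x, hx, y, hy, rfl⟩
  simp only [TensorProduct.map_tmul, LinearMap.comp_apply, AlgHom.toLinearMap_apply]
  rw [I_phi hvc, I_phi hzc]
  · refine supp_mono (fun q hq => ?_) hy
    rcases hq with h | ⟨q', hq', h⟩
    · have := hP _ (hlabv _ h)
      omega
    · obtain rfl : q = q' := by omega
      exact hq'
  · refine par_mem_supp _ (supp_mono (fun q hq => ?_) hx)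
    rcases hq with ⟨h | ⟨q', hq', h⟩, hq2⟩
    · exact h
    · omega

end

section

open Letter

variable {R : Type*} [CommRing R] {d ℓ : ℕ}

/-! ### The differentials on words -/

/-- The result of gluing two neighbour letters, up to sign. -/
def glued : Letter → Letter → Letter
  | core x k, core y l => pair x k y l
  | core x k, leaf y => if x = y then star x k else mixed x k y
  | leaf x, core y k => mixed y k x
  | leaf x, leaf y => if x < y then twin x y else twin y x
  | l, _ => l

/-- The coefficient in the gluing of two neighbour letters. If a leaf is involved, it is graded
antisymmetric. (The value on `leaf x, core x k` is not used.) -/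
def glueCoef (R : Type*) [CommRing R] (d : ℕ) : Letter → Letter → R
  | core _ _, core _ _ => 1
  | core x k, leaf y => if x = y then (-1 : R) ^ (k * d + d + 1) else 1
  | leaf x, core y k => if x = y then 0 else (-1 : R) ^ (deg d (leaf x) * deg d (core y k) + 1)
  | leaf x, leaf y => if x < y then 1 else if y < x then
      (-1 : R) ^ (deg d (leaf x) * deg d (leaf y) + 1) else 0
  | _, _ => 0

/-- The coefficient in the vertical differential of a letter. -/
def dropCoef (R : Type*) [CommRing R] (d : ℕ) : Letter → R
  | core _ k => if k = 0 then 0 else (-1 : R) ^ (k * d)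
  | _ => 0

/-- The lowest top asterisk becomes a bottom asterisk. -/
def dropped : Letter → Letter
  | core x k => star x (k - 1)
  | l => l

/-- The gluing of two letters changes the parity of the degree. -/
theorem oddGlue : OddGlue (R := R) (deg d) (glueCoef R d) glued := by
  intro p q
  cases p with
  | core x k =>
    cases q with
    | core y l =>
      right
      rw [show deg d (glued (core x k) (core y l)) = deg d (core x k) + deg d (core y l) + 1 by
        simp only [glued, deg, tdeg, bdeg, top]; ring]
    | leaf y =>
      right
      by_cases h : x = y
      · rw [show deg d (core x k) + deg d (leaf y) + 1 = deg d (glued (core x k) (leaf y)) + 2 by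
          simp only [glued, if_pos h, deg, tdeg, bdeg, top]; ring, Nat.even_add]
        simp
      · rw [show deg d (glued (core x k) (leaf y)) = deg d (core x k) + deg d (leaf y) + 1 by
          simp only [glued, if_neg h, deg, tdeg, bdeg, top]; ring]
    | _ => exact Or.inl rfl
  | leaf x =>
    cases q with
    | core y l =>
      right
      rw [show deg d (glued (leaf x) (core y l)) = deg d (leaf x) + deg d (core y l) + 1 by
        simp only [glued, deg, tdeg, bdeg, top]; ring]
    | leaf y =>
      right
      rw [show deg d (glued (leaf x) (leaf y)) = deg d (leaf x) + deg d (leaf y) + 1 by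
        simp only [glued]; split_ifs <;> simp only [deg, tdeg, bdeg, top] <;> ring]
    | _ => exact Or.inl rfl
  | _ => exact Or.inl rfl

/-- A leaf and a point can be glued in either order with opposite results, unless they are joined
by a chord. -/
theorem glueAnti_leaf_core {x y k : ℕ} (h : x ≠ y) :
    GlueAnti (R := R) (deg d) (glueCoef R d) glued (leaf x) (core y k) := by
  refine ⟨fun m => ?_⟩
  simp only [glueCoef, glued, if_neg h, if_neg h.symm, one_smul]

/-- Two leaves can be glued in either order with opposite results. Leaves of the same point give
zero, as they would form a double chord. -/
theorem glueAnti_leaf_leaf (x y : ℕ) :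
    GlueAnti (R := R) (deg d) (glueCoef R d) glued (leaf x) (leaf y) := by
  refine ⟨fun m => ?_⟩
  rcases lt_trichotomy x y with h | rfl | h
  · simp only [glueCoef, glued, if_pos h, if_neg h.not_gt, smul_smul]
    congr 1
    rw [mul_comm (deg d (leaf y)), sign_mul_self]
  · simp [glueCoef]
  · simp only [glueCoef, glued, if_pos h, if_neg h.not_gt, smul_smul, mul_one]

/-- The vertical differential of a letter changes the parity of the degree. -/
theorem oddLetters : OddLetters (R := R) (deg d) (dropCoef R d) dropped := by
  intro l
  cases l with
  | core x k =>
    cases k with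
    | zero => exact Or.inl rfl
    | succ k =>
      right
      simp only [dropped, deg, tdeg, bdeg, top, Nat.add_sub_cancel, Nat.even_add, Nat.even_mul,
        Nat.not_even_one, Even.zero]
      tauto
  | _ => exact Or.inl rfl

/-- The extension of the map `expand` to the glued letters `pair x k y l`. -/
def expandPair (R : Type*) [CommRing R] (d : ℕ) : Letter → Words R Letter
  | pair x k y l => ∑ i ∈ Finset.range (k + 1), ∑ j ∈ Finset.range (l + 1),
      (-1 : R) ^ (deg d (core y (l - j)) * (i * deg d (leaf x))) • cons (pair x (k - i) y (l - j))
        (sh (deg d) (wd R (List.replicate i (leaf x))) (wd R (List.replicate j (leaf y))))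
  | l => expand R l

/-- Where no points have been glued, `expandPair` agrees with `expand`. -/
theorem zin_expandPair {w : List Letter} (hw : IsCoreWord w) :
    zin (deg d) (expandPair R d) w = IWord R d w := by
  induction w with
  | nil => rfl
  | cons l w ih =>
    obtain ⟨x, k, rfl, -, hw'⟩ := hw.of_cons
    rw [IWord, zin, zin, ih hw']
    rfl

/-- The first point, with `k - i` top asterisks, stays in front; its `i` leaves are shuffled with
the rest. -/
theorem IWord_cons (x k : ℕ) (w : List Letter) : IWord R d (core x k :: w)
    = ∑ i ∈ Finset.range (k + 1), cons (core x (k - i))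
      (sh (deg d) (wd R (List.replicate i (leaf x))) (IWord R d w)) := by
  rw [IWord, zin, expand, map_sum, LinearMap.sum_apply]
  exact Finset.sum_congr rfl fun i _ => hs_wd_cons _ _ _ _

theorem ExpandsTo.letter {w v : List Letter} (h : ExpandsTo w v) {l : Letter} (hl : l ∈ v) :
    (∃ y ∈ labels w, ∃ k, l = Letter.core y k) ∨ ∃ y ∈ labels w, l = Letter.leaf y := by
  induction h with
  | nil => simp at hl
  | @core x i k w v v' _ _ hp ih =>
    rw [labels_core_cons]
    rcases List.mem_append.1 (hp.mem_iff.1 hl) with h | h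
    · rcases List.mem_cons.1 h with rfl | h
      · exact Or.inl ⟨x, List.mem_cons_self, _, rfl⟩
      · exact Or.inr ⟨x, List.mem_cons_self, (List.mem_replicate.1 h).2⟩
    · rcases ih h with ⟨y, hy, h⟩ | ⟨y, hy, h⟩
      · exact Or.inl ⟨y, List.mem_cons_of_mem _ hy, h⟩
      · exact Or.inr ⟨y, List.mem_cons_of_mem _ hy, h⟩

/-- The differential `∂` on words. -/
def bdWord (R : Type*) [CommRing R] (d : ℕ) : Words R Letter →ₗ[R] Words R Letter :=
  glueDerL (deg d) (glueCoef R d) glued + letterDerL (deg d) (dropCoef R d) dropped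

/-- Chords from new points to a point `x` do not matter for the differential, as long as the point
`x` itself is not involved. -/
theorem bdWord_replicate_sh {w : List Letter} (hw : IsCoreWord w) {x : ℕ} (hx : x ∉ labels w)
    (i : ℕ) : bdWord R d (sh (deg d) (wd R (List.replicate i (leaf x))) (IWord R d w))
      = (-1 : R) ^ (i * deg d (leaf x)) •
        sh (deg d) (wd R (List.replicate i (leaf x))) (bdWord R d (IWord R d w)) := by
  refine eqOn_wordsIn (f := (bdWord R d).comp (sh (deg d) (wd R (List.replicate i (leaf x)))))
    (g := (-1 : R) ^ (i * deg d (leaf x)) •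
      (sh (deg d) (wd R (List.replicate i (leaf x)))).comp (bdWord R d)) (fun v hv => ?_)
    (IWord_expandsTo (R := R) (d := d) hw)
  simp only [LinearMap.comp_apply, LinearMap.smul_apply, bdWord, LinearMap.add_apply, map_add]
  rw [glueDer_replicate_sh oddGlue (by simp [glueCoef]), letterDer_replicate_sh oddLetters rfl, smul_add]
  intro l hl
  rcases hv.letter hl with ⟨y, hy, k, rfl⟩ | ⟨y, -, rfl⟩
  · refine glueAnti_leaf_core ?_
    rintro rfl
    exact hx hy
  · exact glueAnti_leaf_leaf x y

/-- The bottom asterisks which arise from top asterisks cancel with those which arise from chords to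
new points. -/
theorem sum_star_cancel (x k : ℕ) (m : Words R Letter) :
    ∑ i ∈ Finset.range (k + 1), (if i = 0 then 0 else (-1 : R) ^ ((k - i) * d + d + 1) •
        cons (star x (k - i)) (sh (deg d) (wd R (List.replicate (i - 1) (leaf x))) m))
      + ∑ i ∈ Finset.range (k + 1), dropCoef R d (core x (k - i)) •
        cons (star x (k - i - 1)) (sh (deg d) (wd R (List.replicate i (leaf x))) m) = 0 := by
  -- The terms for `i + 1` in the first sum and `i` in the second one cancel: they have `k - i - 1`
  -- top asterisks and `i` leaves.
  rw [Finset.sum_range_succ', Finset.sum_range_succ _ k, if_pos rfl, Nat.sub_self, dropCoef,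
    if_pos rfl, zero_smul, add_zero, add_zero, ← Finset.sum_add_distrib]
  refine Finset.sum_eq_zero fun i hi => ?_
  have hi := Finset.mem_range.1 hi
  obtain ⟨j, rfl⟩ := Nat.exists_eq_add_of_lt hi
  have e1 : i + j + 1 - (i + 1) = j := by omega
  have e2 : i + j + 1 - i = j + 1 := by omega
  rw [if_neg (by omega), dropCoef, e1, e2, if_neg (by omega), Nat.add_sub_cancel, Nat.add_sub_cancel,
    ← add_smul]
  have : (-1 : R) ^ (j * d + d + 1) + (-1 : R) ^ ((j + 1) * d) = 0 := by
    rw [pow_succ, show (j + 1) * d = j * d + d by ring]; ring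
  rw [this, zero_smul]

/-- Gluing with the first letter of a shuffle. -/
theorem glueFirst_core_sh_cons (x t y l i : ℕ) (m : Words R Letter) :
    glueFirstL (glueCoef R d) glued (core x t)
        (sh (deg d) (wd R (List.replicate i (leaf x))) (cons (core y l) m))
      = (if i = 0 then 0 else (-1 : R) ^ (t * d + d + 1) • cons (star x t)
          (sh (deg d) (wd R (List.replicate (i - 1) (leaf x))) (cons (core y l) m)))
        + (-1 : R) ^ (deg d (core y l) * (i * deg d (leaf x))) •
          cons (pair x t y l) (sh (deg d) (wd R (List.replicate i (leaf x))) m) := by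
  cases i with
  | zero => simp [glueFirstL_cons, glueCoef, glued]
  | succ i =>
    rw [replicate_sh_cons, map_add, map_smul, glueFirstL_cons, glueFirstL_cons, if_neg (by omega)]
    simp [glueCoef, glued]

theorem glueFirst_core_replicate (x t i : ℕ) :
    glueFirstL (R := R) (glueCoef R d) glued (core x t) (wd R (List.replicate i (leaf x)))
      = if i = 0 then 0 else (-1 : R) ^ (t * d + d + 1) • cons (star x t)
          (wd R (List.replicate (i - 1) (leaf x))) := by
  cases i with
  | zero => simp [glueFirst]
  | succ i => simp [List.replicate_succ, glueFirst, glueCoef, glued]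

theorem bdWord_cons_core (x k : ℕ) (m : Words R Letter) : bdWord R d (cons (core x k) m)
    = glueFirstL (glueCoef R d) glued (core x k) m
      + dropCoef R d (core x k) • cons (star x (k - 1)) m
      + (-1 : R) ^ deg d (core x k) • cons (core x k) (bdWord R d m) := by
  rw [bdWord, LinearMap.add_apply, glueDerL_cons, letterDerL_cons, LinearMap.add_apply, map_add,
    smul_add, dropped]
  abel

/-- The gluings of the first point with its successor, which may be one of its leaves (the result
is a bottom asterisk) or the next point of the word. -/
theorem sum_glueFirst {x k : ℕ} {w : List Letter} (hw : IsCoreWord w) :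
    ∑ i ∈ Finset.range (k + 1), glueFirstL (glueCoef R d) glued (core x (k - i))
        (sh (deg d) (wd R (List.replicate i (leaf x))) (IWord R d w))
      = ∑ i ∈ Finset.range (k + 1), (if i = 0 then 0 else (-1 : R) ^ ((k - i) * d + d + 1) •
          cons (star x (k - i)) (sh (deg d) (wd R (List.replicate (i - 1) (leaf x))) (IWord R d w)))
        + zinL (deg d) (expandPair R d) (glueFirst (glueCoef R d) glued (core x k) w) := by
  cases w with
  | nil =>
    rw [IWord, zin, glueFirst, map_zero, add_zero]
    refine Finset.sum_congr rfl fun i _ => ?_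
    rw [sh_one, sh_one, glueFirst_core_replicate]
  | cons l w =>
    obtain ⟨y, l, rfl, -, hw'⟩ := hw.of_cons
    have e : zinL (deg d) (expandPair R d) (glueFirst (glueCoef R d) glued (core x k) (core y l :: w))
        = ∑ i ∈ Finset.range (k + 1), ∑ j ∈ Finset.range (l + 1),
          (-1 : R) ^ (deg d (core y (l - j)) * (i * deg d (leaf x))) •
            cons (pair x (k - i) y (l - j)) (sh (deg d) (wd R (List.replicate i (leaf x)))
              (sh (deg d) (wd R (List.replicate j (leaf y))) (IWord R d w))) := by
      rw [glueFirst, map_smul, zinL_wd, glueCoef, one_smul, glued, zin, expandPair, map_sum,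
        LinearMap.sum_apply, zin_expandPair hw']
      refine Finset.sum_congr rfl fun i _ => ?_
      rw [map_sum, LinearMap.sum_apply]
      refine Finset.sum_congr rfl fun j _ => ?_
      rw [map_smul, LinearMap.smul_apply, hs_cons, sh_assoc]
    rw [e, ← Finset.sum_add_distrib, IWord_cons]
    refine Finset.sum_congr rfl fun i _ => ?_
    rw [map_sum, map_sum, Finset.sum_congr rfl fun j _ => glueFirst_core_sh_cons _ _ _ _ _ _,
      Finset.sum_add_distrib]
    congr 1
    split_ifs
    · simp
    · rw [map_sum, map_sum, Finset.smul_sum]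

/-- The differential of the value of `I` on a word: all that remains are the gluings of neighbour
points of the original word. -/
theorem bdWord_IWord {w : List Letter} (hw : IsCoreWord w) : bdWord R d (IWord R d w)
    = zinL (deg d) (expandPair R d) (glueDer (deg d) (glueCoef R d) glued w) := by
  induction w with
  | nil => simp [bdWord, zin, glueDer, letterDer]
  | cons l w ih =>
    obtain ⟨x, k, rfl, hx, hw'⟩ := hw.of_cons
    rw [IWord_cons, map_sum, Finset.sum_congr rfl fun i _ => bdWord_cons_core _ _ _,
      Finset.sum_add_distrib, Finset.sum_add_distrib, sum_glueFirst hw', glueDer, map_add, map_smul,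
      zinL_cons, ← ih hw', add_right_comm _ (zinL _ _ _), sum_star_cancel, zero_add]
    simp only [bdWord_replicate_sh hw' hx]
    congr 1
    rw [show expandPair R d (core x k) = expand R (core x k) from rfl, expand, map_sum,
      LinearMap.sum_apply, Finset.smul_sum]
    refine Finset.sum_congr rfl fun i hi => ?_
    have hi := Finset.mem_range.1 hi
    obtain ⟨j, rfl⟩ := Nat.exists_eq_add_of_le (show i ≤ k by omega)
    rw [hs_wd_cons, map_smul, smul_smul, ← pow_add, Nat.add_sub_cancel_left]
    congr 1
    apply sign_congr
    simp only [deg, tdeg, bdeg, top, Nat.even_add, Nat.even_mul, Nat.not_even_one, Even.zero]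
    tauto

end

section

open Letter

variable {R : Type*} [CommRing R] {d ℓ : ℕ}

/-! ### Gluing of neighbour points in diagrams given by words -/

/-- The summand of `∂_h` which belongs to the gluing of the points `i` and `i + 1`. -/
def glueAt (R : Type*) [CommRing R] (d i : ℕ) : Space R d →ₗ[R] Space R d :=
  Finsupp.lsum R fun k => ((-1 : R) ^ (blockDeg d (k.take i) + k.getD i 0 * d)
        * (qbinom d (k.getD i 0) (k.getD (i + 1) 0) : R)) •
      (Finsupp.lsingle (k.take i ++ (k.getD i 0 + k.getD (i + 1) 0) :: k.drop (i + 2)) ∘ₗ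
        (glue R d i).toLinearMap)

theorem glueAt_single (i : ℕ) (k : List ℕ) (a : Alg R d) : glueAt R d i (Finsupp.single k a)
    = ((-1 : R) ^ (blockDeg d (k.take i) + k.getD i 0 * d)
        * (qbinom d (k.getD i 0) (k.getD (i + 1) 0) : R)) •
      (Finsupp.single (k.take i ++ (k.getD i 0 + k.getD (i + 1) 0) :: k.drop (i + 2))
        (glue R d i a) : Space R d) := by
  simp [glueAt]

theorem boundaryH_single_eq (k : List ℕ) (a : Alg R d) : boundaryH R d (Finsupp.single k a)
    = ∑ i ∈ Finset.range (k.length - 1), glueAt R d i (Finsupp.single k a) := by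
  simp only [boundaryH_single, glueAt_single]

theorem gluePos_of_lt {i n : ℕ} (h : n ≤ i) : gluePos i n = n := if_pos h

theorem gluePos_succ {i n : ℕ} (h : i ≤ n) : gluePos i (n + 1) = n := by
  rw [gluePos, if_neg (by omega), Nat.add_sub_cancel]

theorem glue_fac_left {f : ℕ → ℕ} {i n : ℕ} (h : n < i) (l : Letter) :
    glue R d i (fac R d f n l) = fac R d (gluePos i ∘ f) n l := by
  cases l with
  | core => exact map_one _
  | leaf x =>
    rw [fac, fac, map_smul, glue_gen, glueGen, if_neg (by omega), if_neg (by omega),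
      gluePos_of_lt h.le, Function.comp_apply]
  | star => rw [fac, fac, glue_gen, glueGen, gluePos_of_lt h.le]
  | _ => exact map_zero _

theorem glue_fac_right {f : ℕ → ℕ} {i n : ℕ} (h : i < n) (l : Letter) :
    glue R d i (fac R d f (n + 1) l) = fac R d (gluePos i ∘ f) n l := by
  cases l with
  | core => exact map_one _
  | leaf x =>
    rw [fac, fac, map_smul, glue_gen, glueGen, if_neg (by omega), if_neg (by omega),
      gluePos_succ h.le, Function.comp_apply]
  | star => rw [fac, fac, glue_gen, glueGen, gluePos_succ h.le]
  | _ => exact map_zero _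

theorem glue_fac_fst {f : ℕ → ℕ} {i : ℕ} {l : Letter} (h : ∀ x, l = leaf x → f x ≠ i + 1) :
    glue R d i (fac R d f i l) = fac R d (gluePos i ∘ f) i l := by
  cases l with
  | core => exact map_one _
  | leaf x =>
    have := h x rfl
    rw [fac, fac, map_smul, glue_gen, glueGen, if_neg (by omega), if_neg (by omega),
      gluePos_of_lt le_rfl, Function.comp_apply]
  | star => rw [fac, fac, glue_gen, glueGen, gluePos_of_lt le_rfl]
  | _ => exact map_zero _

theorem glue_fac_snd {f : ℕ → ℕ} {i : ℕ} {l : Letter} (h : ∀ x, l = leaf x → f x ≠ i) :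
    glue R d i (fac R d f (i + 1) l) = fac R d (gluePos i ∘ f) i l := by
  cases l with
  | core => exact map_one _
  | leaf x =>
    have := h x rfl
    rw [fac, fac, map_smul, glue_gen, glueGen, if_neg (by omega), if_neg (by omega),
      gluePos_succ le_rfl, Function.comp_apply]
  | star => rw [fac, fac, glue_gen, glueGen, gluePos_succ le_rfl]
  | _ => exact map_zero _

theorem glue_algOf_left {f : ℕ → ℕ} {i n : ℕ} {w : List Letter} (h : n + w.length ≤ i) :
    glue R d i (algOf R d f n w) = algOf R d (gluePos i ∘ f) n w := by
  induction w generalizing n with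
  | nil => exact map_one _
  | cons l w ih =>
    rw [List.length_cons] at h
    rw [algOf, algOf, map_mul, glue_par, glue_fac_left (by omega), ih (by omega)]

theorem glue_algOf_right {f : ℕ → ℕ} {i n : ℕ} {w : List Letter} (h : i < n) :
    glue R d i (algOf R d f (n + 1) w) = algOf R d (gluePos i ∘ f) n w := by
  induction w generalizing n with
  | nil => exact map_one _
  | cons l w ih => rw [algOf, algOf, map_mul, glue_par, glue_fac_right h, ih (by omega)]

theorem homog_algOf (f : ℕ → ℕ) (n : ℕ) (w : List Letter) :
    Homog (wdeg (bdeg d) w) (algOf R d f n w) := by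
  induction w generalizing n with
  | nil => exact homog_one
  | cons l w ih =>
    rw [algOf, (homog_fac f n l).par_eq, wdeg_cons]
    exact ((homog_fac f n l).smul _).mul (ih _)

/-- The diagram with the points of `u` and of `v` and a point with `k` top asterisks between them,
to which the letters `e` are attached. -/
def joined (R : Type*) [CommRing R] (d : ℕ) (u v : List Letter) (k : ℕ) (e : Alg R d) (f : ℕ → ℕ)
    (b : Alg R d) : Space R d :=
  Finsupp.single (u.map top ++ k :: v.map top)
    (par R d (wdeg (tdeg d) v + (1 + k * d)) (algOf R d f 0 u) *
      (par R d (wdeg (tdeg d) v) e * (algOf R d f (u.length + 1) v * b)))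

theorem joined_smul (u v : List Letter) (k : ℕ) (r : R) (e : Alg R d) (f : ℕ → ℕ) (b : Alg R d) :
    joined R d u v k (r • e) f b = r • joined R d u v k e f b := by
  rw [joined, joined, map_smul, smul_mul_assoc, mul_smul_comm, Finsupp.smul_single]

theorem joined_zero (u v : List Letter) (k : ℕ) (f : ℕ → ℕ) (b : Alg R d) :
    joined R d u v k 0 f b = 0 := by
  rw [joined, map_zero, zero_mul, mul_zero, Finsupp.single_zero]

/-- A diagram given by a word, with the contribution of one letter singled out. -/
theorem phi_middle (u : List Letter) (l : Letter) (v : List Letter) (a : Alg R d) :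
    phi R d (u ++ l :: v) a = joined R d u v l.top (fac R d (coreIdx (u ++ l :: v)) u.length l)
      (coreIdx (u ++ l :: v)) (relabel R d (coreIdx (u ++ l :: v)) a) := by
  rw [phi_apply, joined, algOf_append, algOf, zero_add, wdeg_cons, tdeg, List.map_append,
    List.map_cons, add_comm (1 + l.top * d), mul_assoc, mul_assoc]

theorem wdeg_deg (u : List Letter) : wdeg (deg d) u = wdeg (tdeg d) u + wdeg (bdeg d) u := by
  induction u with
  | nil => rfl
  | cons l u ih => rw [wdeg_cons, wdeg_cons, wdeg_cons, deg, ih]; ring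

theorem even_add_two_mul (m n : ℕ) : Even (m + 2 * n) ↔ Even m := by simp [Nat.even_add]

/-- The gluing of two neighbours in a diagram given by a word, with the contributions of the two
letters singled out. -/
theorem glueAt_phi (u : List Letter) (p q : Letter) (v : List Letter) {f : ℕ → ℕ}
    (hf : coreIdx (u ++ p :: q :: v) = f) (a : Alg R d) :
    glueAt R d u.length (phi R d (u ++ p :: q :: v) a)
      = ((-1 : R) ^ (wdeg (deg d) u + p.top * d) * (qbinom d p.top q.top : R)) •
        joined R d u v (p.top + q.top) (par R d (q.tdeg d) (glue R d u.length (fac R d f u.length p))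
          * glue R d u.length (fac R d f (u.length + 1) q)) (gluePos u.length ∘ f)
          (glue R d u.length (relabel R d f a)) := by
  have e0 : (u.map top).length = u.length := List.length_map _
  have e1 : ((u ++ p :: q :: v).map top).take u.length = u.map top := by simp
  have e2 : ((u ++ p :: q :: v).map top).getD u.length 0 = p.top := by simp
  have e3 : ((u ++ p :: q :: v).map top).getD (u.length + 1) 0 = q.top := by
    rw [List.map_append, List.getD_append_right _ _ _ _ (by simp)]; simp
  have e4 : ((u ++ p :: q :: v).map top).drop (u.length + 2) = v.map top := by
    rw [List.map_append, List.drop_append]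
    simp
  have e5 : par R d (wdeg (tdeg d) (p :: q :: v)) (algOf R d (gluePos u.length ∘ f) 0 u)
      = (-1 : R) ^ wdeg (bdeg d) u • par R d (wdeg (tdeg d) v + (1 + (p.top + q.top) * d))
        (algOf R d (gluePos u.length ∘ f) 0 u) := by
    rw [(homog_algOf _ _ _).par_eq, (homog_algOf _ _ _).par_eq, smul_smul, ← pow_add]
    congr 1
    rw [show wdeg (tdeg d) (p :: q :: v) = wdeg (tdeg d) v + (1 + (p.top + q.top) * d) + 1 by
      simp only [wdeg_cons, tdeg]; ring]
    congr 1
    ring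
  rw [phi_apply, hf, glueAt_single, e1, e2, e3, e4, blockDeg_map_top, joined, algOf_append, algOf,
    algOf, zero_add, map_mul, map_mul, map_mul, map_mul, glue_par, glue_par, glue_par,
    glue_algOf_left (by omega), glue_algOf_right (by omega), e5, smul_mul_assoc, smul_mul_assoc,
    ← Finsupp.smul_single, smul_smul, wdeg_deg, map_mul, ← par_add, wdeg_cons, add_comm (wdeg _ v) (tdeg d q)]
  congr 1
  · ring
  · simp only [mul_assoc]

theorem coreIdx_cons (l : Letter) (w : List Letter) (x : ℕ) :
    coreIdx (l :: w) x = if l.label = some x then 0 else coreIdx w x + 1 := by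
  rw [coreIdx, List.findIdx_cons]
  by_cases h : l.label = some x
  · simp [h]
  · simp [h, coreIdx]

theorem gluePos_succ_succ (i n : ℕ) : gluePos (i + 1) (n + 1) = gluePos i n + 1 := by
  simp only [gluePos]; split_ifs <;> omega

/-- Places of the labelled points after the gluing of two points one of which has no label. -/
theorem gluePos_coreIdx {p q r : Letter} (u v : List Letter)
    (h : p.label = none ∧ r.label = q.label ∨ q.label = none ∧ r.label = p.label) :
    gluePos u.length ∘ coreIdx (u ++ p :: q :: v) = coreIdx (u ++ r :: v) := by
  funext x
  rw [Function.comp_apply]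
  induction u with
  | nil =>
    simp only [List.nil_append, coreIdx_cons, List.length_nil]
    rcases h with ⟨h1, h2⟩ | ⟨h1, h2⟩ <;> rw [h1, h2] <;> simp only [reduceCtorEq, if_false] <;>
      split_ifs <;> simp [gluePos]
  | cons l u ih =>
    rw [List.cons_append, List.cons_append, coreIdx_cons, coreIdx_cons, List.length_cons]
    split_ifs
    · rfl
    · rw [gluePos_succ_succ, ih]

theorem coreIdx_middle {u v : List Letter} {p : Letter} {x : ℕ}
    (h : coreIdx (u ++ p :: v) x = u.length) : p.label = some x := by
  have h1 : coreIdx (u ++ p :: v) x < (u ++ p :: v).length := by rw [h]; simp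
  have h2 := label_coreIdx h1
  simpa [h] using h2

theorem coreIdx_middle_succ {u v : List Letter} {p q : Letter} {x : ℕ}
    (h : coreIdx (u ++ p :: q :: v) x = u.length + 1) : q.label = some x := by
  have e : u ++ p :: q :: v = (u ++ [p]) ++ q :: v := by simp
  rw [e] at h
  exact coreIdx_middle (h.trans (by simp))

theorem glue_relabel_of_ne {f : ℕ → ℕ} {i : ℕ} (h : (∀ x, f x ≠ i) ∨ ∀ x, f x ≠ i + 1) (a : Alg R d) :
    glue R d i (relabel R d f a) = relabel R d (gluePos i ∘ f) a := by
  have : (glue R d i).comp (relabel R d f) = relabel R d (gluePos i ∘ f) := by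
    apply alg_hom_ext
    intro x
    cases x with
    | star x => simp [relabelGen, glueGen]
    | chord x y =>
      rw [AlgHom.comp_apply, relabel_gen, glue_gen, relabelGen, glueGen, relabel_gen, relabelGen,
        if_neg (by rintro ⟨h1, h2⟩; rcases h with h | h; exacts [h _ h1, h _ h2]),
        if_neg (by rintro ⟨h1, h2⟩; rcases h with h | h; exacts [h _ h2, h _ h1])]
      rfl
  exact DFunLike.congr_fun this a

/-- Gluing of two neighbour points one of which has no label and which are not joined by a chord. -/
theorem glueAt_phi_of_ne {p q r : Letter} (u v : List Letter)
    (h : p.label = none ∧ r.label = q.label ∨ q.label = none ∧ r.label = p.label)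
    (hp : ∀ x, p = leaf x → q.label ≠ some x) (hq : ∀ x, q = leaf x → p.label ≠ some x)
    (a : Alg R d) :
    glueAt R d u.length (phi R d (u ++ p :: q :: v) a)
      = ((-1 : R) ^ (wdeg (deg d) u + p.top * d) * (qbinom d p.top q.top : R)) •
        joined R d u v (p.top + q.top)
          (par R d (q.tdeg d) (fac R d (coreIdx (u ++ r :: v)) u.length p)
            * fac R d (coreIdx (u ++ r :: v)) u.length q)
          (coreIdx (u ++ r :: v)) (relabel R d (coreIdx (u ++ r :: v)) a) := by
  rw [glueAt_phi u p q v rfl, glue_fac_fst fun x hx h' => hp x hx (coreIdx_middle_succ h'),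
    glue_fac_snd fun x hx h' => hq x hx (coreIdx_middle h'), glue_relabel_of_ne, gluePos_coreIdx u v h]
  rcases h with h | h
  · refine Or.inl fun x hx => ?_
    have := coreIdx_middle hx
    rw [h.1] at this
    cases this
  · refine Or.inr fun x hx => ?_
    have := coreIdx_middle_succ hx
    rw [h.1] at this
    cases this

theorem qbinom_zero_left (d k : ℕ) : qbinom d 0 k = 1 := by
  rw [qbinom]; split_ifs <;> simp_all

/-- The gluing of two neighbour points is graded antisymmetric if one of them has neither a label
nor top asterisks and if they are not joined by a chord. -/
theorem glueAt_phi_swap {p q : Letter} (u v : List Letter) (h : p.label = none)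
    (hp : ∀ x, p = leaf x → q.label ≠ some x) (ht : p.top = 0) (a : Alg R d) :
    glueAt R d u.length (phi R d (u ++ p :: q :: v) a)
      = (-1 : R) ^ (p.deg d * q.deg d + 1) • glueAt R d u.length (phi R d (u ++ q :: p :: v) a) := by
  have hq : ∀ x, q = leaf x → p.label ≠ some x := by simp [h]
  rw [glueAt_phi_of_ne (r := q) u v (Or.inl ⟨h, rfl⟩) hp hq,
    glueAt_phi_of_ne (r := q) u v (Or.inr ⟨h, rfl⟩) hq hp, ht, qbinom_zero, qbinom_zero_left,
    (homog_fac _ _ p).par_eq, (homog_fac _ _ q).par_eq, smul_mul_assoc, smul_mul_assoc,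
    (homog_fac _ _ p).mul_comm (homog_fac _ _ q), joined_smul, joined_smul, joined_smul, smul_smul,
    smul_smul, smul_smul, smul_smul, add_comm q.top]
  congr 1
  simp only [Nat.cast_one, mul_one, ← pow_add]
  have e : tdeg d p = 1 := by rw [tdeg, ht, zero_mul, add_zero]
  apply sign_congr
  rw [deg, deg, e, tdeg]
  generalize hbp : bdeg d p = bp
  generalize hbq : bdeg d q = bq
  generalize q.top = t
  rw [show (1 + bp) * (1 + t * d + bq) + 1 + (wdeg (deg d) u + t * d) + 1 * bq
    = (wdeg (deg d) u + 0 * d + (1 + t * d) * bp + bp * bq) + 2 * (1 + t * d + bq) by ring]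
  rw [even_add_two_mul]

/-- Gluing two leaves of the same point produces a double chord. -/
theorem glueAt_phi_leaf_leaf (u v : List Letter) (x : ℕ) (a : Alg R d) :
    glueAt R d u.length (phi R d (u ++ leaf x :: leaf x :: v) a) = 0 := by
  rw [glueAt_phi_of_ne (r := leaf x) u v (Or.inl ⟨rfl, rfl⟩) (by simp [label]) (by simp [label]), fac,
    map_smul, par_gen, smul_smul, smul_mul_smul_comm, gen_sq, smul_zero, joined_zero, smul_zero]

/-- Gluing a point with a leaf of it produces a bottom asterisk. -/
theorem glueAt_phi_core_leaf {u v : List Letter} {x k : ℕ} (hx : x ∉ labels u) (a : Alg R d) :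
    glueAt R d u.length (phi R d (u ++ core x k :: leaf x :: v) a)
      = ((-1 : R) ^ wdeg (deg d) u * (-1 : R) ^ (k * d + d + 1)) •
        phi R d (u ++ star x k :: v) a := by
  have e : gluePos u.length ∘ coreIdx (u ++ core x k :: leaf x :: v) = coreIdx (u ++ star x k :: v) :=
    gluePos_coreIdx u v (Or.inr ⟨rfl, rfl⟩)
  have e' : coreIdx (u ++ core x k :: leaf x :: v) x = u.length := by
    rw [coreIdx_append_right hx, coreIdx_cons, label, if_pos rfl, add_zero]
  rw [glueAt_phi u _ _ v rfl, glue_relabel_of_ne, e, fac, map_one, map_one, one_mul, fac, e', map_smul,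
    glue_gen, glueGen, if_pos ⟨rfl, rfl⟩, phi_middle, fac, joined_smul, smul_smul]
  · simp only [top, qbinom_zero, Nat.cast_one, mul_one, add_zero]
    congr 1
    rw [← pow_add, ← pow_add]
    congr 1
    ring
  · refine Or.inr fun y hy => ?_
    have := coreIdx_middle_succ hy
    cases this

end

section

open Letter

variable {R : Type*} [CommRing R] {d ℓ : ℕ}

/-! ### The differentials of diagrams given by words -/

/-- The letters for points with a label and top asterisks, and for points joined to them. -/
def Letter.Plain : Letter → Prop
  | core _ _ => True
  | leaf _ => True
  | _ => False

/-- The effect on letters of the gluing of the points with labels `i` and `i + 1`. -/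
def merge (i : ℕ) : Letter → Letter
  | core x k => core (gluePos i x) k
  | leaf x => leaf (gluePos i x)
  | pair x k _ l => core (gluePos i x) (k + l)
  | l => l

theorem map_top_merge (i : ℕ) {w : List Letter} (hw : ∀ l ∈ w, l.Plain) :
    (w.map (merge i)).map top = w.map top := by
  rw [List.map_map]
  refine List.map_congr_left fun l hl => ?_
  have := hw l hl
  cases l <;> first | rfl | cases this

theorem wdeg_merge (g : Letter → ℕ) (hg : ∀ x y k, g (core x k) = g (core y k))
    (hg' : ∀ x y, g (leaf x) = g (leaf y)) (i : ℕ) {w : List Letter} (hw : ∀ l ∈ w, l.Plain) :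
    wdeg g (w.map (merge i)) = wdeg g w := by
  rw [wdeg, wdeg, List.map_map]
  congr 1
  refine List.map_congr_left fun l hl => ?_
  have := hw l hl
  cases l with
  | core => exact hg _ _ _
  | leaf => exact hg' _ _
  | _ => cases this

theorem algOf_merge (f : ℕ → ℕ) (n i : ℕ) {w : List Letter} (hw : ∀ l ∈ w, l.Plain) :
    algOf R d f n (w.map (merge i)) = algOf R d (f ∘ gluePos i) n w := by
  induction w generalizing n with
  | nil => rfl
  | cons l w ih =>
    have hw' : ∀ l ∈ w, l.Plain := fun l hl => hw l (List.mem_cons_of_mem _ hl)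
    rw [List.map_cons, algOf, algOf, ih _ hw', wdeg_merge _ (fun _ _ _ => rfl) (fun _ _ => rfl) i hw']
    congr 2
    have := hw l List.mem_cons_self
    cases l <;> first | rfl | cases this

theorem gluePos_inj {i x y : ℕ} (hx : x ≠ i + 1) (hy : y ≠ i + 1) :
    gluePos i x = gluePos i y ↔ x = y := by
  simp only [gluePos]
  split_ifs <;> omega

theorem gluePos_eq_self {i x : ℕ} : gluePos i x = i ↔ x = i ∨ x = i + 1 := by
  simp only [gluePos]
  split_ifs <;> omega

theorem label_merge {i x : ℕ} {l : Letter} (hl : l.Plain) (h1 : l.label ≠ some i)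
    (h2 : l.label ≠ some (i + 1)) : (merge i l).label = some (gluePos i x) ↔ l.label = some x := by
  cases l with
  | core y k =>
    simp only [merge, label, Option.some.injEq, ne_eq] at h1 h2 ⊢
    by_cases hx : x = i + 1
    · have : gluePos i x = i := gluePos_eq_self.2 (Or.inr hx)
      rw [this, gluePos_eq_self]
      omega
    · exact gluePos_inj h2 hx
  | leaf => simp [merge, label]
  | _ => cases hl

theorem coreIdx_merge {i : ℕ} {w : List Letter} (hw : ∀ l ∈ w, l.Plain) (h1 : i ∉ labels w)
    (h2 : i + 1 ∉ labels w) (x : ℕ) : coreIdx (w.map (merge i)) (gluePos i x) = coreIdx w x := by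
  induction w with
  | nil => rfl
  | cons l w ih =>
    rw [mem_labels] at h1 h2
    push Not at h1 h2
    rw [List.map_cons, coreIdx_cons, coreIdx_cons, ih (fun l hl => hw l (List.mem_cons_of_mem _ hl))]
    · simp only [label_merge (hw l List.mem_cons_self) (h1 l List.mem_cons_self)
        (h2 l List.mem_cons_self)]
    · rw [mem_labels]; rintro ⟨l', hl', h⟩; exact h1 l' (List.mem_cons_of_mem _ hl') h
    · rw [mem_labels]; rintro ⟨l', hl', h⟩; exact h2 l' (List.mem_cons_of_mem _ hl') h

theorem mem_labels_merge {i x : ℕ} {w : List Letter} (hw : ∀ l ∈ w, l.Plain) (h1 : i ∉ labels w)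
    (h2 : i + 1 ∉ labels w) : gluePos i x ∈ labels (w.map (merge i)) ↔ x ∈ labels w := by
  rw [← coreIdx_lt, coreIdx_merge hw h1 h2, List.length_map, coreIdx_lt]

/-- Places in the word after the points `i` and `i + 1` have been glued. -/
theorem coreIdx_merged {i k l t : ℕ} {u v : List Letter} (hu : ∀ l ∈ u, l.Plain)
    (hv : ∀ l ∈ v, l.Plain) (hu1 : i ∉ labels u) (hu2 : i + 1 ∉ labels u) (hv1 : i ∉ labels v)
    (hv2 : i + 1 ∉ labels v) (x : ℕ) :
    coreIdx (u.map (merge i) ++ core i t :: v.map (merge i)) (gluePos i x)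
      = gluePos u.length (coreIdx (u ++ core i k :: core (i + 1) l :: v) x) := by
  by_cases hx : x ∈ labels u
  · rw [coreIdx_append_left hx, coreIdx_append_left ((mem_labels_merge hu hu1 hu2).2 hx),
      coreIdx_merge hu hu1 hu2, gluePos_of_lt (coreIdx_lt.2 hx).le]
  · rw [coreIdx_append_right hx, coreIdx_append_right (mt (mem_labels_merge hu hu1 hu2).1 hx),
      coreIdx_cons, coreIdx_cons, coreIdx_cons, coreIdx_merge hv hv1 hv2, List.length_map, label,
      label, label]
    simp only [Option.some.injEq, gluePos]
    split_ifs <;> omega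

theorem glue_relabel {f f' : ℕ → ℕ} {i m : ℕ} (h : ∀ x, f' (gluePos i x) = gluePos m (f x))
    (h1 : ∀ x, f x = m ↔ x = i) (h2 : ∀ x, f x = m + 1 ↔ x = i + 1) (a : Alg R d) :
    glue R d m (relabel R d f a) = relabel R d f' (glue R d i a) := by
  have : (glue R d m).comp (relabel R d f) = (relabel R d f').comp (glue R d i) := by
    have hi : f' i = m := by
      have := h i
      rwa [(h1 i).2 rfl, gluePos_of_lt le_rfl, gluePos_of_lt le_rfl] at this
    apply alg_hom_ext
    intro x
    cases x with
    | star x => simp [relabelGen, glueGen, h]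
    | chord x y =>
      rw [AlgHom.comp_apply, AlgHom.comp_apply, relabel_gen, glue_gen, glue_gen, relabelGen, glueGen,
        glueGen]
      simp only [h1, h2]
      split_ifs
      · simp [relabelGen, hi]
      · simp [relabelGen, hi]
      · simp [relabelGen, h]
  exact DFunLike.congr_fun this a

/-- Gluing the points with labels `i` and `i + 1`, expressed with the words and the letters on
labels. -/
theorem glueAt_phi_core_core {i k l : ℕ} {u v : List Letter} (hu : ∀ l ∈ u, l.Plain)
    (hv : ∀ l ∈ v, l.Plain) (hn : (labels (u ++ core i k :: core (i + 1) l :: v)).Nodup) (a : Alg R d) :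
    (-1 : R) ^ wdeg (deg d) u • glueAt R d u.length (phi R d (u ++ core i k :: core (i + 1) l :: v) a)
      = ((-1 : R) ^ (k * d) * (qbinom d k l : R)) •
        phi R d (u.map (merge i) ++ core i (k + l) :: v.map (merge i)) (glue R d i a) := by
  rw [labels_append, labels_core_cons, labels_core_cons, List.nodup_append] at hn
  obtain ⟨-, hn1, hn2⟩ := hn
  rw [List.nodup_cons, List.nodup_cons] at hn1
  obtain ⟨hn3, hv2, -⟩ := hn1
  have hv1 : i ∉ labels v := fun h => hn3 (List.mem_cons_of_mem _ h)
  have hu1 : i ∉ labels u := fun h => hn2 i h i (by simp) rfl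
  have hu2 : i + 1 ∉ labels u := fun h => hn2 (i + 1) h (i + 1) (by simp) rfl
  have hc := coreIdx_merged (k := k) (l := l) (t := k + l) hu hv hu1 hu2 hv1 hv2
  have hc' : coreIdx (u.map (merge i) ++ core i (k + l) :: v.map (merge i)) ∘ gluePos i
      = gluePos u.length ∘ coreIdx (u ++ core i k :: core (i + 1) l :: v) := funext hc
  have i1 : ∀ x, coreIdx (u ++ core i k :: core (i + 1) l :: v) x = u.length ↔ x = i := by
    refine fun x => ⟨fun h => ?_, ?_⟩
    · have := coreIdx_middle h
      simp only [label, Option.some.injEq] at this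
      exact this.symm
    · rintro rfl
      rw [coreIdx_append_right hu1, coreIdx_cons, label, if_pos rfl, add_zero]
  have i2 : ∀ x, coreIdx (u ++ core i k :: core (i + 1) l :: v) x = u.length + 1 ↔ x = i + 1 := by
    refine fun x => ⟨fun h => ?_, ?_⟩
    · have := coreIdx_middle_succ h
      simp only [label, Option.some.injEq] at this
      exact this.symm
    · rintro rfl
      rw [coreIdx_append_right hu2, coreIdx_cons, coreIdx_cons, label, label, if_pos rfl,
        if_neg (by simp)]
  rw [glueAt_phi u _ _ v rfl, phi_middle, joined, joined, map_top_merge i hu, map_top_merge i hv,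
    wdeg_merge _ (fun _ _ _ => rfl) (fun _ _ => rfl) i hv, algOf_merge _ _ _ hu, algOf_merge _ _ _ hv,
    hc', List.length_map, glue_relabel hc i1 i2, smul_smul]
  simp only [fac, map_one, one_mul, top]
  congr 1
  rw [← mul_assoc, ← pow_add]
  congr 1
  apply sign_congr
  rw [show wdeg (deg d) u + (wdeg (deg d) u + k * d) = k * d + 2 * wdeg (deg d) u by ring,
    even_add_two_mul]

/-- The two letters whose gluing is the given letter. -/
def unglue : Letter → Option (Letter × Letter)
  | pair x k y l => some (core x k, core y l)
  | mixed x k y => some (core x k, leaf y)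
  | twin x y => some (leaf x, leaf y)
  | _ => none

/-- The element of the space of diagrams described by the word `u ++ w`, where the first glued letter
of `w` stands for a point which arises by gluing. -/
def phiGlued (R : Type*) [CommRing R] (d : ℕ) (u : List Letter) : List Letter → Alg R d →ₗ[R] Space R d
  | [] => phi R d u
  | l :: w => match unglue l with
    | none => phiGlued R d (u ++ [l]) w
    | some (p, q) => (-1 : R) ^ wdeg (deg d) u •
        (glueAt R d u.length ∘ₗ phi R d (u ++ p :: q :: w))

/-- The linear extension of `phiGlued`. -/
def PhiGlued (R : Type*) [CommRing R] (d : ℕ) (u : List Letter) :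
    Words R Letter →ₗ[R] Alg R d →ₗ[R] Space R d :=
  onWords (phiGlued R d u)

@[simp] theorem PhiGlued_wd (u w : List Letter) : PhiGlued R d u (wd R w) = phiGlued R d u w :=
  onWords_wd _ _

theorem phiGlued_cons (u : List Letter) {l : Letter} (hl : unglue l = none) (w : List Letter) :
    phiGlued R d u (l :: w) = phiGlued R d (u ++ [l]) w := by
  rw [phiGlued, hl]

theorem phiGlued_cons_some (u : List Letter) {l p q : Letter} (hl : unglue l = some (p, q))
    (w : List Letter) : phiGlued R d u (l :: w) = (-1 : R) ^ wdeg (deg d) u •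
        (glueAt R d u.length ∘ₗ phi R d (u ++ p :: q :: w)) := by
  rw [phiGlued, hl]

theorem phiGlued_append (u v w : List Letter) (hv : ∀ l ∈ v, unglue l = none) :
    phiGlued R d u (v ++ w) = phiGlued R d (u ++ v) w := by
  induction v generalizing u with
  | nil => simp
  | cons l v ih =>
    rw [List.cons_append, phiGlued_cons u (hv l List.mem_cons_self),
      ih _ fun l hl => hv l (List.mem_cons_of_mem _ hl), List.append_assoc]
    rfl

theorem phiGlued_eq_phi (u w : List Letter) (hw : ∀ l ∈ w, unglue l = none) :
    phiGlued R d u w = phi R d (u ++ w) := by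
  have := phiGlued_append (R := R) (d := d) u w [] hw
  rwa [List.append_nil, phiGlued] at this

theorem PhiGlued_cons (u : List Letter) {l : Letter} (hl : unglue l = none) (m : Words R Letter) :
    PhiGlued R d u (cons l m) = PhiGlued R d (u ++ [l]) m :=
  DFunLike.congr_fun (words_ext (f := (PhiGlued R d u).comp (cons l))
    (g := PhiGlued R d (u ++ [l])) fun w => by
      rw [LinearMap.comp_apply, cons_wd, PhiGlued_wd, PhiGlued_wd, phiGlued_cons u hl]) m

theorem Letter.Plain.unglue_eq {l : Letter} (h : l.Plain) : unglue l = none := by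
  cases l <;> first | rfl | cases h

/-- The words of plain letters, with pairwise distinct labels, in which no point is followed
directly by the point to which it is joined. -/
structure Good (w : List Letter) : Prop where
  plain : ∀ l ∈ w, l.Plain
  nodup : (labels w).Nodup
  not_leaf_core : ∀ u v x k, w ≠ u ++ leaf x :: core x k :: v

/-- The gluing of two neighbours of a diagram given by a word is described by `glueCoef` and
`glued`. -/
theorem glueAt_phi_eq {u v : List Letter} {p q : Letter} (h : Good (u ++ p :: q :: v)) (a : Alg R d) :
    glueAt R d u.length (phi R d (u ++ p :: q :: v) a)
      = (-1 : R) ^ wdeg (deg d) u • glueCoef R d p q • phiGlued R d u (glued p q :: v) a := by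
  -- The gluing of a pair of letters is by definition the meaning of the glued letter; the other
  -- order of a leaf and another letter is reduced to this by antisymmetry.
  have key : ∀ {l p' q' : Letter}, unglue l = some (p', q') →
      glueAt R d u.length (phi R d (u ++ p' :: q' :: v) a)
        = (-1 : R) ^ wdeg (deg d) u • phiGlued R d u (l :: v) a := by
    intro l p' q' hl
    rw [phiGlued_cons_some u hl, LinearMap.smul_apply, smul_smul, sign_mul_self, one_smul,
      LinearMap.comp_apply]
  have hp := h.plain p (by simp)
  have hq := h.plain q (by simp)
  cases p with
  | core x k =>
    cases q with
    | core y l => rw [glueCoef, one_smul, glued, key (l := pair x k y l) rfl]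
    | leaf y =>
      by_cases hxy : x = y
      · subst hxy
        have hx : x ∉ labels u := by
          have := h.nodup
          rw [labels_append, labels_core_cons, List.nodup_append] at this
          exact fun hx => this.2.2 x hx x (by simp) rfl
        rw [glueAt_phi_core_leaf hx, glueCoef, if_pos rfl, glued, if_pos rfl,
          phiGlued_cons u rfl, phiGlued_eq_phi _ _ fun l hl => (h.plain l (by simp [hl])).unglue_eq,
          smul_smul]
        simp
      · rw [glueCoef, if_neg hxy, one_smul, glued, if_neg hxy, key (l := mixed x k y) rfl]
    | _ => cases hq
  | leaf x =>
    cases q with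
    | core y k =>
      have hxy : x ≠ y := by
        rintro rfl
        exact h.not_leaf_core u v x k rfl
      rw [glueAt_phi_swap u v rfl _ rfl, glueCoef, if_neg hxy, glued, key (l := mixed y k x) rfl,
        smul_comm]
      rintro z hz h'
      cases hz
      simp only [label, Option.some.injEq] at h'
      exact hxy h'.symm
    | leaf y =>
      rcases lt_trichotomy x y with hxy | rfl | hxy
      · rw [glueCoef, if_pos hxy, one_smul, glued, if_pos hxy, key (l := twin x y) rfl]
      · rw [glueAt_phi_leaf_leaf, glueCoef, if_neg (lt_irrefl _), if_neg (lt_irrefl _), zero_smul,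
          smul_zero]
      · rw [glueAt_phi_swap u v rfl (by simp [label]) rfl, glueCoef, if_neg hxy.not_gt, if_pos hxy,
          glued, if_neg hxy.not_gt, key (l := twin y x) rfl, smul_comm]
    | _ => cases hq
  | _ => cases hp

/-- The induction step for `boundaryH_phi`: gluings of letters behind the prefix `u`. -/
theorem sum_glueAt_phi {u w : List Letter} (h : Good (u ++ w)) (a : Alg R d) :
    ∑ j ∈ Finset.range (w.length - 1), glueAt R d (u.length + j) (phi R d (u ++ w) a)
      = (-1 : R) ^ wdeg (deg d) u • PhiGlued R d u (glueDer (deg d) (glueCoef R d) glued w) a := by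
  induction w generalizing u with
  | nil => simp [glueDer]
  | cons p w ih =>
    cases w with
    | nil => simp [glueDer, glueFirst]
    | cons q v =>
      have e : u ++ p :: q :: v = (u ++ [p]) ++ q :: v := by simp
      have ih' := ih (u := u ++ [p]) (e ▸ h)
      have hl : (u ++ [p]).length = u.length + 1 := by simp
      rw [← e, hl] at ih'
      simp only [List.length_cons, Nat.add_sub_cancel] at ih' ⊢
      rw [Finset.sum_range_succ', add_zero, glueAt_phi_eq h, glueDer, map_add, LinearMap.add_apply,
        map_smul, LinearMap.smul_apply, PhiGlued_cons u (h.plain p (by simp)).unglue_eq, smul_add,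
        glueFirst, map_smul, LinearMap.smul_apply, PhiGlued_wd, add_comm]
      congr 1
      rw [smul_smul, ← pow_add]
      rw [wdeg_append, wdeg_cons, wdeg_nil, add_zero] at ih'
      rw [← ih']
      refine Finset.sum_congr rfl fun j _ => ?_
      rw [add_right_comm, add_assoc]

/-- The horizontal differential of a diagram given by a word. -/
theorem boundaryH_phi {w : List Letter} (h : Good w) (a : Alg R d) :
    boundaryH R d (phi R d w a) = PhiGlued R d [] (glueDerL (deg d) (glueCoef R d) glued (wd R w)) a := by
  have := sum_glueAt_phi (R := R) (d := d) (u := []) (w := w) h a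
  rw [phi_apply, boundaryH_single_eq, ← phi_apply, glueDerL_wd, List.length_map]
  simpa using this

/-- The summand of `∂_v` which belongs to the lowest top asterisk over the point `i`. -/
def dropAt (R : Type*) [CommRing R] (d i : ℕ) : Space R d →ₗ[R] Space R d :=
  Finsupp.lsum R fun k => if k.getD i 0 = 0 then 0 else
    ((-1 : R) ^ (blockDeg d (k.take i) + k.getD i 0 * d + (d + 1) * blockDeg d (k.drop (i + 1)))) •
      (Finsupp.lsingle (k.set i (k.getD i 0 - 1)) ∘ₗ LinearMap.mulLeft R (gen R d (Gen.star i)))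

theorem dropAt_single (i : ℕ) (k : List ℕ) (a : Alg R d) : dropAt R d i (Finsupp.single k a)
    = if k.getD i 0 = 0 then 0 else
      ((-1 : R) ^ (blockDeg d (k.take i) + k.getD i 0 * d
          + (d + 1) * blockDeg d (k.drop (i + 1)))) •
      (Finsupp.single (k.set i (k.getD i 0 - 1)) (gen R d (Gen.star i) * a) : Space R d) := by
  rw [dropAt, Finsupp.lsum_apply, Finsupp.sum_single_index (by simp)]
  split_ifs <;> simp

theorem boundaryV_single_eq (k : List ℕ) (a : Alg R d) : boundaryV R d (Finsupp.single k a)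
    = ∑ i ∈ Finset.range k.length, dropAt R d i (Finsupp.single k a) := by
  simp only [boundaryV_single, dropAt_single]

/-- The drop of an asterisk over one point, in terms of letters. -/
theorem dropAt_phi (u v : List Letter) {l : Letter} (hl : l.Plain) (a : Alg R d) :
    dropAt R d u.length (phi R d (u ++ l :: v) a)
      = (-1 : R) ^ wdeg (deg d) u • dropCoef R d l • phi R d (u ++ dropped l :: v) a := by
  have e0 : (u.map top).length = u.length := List.length_map _
  have e1 : ((u ++ l :: v).map top).take u.length = u.map top := by simp
  have e2 : ((u ++ l :: v).map top).getD u.length 0 = l.top := by simp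
  have e3 : ((u ++ l :: v).map top).drop (u.length + 1) = v.map top := by
    rw [List.map_append, List.drop_append]
    simp
  have e4 : ((u ++ l :: v).map top).set u.length (l.top - 1) = u.map top ++ (l.top - 1) :: v.map top := by
    rw [List.map_append, List.map_cons, List.set_append_right _ _ (by simp), e0, Nat.sub_self,
      List.set_cons_zero]
  cases l with
  | core x k =>
    have hc : coreIdx (u ++ star x (k - 1) :: v) = coreIdx (u ++ core x k :: v) := by
      funext y
      by_cases hy : y ∈ labels u
      · rw [coreIdx_append_left hy, coreIdx_append_left hy]
      · rw [coreIdx_append_right hy, coreIdx_append_right hy, coreIdx_cons, coreIdx_cons, label, label]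
    rw [phi_apply, dropAt_single, e1, e2, e3, e4, dropped, phi_middle, hc, dropCoef]
    cases k with
    | zero => simp [top]
    | succ k =>
      rw [if_neg (by simp [top]), if_neg (by simp), joined, algOf_append, algOf, fac, map_one, one_mul,
        blockDeg_map_top, blockDeg_map_top, fac, wdeg_deg u, zero_add, ← mul_assoc, ← mul_assoc,
        (homog_gen _).comm, ← par_add, (homog_algOf _ _ _).par_eq, (homog_algOf _ _ _).par_eq, par_gen]
      simp only [top, Nat.add_sub_cancel, smul_mul_assoc, mul_smul_comm, ← Finsupp.smul_single, smul_smul,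
        ← pow_add, mul_assoc, wdeg_cons, tdeg]
      congr 1
      apply sign_congr
      generalize wdeg (tdeg d) v = V
      generalize wdeg (tdeg d) u = U
      generalize wdeg (bdeg d) u = B
      rw [show U + (k + 1) * d + (d + 1) * V + (d + 1 + (1 + (k + 1) * d + V)) * B
        = U + B + (k + 1) * d + V * (d + 1) + (V + (1 + k * d)) * B + 2 * (d * B) by ring,
        even_add_two_mul]
      ring_nf
  | leaf x =>
    have h0 : (leaf x).top = 0 := rfl
    have h1 : dropCoef R d (leaf x) = 0 := rfl
    rw [phi_apply, dropAt_single, e2, if_pos h0, h1, zero_smul, smul_zero]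
  | _ => cases hl

theorem sum_dropAt_phi (u : List Letter) {w : List Letter} (h : ∀ l ∈ w, l.Plain) (a : Alg R d) :
    ∑ j ∈ Finset.range w.length, dropAt R d (u.length + j) (phi R d (u ++ w) a)
      = (-1 : R) ^ wdeg (deg d) u • PhiGlued R d u (letterDer (deg d) (dropCoef R d) dropped w) a := by
  induction w generalizing u with
  | nil => simp [letterDer]
  | cons l v ih =>
    have hv : ∀ l ∈ v, l.Plain := fun l hl => h l (List.mem_cons_of_mem _ hl)
    have hl := h l List.mem_cons_self
    have e : u ++ l :: v = (u ++ [l]) ++ v := by simp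
    have ih' := ih (u ++ [l]) hv
    have hlen : (u ++ [l]).length = u.length + 1 := by simp
    have hd : unglue (dropped l) = none := by
      cases l <;> first | rfl | cases hl
    rw [← e, hlen] at ih'
    rw [List.length_cons, Finset.sum_range_succ', add_zero, dropAt_phi u v hl, letterDer, map_add,
      LinearMap.add_apply, map_smul, LinearMap.smul_apply, map_smul, LinearMap.smul_apply,
      PhiGlued_cons u hl.unglue_eq, smul_add, PhiGlued_wd,
      phiGlued_cons u hd, phiGlued_eq_phi _ _ fun l hl => (hv l hl).unglue_eq, add_comm,
      List.append_assoc, List.singleton_append]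
    congr 1
    rw [smul_smul, ← pow_add]
    rw [wdeg_append, wdeg_cons, wdeg_nil, add_zero] at ih'
    rw [← ih']
    refine Finset.sum_congr rfl fun j _ => ?_
    rw [add_right_comm, add_assoc]

/-- The vertical differential of a diagram given by a word. -/
theorem boundaryV_phi {w : List Letter} (h : ∀ l ∈ w, l.Plain) (a : Alg R d) :
    boundaryV R d (phi R d w a)
      = PhiGlued R d [] (letterDerL (deg d) (dropCoef R d) dropped (wd R w)) a := by
  have := sum_dropAt_phi (R := R) (d := d) [] h a
  rw [phi_apply, boundaryV_single_eq, ← phi_apply, letterDerL_wd, List.length_map]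
  simpa using this

/-- The differential of a diagram given by a word. -/
theorem boundary_phi {w : List Letter} (h : Good w) (a : Alg R d) :
    boundary R d (phi R d w a) = PhiGlued R d [] (bdWord R d (wd R w)) a := by
  rw [boundary, LinearMap.add_apply, boundaryH_phi h, boundaryV_phi h.plain, bdWord,
    LinearMap.add_apply, map_add, LinearMap.add_apply]

end

section

open Letter

variable {R : Type*} [CommRing R] {d ℓ : ℕ}

/-! ### Quantum binomial coefficients at `q = (-1)^d` -/

/-- The Pascal identity for quantum binomial coefficients at `q = (-1) ^ d`. -/
theorem qbinom_succ_succ (d k n : ℕ) : (qbinom d (k + 1) (n + 1) : R)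
    = qbinom d k (n + 1) + (-1 : R) ^ (d * (k + 1)) * qbinom d (k + 1) n := by
  have sg : ∀ m : ℕ, ¬ Even d → (-1 : R) ^ (d * m) = (-1 : R) ^ m := fun m hd =>
    sign_congr (by simp [Nat.even_mul, hd])
  by_cases hd : Even d
  · rw [sign_congr (n := 0) (by simp [hd])]
    simp only [qbinom, if_pos hd, pow_zero, one_mul]
    rw [show k + 1 + (n + 1) = (k + (n + 1)) + 1 by ring, Nat.choose_succ_succ]
    push_cast
    congr 3
    omega
  -- For odd `d`, the cases are the parities of `k` and `n`; the ordinary Pascal identity is needed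
  -- only if both are odd.
  · rw [sg _ hd]
    simp only [qbinom, if_neg hd]
    obtain ⟨p, rfl | rfl⟩ := Nat.even_or_odd' k <;> obtain ⟨q, rfl | rfl⟩ := Nat.even_or_odd' n
    · rw [if_pos ⟨⟨p, rfl⟩, ⟨q, rfl⟩⟩, if_neg (by simp), if_neg (by simp), Odd.neg_one_pow ⟨p, rfl⟩,
        show (2 * p + (2 * q + 1)) / 2 = p + q by omega, show (2 * p + 1 + 2 * q) / 2 = p + q by omega,
        show 2 * p / 2 = p by omega, show (2 * p + 1) / 2 = p by omega]
      simp
    · rw [if_neg (by rintro ⟨-, h⟩; exact absurd h (by rw [Nat.not_odd_iff_even]; exact ⟨q + 1, by ring⟩)),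
        if_neg (by simp), if_pos ⟨⟨p, rfl⟩, ⟨q, rfl⟩⟩,
        show (2 * p + 1 + (2 * q + 1 + 1)) / 2 = p + q + 1 by omega,
        show (2 * p + (2 * q + 1 + 1)) / 2 = p + q + 1 by omega,
        show 2 * p / 2 = p by omega, show (2 * p + 1) / 2 = p by omega]
      simp
    · rw [if_neg (by rintro ⟨h, -⟩; exact absurd h (by rw [Nat.not_odd_iff_even]; exact ⟨p + 1, by ring⟩)),
        if_pos ⟨⟨p, rfl⟩, ⟨q, rfl⟩⟩,
        if_neg (by rintro ⟨h, -⟩; exact absurd h (by rw [Nat.not_odd_iff_even]; exact ⟨p + 1, by ring⟩)),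
        Even.neg_one_pow ⟨p + 1, by ring⟩,
        show (2 * p + 1 + 1 + (2 * q + 1)) / 2 = p + q + 1 by omega,
        show (2 * p + 1 + 1 + 2 * q) / 2 = p + q + 1 by omega]
      simp
    · have ep : Even (2 * p + 1 + 1) := ⟨p + 1, by ring⟩
      have eq : Even (2 * q + 1 + 1) := ⟨q + 1, by ring⟩
      rw [if_neg (by rintro ⟨h, -⟩; exact absurd h (by rwa [Nat.not_odd_iff_even])),
        if_neg (by rintro ⟨-, h⟩; exact absurd h (by rwa [Nat.not_odd_iff_even])),
        if_neg (by rintro ⟨h, -⟩; exact absurd h (by rwa [Nat.not_odd_iff_even])),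
        ep.neg_one_pow,
        show (2 * p + 1 + 1 + (2 * q + 1 + 1)) / 2 = p + q + 1 + 1 by omega,
        show (2 * p + 1 + (2 * q + 1 + 1)) / 2 = p + q + 1 by omega,
        show (2 * p + 1 + 1 + (2 * q + 1)) / 2 = p + q + 1 by omega,
        show (2 * p + 1) / 2 = p by omega, show (2 * p + 1 + 1) / 2 = p + 1 by omega,
        Nat.choose_succ_succ]
      push_cast
      ring

/-- The Pascal identity including the boundary cases. -/
theorem qbinom_eq_add {K L : ℕ} (h : K + L ≠ 0) : (qbinom d K L : R)
    = (if K = 0 then 0 else (qbinom d (K - 1) L : R))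
      + (if L = 0 then 0 else (-1 : R) ^ (d * K) * qbinom d K (L - 1)) := by
  cases K with
  | zero =>
    cases L with
    | zero => simp at h
    | succ L => simp [qbinom_zero_left]
  | succ K =>
    cases L with
    | zero => simp [qbinom_zero]
    | succ L => simpa using qbinom_succ_succ d K L

/-- The quantum Vandermonde identity. -/
theorem sum_qbinom (m k l : ℕ) (h : m ≤ k + l) :
    ∑ p ∈ Finset.HasAntidiagonal.antidiagonal m, (if p.1 ≤ k ∧ p.2 ≤ l then
      (-1 : R) ^ (p.2 * (k - p.1) * d) * (qbinom d p.1 p.2 * qbinom d (k - p.1) (l - p.2)) else 0)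
      = qbinom d k l := by
  induction m generalizing k l with
  | zero => simp [qbinom_zero]
  | succ m ih =>
    have e : ∀ p ∈ Finset.HasAntidiagonal.antidiagonal (m + 1), (if p.1 ≤ k ∧ p.2 ≤ l then
        (-1 : R) ^ (p.2 * (k - p.1) * d) * (qbinom d p.1 p.2 * qbinom d (k - p.1) (l - p.2)) else 0)
        = (if p.1 = 0 then 0 else if p.1 ≤ k ∧ p.2 ≤ l then (-1 : R) ^ (p.2 * (k - p.1) * d) *
            (qbinom d (p.1 - 1) p.2 * qbinom d (k - p.1) (l - p.2)) else 0)
          + (if p.2 = 0 then 0 else if p.1 ≤ k ∧ p.2 ≤ l then (-1 : R) ^ (p.2 * (k - p.1) * d) *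
            ((-1 : R) ^ (d * p.1) * qbinom d p.1 (p.2 - 1) * qbinom d (k - p.1) (l - p.2)) else 0) := by
      intro p hp
      have hp := Finset.HasAntidiagonal.mem_antidiagonal.1 hp
      split_ifs with h1 h2 h3 h3
      · omega
      · rw [qbinom_eq_add (K := p.1) (by omega), if_pos h2, if_neg h3]; ring
      · rw [qbinom_eq_add (K := p.1) (by omega), if_neg h2, if_pos h3]; ring
      · rw [qbinom_eq_add (K := p.1) (by omega), if_neg h2, if_neg h3]; ring
      all_goals ring
    -- Both sides satisfy the Pascal recursion: the two sums are those for `k - 1` and `l - 1`.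
    rw [Finset.sum_congr rfl e, Finset.sum_add_distrib, Finset.Nat.sum_antidiagonal_succ,
      Finset.Nat.sum_antidiagonal_succ' (f := fun p : ℕ × ℕ => if p.2 = 0 then (0 : R) else _),
      if_pos rfl, if_pos rfl, zero_add, zero_add, qbinom_eq_add (K := k) (L := l) (by omega)]
    congr 1
    · cases k with
      | zero => simp
      | succ k =>
        rw [if_neg (by omega), Nat.add_sub_cancel, ← ih k l (by omega)]
        refine Finset.sum_congr rfl fun p _ => ?_
        simp
    · cases l with
      | zero => simp
      | succ l =>
        rw [if_neg (by omega), Nat.add_sub_cancel, ← ih k l (by omega), Finset.mul_sum]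
        refine Finset.sum_congr rfl fun p _ => ?_
        simp only [Nat.add_eq_zero_iff, one_ne_zero, and_false, if_false, Nat.add_le_add_iff_right,
          Nat.add_sub_cancel, Nat.add_sub_add_right]
        split_ifs with h1
        · obtain ⟨j, rfl⟩ := Nat.exists_eq_add_of_le h1.1
          rw [Nat.add_sub_cancel_left]
          have : (-1 : R) ^ ((p.2 + 1) * j * d) * (-1 : R) ^ (d * p.1)
              = (-1 : R) ^ (d * (p.1 + j)) * (-1 : R) ^ (p.2 * j * d) := by
            rw [← pow_add, ← pow_add]; congr 1; ring
          linear_combination (qbinom d p.1 p.2 * qbinom d j (l - p.2) : R) * this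
        · simp

end

section

open Letter

variable {R : Type*} [CommRing R] {d ℓ : ℕ}

/-! ### Expansion of a pair of glued points -/

/-- A leaf has the parity of `d`, so the shuffle products of its powers are governed by quantum
binomial coefficients. -/
theorem sh_replicate_leaf (x a b : ℕ) :
    sh (deg d) (wd R (List.replicate a (leaf x))) (wd R (List.replicate b (leaf x)))
      = (qbinom d a b : R) • wd R (List.replicate (a + b) (leaf x)) := by
  induction hn : a + b using Nat.strong_induction_on generalizing a b with
  | _ n ih =>
  match a, b with
  | 0, b => simp [qbinom_zero_left, ← hn]
  | a + 1, 0 => simp [qbinom_zero, ← hn]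
  | a + 1, b + 1 =>
    have h1 := ih (a + (b + 1)) (by omega) a (b + 1) rfl
    have h2 := ih (a + 1 + b) (by omega) (a + 1) b rfl
    rw [← hn, List.replicate_succ, List.replicate_succ, ← cons_wd, ← cons_wd, cons_sh_cons, cons_wd,
      cons_wd, ← List.replicate_succ, ← List.replicate_succ, pm_wd, wdeg_replicate_leaf, map_smul,
      LinearMap.smul_apply, h1, h2, map_smul, map_smul, map_smul, cons_wd, cons_wd,
      ← List.replicate_succ, ← List.replicate_succ, qbinom_succ_succ, add_smul, smul_smul]
    rw [show a + (b + 1) + 1 = a + 1 + (b + 1) by ring, mul_comm ((-1 : R) ^ _)]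
    rw [mul_comm ((-1 : R) ^ (d * (a + 1)))]
    congr 3
    apply sign_congr
    rw [show deg d (leaf x) = d + 2 * 1 by simp only [deg, tdeg, bdeg, top]; ring,
      show (d + 2 * 1) * ((a + 1) * (1 + (d + 1))) = d * (a + 1) + 2 * ((d + 2) * (a + 1))
        + d * (d + 1) * (a + 1) by ring, Nat.even_add, even_add_two_mul]
    simp [Nat.even_mul, Nat.even_add_one, Nat.even_or_odd d]

/-- The coefficient of `merge i` in the gluing of the points with labels `i` and `i + 1`. -/
def mergeCoef (R : Type*) [CommRing R] (d : ℕ) : Letter → R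
  | pair _ k _ l => (-1 : R) ^ (k * d) * qbinom d k l
  | mixed _ _ _ => 0
  | twin _ _ => 0
  | _ => 1

/-- The effect of gluing on a letter, with coefficient. -/
def contract (R : Type*) [CommRing R] (d i : ℕ) (l : Letter) : Words R Letter :=
  mergeCoef R d l • wd R [merge i l]

theorem contract_compat (i : ℕ) : ZinCompat (deg d) (deg d) (contract R d i) := by
  intro l
  cases l with
  | pair x k y l =>
    refine Submodule.smul_mem _ _ (wd_mem ⟨by simp, ?_⟩)
    rw [wdeg_cons, wdeg_nil, show deg d (pair x k y l) = deg d (merge i (pair x k y l)) + 0 + 2 * 1 by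
      simp only [merge, deg, tdeg, bdeg, top]; ring, even_add_two_mul]
  | mixed => simp [contract, mergeCoef]
  | twin => simp [contract, mergeCoef]
  | _ => exact Submodule.smul_mem _ _ (wd_mem ⟨by simp, by simp [merge, deg, tdeg, bdeg, top]⟩)

theorem zin_contract (i : ℕ) {w : List Letter} (hw : ∀ l ∈ w, l.Plain) :
    zin (deg d) (contract R d i) w = wd R (w.map (merge i)) := by
  induction w with
  | nil => rfl
  | cons l w ih =>
    have h1 : mergeCoef R d l = 1 := by
      have := hw l List.mem_cons_self
      cases l <;> first | rfl | cases this
    rw [zin, ih fun l hl => hw l (List.mem_cons_of_mem _ hl), contract, h1, one_smul, hs_wd_cons, one_sh,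
      cons_wd, List.map_cons]

theorem zin_contract_pair (i x k y l : ℕ) {u v : List Letter} (hu : ∀ l ∈ u, l.Plain)
    (hv : ∀ l ∈ v, l.Plain) : zin (deg d) (contract R d i) (u ++ pair x k y l :: v)
      = ((-1 : R) ^ (k * d) * qbinom d k l) •
        wd R (u.map (merge i) ++ core (gluePos i x) (k + l) :: v.map (merge i)) := by
  induction u with
  | nil =>
    rw [List.nil_append, zin, zin_contract i hv, contract, map_smul, LinearMap.smul_apply, hs_wd_cons,
      one_sh, cons_wd]
    rfl
  | cons p u ih =>
    have h1 : mergeCoef R d p = 1 := by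
      have := hu p List.mem_cons_self
      cases p <;> first | rfl | cases this
    rw [List.cons_append, zin, ih fun l hl => hu l (List.mem_cons_of_mem _ hl), contract, h1, one_smul,
      hs_wd_cons, one_sh, map_smul, cons_wd, List.map_cons, List.cons_append]

/-- Half-shuffle homomorphisms can be composed. -/
theorem zinL_zin {U V W : Type*} {degV : V → ℕ} {degW : W → ℕ} {X : U → Words R V} {Y : V → Words R W}
    (hY : ZinCompat degV degW Y) (w : List U) :
    zinL degW Y (zin degV X w) = zin degW (fun x => zinL degW Y (X x)) w := by
  induction w with
  | nil => rw [zin, zinL_wd]; rfl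
  | cons x w ih => rw [zin, zin, hY.zin_hs, ih]

theorem contract_expand (i x k : ℕ) : zinL (deg d) (contract R d i) (expand R (core x k))
    = expand R (core (gluePos i x) k) := by
  rw [expand, expand, map_sum]
  refine Finset.sum_congr rfl fun j _ => ?_
  rw [zinL_wd, zin_contract i]
  · rw [List.map_cons, List.map_replicate]; rfl
  · intro l hl
    rcases List.mem_cons.1 hl with rfl | hl
    · trivial
    · rw [(List.mem_replicate.1 hl).2]; trivial

/-- Expansion of two glued points, followed by the identification of their labels, is the expansion
of the resulting point: the numbers of ways to shuffle the asterisks and the leaves add up, by the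
quantum Vandermonde identity. -/
theorem contract_expandPair (i k l : ℕ) :
    zinL (deg d) (contract R d i) (expandPair R d (pair i k (i + 1) l))
      = ((-1 : R) ^ (k * d) * qbinom d k l) • expand R (core i (k + l)) := by
  have hg : gluePos i (i + 1) = i := gluePos_succ le_rfl
  have hg' : gluePos i i = i := gluePos_of_lt le_rfl
  -- The leaves of both points become leaves of the same point.
  have h1 : ∀ a b : ℕ, zinL (deg d) (contract R d i) (cons (pair i (k - a) (i + 1) (l - b))
      (sh (deg d) (wd R (List.replicate a (leaf i))) (wd R (List.replicate b (leaf (i + 1))))))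
      = ((-1 : R) ^ ((k - a) * d) * (qbinom d (k - a) (l - b) * qbinom d a b)) •
        wd R (core i (k - a + (l - b)) :: List.replicate (a + b) (leaf i)) := by
    intro a b
    rw [zinL_cons, (contract_compat i).zin_sh, zinL_wd, zinL_wd, zin_contract, zin_contract,
      List.map_replicate, List.map_replicate, merge, merge, hg, hg', sh_replicate_leaf, contract,
      map_smul, map_smul, LinearMap.smul_apply, hs_wd_cons, one_sh, cons_wd, smul_smul, merge, hg']
    · congr 1
      rw [mergeCoef]
      ring
    · intro l hl; rw [(List.mem_replicate.1 hl).2]; trivial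
    · intro l hl; rw [(List.mem_replicate.1 hl).2]; trivial
  -- The sign in `expandPair` is the one of the quantum Vandermonde identity.
  have h2 : ∀ a ∈ Finset.range (k + 1), ∀ b ∈ Finset.range (l + 1),
      (-1 : R) ^ (deg d (core (i + 1) (l - b)) * (a * deg d (leaf i))) * ((-1 : R) ^ ((k - a) * d))
        = (-1 : R) ^ (k * d) * (-1 : R) ^ ((l - b) * (k - (k - a)) * d) := by
    intro a ha b _
    have ha := Finset.mem_range.1 ha
    obtain ⟨j, rfl⟩ := Nat.exists_eq_add_of_le (show a ≤ k by omega)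
    rw [Nat.add_sub_cancel_left, Nat.add_sub_cancel, ← pow_add, ← pow_add]
    apply sign_congr
    generalize l - b = t
    rw [show deg d (core (i + 1) t) = 1 + t * d by simp [deg, tdeg, bdeg, top],
      show deg d (leaf i) = d + 2 by simp only [deg, tdeg, bdeg, top]; ring,
      show (1 + t * d) * (a * (d + 2)) + j * d
        = (a * d + j * d) + t * a * (d * d) + 2 * (a + a * t * d) by ring, even_add_two_mul,
      add_mul, Nat.even_add, Nat.even_add (m := a * d + j * d)]
    simp only [Nat.even_mul, or_self]
  rw [expandPair, map_sum]
  simp only [map_sum, map_smul, h1, smul_smul]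
  -- Terms are indexed by the numbers `K = k - a` and `L = l - b` of remaining top asterisks and
  -- collected by `m = K + L`.
  have h3 : ∀ a ∈ Finset.range (k + 1), ∀ b ∈ Finset.range (l + 1),
      ((-1 : R) ^ (deg d (core (i + 1) (l - b)) * (a * deg d (leaf i))) *
        ((-1 : R) ^ ((k - a) * d) * (qbinom d (k - a) (l - b) * qbinom d a b))) •
        wd R (core i (k - a + (l - b)) :: List.replicate (a + b) (leaf i))
      = (-1 : R) ^ (k * d) • ((-1 : R) ^ ((l - b) * (k - (k - a)) * d)
          * (qbinom d (k - a) (l - b) * qbinom d (k - (k - a)) (l - (l - b)))) •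
        wd R (core i (k + l - (k + l - (k - a + (l - b)))) ::
          List.replicate (k + l - (k - a + (l - b))) (leaf i)) := by
    intro a ha b hb
    rw [smul_smul, ← mul_assoc, h2 a ha b hb]
    have ha := Finset.mem_range.1 ha
    have hb := Finset.mem_range.1 hb
    rw [show k - (k - a) = a by omega, show l - (l - b) = b by omega,
      show k + l - (k - a + (l - b)) = a + b by omega,
      show k + l - (a + b) = k - a + (l - b) by omega, mul_assoc]
  rw [Finset.sum_congr rfl fun a ha => Finset.sum_congr rfl (h3 a ha)]
  simp only [← Finset.smul_sum]
  rw [mul_smul]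
  congr 1
  have h4 := Finset.sum_range_reflect (fun K => ∑ b ∈ Finset.range (l + 1),
    ((-1 : R) ^ ((l - b) * (k - K) * d) * (qbinom d K (l - b) * qbinom d (k - K) (l - (l - b)))) •
      wd R (core i (k + l - (k + l - (K + (l - b)))) ::
        List.replicate (k + l - (K + (l - b))) (leaf i))) (k + 1)
  rw [Nat.add_sub_cancel] at h4
  rw [h4]
  have h5 : ∀ K : ℕ, _ := fun K => Finset.sum_range_reflect (fun L =>
    ((-1 : R) ^ (L * (k - K) * d) * (qbinom d K L * qbinom d (k - K) (l - L))) •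
      wd R (core i (k + l - (k + l - (K + L))) ::
        List.replicate (k + l - (K + L)) (leaf i))) (l + 1)
  simp only [Nat.add_sub_cancel] at h5
  rw [Finset.sum_congr rfl fun K _ => h5 K, expand, Finset.smul_sum, ← Finset.sum_product',
    ← Finset.sum_range_reflect _ (k + l + 1), Nat.add_sub_cancel,
    ← Finset.sum_fiberwise_of_maps_to (t := Finset.range (k + l + 1)) (g := fun p : ℕ × ℕ => p.1 + p.2)]
  · refine Finset.sum_congr rfl fun m hm => ?_
    have hm := Finset.mem_range.1 hm
    rw [← sum_qbinom m k l (by omega), Finset.sum_smul, ← Finset.sum_filter_add_sum_filter_not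
      (Finset.HasAntidiagonal.antidiagonal m) (fun p => p.1 ≤ k ∧ p.2 ≤ l),
      Finset.sum_eq_zero (s := Finset.filter (fun p : ℕ × ℕ => ¬ (p.1 ≤ k ∧ p.2 ≤ l)) _), add_zero]
    · refine Finset.sum_congr ?_ ?_
      · ext p
        simp only [Finset.mem_filter, Finset.mem_product, Finset.mem_range,
          Finset.HasAntidiagonal.mem_antidiagonal]
        omega
      · intro p hp
        simp only [Finset.mem_filter, Finset.HasAntidiagonal.mem_antidiagonal] at hp
        rw [if_pos hp.2, hp.1]
    · intro p hp
      rw [if_neg (Finset.mem_filter.1 hp).2, zero_smul]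
  · rintro ⟨p, q⟩ hp
    simp only [Finset.mem_product, Finset.mem_range] at hp ⊢
    omega

end

section

open Letter

variable {R : Type*} [CommRing R] {d ℓ : ℕ}

/-! ### The map `I` intertwines the differentials -/

theorem ExpandsTo.plain {w v : List Letter} (h : ExpandsTo w v) : ∀ l ∈ v, l.Plain := by
  intro l hl
  rcases h.letter hl with ⟨y, -, k, rfl⟩ | ⟨y, -, rfl⟩ <;> trivial

/-- The words in the values of `I` are such that `boundary_phi` applies. -/
theorem good_of_ordered {w v : List Letter} (hw : IsCoreWord w) (h : ExpandsTo w v)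
    (ho : Ordered ∅ v) : Good v where
  plain := h.plain
  nodup := h.labels_perm.nodup_iff.2 hw.2
  not_leaf_core := by
    rintro u v' x k rfl
    have h1 := ho.mem_take (u.length + 1) (y := x) (by simp [List.take_append])
    have e : (u ++ leaf x :: core x k :: v').take (u.length + 1) = u ++ [leaf x] := by
      simp [List.take_append]
    rw [e, labels_append] at h1
    have h2 : x ∈ labels u := by
      simpa [labels, label] using h1
    have h3 := h.labels_perm.nodup_iff.2 hw.2
    rw [labels_append, List.nodup_append] at h3
    exact h3.2.2 x h2 x (by simp [labels, label]) rfl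

/-- The differential of a value of `I` in terms of words. -/
theorem boundary_Phi_IWord {w : List Letter} (hw : IsCoreWord w) (a : Alg R d) :
    boundary R d (Phi R d (IWord R d w) a) = PhiGlued R d [] (bdWord R d (IWord R d w)) a := by
  refine eqOn_wordsIn (P := fun v => ExpandsTo w v ∧ Ordered ∅ v)
    (f := (boundary R d).comp ((Phi R d).flip a))
    (g := ((PhiGlued R d []).flip a).comp (bdWord R d)) (fun v hv => ?_)
    (wordsIn_and (IWord_expandsTo hw) (IWord_ordered hw ∅))
  simp only [LinearMap.comp_apply, LinearMap.flip_apply, Phi_wd]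
  exact boundary_phi (good_of_ordered hw hv.1 hv.2) a

theorem coreWord_congr {x y : ℕ → ℕ} {k : List ℕ} (h : ∀ p < k.length, x p = y p) :
    coreWord x k = coreWord y k := by
  induction k generalizing x y with
  | nil => rfl
  | cons t k ih =>
    rw [coreWord_cons, coreWord_cons, h 0 (by simp), ih (x := x ∘ Nat.succ) (y := y ∘ Nat.succ) fun p hp => h (p + 1) (by simpa using hp)]

theorem coreWord_append (x : ℕ → ℕ) (k l : List ℕ) :
    coreWord x (k ++ l) = coreWord x k ++ coreWord (fun p => x (k.length + p)) l := by
  induction k generalizing x with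
  | nil => simp
  | cons t k ih =>
    rw [List.cons_append, coreWord_cons, ih, coreWord_cons, List.cons_append]
    congr 3
    funext p
    simp only [Function.comp_apply, List.length_cons]
    congr 1
    omega

/-- The words which arise by gluing of two neighbour points of a diagram. -/
theorem glueDer_coreWord (x : ℕ → ℕ) (k : List ℕ) :
    glueDer (deg d) (glueCoef R d) glued (coreWord x k) = ∑ i ∈ Finset.range (k.length - 1),
      (-1 : R) ^ blockDeg d (k.take i) • wd R (coreWord x (k.take i) ++
        pair (x i) (k.getD i 0) (x (i + 1)) (k.getD (i + 1) 0) ::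
          coreWord (fun p => x (i + 2 + p)) (k.drop (i + 2))) := by
  induction k generalizing x with
  | nil => rfl
  | cons s k ih =>
    cases k with
    | nil => simp [glueDer, glueFirst]
    | cons t k =>
      rw [coreWord_cons, glueDer, ih, List.length_cons, Nat.add_sub_cancel, List.length_cons,
        List.length_cons, Nat.add_sub_cancel, Finset.sum_range_succ', map_sum, Finset.smul_sum, add_comm]
      congr 1
      · refine Finset.sum_congr rfl fun i _ => ?_
        rw [map_smul, smul_smul, ← pow_add, cons_wd, List.take_succ_cons, List.drop_succ_cons,
          coreWord_cons]
        congr 2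
        simp only [List.cons_append, Function.comp_apply, List.getD_cons_succ, Nat.succ_eq_add_one]
        congr 4
        funext p
        congr 1
        omega
      · rw [coreWord_cons, glueFirst, glueCoef, one_smul, glued]
        simp only [List.take_zero, coreWord_nil, List.nil_append, List.drop_succ_cons, List.drop_zero,
          List.getD_cons_zero, List.getD_cons_succ, blockDeg, List.map_nil, List.sum_nil, pow_zero,
          one_smul, Function.comp_apply]
        congr 3
        funext p
        simp only [Function.comp_apply]
        congr 1
        omega

/-- If no glued pair occurs, expansion and identification of labels give the expansion of the
relabelled word. -/
theorem zin_contract_expand (i : ℕ) (x : ℕ → ℕ) (k : List ℕ) :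
    zin (deg d) (fun l => zinL (deg d) (contract R d i) (expandPair R d l)) (coreWord x k)
      = IWord R d (coreWord (gluePos i ∘ x) k) := by
  induction k generalizing x with
  | nil => rfl
  | cons t k ih =>
    rw [coreWord_cons, zin, ih, coreWord_cons, IWord, zin]
    congr 2
    exact contract_expand i (x 0) t

/-- Expansion and identification of labels for a word with one glued pair. -/
theorem zin_contract_expandPair (i k l : ℕ) (x y : ℕ → ℕ) (κ κ' : List ℕ) :
    zin (deg d) (fun l => zinL (deg d) (contract R d i) (expandPair R d l))
      (coreWord x κ ++ pair i k (i + 1) l :: coreWord y κ')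
      = ((-1 : R) ^ (k * d) * qbinom d k l) • IWord R d
        (coreWord (gluePos i ∘ x) κ ++ core i (k + l) :: coreWord (gluePos i ∘ y) κ') := by
  induction κ generalizing x with
  | nil =>
    rw [coreWord_nil, List.nil_append, zin, zin_contract_expand, contract_expandPair, map_smul,
      LinearMap.smul_apply]
    rfl
  | cons t κ ih =>
    rw [coreWord_cons, List.cons_append, zin, ih, map_smul, coreWord_cons, List.cons_append, IWord, zin]
    congr 3
    exact contract_expand i (x 0) t

/-- Words with exactly one glued letter, which stands for the gluing of the points with labels `i` and
`i + 1`. -/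
def OnePair (i : ℕ) (w : List Letter) : Prop := ∃ k l v, w.Perm (pair i k (i + 1) l :: v) ∧
  (∀ l ∈ v, l.Plain) ∧ (i :: (i + 1) :: labels v).Nodup

/-- For a word with a single glued pair of points `i` and `i + 1`, the gluing amounts to an
identification of the two labels. -/
theorem PhiGlued_contract {i : ℕ} {w : List Letter} (h : OnePair i w) (a : Alg R d) :
    phiGlued R d [] w a = Phi R d (zin (deg d) (contract R d i) w) (glue R d i a) := by
  obtain ⟨k, l, v, hp, hv, hn⟩ := h
  obtain ⟨u, v', rfl⟩ := List.append_of_mem (hp.mem_iff.2 List.mem_cons_self)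
  have hp' : (u ++ v').Perm v := (List.perm_cons _).1 (List.perm_middle.symm.trans hp)
  have hu : ∀ l ∈ u, l.Plain := fun l hl => hv l (hp'.mem_iff.1 (by simp [hl]))
  have hv' : ∀ l ∈ v', l.Plain := fun l hl => hv l (hp'.mem_iff.1 (by simp [hl]))
  have hn' : (labels (u ++ core i k :: core (i + 1) l :: v')).Nodup := by
    have : (labels (u ++ core i k :: core (i + 1) l :: v')).Perm (i :: (i + 1) :: labels v) := by
      have e : (i :: (i + 1) :: labels v) = labels (core i k :: core (i + 1) l :: v) := by
        rw [labels_core_cons, labels_core_cons]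
      rw [e]
      refine List.Perm.filterMap _ (List.perm_middle.trans (List.Perm.cons _ ?_))
      exact List.perm_middle.trans (List.Perm.cons _ hp')
    exact this.nodup_iff.2 hn
  rw [phiGlued_append _ _ _ fun l hl => (hu l hl).unglue_eq, List.nil_append,
    phiGlued_cons_some u (p := core i k) (q := core (i + 1) l) rfl, LinearMap.smul_apply,
    LinearMap.comp_apply, glueAt_phi_core_core hu hv' hn', zin_contract_pair i i k (i + 1) l hu hv',
    map_smul, LinearMap.smul_apply, Phi_wd, gluePos_of_lt le_rfl]

/-- The expansion of a word with one glued pair has this pair in all terms. -/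
theorem zin_expandPair_onePair {i k l : ℕ} {u v : List Letter}
    (hw : IsCoreWord (u ++ core i k :: core (i + 1) l :: v)) :
    zin (deg d) (expandPair R d) (u ++ pair i k (i + 1) l :: v) ∈ wordsIn R (OnePair i) := by
  have key : ∀ u : List Letter, (∀ l ∈ u, ∃ x k, l = core x k) → IsCoreWord v →
      zin (deg d) (expandPair R d) (u ++ pair i k (i + 1) l :: v) ∈ wordsIn R fun w =>
        ∃ k l v', w.Perm (pair i k (i + 1) l :: v') ∧ (∀ l ∈ v', l.Plain) ∧
          (labels v').Perm (labels u ++ labels v) := by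
    intro u hu hv
    induction u with
    | nil =>
      rw [List.nil_append, zin, zin_expandPair hv]
      refine hs_mem (deg d) (P := fun e => ∃ k l v', e.Perm (pair i k (i + 1) l :: v') ∧
        (∀ l ∈ v', l.Plain) ∧ labels v' = []) ?_ ?_ (IWord_expandsTo hv)
      · rintro e v₁ ⟨k, l, v', h1, h2, h3⟩ hv₁ w hw
        refine ⟨k, l, v' ++ v₁, hw.trans (h1.append_right v₁), ?_, ?_⟩
        · intro l hl
          rcases List.mem_append.1 hl with h | h
          · exact h2 l h
          · exact hv₁.plain l h
        · rw [labels_append, h3]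
          exact hv₁.labels_perm
      · refine Submodule.sum_mem _ fun a _ => Submodule.sum_mem _ fun b _ => Submodule.smul_mem _ _ ?_
        refine cons_mem _ (P := fun e => e.Perm (List.replicate a (leaf i) ++
          List.replicate b (leaf (i + 1)))) (fun e he => ⟨k - a, l - b, _, he.cons _, ?_, ?_⟩) ?_
        · rw [sh_wd]
          exact shWord_perm _ _ _
        · intro l hl
          rcases List.mem_append.1 hl with h | h <;> rw [(List.mem_replicate.1 h).2] <;> trivial
        · rw [labels_append, labels_replicate_leaf, labels_replicate_leaf, List.nil_append]
    | cons p u ih =>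
      obtain ⟨x, t, rfl⟩ := hu p List.mem_cons_self
      rw [List.cons_append, zin]
      refine hs_mem (deg d) (P := fun e => ∃ j, e = core x (t - j) :: List.replicate j (leaf x))
        ?_ ?_ (ih fun l hl => hu l (List.mem_cons_of_mem _ hl))
      · rintro _ v₁ ⟨j, rfl⟩ ⟨k, l, v', h1, h2, h3⟩ w hw
        refine ⟨k, l, (core x (t - j) :: List.replicate j (leaf x)) ++ v', ?_, ?_, ?_⟩
        · exact hw.trans ((h1.append_left _).trans List.perm_middle)
        · intro l hl
          rcases List.mem_append.1 hl with h | h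
          · rcases List.mem_cons.1 h with rfl | h
            · trivial
            · rw [(List.mem_replicate.1 h).2]; trivial
          · exact h2 l h
        · rw [labels_append, labels_core_cons, labels_core_cons, labels_replicate_leaf]
          exact h3.cons x
      · exact Submodule.sum_mem _ fun j _ => wd_mem ⟨j, rfl⟩
  have hv : IsCoreWord v := by
    obtain ⟨h1, h2⟩ := hw
    refine ⟨fun l hl => h1 l (by simp [hl]), ?_⟩
    rw [labels_append, labels_core_cons, labels_core_cons] at h2
    exact (List.nodup_cons.1 (List.nodup_cons.1 (List.nodup_append.1 h2).2.1).2).2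
  refine wordsIn_mono ?_ (key u (fun l hl => hw.1 l (by simp [hl])) hv)
  rintro w ⟨k', l', v', h1, h2, h3⟩
  refine ⟨k', l', v', h1, h2, ?_⟩
  have h4 : (i :: (i + 1) :: labels v').Perm (labels (u ++ core i k :: core (i + 1) l :: v)) := by
    rw [labels_append, labels_core_cons, labels_core_cons]
    refine List.Perm.trans ?_ List.perm_middle.symm
    refine List.Perm.cons _ (List.Perm.trans ?_ List.perm_middle.symm)
    exact h3.cons _
  exact h4.nodup_iff.2 hw.2

/-- The diagrams given by the expansion of a glued pair, in terms of the identification of labels.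
-/
theorem PhiGlued_zin_expandPair {i k l : ℕ} {u v : List Letter}
    (hw : IsCoreWord (u ++ core i k :: core (i + 1) l :: v)) (a : Alg R d) :
    PhiGlued R d [] (zin (deg d) (expandPair R d) (u ++ pair i k (i + 1) l :: v)) a
      = Phi R d (zin (deg d) (fun l => zinL (deg d) (contract R d i) (expandPair R d l))
          (u ++ pair i k (i + 1) l :: v)) (glue R d i a) := by
  rw [← zinL_zin (contract_compat i)]
  refine eqOn_wordsIn (f := (PhiGlued R d []).flip a) (P := OnePair i)
    (g := ((Phi R d).flip (glue R d i a)).comp (zinL (deg d) (contract R d i))) (fun w h => ?_)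
    (zin_expandPair_onePair hw)
  simp only [LinearMap.comp_apply, LinearMap.flip_apply, PhiGlued_wd, zinL_wd]
  exact PhiGlued_contract h a

theorem coreWord_eq_split {k : List ℕ} {i : ℕ} (hi : i + 1 < k.length) (x : ℕ → ℕ) :
    coreWord x k = coreWord x (k.take i) ++ core (x i) (k.getD i 0) ::
      core (x (i + 1)) (k.getD (i + 1) 0) :: coreWord (fun p => x (i + 2 + p)) (k.drop (i + 2)) := by
  have e : k = k.take i ++ k.getD i 0 :: k.getD (i + 1) 0 :: k.drop (i + 2) := by
    rw [List.getD_eq_getElem _ _ hi, List.getD_eq_getElem _ _ (by omega : i < k.length),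
      List.getElem_cons_drop, List.getElem_cons_drop, List.take_append_drop]
  have hl : (k.take i).length = i := by rw [List.length_take]; omega
  conv_lhs => rw [e]
  rw [coreWord_append, coreWord_cons, coreWord_cons, hl]
  congr 3
  refine congrArg (fun y => coreWord y _) (funext fun p => ?_)
  simp only [Function.comp_apply]
  congr 1
  omega

theorem coreWord_merged {k : List ℕ} {i : ℕ} (hi : i + 1 < k.length) (t : ℕ) :
    coreWord (gluePos i ∘ id) (k.take i) ++ core i t ::
        coreWord (gluePos i ∘ fun p => id (i + 2 + p)) (k.drop (i + 2))
      = coreWord id (k.take i ++ t :: k.drop (i + 2)) := by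
  have hl : (k.take i).length = i := by rw [List.length_take]; omega
  rw [coreWord_append, coreWord_cons, hl]
  congr 1
  · refine coreWord_congr fun p hp => ?_
    rw [hl] at hp
    exact gluePos_of_lt hp.le
  · congr 1
    refine coreWord_congr fun p _ => ?_
    simp only [Function.comp_apply, id]
    rw [gluePos]
    split_ifs <;> omega

/-- `I ∂_h = ∂ I`. -/
theorem I_boundaryH {A : Space R d} (hA : A ∈ GSpace R d) :
    I R d (boundaryH R d A) = boundary R d (I R d A) := by
  induction hA using Submodule.span_induction with
  | zero => simp
  | add A B _ _ h1 h2 => simp only [map_add, h1, h2]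
  | smul r A _ h => simp only [map_smul, h]
  | mem A h =>
    obtain ⟨k, a, ha, rfl⟩ := h
    have hid : ∀ k : List ℕ, Set.InjOn (id : ℕ → ℕ) {p | p < k.length} := fun k => Set.injOn_id _
    have hcw := isCoreWord_coreWord (hid k)
    -- After the cancellations in `bdWord_IWord`, both sides are sums over the gluings of the
    -- original points `i` and `i + 1`.
    rw [I_single (hid k) ha, relabel_id, boundary_Phi_IWord hcw, bdWord_IWord hcw, glueDer_coreWord,
      boundaryH_single_eq, map_sum, map_sum, map_sum, LinearMap.sum_apply]
    refine Finset.sum_congr rfl fun i hi => ?_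
    have hi : i + 1 < k.length := by have := Finset.mem_range.1 hi; omega
    rw [glueAt_single, map_smul, I_single (hid _), relabel_id, map_smul, map_smul, LinearMap.smul_apply,
      zinL_wd]
    · have hcw' := hcw
      rw [coreWord_eq_split hi] at hcw'
      change IsCoreWord (_ ++ core i _ :: core (i + 1) _ :: _) at hcw'
      -- The gluing of the expanded points is the expansion of the glued points.
      change _ = _ • PhiGlued R d [] (zin _ _ (_ ++ pair i _ (i + 1) _ :: _)) a
      rw [PhiGlued_zin_expandPair hcw', zin_contract_expandPair, coreWord_merged hi, map_smul,
        LinearMap.smul_apply, smul_smul, pow_add, mul_assoc]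
    · rw [length_glued _ _ _ hi]
      exact glue_mem_supp hi ha

end

section

open Letter

variable {R : Type*} [CommRing R] {d ℓ : ℕ}

/-! ### The gluing of left-most points -/

/-- The divided product of two diagrams given by words on disjoint labels is given by the
half-shuffle. -/
theorem dividedProduct_Phi {L L' : Set ℕ} (hL : ∀ x ∈ L, x ∉ L') {n n' : ℕ} {m m' : Words R Letter}
    (hm : m ∈ wordsIn R fun w => Adm L w ∧ (Even (wdeg (deg d) w) ↔ Even n))
    (hm' : m' ∈ wordsIn R fun w => Adm L' w ∧ (Even (wdeg (deg d) w) ↔ Even n'))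
    {a b : Alg R d} (ha : a ∈ supp R d L) (hb : b ∈ supp R d L') :
    dividedProduct R d ![Phi R d m a, Phi R d m' b]
      = Phi R d (hs (deg d) m m') (par R d n' a * b) := by
  have e : (![Phi R d m a, Phi R d m' b] : Fin 2 → Space R d)
      = fun i => Phi R d ((![m, m'] : Fin 2 → Words R Letter) i) ((![a, b] : Fin 2 → Alg R d) i) := by
    funext i; fin_cases i <;> rfl
  rw [dividedProduct_eq, e, shufML_Phi (L := ![L, L']) (n := ![n, n']) (S := ∅) (r := id) 0 ?_ (by simp)
    ?_ ?_ (one_mem _), nest_succ_zero, nest_succ_zero, nest_zero]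
  · have h1 : ∀ x : Words R Letter, hs (deg d) x (wd R []) = x := by
      intro x
      refine DFunLike.congr_fun (words_ext (f := (hs (deg d)).flip (wd R [])) (g := LinearMap.id)
        fun w => ?_) x
      exact hs_one _ w
    rw [h1]
    congr 1
    have h2 : Finset.Ioi (0 : Fin 2) = {1} := by decide
    simp [List.ofFn_succ, h2]
  · intro i i' x h h'
    fin_cases i <;> fin_cases i' <;> first | rfl | exact absurd h' (hL x h) | exact absurd h (hL x h')
  · intro i
    fin_cases i
    · exact wordsIn_mono (fun w hw => ⟨hw.1, hw.2, fun h => h.elim⟩) hm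
    · exact wordsIn_mono (fun w hw => ⟨hw.1, hw.2, fun h => h.elim⟩) hm'
  · intro i
    fin_cases i
    · exact ha
    · exact hb

/-- Words without unlabelled points, with the same labels as a given word and of the other parity. -/
theorem letterDer_mem {u : List Letter} (hu : ∀ l ∈ u, ∃ x k, l = core x k) :
    letterDer (deg d) (dropCoef R d) dropped u ∈ wordsIn R fun w => labels w = labels u ∧
      (∀ l ∈ w, unglue l = none ∧ ∀ x, l ≠ leaf x) ∧
        (Even (wdeg (deg d) w) ↔ Even (wdeg (deg d) u + 1)) := by
  induction u with
  | nil => exact zero_mem _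
  | cons l u ih =>
    have hu' : ∀ l ∈ u, ∃ x k, l = core x k := fun l hl => hu l (List.mem_cons_of_mem _ hl)
    obtain ⟨x, k, rfl⟩ := hu l List.mem_cons_self
    rw [letterDer]
    refine add_mem ?_ (Submodule.smul_mem _ _ (cons_mem _ (fun w hw => ⟨?_, ?_, ?_⟩) (ih hu')))
    · rcases oddLetters (R := R) (d := d) (core x k) with h | h
      · rw [h, zero_smul]
        exact zero_mem _
      · refine Submodule.smul_mem _ _ (wd_mem ⟨?_, ?_, ?_⟩)
        · rw [labels_core_cons]; rfl
        · intro l hl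
          rcases List.mem_cons.1 hl with rfl | hl
          · exact ⟨rfl, by simp [dropped]⟩
          · obtain ⟨y, t, rfl⟩ := hu' l hl
            exact ⟨rfl, by simp⟩
        · rw [wdeg_cons, wdeg_cons, Nat.even_add, h]
          simp only [Nat.even_add]
          tauto
    · rw [labels_core_cons, labels_core_cons, hw.1]
    · intro l hl
      rcases List.mem_cons.1 hl with rfl | hl
      · exact ⟨rfl, by simp⟩
      · exact hw.2.1 l hl
    · rw [wdeg_cons, wdeg_cons, Nat.even_add, hw.2.2]
      simp only [Nat.even_add]
      tauto

theorem boundaryV_Phi {m : Words R Letter} (hm : m ∈ wordsIn R fun w => ∀ l ∈ w, ∃ x k, l = core x k)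
    (a : Alg R d) : boundaryV R d (Phi R d m a)
      = Phi R d (letterDerL (deg d) (dropCoef R d) dropped m) a := by
  refine eqOn_wordsIn (f := (boundaryV R d).comp ((Phi R d).flip a))
    (g := ((Phi R d).flip a).comp (letterDerL (deg d) (dropCoef R d) dropped)) (fun w hw => ?_) hm
  simp only [LinearMap.comp_apply, LinearMap.flip_apply, Phi_wd]
  rw [boundaryV_phi, letterDerL_wd]
  · refine eqOn_wordsIn (f := (PhiGlued R d []).flip a) (g := (Phi R d).flip a) (fun v hv => ?_)
      (letterDer_mem (R := R) (d := d) hw)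
    simp only [LinearMap.flip_apply, PhiGlued_wd, Phi_wd]
    rw [phiGlued_eq_phi _ _ fun l hl => (hv.2.1 l hl).1]
    rfl
  · intro l hl
    obtain ⟨x, k, rfl⟩ := hw l hl
    trivial

theorem spaceParity_phi (w : List Letter) (a : Alg R d) : spaceParity R d (phi R d w a)
    = (-1 : R) ^ wdeg (deg d) w • phi R d w (par R d 1 a) := by
  rw [phi_apply, phi_apply, spaceParity_single, map_mul, (homog_algOf _ _ _).par_eq, relabel_par,
    smul_mul_assoc, ← Finsupp.smul_single, smul_smul, ← pow_add, blockDeg_map_top, wdeg_deg, one_mul]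

/-- The map `I` preserves the parity of the degree. -/
theorem I_spaceParity {A : Space R d} (hA : A ∈ GSpace R d) :
    I R d (spaceParity R d A) = spaceParity R d (I R d A) := by
  refine LinearMap.eqOn_span (f := (I R d).comp (spaceParity R d))
    (g := (spaceParity R d).comp (I R d)) ?_ hA
  rintro _ ⟨κ, b, hb, rfl⟩
  have hid : Set.InjOn (id : ℕ → ℕ) {p | p < κ.length} := Set.injOn_id _
  simp only [LinearMap.comp_apply]
  rw [spaceParity_single, map_smul, I_single hid (par_mem_supp _ hb), I_single hid hb, relabel_par]
  have h := expand_compat (R := R) (d := d).homog (coreWord id κ)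
  rw [wdeg_coreWord] at h
  symm
  refine eqOn_wordsIn (f := (spaceParity R d).comp ((Phi R d).flip (relabel R d id b)))
    (g := (-1 : R) ^ blockDeg d κ • (Phi R d).flip (par R d 1 (relabel R d id b))) (fun w hw => ?_) h
  simp only [LinearMap.comp_apply, LinearMap.flip_apply, Phi_wd, LinearMap.smul_apply]
  rw [spaceParity_phi, sign_congr hw]

theorem coreWord_core (x : ℕ → ℕ) (k : List ℕ) : ∀ l ∈ coreWord x k, ∃ y t, l = core y t := by
  intro l hl
  obtain ⟨p, hp, rfl⟩ := List.mem_mapIdx.1 hl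
  exact ⟨_, _, rfl⟩

/-- `∂_v` is a derivation of the divided product. -/
theorem boundaryV_dividedProduct {A B : Space R d} (hA : A ∈ GSpace R d) (hB : B ∈ GSpace R d) :
    boundaryV R d (dividedProduct R d ![spaceParity R d A, B])
      = dividedProduct R d ![boundaryV R d (spaceParity R d A), B]
        + dividedProduct R d ![A, boundaryV R d B] := by
  -- It suffices to consider diagrams, and these are given by words with disjoint labels, on which
  -- the vertical differential is an odd derivation of the half-shuffle.
  have key : ∀ κ κ' : List ℕ, ∀ a ∈ supp R d {p | p < κ.length}, ∀ b ∈ supp R d {p | p < κ'.length},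
      boundaryV R d (dividedProduct R d ![spaceParity R d (Finsupp.single κ a), Finsupp.single κ' b])
      = dividedProduct R d ![boundaryV R d (spaceParity R d (Finsupp.single κ a)), Finsupp.single κ' b]
        + dividedProduct R d ![Finsupp.single κ a, boundaryV R d (Finsupp.single κ' b)] := by
    intro κ κ' a ha b hb
    have hdis : ∀ x ∈ {y | ∃ p < κ.length, Nat.pair 0 p = y},
        x ∉ {y | ∃ p < κ'.length, Nat.pair 1 p = y} := by
      rintro _ ⟨p, -, rfl⟩ ⟨q, -, h⟩
      have := (Nat.pair_eq_pair.1 h).1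
      omega
    have ha' := relabel_coreWord (x := Nat.pair 0) ha
    have hb' := relabel_coreWord (x := Nat.pair 1) hb
    rw [← phi_coreWord (pair_injOn 0 _) ha, ← phi_coreWord (pair_injOn 1 _) hb, spaceParity_phi]
    have hu := coreWord_core (Nat.pair 0) κ
    have hv := coreWord_core (Nat.pair 1) κ'
    have au := adm_coreWord (Nat.pair 0) κ
    have av := adm_coreWord (Nat.pair 1) κ'
    generalize coreWord (Nat.pair 0) κ = u at *
    generalize coreWord (Nat.pair 1) κ' = v at *
    generalize {y | ∃ p < κ.length, Nat.pair 0 p = y} = L at *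
    generalize {y | ∃ p < κ'.length, Nat.pair 1 p = y} = L' at *
    generalize relabel R d (Nat.pair 0) a = a at *
    generalize relabel R d (Nat.pair 1) b = b at *
    have mu : wd R u ∈ wordsIn R fun w => Adm L w ∧ (Even (wdeg (deg d) w) ↔ Even (wdeg (deg d) u)) :=
      wd_mem ⟨au, Iff.rfl⟩
    have mv : wd R v ∈ wordsIn R fun w => Adm L' w ∧ (Even (wdeg (deg d) w) ↔ Even (wdeg (deg d) v)) :=
      wd_mem ⟨av, Iff.rfl⟩
    have mDu : letterDer (deg d) (dropCoef R d) dropped u ∈ wordsIn R fun w => Adm L w ∧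
        (Even (wdeg (deg d) w) ↔ Even (wdeg (deg d) u + 1)) :=
      wordsIn_mono (fun w hw => ⟨⟨fun x => by rw [hw.1]; exact au.1 x,
        fun x hx => absurd rfl ((hw.2.1 _ hx).2 x)⟩, hw.2.2⟩) (letterDer_mem hu)
    have mDv : letterDer (deg d) (dropCoef R d) dropped v ∈ wordsIn R fun w => Adm L' w ∧
        (Even (wdeg (deg d) w) ↔ Even (wdeg (deg d) v + 1)) :=
      wordsIn_mono (fun w hw => ⟨⟨fun x => by rw [hw.1]; exact av.1 x,
        fun x hx => absurd rfl ((hw.2.1 _ hx).2 x)⟩, hw.2.2⟩) (letterDer_mem hv)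
    rw [map_smul, dividedProduct_smul_left, dividedProduct_smul_left, map_smul, ← Phi_wd, ← Phi_wd,
      dividedProduct_Phi hdis mu mv (par_mem_supp _ ha') hb', boundaryV_Phi, boundaryV_Phi, boundaryV_Phi,
      letterDerL_wd, letterDerL_wd, dividedProduct_Phi hdis mDu mv (par_mem_supp _ ha') hb',
      dividedProduct_Phi hdis mu mDv ha' hb', oddLetters.der_hs, letterDerL_wd, letterDerL_wd, pm_wd,
      map_add, LinearMap.add_apply, smul_add, map_smul, LinearMap.smul_apply, map_smul,
      LinearMap.smul_apply, smul_smul, one_mul, sign_mul_self, one_smul, par_add]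
    · exact wd_mem hv
    · exact wd_mem hu
    · refine hs_mem (deg d) (P := fun w => w = u) (Q := fun w => w = v) ?_ (wd_mem rfl) (wd_mem rfl)
      rintro _ _ rfl rfl w hw l hl
      rcases List.mem_append.1 (hw.mem_iff.1 hl) with h | h
      · exact hu l h
      · exact hv l h
  let f : Space R d →ₗ[R] Space R d →ₗ[R] Space R d :=
    ((divided₂ R d).comp (spaceParity R d)).compr₂ (boundaryV R d)
  let g : Space R d →ₗ[R] Space R d →ₗ[R] Space R d :=
    (divided₂ R d).comp ((boundaryV R d).comp (spaceParity R d))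
      + (divided₂ R d).compl₂ (boundaryV R d)
  have h1 : ∀ κ : List ℕ, ∀ a ∈ supp R d {p | p < κ.length}, f (Finsupp.single κ a) B
      = g (Finsupp.single κ a) B := by
    intro κ a ha
    refine LinearMap.eqOn_span (f := f (Finsupp.single κ a)) (g := g (Finsupp.single κ a)) ?_ hB
    rintro _ ⟨κ', b, hb, rfl⟩
    exact key κ κ' a ha b hb
  refine LinearMap.eqOn_span (f := f.flip B) (g := g.flip B) ?_ hA
  rintro _ ⟨κ, a, ha, rfl⟩
  exact h1 κ a ha

/-- Only the horizontal differential contributes to the gluing of left-most points, as the vertical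
one is a derivation. -/
theorem vdash_eq {A B : Space R d} (hA : A ∈ GSpace R d) (hB : B ∈ GSpace R d) :
    vdash R d A B = - (boundaryH R d (dividedProduct R d ![spaceParity R d A, B])
      - dividedProduct R d ![boundaryH R d (spaceParity R d A), B]
      - dividedProduct R d ![A, boundaryH R d B]) := by
  rw [vdash, boundary, LinearMap.add_apply, LinearMap.add_apply, LinearMap.add_apply,
    boundaryV_dividedProduct hA hB, dividedProduct_add_left, dividedProduct_add_right]
  abel

end

section

open Letter

variable {R : Type*} [CommRing R] {d ℓ : ℕ}

/-! ### Products of letters without isolated points -/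

/-- The active points of a letter. -/
def Gen.Touches : Gen → ℕ → Prop
  | Gen.chord i j, p => i = p ∨ j = p
  | Gen.star i, p => i = p

/-- The product of a list of letters. -/
def genWord (R : Type*) [CommRing R] (d : ℕ) (L : List Gen) : Alg R d := (L.map (gen R d)).prod

@[simp] theorem genWord_cons (g : Gen) (L : List Gen) :
    genWord R d (g :: L) = gen R d g * genWord R d L := by simp [genWord]

theorem genWord_append (L L' : List Gen) :
    genWord R d (L ++ L') = genWord R d L * genWord R d L' := by simp [genWord]

/-- The span of the products of `n` letters on the points of `S` such that each point of `T` belongs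
to some letter. -/
def cov (R : Type*) [CommRing R] (d : ℕ) (S T : Set ℕ) (n : ℕ) : Submodule R (Alg R d) :=
  Submodule.span R {a | ∃ L : List Gen, (∀ g ∈ L, g.InSet S) ∧ (∀ p ∈ T, ∃ g ∈ L, g.Touches p) ∧
    L.length = n ∧ genWord R d L = a}

theorem genWord_mem_cov {S T : Set ℕ} {L : List Gen} (h : ∀ g ∈ L, g.InSet S)
    (h' : ∀ p ∈ T, ∃ g ∈ L, g.Touches p) : genWord R d L ∈ cov R d S T L.length :=
  Submodule.subset_span ⟨L, h, h', rfl, rfl⟩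

theorem cov_mono {S S' T T' : Set ℕ} {n : ℕ} (h : S ⊆ S') (h' : T' ⊆ T) :
    cov R d S T n ≤ cov R d S' T' n := by
  refine Submodule.span_mono ?_
  rintro _ ⟨L, h1, h2, h3, rfl⟩
  exact ⟨L, fun g hg => (h1 g hg).mono h, fun p hp => h2 p (h' hp), h3, rfl⟩

theorem map_mem_cov {S S' T T' : Set ℕ} {n m : ℕ} {f : Alg R d →ₗ[R] Alg R d}
    (h : ∀ L : List Gen, (∀ g ∈ L, g.InSet S) → (∀ p ∈ T, ∃ g ∈ L, g.Touches p) → L.length = n →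
      f (genWord R d L) ∈ cov R d S' T' m) {a : Alg R d} (ha : a ∈ cov R d S T n) :
    f a ∈ cov R d S' T' m := by
  refine (Submodule.span_le (p := (cov R d S' T' m).comap f)).2 ?_ ha
  rintro _ ⟨L, h1, h2, h3, rfl⟩
  exact h L h1 h2 h3

theorem mul_mem_cov {S T T' : Set ℕ} {n n' : ℕ} {a b : Alg R d} (ha : a ∈ cov R d S T n)
    (hb : b ∈ cov R d S T' n') : a * b ∈ cov R d S (T ∪ T') (n + n') := by
  refine map_mem_cov (f := LinearMap.mulRight R b) (fun L h1 h2 h3 => ?_) ha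
  refine map_mem_cov (f := LinearMap.mulLeft R (genWord R d L)) (fun L' h1' h2' h3' => ?_) hb
  rw [LinearMap.mulLeft_apply, ← genWord_append, ← h3, ← h3', ← List.length_append]
  refine genWord_mem_cov (fun g hg => ?_) fun p hp => ?_
  · rcases List.mem_append.1 hg with h | h
    exacts [h1 g h, h1' g h]
  · rcases hp with h | h
    · obtain ⟨g, hg, h⟩ := h2 p h
      exact ⟨g, List.mem_append_left _ hg, h⟩
    · obtain ⟨g, hg, h⟩ := h2' p h
      exact ⟨g, List.mem_append_right _ hg, h⟩

theorem one_mem_cov (S : Set ℕ) : (1 : Alg R d) ∈ cov R d S ∅ 0 :=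
  Submodule.subset_span ⟨[], by simp, by simp, rfl, rfl⟩

theorem gen_mem_cov {S : Set ℕ} {g : Gen} (h : g.InSet S) :
    gen R d g ∈ cov R d S {p | g.Touches p} 1 :=
  Submodule.subset_span ⟨[g], by simpa using h, fun p hp => ⟨g, by simp, hp⟩, rfl, by simp [genWord]⟩

theorem Gen.touches_relabel {f : ℕ → ℕ} {g : Gen} {p : ℕ} (h : g.Touches p) :
    (relabelGen f g).Touches (f p) := by
  cases g with
  | chord i j => exact h.imp (congrArg f) (congrArg f)
  | star i => exact congrArg f h

/-- Algebra homomorphisms which renumber the points of the letters. -/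
theorem algHom_mem_cov {S S' : Set ℕ} {f : ℕ → ℕ} (F : Alg R d →ₐ[R] Alg R d)
    (hF : ∀ g : Gen, g.InSet S → ∃ (r : R) (g' : Gen), F (gen R d g) = r • gen R d g' ∧ g'.InSet S' ∧
      ∀ p, g.Touches p → g'.Touches (f p)) {T : Set ℕ} {n : ℕ} {a : Alg R d}
    (ha : a ∈ cov R d S T n) : F a ∈ cov R d S' (f '' T) n := by
  refine map_mem_cov (f := F.toLinearMap) (fun L h1 h2 h3 => ?_) ha
  have : ∃ (r : R) (L' : List Gen), F (genWord R d L) = r • genWord R d L' ∧ (∀ g ∈ L', g.InSet S') ∧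
      L'.length = L.length ∧ ∀ p, (∃ g ∈ L, g.Touches p) → ∃ g ∈ L', g.Touches (f p) := by
    clear h2 h3
    induction L with
    | nil => exact ⟨1, [], by simp [genWord], by simp, rfl, by simp⟩
    | cons g L ih =>
      obtain ⟨r, L', e1, e2, e3, e4⟩ := ih fun g hg => h1 g (List.mem_cons_of_mem _ hg)
      obtain ⟨s, g', e5, e6, e7⟩ := hF g (h1 g List.mem_cons_self)
      refine ⟨s * r, g' :: L', ?_, ?_, by simp [e3], ?_⟩
      · rw [genWord_cons, map_mul, e1, e5, smul_mul_smul_comm, genWord_cons]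
      · intro x hx
        rcases List.mem_cons.1 hx with rfl | hx
        exacts [e6, e2 x hx]
      · rintro p ⟨x, hx, hp⟩
        rcases List.mem_cons.1 hx with rfl | hx
        · exact ⟨g', List.mem_cons_self, e7 p hp⟩
        · obtain ⟨y, hy, h⟩ := e4 p ⟨x, hx, hp⟩
          exact ⟨y, List.mem_cons_of_mem _ hy, h⟩
  obtain ⟨r, L', e1, e2, e3, e4⟩ := this
  rw [AlgHom.toLinearMap_apply, e1, ← h3, ← e3]
  refine Submodule.smul_mem _ _ (genWord_mem_cov e2 ?_)
  rintro _ ⟨p, hp, rfl⟩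
  exact e4 p (h2 p hp)

theorem relabel_mem_cov {S S' T : Set ℕ} {f : ℕ → ℕ} (h : Set.MapsTo f S S') {n : ℕ} {a : Alg R d}
    (ha : a ∈ cov R d S T n) : relabel R d f a ∈ cov R d S' (f '' T) n :=
  algHom_mem_cov _ (fun g hg => ⟨1, relabelGen f g, by rw [relabel_gen, one_smul], hg.relabel h,
    fun _ hp => Gen.touches_relabel hp⟩) ha

theorem par_mem_cov {S T : Set ℕ} (m : ℕ) {n : ℕ} {a : Alg R d} (ha : a ∈ cov R d S T n) :
    par R d m a ∈ cov R d S T n := by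
  have := algHom_mem_cov (f := id) (S' := S) (par R d m) (fun g hg => ⟨_, g, par_gen m g, hg,
    fun _ hp => hp⟩) ha
  rwa [Set.image_id] at this

/-- After a gluing, the letters touch the images of the points they touched before. -/
theorem glue_mem_cov {i n m : ℕ} (hi : i + 1 < n) {T : Set ℕ} {a : Alg R d}
    (ha : a ∈ cov R d {p | p < n} T m) :
    glue R d i a ∈ cov R d {p | p < n - 1} (gluePos i '' T) m := by
  have h : ∀ p < n, gluePos i p < n - 1 := by
    intro p hp; simp only [gluePos]; split_ifs <;> omega
  refine algHom_mem_cov _ (fun g hg => ?_) ha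
  rw [glue_gen]
  cases g with
  | star p => exact ⟨1, Gen.star (gluePos i p), by rw [glueGen, one_smul], h p hg,
      fun q hq => congrArg _ hq⟩
  | chord p q =>
    have hi' : (Gen.star i).InSet {p | p < n - 1} := show i < n - 1 by omega
    simp only [glueGen]
    split_ifs with h1 h2
    · refine ⟨1, Gen.star i, by rw [one_smul], hi', ?_⟩
      rintro x (rfl | rfl) <;> simp [Gen.Touches, gluePos, h1]
    · refine ⟨_, Gen.star i, rfl, hi', ?_⟩
      rintro x (rfl | rfl) <;> simp [Gen.Touches, gluePos, h2]
    · exact ⟨1, Gen.chord (gluePos i p) (gluePos i q), by rw [one_smul], ⟨h p hg.1, h q hg.2⟩,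
        fun x hx => hx.imp (congrArg _) (congrArg _)⟩

theorem cov_le_supp (S T : Set ℕ) (n : ℕ) {a : Alg R d} (ha : a ∈ cov R d S T n) : a ∈ supp R d S := by
  refine (Submodule.span_le (p := (supp R d S).toSubmodule)).2 ?_ ha
  rintro _ ⟨L, h1, -, -, rfl⟩
  refine Subalgebra.list_prod_mem _ fun x hx => ?_
  obtain ⟨g, hg, rfl⟩ := List.mem_map.1 hx
  exact gen_mem_supp (h1 g hg)

/-! ### The space of diagrams without isolated points -/

/-- The span of the diagrams without isolated points whose complexity, number of points and number
of top asterisks satisfy `P`. Cycles of chords are not excluded, since diagrams with a cycle vanish. -/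
def TS (R : Type*) [CommRing R] (d : ℕ) (P : ℕ → ℕ → ℕ → Prop) : Submodule R (Space R d) :=
  Submodule.span R {x | ∃ (k : List ℕ) (L : List Gen), (∀ g ∈ L, g.InSet {p | p < k.length}) ∧
    (∀ p < k.length, k.getD p 0 = 0 → ∃ g ∈ L, g.Touches p) ∧
    P (L.length + k.sum) (k.length + k.sum) k.sum ∧ Finsupp.single k (genWord R d L) = x}

theorem single_mem_TS {P : ℕ → ℕ → ℕ → Prop} {k : List ℕ} {n : ℕ} {b : Alg R d}
    (hb : b ∈ cov R d {p | p < k.length} {p | p < k.length ∧ k.getD p 0 = 0} n)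
    (h : P (n + k.sum) (k.length + k.sum) k.sum) : (Finsupp.single k b : Space R d) ∈ TS R d P := by
  refine (Submodule.span_le (p := (TS R d P).comap (Finsupp.lsingle k))).2 ?_ hb
  rintro _ ⟨L, h1, h2, rfl, rfl⟩
  exact Submodule.subset_span ⟨k, L, h1, fun p hp h0 => h2 p ⟨hp, h0⟩, h, rfl⟩

theorem TS_mono {P Q : ℕ → ℕ → ℕ → Prop} (h : ∀ i j s, P i j s → Q i j s) : TS R d P ≤ TS R d Q := by
  refine Submodule.span_mono ?_
  rintro _ ⟨k, L, h1, h2, h3, rfl⟩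
  exact ⟨k, L, h1, h2, h _ _ _ h3, rfl⟩

theorem TS_le_GSpace (P : ℕ → ℕ → ℕ → Prop) : TS R d P ≤ GSpace R d := by
  refine Submodule.span_le.2 ?_
  rintro _ ⟨k, L, h1, h2, h3, rfl⟩
  exact single_mem_GSpace (cov_le_supp _ _ _ (genWord_mem_cov (T := ∅) h1 (by simp)))

/-- The linear maps which preserve the spaces of diagrams. -/
theorem map_mem_TS {N : Type*} [AddCommMonoid N] [Module R N] {P : ℕ → ℕ → ℕ → Prop}
    {f : Space R d →ₗ[R] N} {M : Submodule R N}
    (h : ∀ (k : List ℕ) (n : ℕ), P (n + k.sum) (k.length + k.sum) k.sum →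
      ∀ b ∈ cov R d {p | p < k.length} {p | p < k.length ∧ k.getD p 0 = 0} n,
        f (Finsupp.single k b) ∈ M) {A : Space R d} (hA : A ∈ TS R d P) : f A ∈ M := by
  refine (Submodule.span_le (p := M.comap f)).2 ?_ hA
  rintro _ ⟨k, L, h1, h2, h3, rfl⟩
  exact h k _ h3 _ (genWord_mem_cov h1 fun p hp => h2 p hp.1 hp.2)

/-- All diagrams without isolated points. -/
abbrev TAll (R : Type*) [CommRing R] (d : ℕ) : Submodule R (Space R d) := TS R d fun _ _ _ => True

/-- A glued point without top asterisks comes from two points without top asterisks, which were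
touched by letters. -/
theorem glueAt_mem_TAll {k : List ℕ} {i n : ℕ} (hi : i + 1 < k.length) {b : Alg R d}
    (hb : b ∈ cov R d {p | p < k.length} {p | p < k.length ∧ k.getD p 0 = 0} n) :
    glueAt R d i (Finsupp.single k b) ∈ TAll R d := by
  rw [glueAt_single]
  refine Submodule.smul_mem _ _ (single_mem_TS (n := n) ?_ trivial)
  rw [length_glued _ _ _ hi]
  refine cov_mono subset_rfl ?_ (glue_mem_cov hi hb)
  rintro p ⟨hp, h0⟩
  have hl : (k.take i).length = i := by rw [List.length_take]; omega
  rcases lt_trichotomy p i with h | rfl | h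
  · rw [List.getD_append _ _ _ _ (by omega), List.getD_eq_getElem?_getD, List.getElem?_take_of_lt h,
      ← List.getD_eq_getElem?_getD] at h0
    exact ⟨p, ⟨by omega, h0⟩, gluePos_of_lt h.le⟩
  · rw [List.getD_append_right _ _ _ _ (by omega), hl, Nat.sub_self, List.getD_cons_zero] at h0
    exact ⟨p, ⟨by omega, by omega⟩, gluePos_of_lt le_rfl⟩
  · obtain ⟨q, rfl⟩ := Nat.exists_eq_add_of_lt h
    rw [List.getD_append_right _ _ _ _ (by omega), hl, show i + q + 1 - i = q + 1 by omega,
      List.getD_cons_succ, List.getD_eq_getElem?_getD, List.getElem?_drop,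
      ← List.getD_eq_getElem?_getD] at h0
    exact ⟨i + q + 1 + 1, ⟨by omega, by rwa [show i + q + 1 + 1 = i + 2 + q by ring]⟩,
      gluePos_succ (by omega)⟩

/-- A point that loses its last top asterisk receives a bottom asterisk. -/
theorem dropAt_mem_TAll {k : List ℕ} {i n : ℕ} (hi : i < k.length) {b : Alg R d}
    (hb : b ∈ cov R d {p | p < k.length} {p | p < k.length ∧ k.getD p 0 = 0} n) :
    dropAt R d i (Finsupp.single k b) ∈ TAll R d := by
  rw [dropAt_single]
  split_ifs with h
  · exact zero_mem _
  · refine Submodule.smul_mem _ _ (single_mem_TS (n := 1 + n) ?_ trivial)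
    rw [List.length_set]
    refine cov_mono subset_rfl ?_ (mul_mem_cov (gen_mem_cov (g := Gen.star i) hi) hb)
    rintro p ⟨hp, h0⟩
    by_cases hpi : i = p
    · exact Or.inl hpi
    · rw [List.getD_eq_getElem?_getD, List.getElem?_set_ne hpi, ← List.getD_eq_getElem?_getD] at h0
      exact Or.inr ⟨hp, h0⟩

theorem boundaryH_mem_TAll {A : Space R d} (hA : A ∈ TAll R d) : boundaryH R d A ∈ TAll R d := by
  refine map_mem_TS (fun k n _ b hb => ?_) hA
  rw [boundaryH_single_eq]
  refine Submodule.sum_mem _ fun i hi => glueAt_mem_TAll ?_ hb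
  have := Finset.mem_range.1 hi
  omega

theorem boundary_mem_TAll {A : Space R d} (hA : A ∈ TAll R d) : boundary R d A ∈ TAll R d := by
  refine add_mem (boundaryH_mem_TAll hA) (map_mem_TS (fun k n _ b hb => ?_) hA)
  rw [boundaryV_single_eq]
  exact Submodule.sum_mem _ fun i hi => dropAt_mem_TAll (Finset.mem_range.1 hi) hb

theorem spaceParity_mem_TAll {A : Space R d} (hA : A ∈ TAll R d) : spaceParity R d A ∈ TAll R d := by
  refine map_mem_TS (fun k n _ b hb => ?_) hA
  rw [spaceParity_single]
  exact Submodule.smul_mem _ _ (single_mem_TS (par_mem_cov _ hb) trivial)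

theorem unit_mem_TAll : unit R d ∈ TAll R d :=
  single_mem_TS (n := 0) (cov_mono (Set.empty_subset _) (by simp) (one_mem_cov ∅)) trivial

/-- The number of unlabelled points of a word. -/
def leafCount : Letter → ℕ
  | leaf _ => 1
  | _ => 0

/-- The letters of `algOf` touch all leaves and all points that carry leaves. -/
theorem algOf_mem_cov {f : ℕ → ℕ} {n N : ℕ} {w : List Letter} (hw : ∀ l ∈ w, l.Plain)
    (h : ∀ x, leaf x ∈ w → f x < N) (hn : n + w.length ≤ N) :
    algOf R d f n w ∈ cov R d {q | q < N}
      {q | ∃ p x, w[p]? = some (leaf x) ∧ (q = n + p ∨ q = f x)} (wdeg leafCount w) := by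
  induction w generalizing n with
  | nil => exact cov_mono subset_rfl (by simp) (one_mem_cov _)
  | cons l w ih =>
    rw [List.length_cons] at hn
    have ih' := ih (fun l hl => hw l (List.mem_cons_of_mem _ hl))
      (fun x hx => h x (List.mem_cons_of_mem _ hx)) (n := n + 1) (by omega)
    rw [algOf, wdeg_cons]
    have hl := hw l List.mem_cons_self
    cases l with
    | core x k =>
      rw [fac, map_one, one_mul, show leafCount (core x k) = 0 from rfl, zero_add]
      refine cov_mono subset_rfl ?_ ih'
      rintro q ⟨_ | p, y, hp, hq⟩
      · simp at hp
      · refine ⟨p, y, by simpa using hp, hq.imp_left fun h => by omega⟩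
    | leaf x =>
      rw [fac, map_smul]
      refine cov_mono subset_rfl ?_ (mul_mem_cov (Submodule.smul_mem _ _ (par_mem_cov _ (gen_mem_cov
        (g := Gen.chord (f x) n) ⟨h x List.mem_cons_self, show n < N by omega⟩))) ih')
      rintro q ⟨_ | p, y, hp, hq⟩
      · simp only [List.length_cons, Nat.zero_lt_succ, getElem?_pos, List.getElem_cons_zero,
          Option.some.injEq, Letter.leaf.injEq] at hp
        subst hp
        exact Or.inl (hq.symm.imp Eq.symm fun h => by omega)
      · exact Or.inr ⟨p, y, by simpa using hp, hq.imp_left fun h => by omega⟩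
    | _ => cases hl

theorem coreIdx_of_nodup {w : List Letter} (h : (labels w).Nodup) {p x : ℕ}
    (hp : (w[p]?).bind label = some x) : coreIdx w x = p := by
  induction w generalizing p with
  | nil => simp at hp
  | cons l w ih =>
    rw [coreIdx_cons]
    have hn : (labels w).Nodup := by
      rw [labels, List.filterMap_cons] at h
      split at h
      · exact h
      · exact (List.nodup_cons.1 h).2
    cases p with
    | zero => rw [if_pos (by simpa using hp)]
    | succ p =>
      have hp' : (w[p]?).bind label = some x := by simpa using hp
      rw [if_neg, ih hn hp']
      intro hl
      obtain ⟨l', h1, h2⟩ := Option.bind_eq_some_iff.1 hp'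
      rw [labels, List.filterMap_cons, hl] at h
      exact (List.nodup_cons.1 h).1 (mem_labels.2 ⟨l', List.mem_of_getElem? h1, h2⟩)

/-- Diagrams described by words, without isolated points. -/
theorem phi_mem_TS {P : ℕ → ℕ → ℕ → Prop} {w : List Letter} {T : Set ℕ} {n : ℕ} {a : Alg R d}
    (hw : ∀ l ∈ w, l.Plain) (hn : (labels w).Nodup) (hl : ∀ x, leaf x ∈ w → x ∈ labels w)
    (hT : ∀ x, core x 0 ∈ w → x ∈ T ∨ leaf x ∈ w) (ha : a ∈ cov R d {x | x ∈ labels w} T n)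
    (hP : P (n + wdeg leafCount w + wdeg top w) (w.length + wdeg top w) (wdeg top w)) :
    phi R d w a ∈ TS R d P := by
  rw [phi_apply]
  refine single_mem_TS (n := wdeg leafCount w + n) ?_ ?_
  · rw [List.length_map]
    refine cov_mono subset_rfl ?_ (mul_mem_cov (algOf_mem_cov (n := 0) hw
      (fun x hx => coreIdx_lt.2 (hl x hx)) (by omega))
      (relabel_mem_cov (S' := {p | p < w.length}) (fun x hx => coreIdx_lt.2 hx) ha))
    rintro p ⟨hp, h0⟩
    have hp' : w[p]? = some w[p] := List.getElem?_eq_getElem hp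
    rw [List.getD_eq_getElem _ _ (by simpa using hp), List.getElem_map] at h0
    have hmem : w[p] ∈ w := List.getElem_mem hp
    have hpl := hw _ hmem
    generalize w[p] = l at *
    cases l with
    | core x k =>
      obtain rfl : k = 0 := h0
      have hx : coreIdx w x = p := coreIdx_of_nodup hn (by rw [hp']; rfl)
      rcases hT x hmem with h | h
      · exact Or.inr ⟨x, h, hx⟩
      · obtain ⟨q, hq⟩ := List.getElem?_of_mem h
        exact Or.inl ⟨q, x, hq, Or.inr hx.symm⟩
    | leaf x => exact Or.inl ⟨p, x, hp', Or.inl (zero_add p).symm⟩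
    | _ => cases hpl
  · rw [List.length_map, show (w.map top).sum = wdeg top w from rfl, add_comm (wdeg leafCount w)]
    exact hP

end

section

open Letter

variable {R : Type*} [CommRing R] {d ℓ : ℕ}

/-! ### Stability under the products and the coproduct -/

theorem prod_ofFn_mem_cov {S : Set ℕ} {T : Fin ℓ → Set ℕ} {n : Fin ℓ → ℕ} {a : Fin ℓ → Alg R d}
    (h : ∀ i, a i ∈ cov R d S (T i) (n i)) :
    (List.ofFn a).prod ∈ cov R d S (⋃ i, T i) (∑ i, n i) := by
  induction ℓ with
  | zero => exact cov_mono subset_rfl (by simp) (one_mem_cov S)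
  | succ ℓ ih =>
    rw [List.ofFn_succ, List.prod_cons, Fin.sum_univ_succ]
    refine cov_mono subset_rfl ?_ (mul_mem_cov (h 0) (ih fun i => h i.succ))
    intro x hx
    obtain ⟨i, hi⟩ := Set.mem_iUnion.1 hx
    cases i using Fin.cases with
    | zero => exact Or.inl hi
    | succ i => exact Or.inr (Set.mem_iUnion.2 ⟨i, hi⟩)

/-- Products and divided products of diagrams without isolated points have no isolated points. -/
theorem shufML_mem_TAll (s : ℕ) {A : Fin ℓ → Space R d} (hA : ∀ i, A i ∈ TAll R d) :
    shufML R d s ℓ A 1 ∈ TAll R d := by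
  refine multilinear_mem_of_mem_span
    (f := (LinearMap.applyₗ (1 : Alg R d)).compMultilinearMap (shufML R d s ℓ)) (fun v hv => ?_) hA
  choose κ L h1 h2 _ h using hv
  obtain rfl : (fun i => Finsupp.single (κ i) (genWord R d (L i))) = v := funext h
  have ha : ∀ i, genWord R d (L i) ∈ cov R d {p | p < (κ i).length}
      {p | p < (κ i).length ∧ (κ i).getD p 0 = 0} (L i).length :=
    fun i => genWord_mem_cov (h1 i) fun p hp => h2 i p hp.1 hp.2
  change shufML R d s ℓ _ 1 ∈ _
  rw [shufML_single_eq s κ fun i => cov_le_supp _ _ _ (ha i)]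
  let u : Fin ℓ → List Letter := fun i => coreWord (Nat.pair i) (κ i)
  have hu : ∀ i, IsCoreWord (u i) := fun i => isCoreWord_coreWord (pair_injOn _ _)
  have hL : ∀ i i' x, x ∈ labels (u i) → x ∈ labels (u i') → i = i' := by
    intro i i' x h h'
    obtain ⟨p, -, rfl⟩ := mem_labels_coreWord.1 h
    obtain ⟨q, -, h⟩ := mem_labels_coreWord.1 h'
    exact Fin.ext (Nat.pair_eq_pair.1 h).1.symm
  refine map_mem_wordsIn (f := (Phi R d).flip _) (fun w hw => ?_) (nest_perm (deg d) s u)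
  rw [LinearMap.flip_apply, Phi_wd]
  have hcw : IsCoreWord w := (isCoreWord_flatten hu hL).perm hw.symm
  have hsub : ∀ i : Fin ℓ, ∀ p < (κ i).length, Nat.pair i p ∈ labels w := by
    intro i p hp
    rw [labels_perm hw]
    obtain ⟨l, hl, e⟩ := mem_labels.1 (mem_labels_coreWord.2 ⟨p, hp, rfl⟩ : Nat.pair i p ∈ labels (u i))
    exact mem_labels.2 ⟨l, List.mem_flatten.2 ⟨_, List.mem_ofFn.2 ⟨i, rfl⟩, hl⟩, e⟩
  refine phi_mem_TS (n := ∑ i, (L i).length) ?_ hcw.2 ?_ ?_ (prod_ofFn_mem_cov fun i => par_mem_cov _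
    (relabel_mem_cov (S' := {x | x ∈ labels w}) (fun p hp => hsub i p hp) (ha i))) trivial
  · intro l hl
    obtain ⟨x, k, rfl⟩ := hcw.1 l hl
    trivial
  · intro x hx
    obtain ⟨y, k, h⟩ := hcw.1 _ hx
    cases h
  · intro x hx
    left
    obtain ⟨v, hv, hx⟩ := List.mem_flatten.1 (hw.mem_iff.1 hx)
    obtain ⟨i, rfl⟩ := List.mem_ofFn.1 hv
    obtain ⟨p, hp, h⟩ := List.mem_mapIdx.1 hx
    simp only [Letter.core.injEq] at h
    refine Set.mem_iUnion.2 ⟨i, p, ⟨hp, ?_⟩, h.1⟩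
    rw [List.getD_eq_getElem _ _ hp, h.2]

theorem dividedProduct_mem_TAll {A : Fin ℓ → Space R d} (hA : ∀ i, A i ∈ TAll R d) :
    dividedProduct R d A ∈ TAll R d := by
  rw [dividedProduct_eq]
  exact shufML_mem_TAll 0 hA

theorem mul_mem_TAll {A B : Space R d} (hA : A ∈ TAll R d) (hB : B ∈ TAll R d) :
    mul R d A B ∈ TAll R d := by
  rw [mul_eq]
  exact shufML_mem_TAll 2 (by intro i; fin_cases i; exacts [hA, hB])

/-- The span of the tensors of products of letters on the two sides of a cut. -/
def covCut (R : Type*) [CommRing R] (d p N : ℕ) (T : Set ℕ) : Submodule R (Alg R d ⊗[R] Alg R d) :=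
  Submodule.span R {z | ∃ n m, ∃ a ∈ cov R d {q | q < p} {q | q < p ∧ q ∈ T} n,
    ∃ b ∈ cov R d {q | q < N - p} {q | p + q ∈ T} m, a ⊗ₜ b = z}

/-- Letters survive a cut on the side of their points, so no point becomes isolated. -/
theorem cut_genWord_mem {p N : ℕ} (hp : p ≤ N) {L : List Gen} (h : ∀ g ∈ L, g.InSet {q | q < N}) :
    cut R d p (genWord R d L) ∈ covCut R d p N {q | ∃ g ∈ L, g.Touches q} := by
  induction L with
  | nil =>
    refine Submodule.subset_span ⟨0, 0, 1, cov_mono subset_rfl (by simp) (one_mem_cov _), 1,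
      cov_mono subset_rfl (by simp) (one_mem_cov _), ?_⟩
    rw [genWord, List.map_nil, List.prod_nil, cut_eq, map_one]
    rfl
  | cons g L ih =>
    have hg := h g List.mem_cons_self
    rw [genWord_cons, cut_mul, cutAct_gen]
    refine (Submodule.span_le (p := (covCut R d p N _).comap (cutGen R d p g))).2 ?_
      (ih fun g hg => h g (List.mem_cons_of_mem _ hg))
    rintro _ ⟨n, m, a, ha, b, hb, rfl⟩
    rw [SetLike.mem_coe, Submodule.mem_comap]
    -- A letter on the left-hand side of the cut is added to the first factor.
    have left : (∀ q, g.Touches q → q < p) → g.InSet {q | q < p} →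
        (gen R d g * a) ⊗ₜ[R] b ∈ covCut R d p N {q | ∃ g' ∈ g :: L, g'.Touches q} := by
      intro h1 h2
      refine Submodule.subset_span ⟨1 + n, m, _, cov_mono subset_rfl ?_
        (mul_mem_cov (gen_mem_cov h2) ha), b, cov_mono subset_rfl ?_ hb, rfl⟩
      · rintro q ⟨hq, g', hg', hq'⟩
        rcases List.mem_cons.1 hg' with rfl | hg'
        · exact Or.inl hq'
        · exact Or.inr ⟨hq, g', hg', hq'⟩
      · rintro q ⟨g', hg', hq'⟩
        rcases List.mem_cons.1 hg' with rfl | hg'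
        · have := h1 _ hq'
          omega
        · exact ⟨g', hg', hq'⟩
    -- A letter on the right-hand side passes over the first factor and is added to the second one.
    have right : ∀ g' : Gen, (∀ q, g.Touches q → p ≤ q ∧ g'.Touches (q - p)) →
        g'.InSet {q | q < N - p} →
        parity R d a ⊗ₜ[R] (gen R d g' * b) ∈ covCut R d p N {q | ∃ g' ∈ g :: L, g'.Touches q} := by
      intro g₁ h1 h2
      refine Submodule.subset_span ⟨n, 1 + m, _, cov_mono subset_rfl ?_ (par_mem_cov 1 ha), _,
        cov_mono subset_rfl ?_ (mul_mem_cov (gen_mem_cov h2) hb), by rw [parity_eq_par]⟩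
      · rintro q ⟨hq, g', hg', hq'⟩
        rcases List.mem_cons.1 hg' with rfl | hg'
        · have := (h1 _ hq').1
          omega
        · exact ⟨hq, g', hg', hq'⟩
      · rintro q ⟨g', hg', hq'⟩
        rcases List.mem_cons.1 hg' with rfl | hg'
        · have := (h1 _ hq').2
          rw [Nat.add_sub_cancel_left] at this
          exact Or.inl this
        · exact Or.inr ⟨g', hg', hq'⟩
    cases g with
    | chord i j =>
      rw [cutGen]
      have hi : i < N := hg.1
      have hj : j < N := hg.2
      split_ifs with h1 h2
      · refine left ?_ h1
        rintro q (rfl | rfl)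
        exacts [h1.1, h1.2]
      · refine right (Gen.chord (i - p) (j - p)) ?_ ⟨show i - p < N - p by omega,
          show j - p < N - p by omega⟩
        rintro q (rfl | rfl)
        exacts [⟨h2.1, Or.inl rfl⟩, ⟨h2.2, Or.inr rfl⟩]
      · rw [LinearMap.zero_apply]
        exact zero_mem _
    | star i =>
      rw [cutGen]
      have hi : i < N := hg
      split_ifs with h1
      · refine left ?_ h1
        rintro q rfl
        exact h1
      · refine right (Gen.star (i - p)) ?_ (show i - p < N - p by omega)
        rintro q rfl
        exact ⟨by omega, rfl⟩

/-- Over a general ring, `TAll ⊗ TAll` need not embed into the full tensor product, so the statement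
refers to its image there. -/
theorem comul_mem_TAll {A : Space R d} (hA : A ∈ TAll R d) :
    comul R d A ∈ LinearMap.range (TensorProduct.map (TAll R d).subtype (TAll R d).subtype) := by
  refine (Submodule.span_le (p := Submodule.comap (comul R d)
    (LinearMap.range (TensorProduct.map (TAll R d).subtype (TAll R d).subtype)))).2 ?_ hA
  rintro _ ⟨k, L, h1, h2, -, rfl⟩
  rw [SetLike.mem_coe, Submodule.mem_comap, comul_single]
  refine Submodule.sum_mem _ fun p hp => ?_
  have hp : p ≤ k.length := by have := Finset.mem_range.1 hp; omega
  refine (Submodule.span_le (p := Submodule.comap (TensorProduct.map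
    (Finsupp.lsingle (k.take p) ∘ₗ (par R d (blockDeg d (k.drop p))).toLinearMap)
    (Finsupp.lsingle (k.drop p)))
    (LinearMap.range (TensorProduct.map (TAll R d).subtype (TAll R d).subtype)))).2 ?_
    (cut_genWord_mem (R := R) (d := d) hp h1)
  rintro _ ⟨n, m, a, ha, b, hb, rfl⟩
  rw [SetLike.mem_coe, Submodule.mem_comap]
  have hl : (k.take p).length = p := by rw [List.length_take]; omega
  have ha' : (Finsupp.single (k.take p) (par R d (blockDeg d (k.drop p)) a) : Space R d) ∈ TAll R d := by
    refine single_mem_TS (n := n) ?_ trivial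
    rw [hl]
    refine cov_mono subset_rfl ?_ (par_mem_cov _ ha)
    rintro q ⟨hq, h0⟩
    rw [List.getD_eq_getElem?_getD, List.getElem?_take_of_lt hq, ← List.getD_eq_getElem?_getD] at h0
    exact ⟨hq, h2 q (by omega) h0⟩
  have hb' : (Finsupp.single (k.drop p) b : Space R d) ∈ TAll R d := by
    refine single_mem_TS (n := m) ?_ trivial
    rw [List.length_drop]
    refine cov_mono subset_rfl ?_ hb
    rintro q ⟨hq, h0⟩
    rw [List.getD_eq_getElem?_getD, List.getElem?_drop, ← List.getD_eq_getElem?_getD] at h0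
    exact h2 (p + q) (by omega) h0
  exact ⟨⟨_, ha'⟩ ⊗ₜ ⟨_, hb'⟩, by simp⟩

end

section

open Letter

variable {R : Type*} [CommRing R] {d ℓ : ℕ}

/-! ### Cycles of chords vanish -/

/-- A reordering of letters changes their product by a sign. -/
theorem genWord_perm {L L' : List Gen} (h : L.Perm L') :
    ∃ u : R, genWord R d L = u • genWord R d L' := by
  induction h with
  | nil => exact ⟨1, (one_smul _ _).symm⟩
  | cons x _ ih =>
    obtain ⟨u, hu⟩ := ih
    exact ⟨u, by rw [genWord_cons, genWord_cons, hu, mul_smul_comm]⟩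
  | swap x y L =>
    exact ⟨(-1) ^ (d + 1), by
      simp only [genWord_cons, ← mul_assoc, gen_comm R d y x, smul_mul_assoc]⟩
  | trans _ _ ih1 ih2 =>
    obtain ⟨u, hu⟩ := ih1
    obtain ⟨v, hv⟩ := ih2
    exact ⟨u * v, by rw [hu, hv, smul_smul]⟩

/-- The product of a list of chords. -/
abbrev chordWord (R : Type*) [CommRing R] (d : ℕ) (C : List (ℕ × ℕ)) : Alg R d :=
  genWord R d (C.map fun c => Gen.chord c.1 c.2)

theorem chordWord_cons (c : ℕ × ℕ) (C : List (ℕ × ℕ)) :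
    chordWord R d (c :: C) = gen R d (Gen.chord c.1 c.2) * chordWord R d C := genWord_cons _ _

/-- The graph of a list of chords. -/
def chordGraph (C : List (ℕ × ℕ)) : SimpleGraph ℕ :=
  SimpleGraph.fromEdgeSet {e | e ∈ C.map fun c => s(c.1, c.2)}

/-- The inversion of a chord changes it by a sign. -/
theorem gen_chord_eq_smul {c e : ℕ × ℕ} (h : s(c.1, c.2) = s(e.1, e.2)) :
    ∃ u : R, gen R d (Gen.chord c.1 c.2) = u • gen R d (Gen.chord e.1 e.2) := by
  rcases Sym2.eq_iff.1 h with ⟨h1, h2⟩ | ⟨h1, h2⟩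
  · exact ⟨1, by rw [h1, h2, one_smul]⟩
  · exact ⟨(-1) ^ d, by rw [h1, h2, gen_flip]⟩

/-- By the Arnold relation, the product of the chords of a walk is divisible by the chord that joins
its ends. -/
theorem chordWord_walk {G : SimpleGraph ℕ} {a b : ℕ} (w : G.Walk a b) (hab : 0 < w.length) :
    ∃ z, chordWord R d (w.darts.map fun e => e.toProd) = gen R d (Gen.chord a b) * z := by
  induction w with
  | nil => simp at hab
  | @cons a b c h w ih =>
    rcases Nat.eq_zero_or_pos w.length with h0 | h0
    · obtain rfl := SimpleGraph.Walk.eq_of_length_eq_zero h0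
      obtain rfl := SimpleGraph.Walk.eq_nil_iff_nil.2 (SimpleGraph.Walk.length_eq_zero_iff.1 h0)
      exact ⟨1, by simp [genWord]⟩
    · obtain ⟨z, hz⟩ := ih h0
      -- The Arnold relation expresses the product of the chords `a b` and `b c` by products with
      -- the chord `a c`.
      refine ⟨-((-1 : R) ^ d • (((-1 : R) ^ (d + 1) • gen R d (Gen.chord b c))
        + gen R d (Gen.chord a b))) * z, ?_⟩
      rw [SimpleGraph.Walk.darts_cons, List.map_cons, chordWord_cons, hz, ← mul_assoc,
        ← mul_assoc]
      congr 1
      have h := gen_arnold R d a b c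
      rw [gen_comm R d (Gen.chord b c), gen_flip R d c a] at h
      rw [mul_neg, mul_smul_comm, mul_add, mul_smul_comm]
      rw [eq_neg_iff_add_eq_zero, ← h]
      simp only [smul_mul_assoc, smul_add]
      rw [smul_comm, add_assoc]

/-- A product of chords is divisible by the product of those in a subset, in any order and with any
directions. -/
theorem chordWord_dvd {E C : List (ℕ × ℕ)} (hE : (E.map fun c => s(c.1, c.2)).Nodup)
    (h : ∀ e ∈ E, s(e.1, e.2) ∈ C.map fun c => s(c.1, c.2)) :
    ∃ z, chordWord R d C = chordWord R d E * z := by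
  induction E generalizing C with
  | nil => exact ⟨_, by simp only [List.map_nil, genWord, List.prod_nil, one_mul]; rfl⟩
  | cons e E ih =>
    rw [List.map_cons, List.nodup_cons] at hE
    obtain ⟨c, hc, hce⟩ := List.mem_map.1 (h e List.mem_cons_self)
    obtain ⟨C', hC⟩ : ∃ C', C.Perm (c :: C') := ⟨_, List.perm_cons_erase hc⟩
    obtain ⟨z, hz⟩ := ih hE.2 (C := C') fun e' he' => by
      have := (hC.map fun c => s(c.1, c.2)).mem_iff.1 (h e' (List.mem_cons_of_mem _ he'))
      rw [List.map_cons, List.mem_cons] at this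
      refine this.resolve_left fun h' => hE.1 ?_
      rw [← hce]
      exact List.mem_map.2 ⟨e', he', h'⟩
    obtain ⟨u, hu⟩ := genWord_perm (R := R) (d := d) (hC.map fun c => Gen.chord c.1 c.2)
    obtain ⟨v, hv⟩ := gen_chord_eq_smul (R := R) (d := d) hce
    refine ⟨(u * v) • z, ?_⟩
    rw [show chordWord R d C = u • chordWord R d (c :: C') from hu, chordWord_cons, hz, hv,
      chordWord_cons]
    simp only [smul_mul_assoc, mul_smul_comm, smul_smul, mul_assoc]

/-- A chord which closes a cycle gives zero. -/
theorem gen_mul_chordWord_of_reachable {C : List (ℕ × ℕ)} {a b : ℕ}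
    (h : (chordGraph C).Reachable a b) : gen R d (Gen.chord a b) * chordWord R d C = 0 := by
  rcases eq_or_ne a b with rfl | hab
  · rw [gen_loop, zero_mul]
  obtain ⟨w, hw⟩ := h.exists_isPath
  have hpos : 0 < w.length := by
    by_contra h0
    exact hab (SimpleGraph.Walk.eq_of_length_eq_zero (p := w) (by omega))
  obtain ⟨z, hz⟩ := chordWord_walk (R := R) (d := d) w hpos
  have he : (w.darts.map fun e => e.toProd).map (fun c => s(c.1, c.2)) = w.edges := by
    rw [List.map_map]
    rfl
  obtain ⟨y, hy⟩ := chordWord_dvd (R := R) (d := d) (E := w.darts.map fun e => e.toProd) (C := C)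
    (by rw [he]; exact hw.isTrail.edges_nodup) fun e hm => by
      have h1 : s(e.1, e.2) ∈ w.edges := by
        rw [← he]
        exact List.mem_map_of_mem hm
      have h2 := w.edges_subset_edgeSet h1
      rw [chordGraph, SimpleGraph.edgeSet_fromEdgeSet] at h2
      exact h2.1
  -- The chords of a path from `a` to `b` provide a factor `gen (chord a b)`, whose square is zero.
  rw [hy, hz, ← mul_assoc, ← mul_assoc, gen_sq, zero_mul, zero_mul]

/-- The product of the chords of a graph vanishes unless the graph is a forest. -/
theorem chordWord_eq_zero_or (C : List (ℕ × ℕ)) : chordWord R d C = 0 ∨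
    ((∀ c ∈ C, c.1 ≠ c.2) ∧ (C.map fun c => s(c.1, c.2)).Nodup ∧ (chordGraph C).IsAcyclic) := by
  induction C with
  | nil => exact Or.inr ⟨by simp, by simp, by simp [chordGraph]⟩
  | cons c C ih =>
    rcases ih with h | ⟨h1, h2, h3⟩
    · exact Or.inl (by rw [chordWord_cons, h, mul_zero])
    -- The first chord either closes a cycle of the remaining ones or joins two of their
    -- components.
    by_cases hr : (chordGraph C).Reachable c.1 c.2
    · exact Or.inl (by rw [chordWord_cons,
        gen_mul_chordWord_of_reachable hr])
    right
    have hne : c.1 ≠ c.2 := fun h => hr (h ▸ SimpleGraph.Reachable.refl _)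
    refine ⟨?_, ?_, ?_⟩
    · intro e he
      rcases List.mem_cons.1 he with rfl | he
      exacts [hne, h1 e he]
    · rw [List.map_cons, List.nodup_cons]
      refine ⟨fun hm => hr (SimpleGraph.Adj.reachable ?_), h2⟩
      rw [chordGraph, SimpleGraph.fromEdgeSet_adj]
      exact ⟨hm, hne⟩
    · refine (h3.sup_edge_of_not_reachable hr).anti fun x y hxy => ?_
      rw [chordGraph, SimpleGraph.fromEdgeSet_adj, Set.mem_ofPred_eq, List.map_cons,
        List.mem_cons] at hxy
      rw [SimpleGraph.sup_adj, SimpleGraph.edge_adj]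
      rcases hxy with ⟨h | h, hn⟩
      · right
        rcases Sym2.eq_iff.1 h with ⟨rfl, rfl⟩ | ⟨rfl, rfl⟩
        exacts [⟨Or.inl ⟨rfl, rfl⟩, hn⟩, ⟨Or.inr ⟨rfl, rfl⟩, hn⟩]
      · exact Or.inl ((SimpleGraph.fromEdgeSet_adj _).2 ⟨h, hn⟩)

/-- Double bottom asterisks vanish. -/
theorem starWord_eq_zero {B : List ℕ} (h : ¬ B.Nodup) :
    genWord R d (B.map Gen.star) = 0 := by
  obtain ⟨i, hi⟩ := List.exists_duplicate_iff_not_nodup.2 h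
  obtain ⟨B', hB⟩ := (List.duplicate_iff_sublist.1 hi).exists_perm_append
  obtain ⟨u, hu⟩ := genWord_perm (R := R) (d := d) (hB.map Gen.star)
  rw [hu]
  simp [← mul_assoc, gen_sq]

theorem exists_perm_chords_stars (L : List Gen) : ∃ (C : List (ℕ × ℕ)) (B : List ℕ),
    L.Perm ((C.map fun c => Gen.chord c.1 c.2) ++ B.map Gen.star) := by
  induction L with
  | nil => exact ⟨[], [], by simp⟩
  | cons g L ih =>
    obtain ⟨C, B, h⟩ := ih
    cases g with
    | chord i j => exact ⟨(i, j) :: C, B, by simpa using h⟩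
    | star i => exact ⟨C, i :: B, (h.cons _).trans (by simpa using List.perm_middle.symm)⟩

/-! ### Diagrams and words -/

/-- The list of the letters of a diagram. -/
def Diagram.letters (D : Diagram) : List Gen :=
  (D.chords.map fun c => Gen.chord c.1 c.2) ++ D.bottom.map Gen.star

theorem Diagram.word_eq (D : Diagram) : D.word R d = genWord R d D.letters := by
  rw [Diagram.letters, genWord_append, Diagram.word, genWord, genWord, List.map_map, List.map_map]
  rfl

/-- A product of letters is zero or a diagram, up to a factor from the reordering of the letters.
-/
theorem exists_diagram (k : List ℕ) {L : List Gen} (hL : ∀ g ∈ L, g.InSet {p | p < k.length}) :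
    genWord R d L = 0 ∨ ∃ (D : Diagram) (u : R), D.top = k ∧ L.Perm D.letters ∧
      genWord R d L = u • D.word R d := by
  obtain ⟨C, B, h⟩ := exists_perm_chords_stars L
  obtain ⟨u, hu⟩ := genWord_perm (R := R) (d := d) h
  rcases chordWord_eq_zero_or (R := R) (d := d) C with h0 | ⟨h1, h2, h3⟩
  · left
    rw [hu, genWord_append]
    exact (congrArg _ (congrArg (· * _) h0)).trans (by rw [zero_mul, smul_zero])
  by_cases hB : B.Nodup
  · refine Or.inr ⟨⟨k, C, B, fun c hc => ?_, h1, h2, h3, fun i hi => ?_, hB⟩, u, rfl, h, ?_⟩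
    · exact hL (Gen.chord c.1 c.2) (h.mem_iff.2 (List.mem_append_left _ (List.mem_map.2 ⟨c, hc, rfl⟩)))
    · exact hL (Gen.star i) (h.mem_iff.2 (List.mem_append_right _ (List.mem_map.2 ⟨i, hi, rfl⟩)))
    · rw [hu, Diagram.word_eq]
      rfl
  · exact Or.inl (by rw [hu, genWord_append, starWord_eq_zero hB, mul_zero, smul_zero])

/-- A diagram has no isolated points iff each point without top asterisks is touched by a letter.
-/
theorem Diagram.isProper_iff (D : Diagram) :
    D.IsProper ↔ ∀ p < D.top.length, D.top.getD p 0 = 0 → ∃ g ∈ D.letters, g.Touches p := by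
  have key : ∀ p, (∃ g ∈ D.letters, g.Touches p) ↔
      (∃ c ∈ D.chords, c.1 = p ∨ c.2 = p) ∨ p ∈ D.bottom := by
    intro p
    simp only [Diagram.letters, List.mem_append, List.mem_map]
    constructor
    · rintro ⟨_, ⟨c, hc, rfl⟩ | ⟨i, hi, rfl⟩, hg⟩
      exacts [Or.inl ⟨c, hc, hg⟩, Or.inr ((show i = p from hg) ▸ hi)]
    · rintro (⟨c, hc, hg⟩ | hi)
      exacts [⟨_, Or.inl ⟨c, hc, rfl⟩, hg⟩, ⟨_, Or.inr ⟨p, hi, rfl⟩, rfl⟩]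
  refine forall₂_congr fun p hp => ?_
  rw [key, ← or_assoc, or_iff_not_imp_right, Nat.pos_iff_ne_zero, not_not]

/-- The spaces of diagrams are the spaces of words of letters without isolated points. -/
theorem span_diagrams_eq_TS (P : ℕ → ℕ → ℕ → Prop) :
    Submodule.span R {x | ∃ D : Diagram, D.IsProper ∧ P D.complexity D.points D.top.sum ∧
      D.toSpace R d = x} = TS R d P := by
  have hlen : ∀ D : Diagram, D.letters.length + D.top.sum = D.complexity := fun D => by
    simp [Diagram.letters, Diagram.complexity]
  apply le_antisymm
  · refine Submodule.span_le.2 ?_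
    rintro _ ⟨D, hD, hP, rfl⟩
    refine Submodule.subset_span ⟨D.top, D.letters, ?_, D.isProper_iff.1 hD, ?_, ?_⟩
    · intro g hg
      rcases List.mem_append.1 hg with h | h
      · obtain ⟨c, hc, rfl⟩ := List.mem_map.1 h
        exact D.chords_lt c hc
      · obtain ⟨i, hi, rfl⟩ := List.mem_map.1 h
        exact D.bottom_lt i hi
    · rwa [hlen]
    · rw [Diagram.toSpace, Diagram.word_eq]
  · refine Submodule.span_le.2 ?_
    rintro _ ⟨k, L, h1, h2, h3, rfl⟩
    rcases exists_diagram (R := R) (d := d) k h1 with h0 | ⟨D, u, rfl, hp, hu⟩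
    · rw [h0, Finsupp.single_zero]
      exact zero_mem _
    · rw [hu, ← Finsupp.smul_single]
      refine Submodule.smul_mem _ _ (Submodule.subset_span ⟨D, D.isProper_iff.2 fun p hp' h0 => ?_,
        ?_, rfl⟩)
      · obtain ⟨g, hg, ht⟩ := h2 p hp' h0
        exact ⟨g, hp.mem_iff.1 hg, ht⟩
      · rwa [← hlen, ← hp.length_eq]

theorem TSpace_eq : TSpace R d = TAll R d := by
  rw [TAll, ← span_diagrams_eq_TS]
  simp [TSpace]

theorem TBigraded_eq (i j : ℕ) : TBigraded R d i j = TS R d fun a b _ => a = i ∧ b = j := by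
  rw [← span_diagrams_eq_TS]
  simp [TBigraded, and_assoc]

end

section

open Letter

variable {R : Type*} [CommRing R] {d ℓ : ℕ}

/-! ### The map `I` is unitriangular -/

/-- In the values of `I`, top asterisks are traded for new points with a chord; the bidegree
remains the same. -/
theorem ExpandsTo.counts {w v : List Letter} (h : ExpandsTo w v) :
    wdeg leafCount v + wdeg top v = wdeg top w ∧ v.length = w.length + wdeg leafCount v := by
  induction h with
  | nil => simp
  | @core x i k w v v' hi _ hp ih =>
    have h1 : wdeg leafCount (List.replicate i (Letter.leaf x)) = i := by simp [wdeg, leafCount]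
    have h2 : wdeg top (List.replicate i (Letter.leaf x)) = 0 := by simp [wdeg, top]
    rw [wdeg_perm leafCount hp, wdeg_perm top hp, hp.length_eq]
    simp only [List.cons_append, wdeg_cons, wdeg_append, h1, h2, List.length_cons,
      List.length_append, List.length_replicate]
    simp only [leafCount, top]
    omega

/-- A point which has lost all its top asterisks carries chords. -/
theorem ExpandsTo.core_zero {w v : List Letter} (h : ExpandsTo w v) {y : ℕ}
    (hy : Letter.core y 0 ∈ v) : Letter.core y 0 ∈ w ∨ Letter.leaf y ∈ v := by
  induction h with
  | nil => simp at hy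
  | @core x i k w v v' hi _ hp ih =>
    rw [hp.mem_iff] at hy ⊢
    rcases List.mem_append.1 hy with h | h
    · rcases List.mem_cons.1 h with h | h
      · obtain ⟨rfl, h0⟩ : y = x ∧ 0 = k - i := by simpa using h
        rcases Nat.eq_zero_or_pos i with rfl | hpos
        · left
          rw [show k = 0 by omega]
          exact List.mem_cons_self
        · right
          simp [hpos.ne']
      · simp at h
    · exact (ih h).imp (List.mem_cons_of_mem _) (List.mem_append_right _)

/-- The term of `IWord` without new points is the word itself; all other terms have fewer top
asterisks. -/
theorem IWord_sub_mem {w : List Letter} (hw : IsCoreWord w) :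
    IWord R d w - wd R w ∈ wordsIn R fun v => ExpandsTo w v ∧ wdeg top v < wdeg top w := by
  induction w with
  | nil =>
    rw [show IWord R d [] = wd R [] from rfl, sub_self]
    exact zero_mem _
  | cons l w ih =>
    obtain ⟨x, k, rfl, -, hw'⟩ := hw.of_cons
    rw [IWord_cons, Finset.sum_range_succ', List.replicate_zero, add_sub_assoc]
    refine add_mem (Submodule.sum_mem _ fun i hi => ?_) ?_
    · have hi : i + 1 ≤ k := by have := Finset.mem_range.1 hi; omega
      refine cons_mem (P := fun u => ∃ v, ExpandsTo w v ∧
          u.Perm (List.replicate (i + 1) (Letter.leaf x) ++ v)) _ ?_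
        (sh_mem (deg d) (P := fun u => u = List.replicate (i + 1) (Letter.leaf x)) ?_ (wd_mem rfl)
          (IWord_expandsTo hw'))
      · rintro u ⟨v, hv, hp⟩
        refine ⟨ExpandsTo.core hi hv (hp.cons _), ?_⟩
        have h1 : wdeg top (List.replicate (i + 1) (Letter.leaf x)) = 0 := by simp [wdeg, top]
        rw [wdeg_cons, wdeg_perm top hp, wdeg_append, h1, wdeg_cons, ← hv.counts.1]
        simp only [top]
        omega
      · rintro _ v rfl hv u hu
        exact ⟨v, hv, hu⟩
    · have h1 : sh (deg d) (wd R []) (IWord R d w) = IWord R d w := by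
        refine eqOn_wordsIn (f := sh (deg d) (wd R [])) (g := LinearMap.id) (fun v _ => ?_)
          (IWord_expandsTo hw')
        rw [sh_wd, shWord]
        rfl
      rw [h1, Nat.sub_zero, ← cons_wd, ← map_sub]
      refine cons_mem _ (fun u hu => ⟨ExpandsTo.core (Nat.zero_le k) hu.1 (List.Perm.refl _), ?_⟩)
        (ih hw')
      rw [wdeg_cons, wdeg_cons]
      exact Nat.add_lt_add_left hu.2 _

/-- `I` is the identity up to diagrams of the same bidegree with fewer top asterisks. -/
theorem I_sub_mem_TS {P : ℕ → ℕ → Prop} {m : ℕ} {A : Space R d}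
    (hA : A ∈ TS R d fun i j s => P i j ∧ s < m + 1) :
    I R d A - A ∈ TS R d fun i j s => P i j ∧ s < m := by
  refine map_mem_TS (f := I R d - LinearMap.id) (fun k n hP b hb => ?_) hA
  have hid : Set.InjOn (id : ℕ → ℕ) {p | p < k.length} := Set.injOn_id _
  have hcw := isCoreWord_coreWord hid
  have hbs := cov_le_supp _ _ _ hb
  have h := phi_coreWord hid hbs
  rw [relabel_id] at h
  rw [LinearMap.sub_apply, I_single hid hbs, relabel_id, LinearMap.id_apply, ← h, ← Phi_wd]
  change (Phi R d).flip b (IWord R d (coreWord id k)) - (Phi R d).flip b (wd R (coreWord id k)) ∈ _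
  rw [← map_sub]
  refine map_mem_wordsIn (f := (Phi R d).flip b) (fun v hv => ?_) (IWord_sub_mem hcw)
  rw [LinearMap.flip_apply, Phi_wd]
  have hlab : ∀ x, x ∈ labels v ↔ x < k.length := fun x => by
    rw [hv.1.mem_labels_iff, mem_labels_coreWord]
    simp
  have htop : wdeg top (coreWord id k) = k.sum := by rw [wdeg, map_top_coreWord]
  have hc := hv.1.counts
  have hlt := hv.2
  rw [htop] at hc hlt
  rw [length_coreWord] at hc
  refine phi_mem_TS hv.1.plain (hv.1.labels_perm.nodup_iff.2 hcw.2)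
    (fun x hx => hv.1.mem_labels_iff.2 (hv.1.leaf hx)) (fun x hx => ?_)
    (cov_mono (fun x hx => (hlab x).2 hx) subset_rfl hb) ⟨?_, by omega⟩
  -- A point that has lost all its top asterisks carries a leaf, so it does not become isolated.
  · refine (hv.1.core_zero hx).imp_left fun hm => ?_
    obtain ⟨p, hp, h⟩ := List.mem_mapIdx.1 hm
    obtain ⟨rfl, h0⟩ : p = x ∧ k[p] = 0 := by simpa using h
    exact ⟨hp, by rw [List.getD_eq_getElem _ _ hp, h0]⟩
  · have h1 : n + wdeg leafCount v + wdeg top v = n + k.sum := by omega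
    have h2 : v.length + wdeg top v = k.length + k.sum := by omega
    rw [h1, h2]
    exact hP.1

theorem exists_mem_TS {P : ℕ → ℕ → Prop} {A : Space R d} (hA : A ∈ TS R d fun i j _ => P i j) :
    ∃ m, A ∈ TS R d fun i j s => P i j ∧ s < m := by
  induction hA using Submodule.span_induction with
  | mem A h =>
    obtain ⟨k, L, h1, h2, h3, rfl⟩ := h
    exact ⟨k.sum + 1, Submodule.subset_span ⟨k, L, h1, h2, ⟨h3, Nat.lt_succ_self _⟩, rfl⟩⟩
  | zero => exact ⟨0, zero_mem _⟩
  | add A B _ _ hA hB =>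
    obtain ⟨m, hm⟩ := hA
    obtain ⟨n, hn⟩ := hB
    exact ⟨max m n, add_mem (TS_mono (fun _ _ _ h => ⟨h.1, h.2.trans_le (le_max_left _ _)⟩) hm)
      (TS_mono (fun _ _ _ h => ⟨h.1, h.2.trans_le (le_max_right _ _)⟩) hn)⟩
  | smul r A _ hA =>
    obtain ⟨m, hm⟩ := hA
    exact ⟨m, Submodule.smul_mem _ _ hm⟩

theorem eq_zero_of_mem_TS {P : ℕ → ℕ → Prop} {A : Space R d}
    (hA : A ∈ TS R d fun i j s => P i j ∧ s < 0) : A = 0 := by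
  refine (Submodule.mem_bot R).1 ((Submodule.span_le (p := ⊥)).2 ?_ hA)
  rintro _ ⟨k, L, -, -, h3, rfl⟩
  exact absurd h3.2 (Nat.not_lt_zero _)

/-- The map `I` preserves the bidegree. -/
theorem I_mem_TS {P : ℕ → ℕ → Prop} {A : Space R d} (hA : A ∈ TS R d fun i j _ => P i j) :
    I R d A ∈ TS R d fun i j _ => P i j := by
  obtain ⟨m, hm⟩ := exists_mem_TS hA
  have h := TS_mono (Q := fun i j _ => P i j) (fun _ _ _ h => h.1)
    (I_sub_mem_TS (TS_mono (fun _ _ _ h => ⟨h.1, Nat.lt_succ_of_lt h.2⟩) hm))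
  simpa using add_mem h hA

theorem eq_zero_of_I_eq_zero {A : Space R d} (hA : A ∈ TAll R d) (h : I R d A = 0) : A = 0 := by
  obtain ⟨m, hm⟩ := exists_mem_TS (P := fun _ _ => True) hA
  induction m with
  | zero => exact eq_zero_of_mem_TS hm
  | succ m ih =>
    have h' := I_sub_mem_TS hm
    rw [h, zero_sub, Submodule.neg_mem_iff] at h'
    exact ih h'

/-- Surjectivity of a unitriangular map, by induction on the number of top asterisks. -/
theorem exists_I_eq {P : ℕ → ℕ → Prop} {A : Space R d} (hA : A ∈ TS R d fun i j _ => P i j) :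
    ∃ B ∈ TS R d fun i j _ => P i j, I R d B = A := by
  obtain ⟨m, hm⟩ := exists_mem_TS hA
  induction m generalizing A with
  | zero => exact ⟨0, zero_mem _, by rw [map_zero, eq_zero_of_mem_TS hm]⟩
  | succ m ih =>
    have h := I_sub_mem_TS hm
    obtain ⟨B, hB, e⟩ := ih (TS_mono (fun _ _ _ h => h.1) h) h
    -- The difference `I A - A` has fewer top asterisks, so it is equal to `I B` for some `B`.
    exact ⟨A - B, sub_mem hA hB, by rw [map_sub, e, sub_sub_cancel]⟩

theorem map_I_TS (P : ℕ → ℕ → Prop) :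
    (TS R d fun i j _ => P i j).map (I R d) = TS R d fun i j _ => P i j := by
  apply le_antisymm
  · rintro _ ⟨A, hA, rfl⟩
    exact I_mem_TS hA
  · exact fun A hA => exists_I_eq hA

/-- The restriction of `I` to the diagrams without isolated points. -/
theorem exists_equiv_I : ∃ J : TAll R d ≃ₗ[R] TAll R d, ∀ x : TAll R d,
    (J x : Space R d) = I R d x := by
  refine ⟨LinearEquiv.ofBijective ((I R d).restrict fun A hA => I_mem_TS (P := fun _ _ => True) hA)
    ⟨?_, ?_⟩, fun x => rfl⟩
  · refine (injective_iff_map_eq_zero _).2 fun x hx => Subtype.ext ?_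
    exact eq_zero_of_I_eq_zero x.2 (congrArg Subtype.val hx)
  · rintro ⟨A, hA⟩
    obtain ⟨B, hB, e⟩ := exists_I_eq (P := fun _ _ => True) hA
    exact ⟨⟨B, hB⟩, Subtype.ext e⟩

/-! ### Values of `I`, gluings of left-most points -/

/-- The map `I`, which is defined by insertion into the bottom diagrams, takes the prescribed
values on points. -/
theorem I_Z (k : ℕ) : I R d (Z R d k) = IZ R d k := by
  rw [Z, I_single (x := id) (Set.injOn_id _) (one_mem _), map_one, IZ_eq 0 k, coreWord_cons,
    coreWord_nil, IWord_cons, expand]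
  simp only [show IWord R d [] = wd R [] from rfl, sh_one, cons_wd]
  rfl

/-- The gluing of left-most points is expressed by the divided product and `∂_h` by `vdash_eq`, and
`I` sends `∂_h` to `∂`. -/
theorem I_vdash {A B : Space R d} (hA : A ∈ TAll R d) (hB : B ∈ TAll R d) :
    I R d (vdash R d A B) = vdash R d (I R d A) (I R d B) := by
  have hG : TAll R d ≤ GSpace R d := TS_le_GSpace _
  have hP := spaceParity_mem_TAll hA
  have pair : ∀ {X Y : Space R d}, X ∈ TAll R d → Y ∈ TAll R d → ∀ i, (![X, Y] : Fin 2 → _) i ∈ TAll R d := by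
    intro X Y hX hY i
    fin_cases i
    exacts [hX, hY]
  have hI : ∀ {X Y : Space R d}, X ∈ TAll R d → Y ∈ TAll R d →
      I R d (dividedProduct R d ![X, Y]) = dividedProduct R d ![I R d X, I R d Y] := by
    intro X Y hX hY
    rw [I_dividedProduct fun i => hG (pair hX hY i)]
    congr 1
    funext i
    fin_cases i <;> rfl
  rw [vdash_eq (hG hA) (hG hB), vdash, map_neg, map_sub, map_sub,
    I_boundaryH (hG (dividedProduct_mem_TAll (pair hP hB))), hI hP hB, hI (boundaryH_mem_TAll hP) hB,
    hI hA (boundaryH_mem_TAll hB), I_boundaryH (hG hP), I_boundaryH (hG hB),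
    I_spaceParity (hG hA)]

end

end KnotDiagrams

end

open KnotDiagrams TensorProduct in
theorem proposition7p3 (R : Type*) [CommRing R] (d : ℕ) :
    -- the operations restrict to the space of diagrams
    (∀ x ∈ TSpace R d, boundaryH R d x ∈ TSpace R d ∧ boundary R d x ∈ TSpace R d) ∧
    (unit R d ∈ TSpace R d) ∧
    (∀ x ∈ TSpace R d, ∀ y ∈ TSpace R d, mul R d x y ∈ TSpace R d) ∧
    (∀ x ∈ TSpace R d, comul R d x ∈
      LinearMap.range (TensorProduct.map (TSpace R d).subtype (TSpace R d).subtype)) ∧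
    (∀ (ℓ : ℕ) (A : Fin ℓ → Space R d), (∀ i, A i ∈ TSpace R d) →
      dividedProduct R d A ∈ TSpace R d) ∧
    -- the value on the diagrams `Z_k`
    (∀ k : ℕ, KnotDiagrams.I R d (Z R d k)
      = ∑ i ∈ Finset.range (k + 1), vdash R d (Z R d (k - i)) (Zhat R d i)) ∧
    -- isomorphism of bigraded modules
    (∃ J : TSpace R d ≃ₗ[R] TSpace R d, ∀ x : TSpace R d,
      (J x : Space R d) = KnotDiagrams.I R d x) ∧
    (∀ i j : ℕ, (TBigraded R d i j).map (KnotDiagrams.I R d) = TBigraded R d i j) ∧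
    -- compatibility with the differentials
    (∀ x ∈ TSpace R d,
      KnotDiagrams.I R d (boundaryH R d x) = boundary R d (KnotDiagrams.I R d x)) ∧
    -- compatibility with unit, product, counit and coproduct
    (KnotDiagrams.I R d (unit R d) = unit R d) ∧
    (∀ x ∈ TSpace R d, ∀ y ∈ TSpace R d,
      KnotDiagrams.I R d (mul R d x y)
        = mul R d (KnotDiagrams.I R d x) (KnotDiagrams.I R d y)) ∧
    (∀ x ∈ TSpace R d, counit R d (KnotDiagrams.I R d x) = counit R d x) ∧
    (∀ x ∈ TSpace R d, comul R d (KnotDiagrams.I R d x)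
      = TensorProduct.map (KnotDiagrams.I R d) (KnotDiagrams.I R d) (comul R d x)) ∧
    -- compatibility with divided products and divided powers
    (∀ (ℓ : ℕ) (A : Fin ℓ → Space R d), (∀ i, A i ∈ TSpace R d) →
      KnotDiagrams.I R d (dividedProduct R d A)
        = dividedProduct R d fun i => KnotDiagrams.I R d (A i)) ∧
    (∀ (ℓ : ℕ), ∀ x ∈ TSpace R d,
      KnotDiagrams.I R d (dividedPower R d ℓ x) = dividedPower R d ℓ (KnotDiagrams.I R d x)) ∧
    -- compatibility with the gluing of left-most points
    (∀ x ∈ TSpace R d, ∀ y ∈ TSpace R d,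
      KnotDiagrams.I R d (vdash R d x y)
        = vdash R d (KnotDiagrams.I R d x) (KnotDiagrams.I R d y)) := by
  have hG : ∀ {x}, x ∈ TSpace R d → x ∈ GSpace R d := fun {x} hx =>
    TS_le_GSpace _ (TSpace_eq (R := R) (d := d) ▸ hx)
  -- All claims are stated for `TS`, the span of products of letters without isolated points; its
  -- elements lie in `GSpace`, on which `I` has been computed by words.
  rw [TSpace_eq] at *
  refine ⟨fun x hx => ⟨boundaryH_mem_TAll hx, boundary_mem_TAll hx⟩, unit_mem_TAll,
    fun x hx y hy => mul_mem_TAll hx hy, fun x hx => comul_mem_TAll hx,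
    fun ℓ A hA => dividedProduct_mem_TAll hA, fun k => I_Z k, exists_equiv_I, fun i j => ?_,
    fun x hx => I_boundaryH (hG hx), I_unit, fun x hx y hy => I_mul (hG hx) (hG hy),
    fun x hx => counit_I (hG hx), fun x hx => comul_I (hG hx),
    fun ℓ A hA => I_dividedProduct fun i => hG (hA i),
    fun ℓ x hx => I_dividedProduct fun _ => hG hx, fun x hx y hy => I_vdash hx hy⟩
  rw [TBigraded_eq]
  exact map_I_TS fun a b => a = i ∧ b = j
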